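/- **Formulae and arrow terms.** Let $\mathcal P$ be a set (of letters), and let formulae be generated from $\mathcal P$ by the unary connective $\neg$ and the binary connectives $\wedge,\vee$. Arrow terms $f:A\vdash B$ are generated inductively from the primitive arrow terms (for all formulae $A,B,C$, and for $\xi\in\{\wedge,\vee\}$) $$\mathbf 1_A:A\vdash A,\quad b^{\xi\to}_{A,B,C}:A\,\xi\,(B\,\xi\,C)\vdash(A\,\xi\,B)\,\xi\,C,\quad b^{\xi\leftarrow}_{A,B,C}:(A\,\xi\,B)\,\xi\,C\vdash A\,\xi\,(B\,\xi\,C),$$ $$c^\wedge_{A,B}:A\wedge B\vdash B\wedge A,\quad c^\vee_{A,B}:B\vee A\vdash A\vee B,\quad d_{A,B,C}:A\wedge(B\vee C)\vdash(A\wedge B)\vee C,$$ $$\Delta^\wedge_{B,A}:A\vdash A\wedge(\neg B\vee B),\qquad \Sigma^\vee_{B,A}:(B\wedge\neg B)\vee A\vdash A$$ by composition ($f\circ g:A\vdash C$ for $g:A\vdash B$, $f:B\vdash C$) and by $f\,\xi\,g:A\,\xi\,B\vdash D\,\xi\,E$ for $f:A\vdash D$, $g:B\vdash E$. Abbreviate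 $d^R_{C,B,A}=c^\vee_{C,B\wedge A}\circ(c^\wedge_{A,B}\vee\mathbf 1_C)\circ d_{A,B,C}\circ(\mathbf 1_A\wedge c^\vee_{B,C})\circ c^\wedge_{C\vee B,A}$, $\Sigma^\wedge_{B,A}=c^\wedge_{A,\neg B\vee B}\circ\Delta^\wedge_{B,A}$, $\Delta^\vee_{B,A}=\Sigma^\vee_{B,A}\circ c^\vee_{B\wedge\neg B,A}$, $\Delta'_{B,A}=(\mathbf 1_A\wedge c^\vee_{B,\neg B})\circ\Delta^\wedge_{B,A}$, $\Sigma'_{B,A}=\Sigma^\vee_{B,A}\circ(c^\wedge_{\neg B,B}\vee\mathbf 1_A)$. **The category $\mathbf{PN}^\neg$.** Its objects are the formulae and its arrows are the arrow terms modulo the smallest congruence (equivalence relation on arrow terms of the same type compatible with $\circ,\wedge,\vee$) satisfying: the laws of a category; $\wedge$ and $\vee$ are bifunctors; $b^{\xi\to}$, $c^\wedge$, $c^\vee$, $d$ are natural in all indices, and $\Delta^\wedge_{B,A}$, $\Sigma^\vee_{B,A}$ are natural in $A$; $b^{\xi\to}_{A,B,C}$ and $b^{\xi\leftarrow}_{A,B,C}$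 are mutually inverse; $c^\wedge_{B,A}\circ c^\wedge_{A,B}=\mathbf 1_{A\wedge B}$ and $c^\vee_{A,B}\circ c^\vee_{B,A}=\mathbf 1_{A\vee B}$; and - $b^{\xi\leftarrow}_{A,B,C\xi D}\circ b^{\xi\leftarrow}_{A\xi B,C,D}=(\mathbf 1_A\,\xi\,b^{\xi\leftarrow}_{B,C,D})\circ b^{\xi\leftarrow}_{A,B\xi C,D}\circ(b^{\xi\leftarrow}_{A,B,C}\,\xi\,\mathbf 1_D)$, - $(\mathbf 1_B\wedge c^\wedge_{C,A})\circ b^{\wedge\leftarrow}_{B,C,A}\circ c^\wedge_{A,B\wedge C}\circ b^{\wedge\leftarrow}_{A,B,C}\circ(c^\wedge_{B,A}\wedge\mathbf 1_C)=b^{\wedge\leftarrow}_{B,A,C}$, - $(\mathbf 1_B\vee c^\vee_{A,C})\circ b^{\vee\leftarrow}_{B,C,A}\circ c^\vee_{B\vee C,A}\circ b^{\vee\leftarrow}_{A,B,C}\circ(c^\vee_{A,B}\vee\mathbf 1_C)=b^{\vee\leftarrow}_{B,A,C}$, - $(b^{\wedge\leftarrow}_{A,B,C}\vee\mathbf 1_D)\circ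 d_{A\wedge B,C,D}=d_{A,B\wedge C,D}\circ(\mathbf 1_A\wedge d_{B,C,D})\circ b^{\wedge\leftarrow}_{A,B,C\vee D}$, - $d_{D,C,B\vee A}\circ(\mathbf 1_D\wedge b^{\vee\leftarrow}_{C,B,A})=b^{\vee\leftarrow}_{D\wedge C,B,A}\circ(d_{D,C,B}\vee\mathbf 1_A)\circ d_{D,C\vee B,A}$, - $d^R_{A\wedge B,C,D}\circ(d_{A,B,C}\wedge\mathbf 1_D)=d_{A,B,C\wedge D}\circ(\mathbf 1_A\wedge d^R_{B,C,D})\circ b^{\wedge\leftarrow}_{A,B\vee C,D}$, - $(\mathbf 1_D\vee d_{C,B,A})\circ d^R_{D,C,B\vee A}=b^{\vee\leftarrow}_{D,C\wedge B,A}\circ(d^R_{D,C,B}\vee\mathbf 1_A)\circ d_{D\vee C,B,A}$, - $b^{\wedge\leftarrow}_{A,B,\neg C\vee C}\circ\Delta^\wedge_{C,A\wedge B}=\mathbf 1_A\wedge\Delta^\wedge_{C,B}$, and $\Sigma^\vee_{C,B\vee A}\circ b^{\vee\leftarrow}_{C\wedge\neg C,B,A}=\Sigma^\vee_{C,B}\vee\mathbf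 1_A$, - $d_{\neg A\vee A,B,C}\circ\Sigma^\wedge_{A,B\vee C}=\Sigma^\wedge_{A,B}\vee\mathbf 1_C$, and $\Delta^\vee_{A,C\wedge B}\circ d_{C,B,A\wedge\neg A}=\mathbf 1_C\wedge\Delta^\vee_{A,B}$, - $\Sigma^\vee_{A,A}\circ d_{A,\neg A,A}\circ\Delta^\wedge_{A,A}=\mathbf 1_A$, and $\Sigma'_{A,\neg A}\circ d_{\neg A,A,\neg A}\circ\Delta'_{A,\neg A}=\mathbf 1_{\neg A}$. A *proof-net category* is a category with two bifunctors $\wedge,\vee$, a unary operation $\neg$ on objects, and families of arrows $b^{\xi\to},b^{\xi\leftarrow},c^\wedge,c^\vee,d,\Delta^\wedge,\Sigma^\vee$ of the types above, satisfying all these equations. A map from $\mathcal P$ to the objects of a proof-net category interprets every formula as an object and every arrow term as an arrow, in the obvious way. **The category $\mathrm{Br}$.** Its objects are the finite ordinals $n=\{0,\dots,n-1\}$. An arrow $m\vdash n$ is an equivalence relation on the disjoint union of $m$ (source) and $n$ (target) all of whose classes have exactly two elements. The composite of $R:m\vdash n$ and $P:n\vdash k$ is the transitive closure of the union of $R$ and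 $P$ on $m\sqcup n\sqcup k$, restricted to $m\sqcup k$. The identity on $n$ links each $i$ in the source with $i$ in the target. **The functor $G:\mathbf{PN}^\neg\to\mathrm{Br}$.** $GA$ is the number of occurrences of letters in $A$, these occurrences being numbered from left to right. On arrows, $G$ sends $\mathbf 1$, $b^{\xi\to}$, $b^{\xi\leftarrow}$, $d$ to identities; $Gc^\wedge_{A,B}$ and $Gc^\vee_{A,B}$ link each occurrence of a letter in $A$ or $B$ in the source with the same occurrence in the target; $G\Delta^\wedge_{B,A}$ links the occurrences in $A$ in source and target and, in the target, links each occurrence in the $B$ of $\neg B$ with the same occurrence in the other copy of $B$; $G\Sigma^\vee_{B,A}$ does the same with source and target exchanged; $G(f\circ g)$ is the composite of $Gg$ and $Gf$; and $G(f\,\xi\,g)$ places $Gf$ and $Gg$ side by side. **Theorem ($\mathbf{PN}^\neg$ Coherence).** The functor $G:\mathbf{PN}^\neg\to\mathrm{Br}$ is faithful. Thus, for arrow terms $f,g:A\vdash B$: 1. $f=g$ in $\mathbf{PN}^\neg$ if and only if $Gf=Gg$. 2. If $Gf=Gg$, then $f$ and $g$ are interpreted by the same arrow in every proof-net category, for every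 interpretation of the letters. 3. Equality of arrows of $\mathbf{PN}^\neg$ is decidable: there is a total computable function $D$ of two words with values in $\{\text{true},\text{false}\}$ such that, whenever the letters are numbered by an injection $\nu:\mathcal P\to\mathbb N$ and arrow terms are written as words over $\mathbb N$ in Polish notation, for all arrow terms $f,g$ of the same type, $D(f,g)=\text{true}$ if and only if $f=g$ in $\mathbf{PN}^\neg$. -/

import Mathlib

open CategoryTheory

universe u w z

namespace ProofNet

/-! ### Brauerian split equivalences -/

/-- A Brauerian split equivalence `X ⊢ Y`: an equivalence relation on the disjoint union of the
source `X` (elements `Sum.inl x`) and the target `Y` (elements `Sum.inr y`) all of whose equivalence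
classes have exactly two elements. -/
structure BrauerianSplit (X Y : Type) where
  rel : Setoid (X ⊕ Y)
  brauerian : ∀ c ∈ rel.classes, c.ncard = 2

namespace BrauerianSplit

theorem existsUnique_partner {X Y : Type} (R : BrauerianSplit X Y) (u : X ⊕ Y) :
    ∃! v, v ≠ u ∧ R.rel u v := by
  have h := R.brauerian {w | R.rel w u} (R.rel.mem_classes u)
  obtain ⟨p, q, hpq, hs⟩ := Set.ncard_eq_two.1 h
  have hm : ∀ w, R.rel w u ↔ w = p ∨ w = q := fun w => by
    have := Set.ext_iff.1 hs w
    simpa using this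
  have hu := (hm u).1 (R.rel.refl u)
  have hp := (hm p).2 (Or.inl rfl)
  have hq := (hm q).2 (Or.inr rfl)
  rcases hu with rfl | rfl
  · refine ⟨q, ⟨hpq.symm, R.rel.symm hq⟩, fun w hw => ?_⟩
    exact ((hm w).1 (R.rel.symm hw.2)).resolve_left hw.1
  · refine ⟨p, ⟨hpq, R.rel.symm hp⟩, fun w hw => ?_⟩
    exact ((hm w).1 (R.rel.symm hw.2)).resolve_right hw.1

theorem brauerian_of_partner {V : Type} (s : Setoid V)
    (h : ∀ u, ∃! v, v ≠ u ∧ s u v) : ∀ c ∈ s.classes, c.ncard = 2 := by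
  rintro c ⟨u, rfl⟩
  obtain ⟨v, ⟨hne, hv⟩, huniq⟩ := h u
  refine Set.ncard_eq_two.2 ⟨u, v, hne.symm, ?_⟩
  ext w
  constructor
  · intro hw
    by_cases hwu : w = u
    · exact Or.inl hwu
    · exact Or.inr (huniq w ⟨hwu, s.symm hw⟩)
  · rintro (rfl | rfl)
    · exact s.refl _
    · exact s.symm hv

/-- Equality of Brauerian split equivalences follows from one inclusion. -/
theorem eq_of_le {X Y : Type} {R S : BrauerianSplit X Y}
    (h : ∀ u v, R.rel u v → S.rel u v) : R = S := by
  have key : R.rel = S.rel := by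
    ext u v
    refine ⟨h u v, fun hs => ?_⟩
    by_cases huv : v = u
    · subst huv; exact R.rel.refl _
    obtain ⟨w, ⟨hw1, hw2⟩, -⟩ := R.existsUnique_partner u
    have := (S.existsUnique_partner u).unique ⟨hw1, h _ _ hw2⟩ ⟨huv, hs⟩
    exact this ▸ hw2
  cases R; cases S; cases key; rfl

/-- For `R : X ⊢ Y` and `P : Y ⊢ Z`, the union of the relations `R` and `P` on the disjoint union of
`X`, `Y` and `Z`, the target of `R` being identified with the source of `P`. -/
inductive Glue {X Y Z : Type} (P : BrauerianSplit Y Z) (R : BrauerianSplit X Y) :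
    X ⊕ (Y ⊕ Z) → X ⊕ (Y ⊕ Z) → Prop
  | upper {u v : X ⊕ Y} : R.rel u v → Glue P R (Sum.map id Sum.inl u) (Sum.map id Sum.inl v)
  | lower {u v : Y ⊕ Z} : P.rel u v → Glue P R (Sum.inr u) (Sum.inr v)

/-- If `a`, `b` are involutions of a finite set without common fixed points, then the orbit of a
point fixed by `b` contains exactly one other point that is fixed by `a` or by `b`. -/
theorem dihedral_aux {V : Type} [Finite V] (a b : V → V) (ha : Function.Involutive a)
    (hb : Function.Involutive b) (hab : ∀ y, a y = y → b y = y → False) (x : V) (hx : b x = x) :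
    ∃! y, y ≠ x ∧ Relation.ReflTransGen (fun u v => v = a u ∨ v = b u) x y ∧
      (a y = y ∨ b y = y) := by
  let pa : Equiv.Perm V := ha.toPerm
  let pb : Equiv.Perm V := hb.toPerm
  have hpa : pa * pa = 1 := by ext y; exact ha y
  have hpb : pb * pb = 1 := by ext y; exact hb y
  have hpa' : pa⁻¹ = pa := inv_eq_of_mul_eq_one_left hpa
  have hpb' : pb⁻¹ = pb := inv_eq_of_mul_eq_one_left hpb
  let c : Equiv.Perm V := pa * pb
  have hconj : ∀ i : ℤ, pb * c ^ i = c ^ (-i) * pb := by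
    intro i
    have h1 : pb * c * pb⁻¹ = c⁻¹ := by
      simp only [c, mul_inv_rev, hpa', hpb', mul_assoc, hpb, mul_one]
    have h2 : pb * c ^ i * pb⁻¹ = c ^ (-i) := by
      rw [← conj_zpow, h1, inv_zpow, zpow_neg]
    rw [← h2]; group
  have hbi : ∀ i : ℤ, b ((c ^ i) x) = (c ^ (-i)) x := by
    intro i
    have := congrArg (fun p : Equiv.Perm V => p x) (hconj i)
    simp only [Equiv.Perm.mul_apply] at this
    have hbx : pb x = x := hx
    rw [hbx] at this
    exact this
  have hai : ∀ i : ℤ, a ((c ^ i) x) = (c ^ (1 - i)) x := by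
    intro i
    have h1 : pa = c * pb := by simp only [c, mul_assoc, hpb, mul_one]
    have h2 : a ((c ^ i) x) = c (b ((c ^ i) x)) := by
      change pa _ = _
      rw [h1]; rfl
    rw [h2, hbi, sub_eq_add_neg, zpow_add, zpow_one]; rfl
  set N : ℕ := MulAction.period c x with hN
  have hNpos : 0 < N := MulAction.period_pos_of_orderOf_pos (orderOf_pos c) x
  have hper : ∀ i : ℤ, (c ^ i) x = x ↔ (N : ℤ) ∣ i := fun i =>
    MulAction.zpow_smul_eq_iff_period_dvd (g := c) (a := x)
  have hper2 : ∀ i j : ℤ, (c ^ i) x = (c ^ j) x ↔ (N : ℤ) ∣ i - j := by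
    intro i j
    rw [← hper, sub_eq_neg_add, zpow_add, zpow_neg, Equiv.Perm.mul_apply, Equiv.Perm.inv_eq_iff_eq]
  have hreach : ∀ y, Relation.ReflTransGen (fun u v => v = a u ∨ v = b u) x y →
      ∃ i : ℤ, y = (c ^ i) x := by
    intro y hy
    induction hy with
    | refl => exact ⟨0, by simp⟩
    | tail _ hstep ih =>
      obtain ⟨i, rfl⟩ := ih
      rcases hstep with rfl | rfl
      · exact ⟨_, hai i⟩
      · exact ⟨_, hbi i⟩
  have hreach' : ∀ i : ℕ, Relation.ReflTransGen (fun u v => v = a u ∨ v = b u) x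
      ((c ^ (i : ℤ)) x) := by
    intro i
    induction i with
    | zero => simpa using Relation.ReflTransGen.refl
    | succ k ih =>
      refine (ih.tail (Or.inr rfl)).tail (Or.inl ?_)
      rw [hbi, hai]; congr 2; push_cast; ring
  have fixa : ∀ i : ℤ, a ((c ^ i) x) = (c ^ i) x ↔ (N : ℤ) ∣ 1 - 2 * i := by
    intro i; rw [hai, hper2]; ring_nf
  have fixb : ∀ i : ℤ, b ((c ^ i) x) = (c ^ i) x ↔ (N : ℤ) ∣ 2 * i := by
    intro i; rw [hbi, hper2, ← dvd_neg]; ring_nf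
  have hN1 : N ≠ 1 := by
    intro h1
    refine hab x ?_ hx
    have := (fixa 0).2 (by rw [h1]; simp)
    simpa using this
  rcases Nat.even_or_odd' N with ⟨k, hk | hk⟩
  · refine ⟨(c ^ (k : ℤ)) x, ⟨?_, hreach' k, Or.inr ((fixb _).2 ?_)⟩, ?_⟩
    · rw [Ne, hper]; rintro ⟨t, ht⟩
      rw [hk] at ht; push_cast at ht
      have hk0 : (k : ℤ) ≠ 0 := by omega
      have : (k : ℤ) * (2 * t - 1) = 0 := by linarith
      rcases mul_eq_zero.1 this with h | h
      · exact hk0 h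
      · omega
    · rw [hk]; push_cast; exact dvd_rfl
    · rintro y ⟨hyx, hy, hfix⟩
      obtain ⟨i, rfl⟩ := hreach y hy
      rw [fixa, fixb] at hfix
      rw [Ne, hper] at hyx
      rw [hper2]
      rw [hk] at hfix hyx ⊢; push_cast at hfix hyx ⊢
      rcases hfix with ⟨t, ht⟩ | ⟨t, ht⟩
      · exfalso
        have : 2 * (k * t + i) = 1 := by linarith
        omega
      · have hi : i = k * t := by linarith
        rcases Int.even_or_odd' t with ⟨m, hm | hm⟩
        · exact absurd ⟨m, by rw [hi, hm]; ring⟩ hyx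
        · exact ⟨m, by rw [hi, hm]; ring⟩
  · have hodd : ∀ i : ℤ, (N : ℤ) ∣ 2 * i → (N : ℤ) ∣ i := fun i h =>
      Int.dvd_of_dvd_mul_right_of_gcd_one h (by
        rw [hk]
        rw [Int.gcd_eq_natAbs]
        change Nat.gcd (2 * k + 1) 2 = 1
        simp)
    refine ⟨(c ^ ((k + 1 : ℕ) : ℤ)) x, ⟨?_, hreach' (k + 1), Or.inl ((fixa _).2 ?_)⟩, ?_⟩
    · rw [Ne, hper]; intro hd
      have := Int.le_of_dvd (by positivity) hd
      omega
    · rw [hk]; push_cast; exact ⟨-1, by ring⟩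
    · rintro y ⟨hyx, hy, hfix⟩
      obtain ⟨i, rfl⟩ := hreach y hy
      rw [fixa, fixb] at hfix
      rw [Ne, hper] at hyx
      rw [hper2]
      rcases hfix with h | h
      · apply hodd
        have h2 : (2 : ℤ) * (i - ((k + 1 : ℕ) : ℤ)) = -(1 - 2 * i) - N := by
          rw [hk]; push_cast; ring
        rw [h2]
        exact dvd_sub ((dvd_neg).2 h) dvd_rfl
      · exact absurd (hodd i h) hyx


/-- The other element of the equivalence class of `u`. -/
noncomputable def partner {X Y : Type} (R : BrauerianSplit X Y) (u : X ⊕ Y) : X ⊕ Y :=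
  (R.existsUnique_partner u).choose

theorem partner_ne {X Y : Type} (R : BrauerianSplit X Y) (u : X ⊕ Y) : R.partner u ≠ u :=
  (R.existsUnique_partner u).choose_spec.1.1

theorem rel_partner {X Y : Type} (R : BrauerianSplit X Y) (u : X ⊕ Y) :
    R.rel u (R.partner u) :=
  (R.existsUnique_partner u).choose_spec.1.2

theorem eq_partner {X Y : Type} (R : BrauerianSplit X Y) {u v : X ⊕ Y} (h : R.rel u v)
    (hne : v ≠ u) : v = R.partner u :=
  (R.existsUnique_partner u).choose_spec.2 v ⟨hne, h⟩

theorem partner_partner {X Y : Type} (R : BrauerianSplit X Y) (u : X ⊕ Y) :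
    R.partner (R.partner u) = u :=
  (R.eq_partner (R.rel.symm (R.rel_partner u)) (R.partner_ne u).symm).symm

theorem glue_symm {X Y Z : Type} {P : BrauerianSplit Y Z} {R : BrauerianSplit X Y}
    {u v : X ⊕ (Y ⊕ Z)} (h : Glue P R u v) : Glue P R v u := by
  cases h with
  | upper h => exact .upper (R.rel.symm h)
  | lower h => exact .lower (P.rel.symm h)

theorem glue_refl {X Y Z : Type} (P : BrauerianSplit Y Z) (R : BrauerianSplit X Y)
    (u : X ⊕ (Y ⊕ Z)) : Glue P R u u := by
  rcases u with x | u
  · exact .upper (u := .inl x) (v := .inl x) (R.rel.refl _)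
  · exact .lower (P.rel.refl _)

/-- The relation `P ∗ R`: the transitive closure of the union of `R` and `P`, restricted to the
source of `R` and the target of `P`. -/
def compRel {X Y Z : Type} (P : BrauerianSplit Y Z) (R : BrauerianSplit X Y) :
    Setoid (X ⊕ Z) where
  r u v := Relation.TransGen (Glue P R) (Sum.map id Sum.inr u) (Sum.map id Sum.inr v)
  iseqv :=
    { refl := fun _ => .single (glue_refl P R _)
      symm := fun h => by
        have : Std.Symm (Glue P R) := ⟨fun _ _ => glue_symm⟩
        exact (inferInstance : Std.Symm (Relation.TransGen (Glue P R))).symm _ _ h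
      trans := fun h k => h.trans k }

theorem compRel_brauerian {X Y Z : Type} [Finite X] [Finite Y] [Finite Z]
    (P : BrauerianSplit Y Z) (R : BrauerianSplit X Y) :
    ∀ c ∈ (compRel P R).classes, c.ncard = 2 := by
  apply brauerian_of_partner
  let a : X ⊕ (Y ⊕ Z) → X ⊕ (Y ⊕ Z) := fun w => match w with
    | .inl x => Sum.map id Sum.inl (R.partner (.inl x))
    | .inr (.inl y) => Sum.map id Sum.inl (R.partner (.inr y))
    | .inr (.inr z) => .inr (.inr z)
  let b : X ⊕ (Y ⊕ Z) → X ⊕ (Y ⊕ Z) := fun w => match w with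
    | .inl x => .inl x
    | .inr v => .inr (P.partner v)
  have a_up : ∀ u : X ⊕ Y, a (Sum.map id Sum.inl u) = Sum.map id Sum.inl (R.partner u) := by
    rintro (x | y) <;> rfl
  have inj_up : Function.Injective (Sum.map id Sum.inl : X ⊕ Y → X ⊕ (Y ⊕ Z)) :=
    Sum.map_injective.2 ⟨Function.injective_id, Sum.inl_injective⟩
  have inj_out : Function.Injective (Sum.map id Sum.inr : X ⊕ Z → X ⊕ (Y ⊕ Z)) :=
    Sum.map_injective.2 ⟨Function.injective_id, Sum.inr_injective⟩
  have cases_up : ∀ w : X ⊕ (Y ⊕ Z), (∃ u : X ⊕ Y, w = Sum.map id Sum.inl u) ∨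
      ∃ z, w = .inr (.inr z) := by
    rintro (x | y | z)
    · exact .inl ⟨.inl x, rfl⟩
    · exact .inl ⟨.inr y, rfl⟩
    · exact .inr ⟨z, rfl⟩
  have ha : Function.Involutive a := by
    intro w
    rcases cases_up w with ⟨u, rfl⟩ | ⟨z, rfl⟩
    · rw [a_up, a_up, partner_partner]
    · rfl
  have hb : Function.Involutive b := by
    rintro (x | v)
    · rfl
    · exact congrArg Sum.inr (P.partner_partner v)
  have fixa : ∀ w, a w = w ↔ ∃ z, w = .inr (.inr z) := by
    intro w
    rcases cases_up w with ⟨u, rfl⟩ | ⟨z, rfl⟩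
    · rw [a_up]
      refine ⟨fun h => absurd (inj_up h) (R.partner_ne u), ?_⟩
      rintro ⟨z, hz⟩
      rcases u with x | y <;> simp at hz
    · exact ⟨fun _ => ⟨z, rfl⟩, fun _ => rfl⟩
  have fixb : ∀ w, b w = w ↔ ∃ x, w = .inl x := by
    rintro (x | v)
    · exact ⟨fun _ => ⟨x, rfl⟩, fun _ => rfl⟩
    · refine ⟨fun h => absurd (Sum.inr_injective h) (P.partner_ne v), ?_⟩
      rintro ⟨x, hx⟩
      simp at hx
  have hout : ∀ w, (a w = w ∨ b w = w) ↔ ∃ u : X ⊕ Z, w = Sum.map id Sum.inr u := by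
    intro w
    rw [fixa, fixb]
    constructor
    · rintro (⟨z, rfl⟩ | ⟨x, rfl⟩)
      · exact ⟨.inr z, rfl⟩
      · exact ⟨.inl x, rfl⟩
    · rintro ⟨x | z, rfl⟩
      · exact .inr ⟨x, rfl⟩
      · exact .inl ⟨z, rfl⟩
  have hab : ∀ y, a y = y → b y = y → False := by
    intro y h1 h2
    obtain ⟨z, rfl⟩ := (fixa y).1 h1
    obtain ⟨x, hx⟩ := (fixb (.inr (.inr z))).1 h2
    simp at hx
  have glue_a : ∀ w, Glue P R w (a w) := by
    intro w
    rcases cases_up w with ⟨u, rfl⟩ | ⟨z, rfl⟩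
    · rw [a_up]; exact .upper (R.rel_partner u)
    · exact glue_refl P R _
  have glue_b : ∀ w, Glue P R w (b w) := by
    rintro (x | v)
    · exact glue_refl P R _
    · exact .lower (P.rel_partner v)
  have htrans : ∀ u v, Relation.TransGen (Glue P R) u v ↔
      Relation.ReflTransGen (fun u v => v = a u ∨ v = b u) u v := by
    intro u v
    constructor
    · intro h
      induction h with
      | single h =>
        cases h with
        | @upper p q h =>
          by_cases hpq : q = p
          · subst hpq; exact .refl
          · exact .single (.inl (by rw [a_up, R.eq_partner h hpq]))
        | @lower p q h =>
          by_cases hpq : q = p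
          · subst hpq; exact .refl
          · exact .single (.inr (congrArg Sum.inr (P.eq_partner h hpq)))
      | tail _ h ih =>
        cases h with
        | @upper p q h =>
          by_cases hpq : q = p
          · subst hpq; exact ih
          · exact ih.tail (.inl (by rw [a_up, R.eq_partner h hpq]))
        | @lower p q h =>
          by_cases hpq : q = p
          · subst hpq; exact ih
          · exact ih.tail (.inr (congrArg Sum.inr (P.eq_partner h hpq)))
    · intro h
      induction h with
      | refl => exact .single (glue_refl P R _)
      | tail _ h ih =>
        rcases h with rfl | rfl
        · exact ih.tail (glue_a _)
        · exact ih.tail (glue_b _)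
  have main : ∀ x : X ⊕ Z, ∃! y, y ≠ Sum.map id Sum.inr x ∧
      Relation.ReflTransGen (fun u v => v = a u ∨ v = b u) (Sum.map id Sum.inr x) y ∧
      (a y = y ∨ b y = y) := by
    rintro (x | z)
    · exact dihedral_aux a b ha hb hab _ rfl
    · have := dihedral_aux b a hb ha (fun y h1 h2 => hab y h2 h1) (.inr (.inr z)) rfl
      simp only [@or_comm (b _ = _), @or_comm (_ = b _)] at this
      exact this
  intro u
  obtain ⟨y, ⟨h1, h2, h3⟩, h4⟩ := main u
  obtain ⟨v, rfl⟩ := (hout y).1 h3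
  refine ⟨v, ⟨fun h => h1 (by rw [h]), (htrans _ _).2 h2⟩, ?_⟩
  rintro w ⟨hw1, hw2⟩
  exact inj_out (h4 _ ⟨fun h => hw1 (inj_out h), (htrans _ _).1 hw2, (hout _).2 ⟨w, rfl⟩⟩)

/-- The composite `P ∗ R : X ⊢ Z` of `R : X ⊢ Y` and `P : Y ⊢ Z`. -/
def comp {X Y Z : Type} [Finite X] [Finite Y] [Finite Z]
    (P : BrauerianSplit Y Z) (R : BrauerianSplit X Y) : BrauerianSplit X Z where
  rel := compRel P R
  brauerian := compRel_brauerian P R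

/-- Adjacency on the four levels of a threefold composition. -/
inductive Glue₃ {W X Y Z : Type} (Q : BrauerianSplit Y Z) (P : BrauerianSplit X Y)
    (R : BrauerianSplit W X) : W ⊕ (X ⊕ (Y ⊕ Z)) → W ⊕ (X ⊕ (Y ⊕ Z)) → Prop
  | upper {u v : W ⊕ X} : R.rel u v → Glue₃ Q P R (Sum.map id Sum.inl u) (Sum.map id Sum.inl v)
  | lower {u v : X ⊕ (Y ⊕ Z)} : Glue Q P u v → Glue₃ Q P R (Sum.inr u) (Sum.inr v)

theorem comp_assoc {W X Y Z : Type} [Finite W] [Finite X] [Finite Y] [Finite Z]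
    (Q : BrauerianSplit Y Z) (P : BrauerianSplit X Y) (R : BrauerianSplit W X) :
    comp Q (comp P R) = comp (comp Q P) R := by
  refine eq_of_le fun u v h => ?_
  have h1 : ∀ p q : W ⊕ (X ⊕ Y), Glue P R p q →
      Glue₃ Q P R (Sum.map id (Sum.map id Sum.inl) p) (Sum.map id (Sum.map id Sum.inl) q) := by
    intro p q h
    cases h with
    | @upper p q h =>
      have := Glue₃.upper (Q := Q) (P := P) h
      rcases p with p | p <;> rcases q with q | q <;> exact this
    | @lower p q h => exact .lower (.upper h)
  have h2 : ∀ p q : W ⊕ (Y ⊕ Z), Glue Q (comp P R) p q →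
      Relation.TransGen (Glue₃ Q P R) (Sum.map id Sum.inr p) (Sum.map id Sum.inr q) := by
    intro p q h
    cases h with
    | @upper p q h =>
      have := Relation.TransGen.lift _ h1 _ _ h
      rcases p with p | p <;> rcases q with q | q <;> exact this
    | lower h => exact .single (.lower (.lower h))
  have h3 : Relation.TransGen (Glue₃ Q P R) (Sum.map id (Sum.inr ∘ Sum.inr) u)
      (Sum.map id (Sum.inr ∘ Sum.inr) v) := by
    have := Relation.TransGen.lift' _ h2 _ _ h
    rcases u with u | u <;> rcases v with v | v <;> exact this
  have key : ∀ (p : W ⊕ (X ⊕ Z)) (q : W ⊕ (X ⊕ (Y ⊕ Z))),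
      Relation.ReflTransGen (Glue₃ Q P R) (Sum.map id (Sum.map id Sum.inr) p) q →
      ∃ q' : W ⊕ (X ⊕ Z), Relation.TransGen (Glue (comp Q P) R) p q' ∧
        (q = Sum.map id (Sum.map id Sum.inr) q' ∨ ∃ s t, q' = .inr s ∧ q = .inr t ∧
          Relation.TransGen (Glue Q P) (Sum.map id Sum.inr s) t) := by
    intro p q h
    induction h with
    | refl => exact ⟨p, .single (glue_refl _ _ _), .inl rfl⟩
    | @tail q r _ hqr ih =>
      obtain ⟨q', hp, hq⟩ := ih
      cases hqr with
      | @upper a b hab =>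
        have hb : (Sum.map id Sum.inl b : W ⊕ (X ⊕ (Y ⊕ Z))) =
            Sum.map id (Sum.map id Sum.inr) (Sum.map id Sum.inl b : W ⊕ (X ⊕ Z)) := by
          rcases b with b | b <;> rfl
        refine ⟨Sum.map id Sum.inl b, ?_, .inl hb⟩
        have hqa : Relation.TransGen (Glue (comp Q P) R) p (Sum.map id Sum.inl a) := by
          rcases hq with hq | ⟨s, t, rfl, ht, hst⟩
          · have : q' = Sum.map id Sum.inl a := by
              rcases q' with q' | q' | q' <;> rcases a with a | a <;> simp_all
            exact this ▸ hp
          · rcases a with a | a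
            · simp at ht
            · simp only [Sum.map_inr, Sum.inr.injEq] at ht
              subst ht
              exact hp.tail (.lower (v := .inl a) hst)
        exact hqa.tail (.upper hab)
      | @lower a b hab =>
        rcases hq with hq | ⟨s, t, rfl, ht, hst⟩
        · rcases q' with q' | s
          · simp at hq
          · simp only [Sum.map_inr, Sum.inr.injEq] at hq
            exact ⟨.inr s, hp, .inr ⟨s, b, rfl, rfl, .single (hq ▸ hab)⟩⟩
        · simp only [Sum.inr.injEq] at ht
          subst ht
          exact ⟨.inr s, hp, .inr ⟨s, b, rfl, rfl, hst.tail hab⟩⟩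
  have e : ∀ w : W ⊕ Z, (Sum.map id (Sum.inr ∘ Sum.inr) w : W ⊕ (X ⊕ (Y ⊕ Z))) =
      Sum.map id (Sum.map id Sum.inr) (Sum.map id Sum.inr w : W ⊕ (X ⊕ Z)) := by
    rintro (w | w) <;> rfl
  rw [e] at h3
  obtain ⟨q', hp, hq⟩ := key _ _ h3.to_reflTransGen
  rcases hq with hq | ⟨s, t, rfl, ht, hst⟩
  · have inj : Function.Injective
        (Sum.map id (Sum.map id Sum.inr) : W ⊕ (X ⊕ Z) → W ⊕ (X ⊕ (Y ⊕ Z))) :=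
      Sum.map_injective.2 ⟨Function.injective_id,
        Sum.map_injective.2 ⟨Function.injective_id, Sum.inr_injective⟩⟩
    rw [e] at hq
    have h5 := inj hq
    subst h5
    exact hp
  · rcases v with v | v
    · simp at ht
    · simp only [Sum.map_inr, Function.comp_apply, Sum.inr.injEq] at ht
      subst ht
      exact hp.tail (.lower (v := .inr v) hst)

/-- The Brauerian split equivalence of a bijection, with members `{u_s, e(u)_t}`. -/
def ofEquiv {X Y : Type} (e : X ≃ Y) : BrauerianSplit X Y where
  rel := Setoid.ker (Sum.elim e id)
  brauerian := by
    apply brauerian_of_partner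
    rintro (x | y)
    · refine ⟨.inr (e x), ⟨by simp, by simp [Setoid.ker_def]⟩, ?_⟩
      rintro (x' | y') ⟨h1, h2⟩ <;> simp_all [Setoid.ker_def]
    · refine ⟨.inl (e.symm y), ⟨by simp, by simp [Setoid.ker_def]⟩, ?_⟩
      rintro (x' | y') ⟨h1, h2⟩
      · simp only [Setoid.ker_def, Sum.elim_inr, Sum.elim_inl, id] at h2
        simp [h2]
      · simp only [Setoid.ker_def, Sum.elim_inr, id] at h2
        simp [h2] at h1

/-- Transport of a Brauerian split equivalence along bijections of source and target. -/
def relabel {X Y X' Y' : Type} (e : X ≃ X') (f : Y ≃ Y') (R : BrauerianSplit X Y) :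
    BrauerianSplit X' Y' where
  rel := Setoid.comap (Sum.map e.symm f.symm) R.rel
  brauerian := by
    apply brauerian_of_partner
    let k : X' ⊕ Y' ≃ X ⊕ Y := Equiv.sumCongr e.symm f.symm
    intro u
    obtain ⟨v, ⟨h1, h2⟩, h3⟩ := R.existsUnique_partner (k u)
    refine ⟨k.symm v, ⟨fun h => h1 ?_, ?_⟩, fun w hw => ?_⟩
    · rw [← h, Equiv.apply_symm_apply]
    · change R.rel (k u) (k (k.symm v))
      rwa [Equiv.apply_symm_apply]
    · rw [Equiv.eq_symm_apply]
      exact h3 _ ⟨fun h => hw.1 (k.injective h), hw.2⟩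

theorem comp_ofEquiv {X Y Z : Type} [Finite X] [Finite Y] [Finite Z]
    (R : BrauerianSplit Y Z) (e : X ≃ Y) :
    comp R (ofEquiv e) = relabel e.symm (Equiv.refl Z) R := by
  refine (eq_of_le fun u v h => ?_).symm
  have h1 : ∀ w : X ⊕ Z, Glue R (ofEquiv e) (Sum.map id Sum.inr w) (Sum.inr (Sum.map e id w)) := by
    rintro (x | z)
    · exact .upper (u := .inl x) (v := .inr (e x)) rfl
    · exact .lower (R.rel.refl _)
  exact ((Relation.TransGen.single (h1 u)).tail (.lower h)).tail (glue_symm (h1 v))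

theorem ofEquiv_comp {X Y Z : Type} [Finite X] [Finite Y] [Finite Z]
    (e : Y ≃ Z) (R : BrauerianSplit X Y) :
    comp (ofEquiv e) R = relabel (Equiv.refl X) e R := by
  refine (eq_of_le fun u v h => ?_).symm
  have h1 : ∀ w : X ⊕ Z, Glue (ofEquiv e) R (Sum.map id Sum.inr w)
      (Sum.map id Sum.inl (Sum.map id e.symm w)) := by
    rintro (x | z)
    · exact .upper (u := .inl x) (v := .inl x) (R.rel.refl _)
    · exact .lower (u := .inr z) (v := .inl (e.symm z)) (e.apply_symm_apply z).symm
  exact ((Relation.TransGen.single (h1 u)).tail (.upper h)).tail (glue_symm (h1 v))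

theorem relabel_refl {X Y : Type} (R : BrauerianSplit X Y) :
    relabel (Equiv.refl X) (Equiv.refl Y) R = R :=
  eq_of_le fun u v h => by rcases u with u | u <;> rcases v with v | v <;> exact h

theorem comp_id {X Y : Type} [Finite X] [Finite Y] (R : BrauerianSplit X Y) :
    comp R (ofEquiv (Equiv.refl X)) = R :=
  (comp_ofEquiv R _).trans (relabel_refl R)

theorem id_comp {X Y : Type} [Finite X] [Finite Y] (R : BrauerianSplit X Y) :
    comp (ofEquiv (Equiv.refl Y)) R = R :=
  (ofEquiv_comp _ R).trans (relabel_refl R)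

theorem relabel_comp {X Y Z X' Y' Z' : Type} [Finite X] [Finite Y] [Finite Z] [Finite X']
    [Finite Y'] [Finite Z'] (e : X ≃ X') (f : Y ≃ Y') (g : Z ≃ Z')
    (P : BrauerianSplit Y Z) (R : BrauerianSplit X Y) :
    relabel e g (comp P R) = comp (relabel f g P) (relabel e f R) := by
  refine eq_of_le fun u v h => ?_
  have h1 : ∀ p q, Glue P R p q → Glue (relabel f g P) (relabel e f R)
      (Sum.map e (Sum.map f g) p) (Sum.map e (Sum.map f g) q) := by
    intro p q h
    cases h with
    | @upper p q h =>
      have : (relabel e f R).rel (Sum.map e f p) (Sum.map e f q) := by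
        change R.rel (Sum.map _ _ _) (Sum.map _ _ _)
        simpa [Sum.map_map] using h
      have := Glue.upper (P := relabel f g P) this
      rcases p with p | p <;> rcases q with q | q <;> exact this
    | @lower p q h =>
      refine .lower (u := Sum.map f g p) (v := Sum.map f g q) ?_
      change P.rel (Sum.map _ _ _) (Sum.map _ _ _)
      simpa [Sum.map_map] using h
  have := Relation.TransGen.lift _ h1 _ _ h
  have e1 : ∀ w : X' ⊕ Z', Sum.map e (Sum.map f g)
      (Sum.map id Sum.inr (Sum.map e.symm g.symm w)) = Sum.map id Sum.inr w := by
    rintro (w | w) <;> simp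
  rw [Function.onFun, e1, e1] at this
  exact this

/-- Collects source and target of the first and of the second of two relations. -/
def regroup (A B D E : Type) : (A ⊕ B) ⊕ (D ⊕ E) ≃ (A ⊕ D) ⊕ (B ⊕ E) where
  toFun
    | .inl (.inl a) => .inl (.inl a)
    | .inl (.inr b) => .inr (.inl b)
    | .inr (.inl d) => .inl (.inr d)
    | .inr (.inr e) => .inr (.inr e)
  invFun
    | .inl (.inl a) => .inl (.inl a)
    | .inl (.inr d) => .inr (.inl d)
    | .inr (.inl b) => .inl (.inr b)
    | .inr (.inr e) => .inr (.inr e)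
  left_inv := by rintro ((_ | _) | (_ | _)) <;> rfl
  right_inv := by rintro ((_ | _) | (_ | _)) <;> rfl

/-- The juxtaposition of two Brauerian split equivalences: the disjoint union of the relation `R` on
`A ⊕ D` and the relation `S` on `B ⊕ E`, with source `A ⊕ B` and target `D ⊕ E`. -/
def juxtapose {A B D E : Type} (R : BrauerianSplit A D) (S : BrauerianSplit B E) :
    BrauerianSplit (A ⊕ B) (D ⊕ E) where
  rel :=
    { r := fun u v => Sum.LiftRel R.rel S.rel
        (regroup A B D E u) (regroup A B D E v)
      iseqv :=
        { refl := fun u => by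
            rcases regroup A B D E u with w | w
            · exact .inl (R.rel.refl _)
            · exact .inr (S.rel.refl _)
          symm := fun {u v} h => by
            generalize regroup A B D E u = u at *
            generalize regroup A B D E v = v at *
            cases h with
            | inl h => exact .inl (R.rel.symm h)
            | inr h => exact .inr (S.rel.symm h)
          trans := fun {u v w} h k => by
            generalize regroup A B D E u = u at *
            generalize regroup A B D E v = v at *
            generalize regroup A B D E w = w at *
            cases h with
            | inl h => cases k with | inl k => exact .inl (R.rel.trans h k)
            | inr h => cases k with | inr k => exact .inr (S.rel.trans h k) } }
  brauerian := by
    apply brauerian_of_partner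
    intro u
    obtain ⟨u, rfl⟩ := (regroup A B D E).symm.surjective u
    rcases u with u | u
    · obtain ⟨v, ⟨h1, h2⟩, h3⟩ := R.existsUnique_partner u
      refine ⟨(regroup A B D E).symm (.inl v), ⟨?_, ?_⟩, ?_⟩
      · rw [Ne, Equiv.apply_eq_iff_eq]; exact fun h => h1 (Sum.inl_injective h)
      · change Sum.LiftRel _ _ _ _
        rw [Equiv.apply_symm_apply, Equiv.apply_symm_apply]
        constructor; exact h2
      · intro w hw
        obtain ⟨w, rfl⟩ := (regroup A B D E).symm.surjective w
        have hw2 : Sum.LiftRel R.rel S.rel _ _ := hw.2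
        rw [Equiv.apply_symm_apply, Equiv.apply_symm_apply] at hw2
        cases hw2 with
        | inl h => rw [h3 _ ⟨fun h => hw.1 (by rw [h]), h⟩]
    · obtain ⟨v, ⟨h1, h2⟩, h3⟩ := S.existsUnique_partner u
      refine ⟨(regroup A B D E).symm (.inr v), ⟨?_, ?_⟩, ?_⟩
      · rw [Ne, Equiv.apply_eq_iff_eq]; exact fun h => h1 (Sum.inr_injective h)
      · change Sum.LiftRel _ _ _ _
        rw [Equiv.apply_symm_apply, Equiv.apply_symm_apply]
        constructor; exact h2
      · intro w hw
        obtain ⟨w, rfl⟩ := (regroup A B D E).symm.surjective w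
        have hw2 : Sum.LiftRel R.rel S.rel _ _ := hw.2
        rw [Equiv.apply_symm_apply, Equiv.apply_symm_apply] at hw2
        cases hw2 with
        | inr h => rw [h3 _ ⟨fun h => hw.1 (by rw [h]), h⟩]

/-- `X ⊢ X ⊕ (Y ⊕ Y)`: each `x` in the source is linked with `x` in the target, and in the target the
two copies of each `y` are linked with each other. -/
def caps (Y X : Type) : BrauerianSplit X (X ⊕ (Y ⊕ Y)) where
  rel := Setoid.ker (Sum.elim Sum.inl (Sum.map id (Sum.elim id id)) : _ → X ⊕ Y)
  brauerian := by
    apply brauerian_of_partner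
    rintro (x | x | y | y)
    · refine ⟨.inr (.inl x), ⟨by simp, by simp [Setoid.ker_def]⟩, ?_⟩
      rintro (x' | x' | y' | y') ⟨h1, h2⟩ <;> simp_all [Setoid.ker_def]
    · refine ⟨.inl x, ⟨by simp, by simp [Setoid.ker_def]⟩, ?_⟩
      rintro (x' | x' | y' | y') ⟨h1, h2⟩ <;> simp_all [Setoid.ker_def]
    · refine ⟨.inr (.inr (.inr y)), ⟨by simp, by simp [Setoid.ker_def]⟩, ?_⟩
      rintro (x' | x' | y' | y') ⟨h1, h2⟩ <;> simp_all [Setoid.ker_def]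
    · refine ⟨.inr (.inr (.inl y)), ⟨by simp, by simp [Setoid.ker_def]⟩, ?_⟩
      rintro (x' | x' | y' | y') ⟨h1, h2⟩ <;> simp_all [Setoid.ker_def]

/-- `(Y ⊕ Y) ⊕ X ⊢ X`: each `x` in the source is linked with `x` in the target, and in the source the
two copies of each `y` are linked with each other. -/
def cups (Y X : Type) : BrauerianSplit ((Y ⊕ Y) ⊕ X) X where
  rel := Setoid.ker (Sum.elim (Sum.map (Sum.elim id id) id) Sum.inr : _ → Y ⊕ X)
  brauerian := by
    apply brauerian_of_partner
    rintro (((y | y) | x) | x)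
    · refine ⟨.inl (.inl (.inr y)), ⟨by simp, by simp [Setoid.ker_def]⟩, ?_⟩
      rintro (((y' | y') | x') | x') ⟨h1, h2⟩ <;> simp_all [Setoid.ker_def]
    · refine ⟨.inl (.inl (.inl y)), ⟨by simp, by simp [Setoid.ker_def]⟩, ?_⟩
      rintro (((y' | y') | x') | x') ⟨h1, h2⟩ <;> simp_all [Setoid.ker_def]
    · refine ⟨.inr x, ⟨by simp, by simp [Setoid.ker_def]⟩, ?_⟩
      rintro (((y' | y') | x') | x') ⟨h1, h2⟩ <;> simp_all [Setoid.ker_def]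
    · refine ⟨.inl (.inr x), ⟨by simp, by simp [Setoid.ker_def]⟩, ?_⟩
      rintro (((y' | y') | x') | x') ⟨h1, h2⟩ <;> simp_all [Setoid.ker_def]

end BrauerianSplit

/-! ### The category `Br` -/

/-- The objects of `Br`: the finite ordinals. -/
structure Br where
  ord : ℕ

/-- The arrows of `Br` are the Brauerian split equivalences of finite ordinals. -/
instance : Category Br where
  Hom m n := BrauerianSplit (Fin m.ord) (Fin n.ord)
  id m := BrauerianSplit.ofEquiv (Equiv.refl (Fin m.ord))
  comp R P := BrauerianSplit.comp P R
  id_comp R := BrauerianSplit.comp_id R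
  comp_id R := BrauerianSplit.id_comp R
  assoc R P Q := BrauerianSplit.comp_assoc Q P R

/-! ### Formulae, arrow terms and equations -/

/-- The two binary connectives. -/
inductive Conn
  | conj
  | disj

/-- Formulae generated from the set `P` of letters with negation and the two connectives. -/
inductive Formula (P : Type u) : Type u
  | letter : P → Formula P
  | neg : Formula P → Formula P
  | bin : Conn → Formula P → Formula P → Formula P

section Syntactic

local infixl:70 " ⋏ " => Formula.bin Conn.conj
local infixl:65 " ⋎ " => Formula.bin Conn.disj
local prefix:max "∼" => Formula.neg

/-- The arrow terms `f : A ⊢ B`. The indices of `commDisj A B : B ∨ A ⊢ A ∨ B` are in this order by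
convention. -/
inductive ArrowTerm {P : Type u} : Formula P → Formula P → Type u
  | id (A : Formula P) : ArrowTerm A A
  | assocTo (ξ : Conn) (A B C : Formula P) :
      ArrowTerm (.bin ξ A (.bin ξ B C)) (.bin ξ (.bin ξ A B) C)
  | assocFrom (ξ : Conn) (A B C : Formula P) :
      ArrowTerm (.bin ξ (.bin ξ A B) C) (.bin ξ A (.bin ξ B C))
  | commConj (A B : Formula P) : ArrowTerm (A ⋏ B) (B ⋏ A)
  | commDisj (A B : Formula P) : ArrowTerm (B ⋎ A) (A ⋎ B)
  | dissoc (A B C : Formula P) : ArrowTerm (A ⋏ (B ⋎ C)) ((A ⋏ B) ⋎ C)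
  | deltaConj (B A : Formula P) : ArrowTerm A (A ⋏ (∼B ⋎ B))
  | sigmaDisj (B A : Formula P) : ArrowTerm ((B ⋏ ∼B) ⋎ A) A
  | comp {A B C : Formula P} (f : ArrowTerm B C) (g : ArrowTerm A B) : ArrowTerm A C
  | bin (ξ : Conn) {A B D E : Formula P} (f : ArrowTerm A D) (g : ArrowTerm B E) :
      ArrowTerm (.bin ξ A B) (.bin ξ D E)

namespace ArrowTerm

local infixl:60 " ⊚ " => ArrowTerm.comp
local infixl:70 " ⋏ₐ " => ArrowTerm.bin Conn.conj
local infixl:65 " ⋎ₐ " => ArrowTerm.bin Conn.disj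
local notation "𝟏" => ArrowTerm.id

variable {P : Type u}

/-- `d^R : (C ∨ B) ∧ A ⊢ C ∨ (B ∧ A)`. -/
def dissocR (C B A : Formula P) : ArrowTerm ((C ⋎ B) ⋏ A) (C ⋎ (B ⋏ A)) :=
  commDisj C (B ⋏ A) ⊚ (commConj A B ⋎ₐ 𝟏 C) ⊚ dissoc A B C ⊚ (𝟏 A ⋏ₐ commDisj B C) ⊚
    commConj (C ⋎ B) A

/-- `Σ^∧ : A ⊢ (¬B ∨ B) ∧ A`. -/
def sigmaConj (B A : Formula P) : ArrowTerm A ((∼B ⋎ B) ⋏ A) :=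
  commConj A (∼B ⋎ B) ⊚ deltaConj B A

/-- `Δ^∨ : A ∨ (B ∧ ¬B) ⊢ A`. -/
def deltaDisj (B A : Formula P) : ArrowTerm (A ⋎ (B ⋏ ∼B)) A :=
  sigmaDisj B A ⊚ commDisj (B ⋏ ∼B) A

/-- The variant of `Δ^∧` of type `A ⊢ A ∧ (B ∨ ¬B)`. -/
def deltaConjPrime (B A : Formula P) : ArrowTerm A (A ⋏ (B ⋎ ∼B)) :=
  (𝟏 A ⋏ₐ commDisj B (∼B)) ⊚ deltaConj B A

/-- The variant of `Σ^∨` of type `(¬B ∧ B) ∨ A ⊢ A`. -/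
def sigmaDisjPrime (B A : Formula P) : ArrowTerm ((∼B ⋏ B) ⋎ A) A :=
  sigmaDisj B A ⊚ (commConj (∼B) B ⋎ₐ 𝟏 A)

/-- The equations of `PN^¬`: the smallest congruence on arrow terms that satisfies the listed laws. -/
inductive Equation : {A B : Formula P} → ArrowTerm A B → ArrowTerm A B → Prop
  | refl {A B : Formula P} (f : ArrowTerm A B) : Equation f f
  | symm {A B : Formula P} {f g : ArrowTerm A B} : Equation f g → Equation g f
  | trans {A B : Formula P} {f g h : ArrowTerm A B} :
      Equation f g → Equation g h → Equation f h
  | cong_comp {A B C : Formula P} {f f₁ : ArrowTerm B C} {g g₁ : ArrowTerm A B} :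
      Equation f f₁ → Equation g g₁ → Equation (f ⊚ g) (f₁ ⊚ g₁)
  | cong_bin (ξ : Conn) {A B D E : Formula P} {f f₁ : ArrowTerm A D} {g g₁ : ArrowTerm B E} :
      Equation f f₁ → Equation g g₁ → Equation (bin ξ f g) (bin ξ f₁ g₁)
  | comp_id {A B : Formula P} (f : ArrowTerm A B) : Equation (f ⊚ 𝟏 A) f
  | id_comp {A B : Formula P} (f : ArrowTerm A B) : Equation (𝟏 B ⊚ f) f
  | assoc {A B C D : Formula P} (h : ArrowTerm C D) (g : ArrowTerm B C) (f : ArrowTerm A B) :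
      Equation (h ⊚ (g ⊚ f)) ((h ⊚ g) ⊚ f)
  | bin_id (ξ : Conn) (A B : Formula P) : Equation (bin ξ (𝟏 A) (𝟏 B)) (𝟏 (.bin ξ A B))
  | bin_comp (ξ : Conn) {A₁ B₁ C₁ A₂ B₂ C₂ : Formula P}
      (g₁ : ArrowTerm B₁ C₁) (f₁ : ArrowTerm A₁ B₁)
      (g₂ : ArrowTerm B₂ C₂) (f₂ : ArrowTerm A₂ B₂) :
      Equation (bin ξ (g₁ ⊚ f₁) (g₂ ⊚ f₂)) (bin ξ g₁ g₂ ⊚ bin ξ f₁ f₂)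
  | assocTo_nat (ξ : Conn) {A B C D E F : Formula P}
      (f : ArrowTerm A D) (g : ArrowTerm B E) (h : ArrowTerm C F) :
      Equation (bin ξ (bin ξ f g) h ⊚ assocTo ξ A B C) (assocTo ξ D E F ⊚ bin ξ f (bin ξ g h))
  | commConj_nat {A B D E : Formula P} (f : ArrowTerm A D) (g : ArrowTerm B E) :
      Equation ((g ⋏ₐ f) ⊚ commConj A B) (commConj D E ⊚ (f ⋏ₐ g))
  | commDisj_nat {A B D E : Formula P} (f : ArrowTerm A D) (g : ArrowTerm B E) :
      Equation ((g ⋎ₐ f) ⊚ commDisj B A) (commDisj E D ⊚ (f ⋎ₐ g))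
  | dissoc_nat {A B C D E F : Formula P}
      (f : ArrowTerm A D) (g : ArrowTerm B E) (h : ArrowTerm C F) :
      Equation (((f ⋏ₐ g) ⋎ₐ h) ⊚ dissoc A B C) (dissoc D E F ⊚ (f ⋏ₐ (g ⋎ₐ h)))
  | assocFrom_assocTo (ξ : Conn) (A B C : Formula P) :
      Equation (assocFrom ξ A B C ⊚ assocTo ξ A B C) (𝟏 (.bin ξ A (.bin ξ B C)))
  | assocTo_assocFrom (ξ : Conn) (A B C : Formula P) :
      Equation (assocTo ξ A B C ⊚ assocFrom ξ A B C) (𝟏 (.bin ξ (.bin ξ A B) C))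
  | pentagon (ξ : Conn) (A B C D : Formula P) :
      Equation (assocFrom ξ A B (.bin ξ C D) ⊚ assocFrom ξ (.bin ξ A B) C D)
        (bin ξ (𝟏 A) (assocFrom ξ B C D) ⊚ assocFrom ξ A (.bin ξ B C) D ⊚
          bin ξ (assocFrom ξ A B C) (𝟏 D))
  | commConj_commConj (A B : Formula P) :
      Equation (commConj B A ⊚ commConj A B) (𝟏 (A ⋏ B))
  | commDisj_commDisj (A B : Formula P) :
      Equation (commDisj A B ⊚ commDisj B A) (𝟏 (A ⋎ B))
  | hexagonConj (A B C : Formula P) :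
      Equation ((𝟏 B ⋏ₐ commConj C A) ⊚ assocFrom .conj B C A ⊚ commConj A (B ⋏ C) ⊚
        assocFrom .conj A B C ⊚ (commConj B A ⋏ₐ 𝟏 C)) (assocFrom .conj B A C)
  | hexagonDisj (A B C : Formula P) :
      Equation ((𝟏 B ⋎ₐ commDisj A C) ⊚ assocFrom .disj B C A ⊚ commDisj (B ⋎ C) A ⊚
        assocFrom .disj A B C ⊚ (commDisj A B ⋎ₐ 𝟏 C)) (assocFrom .disj B A C)
  | dissoc_conj (A B C D : Formula P) :
      Equation ((assocFrom .conj A B C ⋎ₐ 𝟏 D) ⊚ dissoc (A ⋏ B) C D)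
        (dissoc A (B ⋏ C) D ⊚ (𝟏 A ⋏ₐ dissoc B C D) ⊚ assocFrom .conj A B (C ⋎ D))
  | dissoc_disj (A B C D : Formula P) :
      Equation (dissoc D C (B ⋎ A) ⊚ (𝟏 D ⋏ₐ assocFrom .disj C B A))
        (assocFrom .disj (D ⋏ C) B A ⊚ (dissoc D C B ⋎ₐ 𝟏 A) ⊚ dissoc D (C ⋎ B) A)
  | dissoc_assocConj (A B C D : Formula P) :
      Equation (dissocR (A ⋏ B) C D ⊚ (dissoc A B C ⋏ₐ 𝟏 D))
        (dissoc A B (C ⋏ D) ⊚ (𝟏 A ⋏ₐ dissocR B C D) ⊚ assocFrom .conj A (B ⋎ C) D)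
  | dissoc_assocDisj (A B C D : Formula P) :
      Equation ((𝟏 D ⋎ₐ dissoc C B A) ⊚ dissocR D C (B ⋎ A))
        (assocFrom .disj D (C ⋏ B) A ⊚ (dissocR D C B ⋎ₐ 𝟏 A) ⊚ dissoc (D ⋎ C) B A)
  | deltaConj_nat (B : Formula P) {A D : Formula P} (f : ArrowTerm A D) :
      Equation ((f ⋏ₐ 𝟏 (∼B ⋎ B)) ⊚ deltaConj B A) (deltaConj B D ⊚ f)
  | sigmaDisj_nat (B : Formula P) {A D : Formula P} (f : ArrowTerm A D) :
      Equation (f ⊚ sigmaDisj B A) (sigmaDisj B D ⊚ (𝟏 (B ⋏ ∼B) ⋎ₐ f))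
  | assocConj_deltaConj (A B C : Formula P) :
      Equation (assocFrom .conj A B (∼C ⋎ C) ⊚ deltaConj C (A ⋏ B)) (𝟏 A ⋏ₐ deltaConj C B)
  | assocDisj_sigmaDisj (A B C : Formula P) :
      Equation (sigmaDisj C (B ⋎ A) ⊚ assocFrom .disj (C ⋏ ∼C) B A) (sigmaDisj C B ⋎ₐ 𝟏 A)
  | dissoc_sigmaConj (A B C : Formula P) :
      Equation (dissoc (∼A ⋎ A) B C ⊚ sigmaConj A (B ⋎ C)) (sigmaConj A B ⋎ₐ 𝟏 C)
  | dissoc_deltaDisj (A B C : Formula P) :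
      Equation (deltaDisj A (C ⋏ B) ⊚ dissoc C B (A ⋏ ∼A)) (𝟏 C ⋏ₐ deltaDisj A B)
  | sigmaDisj_deltaConj (A : Formula P) :
      Equation (sigmaDisj A A ⊚ dissoc A (∼A) A ⊚ deltaConj A A) (𝟏 A)
  | sigmaDisjPrime_deltaConjPrime (A : Formula P) :
      Equation (sigmaDisjPrime A (∼A) ⊚ dissoc (∼A) A (∼A) ⊚ deltaConjPrime A (∼A)) (𝟏 (∼A))

end ArrowTerm

end Syntactic

/-! ### Graphs of arrow terms -/

/-- The set of occurrences of letters in a formula. -/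
def Formula.Occ {P : Type u} : Formula P → Type
  | .letter _ => Unit
  | .neg A => A.Occ
  | .bin _ A B => A.Occ ⊕ B.Occ

/-- The number of occurrences of letters in a formula. -/
def Formula.size {P : Type u} : Formula P → ℕ
  | .letter _ => 1
  | .neg A => A.size
  | .bin _ A B => A.size + B.size

/-- The numbering of the occurrences of letters from left to right, starting with `0`. -/
def Formula.number {P : Type u} : (A : Formula P) → A.Occ ≃ Fin A.size
  | .letter _ => Equiv.ofUnique Unit (Fin 1)
  | .neg A => A.number
  | .bin _ A B => (Equiv.sumCongr A.number B.number).trans finSumFinEquiv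

instance {P : Type u} (A : Formula P) : Finite A.Occ := Finite.of_equiv _ A.number.symm

open BrauerianSplit in
/-- The graph of an arrow term, as a relation between occurrences of letters. -/
def ArrowTerm.graph {P : Type u} : {A B : Formula P} → ArrowTerm A B →
    BrauerianSplit A.Occ B.Occ
  | _, _, .id A => ofEquiv (Equiv.refl A.Occ)
  | _, _, .assocTo _ A B C => ofEquiv (Equiv.sumAssoc A.Occ B.Occ C.Occ).symm
  | _, _, .assocFrom _ A B C => ofEquiv (Equiv.sumAssoc A.Occ B.Occ C.Occ)
  | _, _, .commConj A B => ofEquiv (Equiv.sumComm A.Occ B.Occ)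
  | _, _, .commDisj A B => ofEquiv (Equiv.sumComm B.Occ A.Occ)
  | _, _, .dissoc A B C => ofEquiv (Equiv.sumAssoc A.Occ B.Occ C.Occ).symm
  | _, _, .deltaConj B A => caps B.Occ A.Occ
  | _, _, .sigmaDisj B A => cups B.Occ A.Occ
  | _, _, .comp f g => BrauerianSplit.comp f.graph g.graph
  | _, _, .bin _ f g => juxtapose f.graph g.graph

namespace BrauerianSplit

theorem juxtapose_rel {A B D E : Type} (R : BrauerianSplit A D) (S : BrauerianSplit B E)
    (u v : (A ⊕ B) ⊕ (D ⊕ E)) : (juxtapose R S).rel u v ↔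
      Sum.LiftRel R.rel S.rel (regroup A B D E u) (regroup A B D E v) := Iff.rfl

theorem relabel_rel {X Y X' Y' : Type} (e : X ≃ X') (f : Y ≃ Y') (R : BrauerianSplit X Y)
    (u v : X' ⊕ Y') : (relabel e f R).rel u v ↔
      R.rel (Sum.map e.symm f.symm u) (Sum.map e.symm f.symm v) := Iff.rfl

theorem ofEquiv_rel {X Y : Type} (e : X ≃ Y) (u v : X ⊕ Y) :
    (ofEquiv e).rel u v ↔ Sum.elim e id u = Sum.elim e id v := Iff.rfl

theorem caps_rel (Y X : Type) (u v : X ⊕ (X ⊕ (Y ⊕ Y))) :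
    (caps Y X).rel u v ↔ (Sum.elim Sum.inl (Sum.map id (Sum.elim id id)) u : X ⊕ Y) =
      Sum.elim Sum.inl (Sum.map id (Sum.elim id id)) v := Iff.rfl

theorem cups_rel (Y X : Type) (u v : ((Y ⊕ Y) ⊕ X) ⊕ X) :
    (cups Y X).rel u v ↔ (Sum.elim (Sum.map (Sum.elim id id) id) Sum.inr u : Y ⊕ X) =
      Sum.elim (Sum.map (Sum.elim id id) id) Sum.inr v := Iff.rfl

theorem regroup_1 {A B D E : Type} (x : A) : regroup A B D E (.inl (.inl x)) = .inl (.inl x) := rfl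
theorem regroup_2 {A B D E : Type} (x : B) : regroup A B D E (.inl (.inr x)) = .inr (.inl x) := rfl
theorem regroup_3 {A B D E : Type} (x : D) : regroup A B D E (.inr (.inl x)) = .inl (.inr x) := rfl
theorem regroup_4 {A B D E : Type} (x : E) : regroup A B D E (.inr (.inr x)) = .inr (.inr x) := rfl

theorem ext_rel {X Y : Type} {R S : BrauerianSplit X Y}
    (h : ∀ u v, R.rel u v ↔ S.rel u v) : R = S := eq_of_le fun u v => (h u v).1

theorem ofEquiv_comp_ofEquiv {X Y Z : Type} [Finite X] [Finite Y] [Finite Z] (f : Y ≃ Z)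
    (e : X ≃ Y) : comp (ofEquiv f) (ofEquiv e) = ofEquiv (e.trans f) := by
  rw [comp_ofEquiv]
  refine ext_rel ?_
  rintro (u | u) (v | v) <;> simp [relabel_rel, ofEquiv_rel]

theorem juxtapose_ofEquiv {A B D E : Type} (e : A ≃ D) (f : B ≃ E) :
    juxtapose (ofEquiv e) (ofEquiv f) = ofEquiv (Equiv.sumCongr e f) := by
  refine ext_rel ?_
  rintro ((u | u) | (u | u)) ((v | v) | (v | v)) <;>
    simp [juxtapose_rel, ofEquiv_rel, regroup_1, regroup_2, regroup_3, regroup_4]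

theorem juxtapose_comp {A₁ B₁ C₁ A₂ B₂ C₂ : Type} [Finite A₁] [Finite B₁] [Finite C₁]
    [Finite A₂] [Finite B₂] [Finite C₂] (g₁ : BrauerianSplit B₁ C₁) (f₁ : BrauerianSplit A₁ B₁)
    (g₂ : BrauerianSplit B₂ C₂) (f₂ : BrauerianSplit A₂ B₂) :
    juxtapose (comp g₁ f₁) (comp g₂ f₂) = comp (juxtapose g₁ g₂) (juxtapose f₁ f₂) := by
  refine eq_of_le fun u v h => ?_
  let k₁ : A₁ ⊕ (B₁ ⊕ C₁) → (A₁ ⊕ A₂) ⊕ ((B₁ ⊕ B₂) ⊕ (C₁ ⊕ C₂)) :=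
    Sum.map .inl (Sum.map .inl .inl)
  let k₂ : A₂ ⊕ (B₂ ⊕ C₂) → (A₁ ⊕ A₂) ⊕ ((B₁ ⊕ B₂) ⊕ (C₁ ⊕ C₂)) :=
    Sum.map .inr (Sum.map .inr .inr)
  have h1 : ∀ p q, Glue g₁ f₁ p q →
      Glue (juxtapose g₁ g₂) (juxtapose f₁ f₂) (k₁ p) (k₁ q) := by
    intro p q h
    cases h with
    | @upper p q h =>
      have := Glue.upper (P := juxtapose g₁ g₂) (R := juxtapose f₁ f₂)
        (u := Sum.map Sum.inl Sum.inl p) (v := Sum.map Sum.inl Sum.inl q)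
        (by rcases p with p | p <;> rcases q with q | q <;> exact .inl h)
      rcases p with p | p <;> rcases q with q | q <;> exact this
    | @lower p q h =>
      exact Glue.lower (u := Sum.map Sum.inl Sum.inl p) (v := Sum.map Sum.inl Sum.inl q)
        (by rcases p with p | p <;> rcases q with q | q <;> exact .inl h)
  have h2 : ∀ p q, Glue g₂ f₂ p q →
      Glue (juxtapose g₁ g₂) (juxtapose f₁ f₂) (k₂ p) (k₂ q) := by
    intro p q h
    cases h with
    | @upper p q h =>
      have := Glue.upper (P := juxtapose g₁ g₂) (R := juxtapose f₁ f₂)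
        (u := Sum.map Sum.inr Sum.inr p) (v := Sum.map Sum.inr Sum.inr q)
        (by rcases p with p | p <;> rcases q with q | q <;> exact .inr h)
      rcases p with p | p <;> rcases q with q | q <;> exact this
    | @lower p q h =>
      exact Glue.lower (u := Sum.map Sum.inr Sum.inr p) (v := Sum.map Sum.inr Sum.inr q)
        (by rcases p with p | p <;> rcases q with q | q <;> exact .inr h)
  rw [juxtapose_rel] at h
  rcases u with (u | u) | (u | u) <;> rcases v with (v | v) | (v | v) <;>
    simp only [regroup_1, regroup_2, regroup_3, regroup_4, Sum.liftRel_inl_inl,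
      Sum.liftRel_inr_inr, Sum.not_liftRel_inl_inr, Sum.not_liftRel_inr_inl] at h <;>
    first
      | exact Relation.TransGen.lift _ h1 _ _ h
      | exact Relation.TransGen.lift _ h2 _ _ h

theorem eq_of_partner {X Y : Type} {R S : BrauerianSplit X Y}
    (h : ∀ u, ∃ v, v ≠ u ∧ R.rel u v ∧ S.rel u v) : R = S := by
  refine eq_of_le fun u v huv => ?_
  obtain ⟨w, h1, h2, h3⟩ := h u
  by_cases hv : v = u
  · subst hv; exact S.rel.refl _
  · rw [(R.existsUnique_partner u).unique ⟨hv, huv⟩ ⟨h1, h2⟩]; exact h3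

theorem comp_rel_of_path₂ {X Y Z : Type} [Finite X] [Finite Y] [Finite Z]
    {P : BrauerianSplit Y Z} {R : BrauerianSplit X Y} {u v : X ⊕ Z} (p q : X ⊕ (Y ⊕ Z))
    (h1 : Glue P R (Sum.map id Sum.inr u) p) (h2 : Glue P R p q)
    (h3 : Glue P R q (Sum.map id Sum.inr v)) : (comp P R).rel u v :=
  ((Relation.TransGen.single h1).tail h2).tail h3

theorem caps_nat {X X' : Type} (Y : Type) [Finite X] [Finite X'] [Finite Y]
    (f : BrauerianSplit X X') :
    comp (juxtapose f (ofEquiv (Equiv.refl (Y ⊕ Y)))) (caps Y X) = comp (caps Y X') f := by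
  have h1 : ∀ p q : X ⊕ X', f.rel p q →
      (comp (juxtapose f (ofEquiv (Equiv.refl (Y ⊕ Y)))) (caps Y X)).rel
        (Sum.map id Sum.inl p) (Sum.map id Sum.inl q) := by
    intro p q h
    have e : ∀ p : X ⊕ X', Glue (juxtapose f (ofEquiv (Equiv.refl (Y ⊕ Y)))) (caps Y X)
        (Sum.map id Sum.inr (Sum.map id Sum.inl p)) (Sum.inr (Sum.map Sum.inl Sum.inl p)) := by
      rintro (p | p)
      · exact .upper (u := Sum.inl p) (v := Sum.inr (Sum.inl p)) rfl
      · exact glue_refl _ _ _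
    refine comp_rel_of_path₂ _ _ (e p) (.lower ?_) (glue_symm (e q))
    rcases p with p | p <;> rcases q with q | q <;> exact .inl h
  have h2 : ∀ p q : X ⊕ X', f.rel p q → (comp (caps Y X') f).rel
        (Sum.map id Sum.inl p) (Sum.map id Sum.inl q) := by
    intro p q h
    have e : ∀ p : X ⊕ X', Glue (caps Y X') f
        (Sum.map id Sum.inr (Sum.map id Sum.inl p)) (Sum.map id Sum.inl p) := by
      rintro (p | p)
      · exact glue_refl _ _ _
      · exact .lower (u := Sum.inr (Sum.inl p)) (v := Sum.inl p) rfl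
    exact comp_rel_of_path₂ _ _ (e p) (.upper h) (glue_symm (e q))
  have h3 : ∀ y : Y, (comp (juxtapose f (ofEquiv (Equiv.refl (Y ⊕ Y)))) (caps Y X)).rel
      (Sum.inr (Sum.inr (Sum.inl y))) (Sum.inr (Sum.inr (Sum.inr y))) := fun y =>
    comp_rel_of_path₂ (Sum.inr (Sum.inl (Sum.inr (Sum.inl y)))) (Sum.inr (Sum.inl (Sum.inr (Sum.inr y))))
      (.lower (u := Sum.inr (Sum.inr (Sum.inl y))) (v := Sum.inl (Sum.inr (Sum.inl y))) (by exact .inr rfl))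
      (.upper (u := Sum.inr (Sum.inr (Sum.inl y))) (v := Sum.inr (Sum.inr (Sum.inr y))) (by rfl))
      (.lower (v := Sum.inr (Sum.inr (Sum.inr y))) (u := Sum.inl (Sum.inr (Sum.inr y))) (by exact .inr rfl))
  have h4 : ∀ y : Y, (comp (caps Y X') f).rel
      (Sum.inr (Sum.inr (Sum.inl y))) (Sum.inr (Sum.inr (Sum.inr y))) := fun y =>
    .single (.lower (u := Sum.inr (Sum.inr (Sum.inl y))) (v := Sum.inr (Sum.inr (Sum.inr y))) (by rfl))
  have inj : Function.Injective (Sum.map id Sum.inl : X ⊕ X' → X ⊕ (X' ⊕ (Y ⊕ Y))) :=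
    Sum.map_injective.2 ⟨Function.injective_id, Sum.inl_injective⟩
  refine eq_of_partner ?_
  rintro (x | x | y | y)
  · exact ⟨Sum.map id Sum.inl (f.partner (Sum.inl x)), fun h => f.partner_ne (Sum.inl x) (inj h),
      h1 (Sum.inl x) _ (f.rel_partner _), h2 (Sum.inl x) _ (f.rel_partner _)⟩
  · exact ⟨Sum.map id Sum.inl (f.partner (Sum.inr x)), fun h => f.partner_ne (Sum.inr x) (inj h),
      h1 (Sum.inr x) _ (f.rel_partner _), h2 (Sum.inr x) _ (f.rel_partner _)⟩
  · exact ⟨_, by simp, h3 y, h4 y⟩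
  · exact ⟨_, by simp, Setoid.symm' _ (h3 y), Setoid.symm' _ (h4 y)⟩

theorem cups_nat {X X' : Type} (Y : Type) [Finite X] [Finite X'] [Finite Y]
    (f : BrauerianSplit X X') :
    comp f (cups Y X) = comp (cups Y X') (juxtapose (ofEquiv (Equiv.refl (Y ⊕ Y))) f) := by
  have h1 : ∀ p q : X ⊕ X', f.rel p q →
      (comp (cups Y X') (juxtapose (ofEquiv (Equiv.refl (Y ⊕ Y))) f)).rel
        (Sum.map Sum.inr id p) (Sum.map Sum.inr id q) := by
    intro p q h
    have e : ∀ p : X ⊕ X', Glue (cups Y X') (juxtapose (ofEquiv (Equiv.refl (Y ⊕ Y))) f)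
        (Sum.map id Sum.inr (Sum.map Sum.inr id p))
        (Sum.map id Sum.inl (Sum.map Sum.inr Sum.inr p)) := by
      rintro (p | p)
      · exact glue_refl _ _ _
      · exact .lower (u := Sum.inr p) (v := Sum.inl (Sum.inr p)) rfl
    refine comp_rel_of_path₂ _ _ (e p) (.upper ?_) (glue_symm (e q))
    rcases p with p | p <;> rcases q with q | q <;> exact .inr h
  have h2 : ∀ p q : X ⊕ X', f.rel p q → (comp f (cups Y X)).rel
        (Sum.map Sum.inr id p) (Sum.map Sum.inr id q) := by
    intro p q h
    have e : ∀ p : X ⊕ X', Glue f (cups Y X)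
        (Sum.map id Sum.inr (Sum.map Sum.inr id p)) (Sum.inr p) := by
      rintro (p | p)
      · exact .upper (u := Sum.inl (Sum.inr p)) (v := Sum.inr p) rfl
      · exact glue_refl _ _ _
    exact comp_rel_of_path₂ _ _ (e p) (.lower h) (glue_symm (e q))
  have h3 : ∀ y : Y, (comp (cups Y X') (juxtapose (ofEquiv (Equiv.refl (Y ⊕ Y))) f)).rel
      (Sum.inl (Sum.inl (Sum.inl y))) (Sum.inl (Sum.inl (Sum.inr y))) := fun y =>
    comp_rel_of_path₂ (Sum.inr (Sum.inl (Sum.inl (Sum.inl y)))) (Sum.inr (Sum.inl (Sum.inl (Sum.inr y))))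
      (.upper (u := Sum.inl (Sum.inl (Sum.inl y))) (v := Sum.inr (Sum.inl (Sum.inl y))) (by exact .inl rfl))
      (.lower (u := Sum.inl (Sum.inl (Sum.inl y))) (v := Sum.inl (Sum.inl (Sum.inr y))) (by rfl))
      (.upper (v := Sum.inl (Sum.inl (Sum.inr y))) (u := Sum.inr (Sum.inl (Sum.inr y))) (by exact .inl rfl))
  have h4 : ∀ y : Y, (comp f (cups Y X)).rel
      (Sum.inl (Sum.inl (Sum.inl y))) (Sum.inl (Sum.inl (Sum.inr y))) := fun y =>
    .single (.upper (u := Sum.inl (Sum.inl (Sum.inl y))) (v := Sum.inl (Sum.inl (Sum.inr y))) (by rfl))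
  have inj : Function.Injective (Sum.map Sum.inr id : X ⊕ X' → ((Y ⊕ Y) ⊕ X) ⊕ X') :=
    Sum.map_injective.2 ⟨Sum.inr_injective, Function.injective_id⟩
  refine eq_of_partner ?_
  rintro (((y | y) | x) | x)
  · exact ⟨_, by simp, h4 y, h3 y⟩
  · exact ⟨_, by simp, Setoid.symm' _ (h4 y), Setoid.symm' _ (h3 y)⟩
  · exact ⟨Sum.map Sum.inr id (f.partner (Sum.inl x)), fun h => f.partner_ne (Sum.inl x) (inj h),
      h2 (Sum.inl x) _ (f.rel_partner _), h1 (Sum.inl x) _ (f.rel_partner _)⟩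
  · exact ⟨Sum.map Sum.inr id (f.partner (Sum.inr x)), fun h => f.partner_ne (Sum.inr x) (inj h),
      h2 (Sum.inr x) _ (f.rel_partner _), h1 (Sum.inr x) _ (f.rel_partner _)⟩

theorem zigzag (Y : Type) [Finite Y] :
    comp (comp (cups Y Y) (ofEquiv (Equiv.sumAssoc Y Y Y).symm)) (caps Y Y) =
      ofEquiv (Equiv.refl Y) := by
  rw [comp_ofEquiv]
  have key : ∀ y : Y, (comp (relabel (Equiv.sumAssoc Y Y Y).symm.symm (Equiv.refl Y) (cups Y Y))
      (caps Y Y)).rel (Sum.inl y) (Sum.inr y) := fun y =>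
    (((Relation.TransGen.single (b := Sum.inr (Sum.inl (Sum.inl y)))
      (.upper (u := Sum.inl y) (v := Sum.inr (Sum.inl y)) (by rfl))).tail
      (c := Sum.inr (Sum.inl (Sum.inr (Sum.inl y))))
      (.lower (u := Sum.inl (Sum.inl y)) (v := Sum.inl (Sum.inr (Sum.inl y))) (by rfl))).tail
      (c := Sum.inr (Sum.inl (Sum.inr (Sum.inr y))))
      (.upper (u := Sum.inr (Sum.inr (Sum.inl y))) (v := Sum.inr (Sum.inr (Sum.inr y))) (by rfl))).tail
      (.lower (u := Sum.inl (Sum.inr (Sum.inr y))) (v := Sum.inr y) (by rfl))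
  refine eq_of_partner ?_
  rintro (y | y)
  · exact ⟨_, by simp, key y, rfl⟩
  · exact ⟨_, by simp, Setoid.symm' _ (key y), rfl⟩

section

variable {A B C D E F : Type} [Finite A] [Finite B] [Finite C] [Finite D] [Finite E] [Finite F]

theorem assocTo_nat (f : BrauerianSplit A D) (g : BrauerianSplit B E) (h : BrauerianSplit C F) :
    comp (juxtapose (juxtapose f g) h) (ofEquiv (Equiv.sumAssoc A B C).symm) =
      comp (ofEquiv (Equiv.sumAssoc D E F).symm) (juxtapose f (juxtapose g h)) := by
  simp only [comp_ofEquiv, ofEquiv_comp]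
  refine ext_rel ?_
  rintro ((u | u | u) | ((u | u) | u)) ((v | v | v) | ((v | v) | v)) <;>
    simp [juxtapose_rel, relabel_rel, regroup_1, regroup_2, regroup_3, regroup_4]

theorem comm_nat (f : BrauerianSplit A D) (g : BrauerianSplit B E) :
    comp (juxtapose g f) (ofEquiv (Equiv.sumComm A B)) =
      comp (ofEquiv (Equiv.sumComm D E)) (juxtapose f g) := by
  simp only [comp_ofEquiv, ofEquiv_comp]
  refine ext_rel ?_
  rintro ((u | u) | (u | u)) ((v | v) | (v | v)) <;>
    simp [juxtapose_rel, relabel_rel, regroup_1, regroup_2, regroup_3, regroup_4]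

theorem assoc_caps :
    comp (ofEquiv (Equiv.sumAssoc A B (C ⊕ C))) (caps C (A ⊕ B)) =
      juxtapose (ofEquiv (Equiv.refl A)) (caps C B) := by
  simp only [ofEquiv_comp]
  refine ext_rel ?_
  rintro ((u | u) | u | u | u | u) ((v | v) | v | v | v | v) <;>
    simp [juxtapose_rel, relabel_rel, caps_rel, ofEquiv_rel, regroup_1, regroup_2, regroup_3,
      regroup_4]

theorem assoc_cups :
    comp (cups C (B ⊕ A)) (ofEquiv (Equiv.sumAssoc (C ⊕ C) B A)) =
      juxtapose (cups C B) (ofEquiv (Equiv.refl A)) := by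
  simp only [comp_ofEquiv]
  refine ext_rel ?_
  rintro (((((u | u) | u) | u)) | (u | u)) (((((v | v) | v) | v)) | (v | v)) <;>
    simp [juxtapose_rel, relabel_rel, cups_rel, ofEquiv_rel, regroup_1, regroup_2, regroup_3,
      regroup_4]

theorem dissoc_caps :
    comp (ofEquiv (Equiv.sumAssoc (A ⊕ A) B C).symm)
        (comp (ofEquiv (Equiv.sumComm (B ⊕ C) (A ⊕ A))) (caps A (B ⊕ C))) =
      juxtapose (comp (ofEquiv (Equiv.sumComm B (A ⊕ A))) (caps A B))
        (ofEquiv (Equiv.refl C)) := by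
  simp only [ofEquiv_comp]
  refine ext_rel ?_
  rintro ((u | u) | (((u | u) | u) | u)) ((v | v) | (((v | v) | v) | v)) <;>
    simp [juxtapose_rel, relabel_rel, caps_rel, ofEquiv_rel, regroup_1, regroup_2, regroup_3,
      regroup_4]

theorem dissoc_cups :
    comp (comp (cups A (C ⊕ B)) (ofEquiv (Equiv.sumComm (C ⊕ B) (A ⊕ A))))
        (ofEquiv (Equiv.sumAssoc C B (A ⊕ A)).symm) =
      juxtapose (ofEquiv (Equiv.refl C))
        (comp (cups A B) (ofEquiv (Equiv.sumComm B (A ⊕ A)))) := by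
  simp only [comp_ofEquiv]
  refine ext_rel ?_
  rintro ((u | u | u | u) | (u | u)) ((v | v | v | v) | (v | v)) <;>
    simp [juxtapose_rel, relabel_rel, cups_rel, ofEquiv_rel, regroup_1, regroup_2, regroup_3,
      regroup_4]

theorem caps_swap :
    comp (juxtapose (ofEquiv (Equiv.refl A)) (ofEquiv (Equiv.sumComm B B))) (caps B A) =
      caps B A := by
  simp only [juxtapose_ofEquiv, ofEquiv_comp]
  refine ext_rel ?_
  rintro (u | u | u | u) (v | v | v | v) <;> simp [relabel_rel, caps_rel]

theorem cups_swap :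
    comp (cups B A) (juxtapose (ofEquiv (Equiv.sumComm B B)) (ofEquiv (Equiv.refl A))) =
      cups B A := by
  simp only [juxtapose_ofEquiv, comp_ofEquiv]
  refine ext_rel ?_
  rintro (((u | u) | u) | u) (((v | v) | v) | v) <;> simp [relabel_rel, cups_rel]

theorem zigzag_swap :
    comp (comp (comp (cups A A)
        (juxtapose (ofEquiv (Equiv.sumComm A A)) (ofEquiv (Equiv.refl A))))
        (ofEquiv (Equiv.sumAssoc A A A).symm))
        (comp (juxtapose (ofEquiv (Equiv.refl A)) (ofEquiv (Equiv.sumComm A A))) (caps A A)) =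
      ofEquiv (Equiv.refl A) := by
  rw [caps_swap, cups_swap, zigzag]

theorem pentagon : comp (ofEquiv (Equiv.sumAssoc A B (C ⊕ D)))
      (ofEquiv (Equiv.sumAssoc (A ⊕ B) C D)) =
    comp (comp (juxtapose (ofEquiv (Equiv.refl A)) (ofEquiv (Equiv.sumAssoc B C D)))
      (ofEquiv (Equiv.sumAssoc A (B ⊕ C) D)))
      (juxtapose (ofEquiv (Equiv.sumAssoc A B C)) (ofEquiv (Equiv.refl D))) := by
  simp only [ofEquiv_comp_ofEquiv, juxtapose_ofEquiv]
  congr 1; ext (((_ | _) | _) | _) <;> rfl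

theorem hexagon :
    comp (comp (comp (comp (juxtapose (ofEquiv (Equiv.refl B)) (ofEquiv (Equiv.sumComm C A)))
      (ofEquiv (Equiv.sumAssoc B C A))) (ofEquiv (Equiv.sumComm A (B ⊕ C))))
      (ofEquiv (Equiv.sumAssoc A B C)))
      (juxtapose (ofEquiv (Equiv.sumComm B A)) (ofEquiv (Equiv.refl C))) =
    ofEquiv (Equiv.sumAssoc B A C) := by
  simp only [ofEquiv_comp_ofEquiv, juxtapose_ofEquiv]
  congr 1; ext ((_ | _) | _) <;> rfl

theorem comm_comm : comp (ofEquiv (Equiv.sumComm B A)) (ofEquiv (Equiv.sumComm A B)) =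
    ofEquiv (Equiv.refl (A ⊕ B)) := by
  simp only [ofEquiv_comp_ofEquiv]
  congr 1; ext (_ | _) <;> rfl

theorem dissoc_conj :
    comp (juxtapose (ofEquiv (Equiv.sumAssoc A B C)) (ofEquiv (Equiv.refl D)))
      (ofEquiv (Equiv.sumAssoc (A ⊕ B) C D).symm) =
    comp (comp (ofEquiv (Equiv.sumAssoc A (B ⊕ C) D).symm)
      (juxtapose (ofEquiv (Equiv.refl A)) (ofEquiv (Equiv.sumAssoc B C D).symm)))
      (ofEquiv (Equiv.sumAssoc A B (C ⊕ D))) := by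
  simp only [ofEquiv_comp_ofEquiv, juxtapose_ofEquiv]
  congr 1; ext ((_ | _) | (_ | _)) <;> rfl

theorem dissoc_disj :
    comp (ofEquiv (Equiv.sumAssoc D C (B ⊕ A)).symm)
      (juxtapose (ofEquiv (Equiv.refl D)) (ofEquiv (Equiv.sumAssoc C B A))) =
    comp (comp (ofEquiv (Equiv.sumAssoc (D ⊕ C) B A))
      (juxtapose (ofEquiv (Equiv.sumAssoc D C B).symm) (ofEquiv (Equiv.refl A))))
      (ofEquiv (Equiv.sumAssoc D (C ⊕ B) A).symm) := by
  simp only [ofEquiv_comp_ofEquiv, juxtapose_ofEquiv]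
  congr 1; ext (_ | ((_ | _) | _)) <;> rfl

theorem dissocR_eq :
    comp (comp (comp (comp (ofEquiv (Equiv.sumComm (B ⊕ A) C))
      (juxtapose (ofEquiv (Equiv.sumComm A B)) (ofEquiv (Equiv.refl C))))
      (ofEquiv (Equiv.sumAssoc A B C).symm))
      (juxtapose (ofEquiv (Equiv.refl A)) (ofEquiv (Equiv.sumComm C B))))
      (ofEquiv (Equiv.sumComm (C ⊕ B) A)) =
    ofEquiv (Equiv.sumAssoc C B A) := by
  simp only [ofEquiv_comp_ofEquiv, juxtapose_ofEquiv]
  congr 1; ext ((_ | _) | _) <;> rfl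

theorem dissoc_assocConj :
    comp (ofEquiv (Equiv.sumAssoc (A ⊕ B) C D))
      (juxtapose (ofEquiv (Equiv.sumAssoc A B C).symm) (ofEquiv (Equiv.refl D))) =
    comp (comp (ofEquiv (Equiv.sumAssoc A B (C ⊕ D)).symm)
      (juxtapose (ofEquiv (Equiv.refl A)) (ofEquiv (Equiv.sumAssoc B C D))))
      (ofEquiv (Equiv.sumAssoc A (B ⊕ C) D)) := by
  simp only [ofEquiv_comp_ofEquiv, juxtapose_ofEquiv]
  congr 1; ext ((_ | (_ | _)) | _) <;> rfl

theorem dissoc_assocDisj :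
    comp (juxtapose (ofEquiv (Equiv.refl D)) (ofEquiv (Equiv.sumAssoc C B A).symm))
      (ofEquiv (Equiv.sumAssoc D C (B ⊕ A))) =
    comp (comp (ofEquiv (Equiv.sumAssoc D (C ⊕ B) A))
      (juxtapose (ofEquiv (Equiv.sumAssoc D C B)) (ofEquiv (Equiv.refl A))))
      (ofEquiv (Equiv.sumAssoc (D ⊕ C) B A).symm) := by
  simp only [ofEquiv_comp_ofEquiv, juxtapose_ofEquiv]
  congr 1; ext ((_ | _) | (_ | _)) <;> rfl

end

end BrauerianSplit

open BrauerianSplit in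
theorem ArrowTerm.graph_dissocR {P : Type u} (C B A : Formula P) :
    (dissocR C B A).graph = ofEquiv (Equiv.sumAssoc C.Occ B.Occ A.Occ) :=
  dissocR_eq

open BrauerianSplit in
/-- Arrow terms that are equal in `PN^¬` have the same graph. -/
theorem ArrowTerm.Equation.sound {P : Type u} {A B : Formula P} {f g : ArrowTerm A B}
    (h : Equation f g) : f.graph = g.graph := by
  induction h with
  | refl f => rfl
  | symm _ ih => exact ih.symm
  | trans _ _ ih₁ ih₂ => exact ih₁.trans ih₂
  | cong_comp _ _ ih₁ ih₂ => simp only [graph, ih₁, ih₂]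
  | cong_bin ξ _ _ ih₁ ih₂ =>
    change juxtapose _ _ = juxtapose _ _
    rw [ih₁, ih₂]
  | comp_id f => exact BrauerianSplit.comp_id _
  | id_comp f => exact BrauerianSplit.id_comp _
  | assoc h g f => exact comp_assoc _ _ _
  | bin_id ξ A B =>
    exact (juxtapose_ofEquiv _ _).trans (congrArg ofEquiv (Equiv.sumCongr_refl))
  | bin_comp ξ g₁ f₁ g₂ f₂ => exact juxtapose_comp _ _ _ _
  | deltaConj_nat B f => exact caps_nat _ _
  | sigmaDisj_nat B f => exact cups_nat _ _
  | sigmaDisj_deltaConj A => exact zigzag _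
  | assocTo_nat ξ f g h => exact BrauerianSplit.assocTo_nat _ _ _
  | dissoc_nat f g h => exact BrauerianSplit.assocTo_nat _ _ _
  | commConj_nat f g => exact comm_nat _ _
  | commDisj_nat f g => exact comm_nat _ _
  | assocFrom_assocTo ξ A B C =>
    exact (ofEquiv_comp_ofEquiv _ _).trans (congrArg ofEquiv (Equiv.symm_trans_self _))
  | assocTo_assocFrom ξ A B C =>
    exact (ofEquiv_comp_ofEquiv _ _).trans (congrArg ofEquiv (Equiv.self_trans_symm _))
  | pentagon ξ A B C D => exact BrauerianSplit.pentagon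
  | commConj_commConj A B => exact comm_comm
  | commDisj_commDisj A B => exact comm_comm
  | hexagonConj A B C => exact hexagon
  | hexagonDisj A B C => exact hexagon
  | dissoc_conj A B C D => exact BrauerianSplit.dissoc_conj
  | dissoc_disj A B C D => exact BrauerianSplit.dissoc_disj
  | dissoc_assocConj A B C D =>
    have h1 := graph_dissocR (.bin .conj A B) C D
    have h2 := graph_dissocR B C D
    simp only [graph, h1, h2]
    exact BrauerianSplit.dissoc_assocConj
  | dissoc_assocDisj A B C D =>
    have h1 := graph_dissocR D C (.bin .disj B A)
    have h2 := graph_dissocR D C B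
    simp only [graph, h1, h2]
    exact BrauerianSplit.dissoc_assocDisj
  | assocConj_deltaConj A B C => exact assoc_caps
  | assocDisj_sigmaDisj A B C => exact assoc_cups
  | dissoc_sigmaConj A B C => exact dissoc_caps
  | dissoc_deltaDisj A B C => exact dissoc_cups
  | sigmaDisjPrime_deltaConjPrime A => exact zigzag_swap


/-! ### The category `PN^¬` and the functor `G` -/

/-- The objects of the category `PN^¬` generated by the set of letters `P`: the formulae. -/
structure PN (P : Type u) : Type u where
  formula : Formula P

instance ArrowTerm.setoid {P : Type u} (A B : Formula P) : Setoid (ArrowTerm A B) where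
  r := ArrowTerm.Equation
  iseqv := ⟨.refl, .symm, .trans⟩

/-- The category `PN^¬`: arrows are arrow terms modulo the equations. -/
instance (P : Type u) : Category.{u} (PN P) where
  Hom A B := Quotient (ArrowTerm.setoid A.formula B.formula)
  id A := Quotient.mk _ (ArrowTerm.id A.formula)
  comp g f := Quotient.map₂ ArrowTerm.comp (fun _ _ hf _ _ hg => .cong_comp hf hg) f g
  id_comp f := Quotient.inductionOn f fun f => Quotient.sound (.comp_id f)
  comp_id f := Quotient.inductionOn f fun f => Quotient.sound (.id_comp f)
  assoc f g h := Quotient.inductionOn₃ f g h fun f g h => Quotient.sound (.assoc h g f)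

/-- The arrow of `PN^¬` denoted by an arrow term. -/
def ArrowTerm.arrow {P : Type u} {A B : Formula P} (f : ArrowTerm A B) :
    PN.mk A ⟶ PN.mk B :=
  Quotient.mk (ArrowTerm.setoid A B) f

theorem BrauerianSplit.relabel_id {X Y : Type} (e : X ≃ Y) :
    relabel e e (ofEquiv (Equiv.refl X)) = ofEquiv (Equiv.refl Y) := by
  refine ext_rel ?_
  rintro (u | u) (v | v) <;> simp [relabel_rel, ofEquiv_rel]

/-- The functor `G` from `PN^¬` to `Br`: a formula is sent to the number of occurrences of letters
in it, and an arrow to its graph, the `n`-th occurrence of a letter being represented by `n`. -/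
def PN.G (P : Type u) : PN P ⥤ Br where
  obj A := ⟨A.formula.size⟩
  map {A B} f := Quotient.lift
    (fun t : ArrowTerm A.formula B.formula =>
      BrauerianSplit.relabel A.formula.number B.formula.number t.graph)
    (fun _ _ h => congrArg _ (ArrowTerm.Equation.sound h)) f
  map_id A := BrauerianSplit.relabel_id A.formula.number
  map_comp {A B C} f g := Quotient.inductionOn₂ f g fun f g =>
    BrauerianSplit.relabel_comp A.formula.number B.formula.number C.formula.number
      g.graph f.graph

/-! ### Proof-net categories -/

/-- The operations of a proof-net category: two operations `bin .conj` and `bin .disj` on objects and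
arrows, a unary operation on objects, and the families of arrows `b→`, `b←`, `c^∧`, `c^∨`, `d`, `Δ^∧`
and `Σ^∨`. -/
class ProofNetOps (C : Type w) [Category.{z} C] where
  bin : Conn → C → C → C
  neg : C → C
  binMap (ξ : Conn) {A B D E : C} : (A ⟶ D) → (B ⟶ E) → (bin ξ A B ⟶ bin ξ D E)
  assocTo (ξ : Conn) (A B C : C) : bin ξ A (bin ξ B C) ⟶ bin ξ (bin ξ A B) C
  assocFrom (ξ : Conn) (A B C : C) : bin ξ (bin ξ A B) C ⟶ bin ξ A (bin ξ B C)
  commConj (A B : C) : bin .conj A B ⟶ bin .conj B A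
  commDisj (A B : C) : bin .disj B A ⟶ bin .disj A B
  dissoc (A B C : C) : bin .conj A (bin .disj B C) ⟶ bin .disj (bin .conj A B) C
  deltaConj (B A : C) : A ⟶ bin .conj A (bin .disj (neg B) B)
  sigmaDisj (B A : C) : bin .disj (bin .conj B (neg B)) A ⟶ A

section Semantic

open ProofNetOps

local infixl:70 " ⋏ " => ProofNetOps.bin Conn.conj
local infixl:65 " ⋎ " => ProofNetOps.bin Conn.disj
local prefix:max "∼" => ProofNetOps.neg
local notation:60 f:60 " ⊚ " g:61 => CategoryStruct.comp g f
local infixl:70 " ⋏ₐ " => ProofNetOps.binMap Conn.conj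
local infixl:65 " ⋎ₐ " => ProofNetOps.binMap Conn.disj
local notation "𝟏" => CategoryStruct.id

namespace ProofNetOps

variable {𝒞 : Type w} [Category.{z} 𝒞] [ProofNetOps 𝒞]

def dissocR (C B A : 𝒞) : (C ⋎ B) ⋏ A ⟶ C ⋎ (B ⋏ A) :=
  commDisj C (B ⋏ A) ⊚ (commConj A B ⋎ₐ 𝟏 C) ⊚ dissoc A B C ⊚ (𝟏 A ⋏ₐ commDisj B C) ⊚
    commConj (C ⋎ B) A

def sigmaConj (B A : 𝒞) : A ⟶ (∼B ⋎ B) ⋏ A :=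
  commConj A (∼B ⋎ B) ⊚ deltaConj B A

def deltaDisj (B A : 𝒞) : A ⋎ (B ⋏ ∼B) ⟶ A :=
  sigmaDisj B A ⊚ commDisj (B ⋏ ∼B) A

def deltaConjPrime (B A : 𝒞) : A ⟶ A ⋏ (B ⋎ ∼B) :=
  (𝟏 A ⋏ₐ commDisj B (∼B)) ⊚ deltaConj B A

def sigmaDisjPrime (B A : 𝒞) : (∼B ⋏ B) ⋎ A ⟶ A :=
  sigmaDisj B A ⊚ (commConj (∼B) B ⋎ₐ 𝟏 A)

end ProofNetOps

/-- A proof-net category. -/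
class ProofNetCategory (𝒞 : Type w) [Category.{z} 𝒞] extends ProofNetOps 𝒞 where
  bin_id (ξ : Conn) (A B : 𝒞) : binMap ξ (𝟏 A) (𝟏 B) = 𝟏 (bin ξ A B)
  bin_comp (ξ : Conn) {A₁ B₁ C₁ A₂ B₂ C₂ : 𝒞}
      (g₁ : B₁ ⟶ C₁) (f₁ : A₁ ⟶ B₁) (g₂ : B₂ ⟶ C₂) (f₂ : A₂ ⟶ B₂) :
      binMap ξ (g₁ ⊚ f₁) (g₂ ⊚ f₂) = binMap ξ g₁ g₂ ⊚ binMap ξ f₁ f₂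
  assocTo_nat (ξ : Conn) {A B C D E F : 𝒞} (f : A ⟶ D) (g : B ⟶ E) (h : C ⟶ F) :
      binMap ξ (binMap ξ f g) h ⊚ assocTo ξ A B C = assocTo ξ D E F ⊚ binMap ξ f (binMap ξ g h)
  commConj_nat {A B D E : 𝒞} (f : A ⟶ D) (g : B ⟶ E) :
      (g ⋏ₐ f) ⊚ commConj A B = commConj D E ⊚ (f ⋏ₐ g)
  commDisj_nat {A B D E : 𝒞} (f : A ⟶ D) (g : B ⟶ E) :
      (g ⋎ₐ f) ⊚ commDisj B A = commDisj E D ⊚ (f ⋎ₐ g)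
  dissoc_nat {A B C D E F : 𝒞} (f : A ⟶ D) (g : B ⟶ E) (h : C ⟶ F) :
      ((f ⋏ₐ g) ⋎ₐ h) ⊚ dissoc A B C = dissoc D E F ⊚ (f ⋏ₐ (g ⋎ₐ h))
  assocFrom_assocTo (ξ : Conn) (A B C : 𝒞) :
      assocFrom ξ A B C ⊚ assocTo ξ A B C = 𝟏 (bin ξ A (bin ξ B C))
  assocTo_assocFrom (ξ : Conn) (A B C : 𝒞) :
      assocTo ξ A B C ⊚ assocFrom ξ A B C = 𝟏 (bin ξ (bin ξ A B) C)
  pentagon (ξ : Conn) (A B C D : 𝒞) :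
      assocFrom ξ A B (bin ξ C D) ⊚ assocFrom ξ (bin ξ A B) C D =
        binMap ξ (𝟏 A) (assocFrom ξ B C D) ⊚ assocFrom ξ A (bin ξ B C) D ⊚
          binMap ξ (assocFrom ξ A B C) (𝟏 D)
  commConj_commConj (A B : 𝒞) : commConj B A ⊚ commConj A B = 𝟏 (A ⋏ B)
  commDisj_commDisj (A B : 𝒞) : commDisj A B ⊚ commDisj B A = 𝟏 (A ⋎ B)
  hexagonConj (A B C : 𝒞) :
      (𝟏 B ⋏ₐ commConj C A) ⊚ assocFrom .conj B C A ⊚ commConj A (B ⋏ C) ⊚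
        assocFrom .conj A B C ⊚ (commConj B A ⋏ₐ 𝟏 C) = assocFrom .conj B A C
  hexagonDisj (A B C : 𝒞) :
      (𝟏 B ⋎ₐ commDisj A C) ⊚ assocFrom .disj B C A ⊚ commDisj (B ⋎ C) A ⊚
        assocFrom .disj A B C ⊚ (commDisj A B ⋎ₐ 𝟏 C) = assocFrom .disj B A C
  dissoc_conj (A B C D : 𝒞) :
      (assocFrom .conj A B C ⋎ₐ 𝟏 D) ⊚ dissoc (A ⋏ B) C D =
        dissoc A (B ⋏ C) D ⊚ (𝟏 A ⋏ₐ dissoc B C D) ⊚ assocFrom .conj A B (C ⋎ D)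
  dissoc_disj (A B C D : 𝒞) :
      dissoc D C (B ⋎ A) ⊚ (𝟏 D ⋏ₐ assocFrom .disj C B A) =
        assocFrom .disj (D ⋏ C) B A ⊚ (dissoc D C B ⋎ₐ 𝟏 A) ⊚ dissoc D (C ⋎ B) A
  dissoc_assocConj (A B C D : 𝒞) :
      dissocR (A ⋏ B) C D ⊚ (dissoc A B C ⋏ₐ 𝟏 D) =
        dissoc A B (C ⋏ D) ⊚ (𝟏 A ⋏ₐ dissocR B C D) ⊚ assocFrom .conj A (B ⋎ C) D
  dissoc_assocDisj (A B C D : 𝒞) :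
      (𝟏 D ⋎ₐ dissoc C B A) ⊚ dissocR D C (B ⋎ A) =
        assocFrom .disj D (C ⋏ B) A ⊚ (dissocR D C B ⋎ₐ 𝟏 A) ⊚ dissoc (D ⋎ C) B A
  deltaConj_nat (B : 𝒞) {A D : 𝒞} (f : A ⟶ D) :
      (f ⋏ₐ 𝟏 (∼B ⋎ B)) ⊚ deltaConj B A = deltaConj B D ⊚ f
  sigmaDisj_nat (B : 𝒞) {A D : 𝒞} (f : A ⟶ D) :
      f ⊚ sigmaDisj B A = sigmaDisj B D ⊚ (𝟏 (B ⋏ ∼B) ⋎ₐ f)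
  assocConj_deltaConj (A B C : 𝒞) :
      assocFrom .conj A B (∼C ⋎ C) ⊚ deltaConj C (A ⋏ B) = 𝟏 A ⋏ₐ deltaConj C B
  assocDisj_sigmaDisj (A B C : 𝒞) :
      sigmaDisj C (B ⋎ A) ⊚ assocFrom .disj (C ⋏ ∼C) B A = sigmaDisj C B ⋎ₐ 𝟏 A
  dissoc_sigmaConj (A B C : 𝒞) :
      dissoc (∼A ⋎ A) B C ⊚ sigmaConj A (B ⋎ C) = sigmaConj A B ⋎ₐ 𝟏 C
  dissoc_deltaDisj (A B C : 𝒞) :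
      deltaDisj A (C ⋏ B) ⊚ dissoc C B (A ⋏ ∼A) = 𝟏 C ⋏ₐ deltaDisj A B
  sigmaDisj_deltaConj (A : 𝒞) :
      sigmaDisj A A ⊚ dissoc A (∼A) A ⊚ deltaConj A A = 𝟏 A
  sigmaDisjPrime_deltaConjPrime (A : 𝒞) :
      sigmaDisjPrime A (∼A) ⊚ dissoc (∼A) A (∼A) ⊚ deltaConjPrime A (∼A) = 𝟏 (∼A)

end Semantic

instance (P : Type u) : ProofNetOps (PN P) where
  bin ξ A B := ⟨.bin ξ A.formula B.formula⟩
  neg A := ⟨.neg A.formula⟩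
  binMap ξ _ _ _ _ f g :=
    Quotient.map₂ (ArrowTerm.bin ξ) (fun _ _ hf _ _ hg => .cong_bin ξ hf hg) f g
  assocTo ξ A B C := (ArrowTerm.assocTo ξ A.formula B.formula C.formula).arrow
  assocFrom ξ A B C := (ArrowTerm.assocFrom ξ A.formula B.formula C.formula).arrow
  commConj A B := (ArrowTerm.commConj A.formula B.formula).arrow
  commDisj A B := (ArrowTerm.commDisj A.formula B.formula).arrow
  dissoc A B C := (ArrowTerm.dissoc A.formula B.formula C.formula).arrow
  deltaConj B A := (ArrowTerm.deltaConj B.formula A.formula).arrow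
  sigmaDisj B A := (ArrowTerm.sigmaDisj B.formula A.formula).arrow

/-- `PN^¬` is a proof-net category. -/
instance (P : Type u) : ProofNetCategory (PN P) where
  bin_id _ _ _ := Quotient.sound (.bin_id _ _ _)
  bin_comp _ _ _ _ _ _ _ g₁ f₁ g₂ f₂ := Quotient.inductionOn₂ g₁ f₁ fun _ _ =>
    Quotient.inductionOn₂ g₂ f₂ fun _ _ => Quotient.sound (.bin_comp _ _ _ _ _)
  assocTo_nat _ _ _ _ _ _ _ f g h := Quotient.inductionOn₃ f g h fun _ _ _ =>
    Quotient.sound (.assocTo_nat _ _ _ _)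
  commConj_nat f g := Quotient.inductionOn₂ f g fun _ _ => Quotient.sound (.commConj_nat _ _)
  commDisj_nat f g := Quotient.inductionOn₂ f g fun _ _ => Quotient.sound (.commDisj_nat _ _)
  dissoc_nat f g h := Quotient.inductionOn₃ f g h fun _ _ _ =>
    Quotient.sound (.dissoc_nat _ _ _)
  assocFrom_assocTo _ _ _ _ := Quotient.sound (.assocFrom_assocTo _ _ _ _)
  assocTo_assocFrom _ _ _ _ := Quotient.sound (.assocTo_assocFrom _ _ _ _)
  pentagon _ _ _ _ _ := Quotient.sound (.pentagon _ _ _ _ _)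
  commConj_commConj _ _ := Quotient.sound (.commConj_commConj _ _)
  commDisj_commDisj _ _ := Quotient.sound (.commDisj_commDisj _ _)
  hexagonConj _ _ _ := Quotient.sound (.hexagonConj _ _ _)
  hexagonDisj _ _ _ := Quotient.sound (.hexagonDisj _ _ _)
  dissoc_conj _ _ _ _ := Quotient.sound (.dissoc_conj _ _ _ _)
  dissoc_disj _ _ _ _ := Quotient.sound (.dissoc_disj _ _ _ _)
  dissoc_assocConj _ _ _ _ := Quotient.sound (.dissoc_assocConj _ _ _ _)
  dissoc_assocDisj _ _ _ _ := Quotient.sound (.dissoc_assocDisj _ _ _ _)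
  deltaConj_nat _ _ _ f := Quotient.inductionOn f fun _ => Quotient.sound (.deltaConj_nat _ _)
  sigmaDisj_nat _ _ _ f := Quotient.inductionOn f fun _ => Quotient.sound (.sigmaDisj_nat _ _)
  assocConj_deltaConj _ _ _ := Quotient.sound (.assocConj_deltaConj _ _ _)
  assocDisj_sigmaDisj _ _ _ := Quotient.sound (.assocDisj_sigmaDisj _ _ _)
  dissoc_sigmaConj _ _ _ := Quotient.sound (.dissoc_sigmaConj _ _ _)
  dissoc_deltaDisj _ _ _ := Quotient.sound (.dissoc_deltaDisj _ _ _)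
  sigmaDisj_deltaConj _ := Quotient.sound (.sigmaDisj_deltaConj _)
  sigmaDisjPrime_deltaConjPrime _ := Quotient.sound (.sigmaDisjPrime_deltaConjPrime _)

/-- The object of a proof-net category denoted by a formula. -/
def Formula.interp {P : Type u} {𝒞 : Type w} [Category.{z} 𝒞] [ProofNetOps 𝒞] (v : P → 𝒞) :
    Formula P → 𝒞
  | .letter p => v p
  | .neg A => ProofNetOps.neg (A.interp v)
  | .bin ξ A B => ProofNetOps.bin ξ (A.interp v) (B.interp v)

/-- The arrow of a proof-net category denoted by an arrow term. -/
def ArrowTerm.interp {P : Type u} {𝒞 : Type w} [Category.{z} 𝒞] [ProofNetOps 𝒞] (v : P → 𝒞) :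
    {A B : Formula P} → ArrowTerm A B → (A.interp v ⟶ B.interp v)
  | _, _, .id A => 𝟙 (A.interp v)
  | _, _, .assocTo ξ A B C => ProofNetOps.assocTo ξ (A.interp v) (B.interp v) (C.interp v)
  | _, _, .assocFrom ξ A B C => ProofNetOps.assocFrom ξ (A.interp v) (B.interp v) (C.interp v)
  | _, _, .commConj A B => ProofNetOps.commConj (A.interp v) (B.interp v)
  | _, _, .commDisj A B => ProofNetOps.commDisj (A.interp v) (B.interp v)
  | _, _, .dissoc A B C => ProofNetOps.dissoc (A.interp v) (B.interp v) (C.interp v)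
  | _, _, .deltaConj B A => ProofNetOps.deltaConj (B.interp v) (A.interp v)
  | _, _, .sigmaDisj B A => ProofNetOps.sigmaDisj (B.interp v) (A.interp v)
  | _, _, .comp f g => g.interp v ≫ f.interp v
  | _, _, .bin ξ f g => ProofNetOps.binMap ξ (f.interp v) (g.interp v)

/-! ### Arrow terms as words -/

/-- A number for each connective. -/
def Conn.code : Conn → ℕ
  | .conj => 0
  | .disj => 1

/-- A formula in Polish notation, as a word over `ℕ`; the letter `p` is written `16 + ν p`. -/
def Formula.code {P : Type u} (ν : P → ℕ) : Formula P → List ℕ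
  | .letter p => [16 + ν p]
  | .neg A => 0 :: A.code ν
  | .bin ξ A B => (1 + ξ.code) :: (A.code ν ++ B.code ν)

/-- An arrow term in Polish notation, as a word over `ℕ`. -/
def ArrowTerm.code {P : Type u} (ν : P → ℕ) : {A B : Formula P} → ArrowTerm A B → List ℕ
  | _, _, .id A => 3 :: A.code ν
  | _, _, .assocTo ξ A B C => (4 + ξ.code) :: (A.code ν ++ B.code ν ++ C.code ν)
  | _, _, .assocFrom ξ A B C => (6 + ξ.code) :: (A.code ν ++ B.code ν ++ C.code ν)
  | _, _, .commConj A B => 8 :: (A.code ν ++ B.code ν)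
  | _, _, .commDisj A B => 9 :: (A.code ν ++ B.code ν)
  | _, _, .dissoc A B C => 10 :: (A.code ν ++ B.code ν ++ C.code ν)
  | _, _, .deltaConj B A => 11 :: (B.code ν ++ A.code ν)
  | _, _, .sigmaDisj B A => 12 :: (B.code ν ++ A.code ν)
  | _, _, .comp f g => 13 :: (f.code ν ++ g.code ν)
  | _, _, .bin ξ f g => (14 + ξ.code) :: (f.code ν ++ g.code ν)

end ProofNet

namespace ProofNet

open ProofNetOps MonoidalCategory

local infixl:70 " ⋏ " => ProofNetOps.bin Conn.conj
local infixl:65 " ⋎ " => ProofNetOps.bin Conn.disj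
local prefix:max "∼" => ProofNetOps.neg
local infixl:70 " ⋏ₐ " => ProofNetOps.binMap Conn.conj
local infixl:65 " ⋎ₐ " => ProofNetOps.binMap Conn.disj

section

/-! ### Symmetry and associativity without units, and points -/

section SymmetricSemigroup

variable {𝒞 : Type w} [Category.{w} 𝒞] [ProofNetCategory 𝒞]

/-! Equal arrows have equal graphs by soundness of the equations, so the content is the converse.
Arrows are made to act on cut-free derivations of a one-sided sequent calculus, in which the derived
object depends only on the sequent once the axiom links are recorded by labels.

Proof-net categories have no units, and families of arrows replace the arrows that would involve
them. An arrow from a unit of the conjunction to `X` becomes a point, a natural family `K ⟶ K ⋏ X`.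
An arrow from `X` to a unit of the disjunction becomes a form, a natural family `X ⋎ K ⟶ K`. With
the points as arrows a unit can be adjoined to the conjunction, and `Aug 𝒞` is a symmetric monoidal
category. Coherence for trees with distinct leaves (`Tree.Str.unique`) then settles all
rearrangements of contexts. The equations for `Δ` and `Σ` say that `A` and `∼A` are dual, with a
point as unit and a form as counit. Transposition gives a bijection between arrows `Γ ⟶ of X` and
forms on `Γ ⊗ of X'`. Since duals are unique up to isomorphism, De Morgan's laws hold and every
formula is isomorphic to its negation normal form.

The predicate `CF` singles out the forms obtained by axioms, structural arrows, a rule for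
conjunctions and a rule for disjunctions. Precomposition with an arrow term preserves it
(`ArrowTerm.admissibleVia`). For associativity, commutativity and `d` this is a rearrangement of
rules. For `Σ` it rests on cut-free derivations of identities (`NF.ident_dp`), for `Δ` on cut
elimination (`NF.cut_dp`). Axioms link literals with equal labels, so the labels have to be constant
on the classes of the graph of the term.

Conversely, a sequent in which no label occurs more than twice has at most one derivable form
(`CF.unique`). The rule for conjunctions is invertible. For a disjunction the labels determine how
the context is divided between the premises, and every other derivation can be permuted so as to end
with the same rule and the same division (`CF.splits`).

If `f` and `g` have the same graph, label the classes of the graph by distinct numbers. Both terms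
turn the identity derivation of the target into a derivation of one and the same sequent. The
resulting forms are equal, and so are `f` and `g` by transposition. The statement on arbitrary
proof-net categories follows because the equations are valid there, and decidability because the
graph can be computed from the Polish word by primitive recursion. -/

theorem bin_comp' (ξ : Conn) {A₁ B₁ C₁ A₂ B₂ C₂ : 𝒞}
    (f₁ : A₁ ⟶ B₁) (g₁ : B₁ ⟶ C₁) (f₂ : A₂ ⟶ B₂) (g₂ : B₂ ⟶ C₂) :
    binMap ξ f₁ f₂ ≫ binMap ξ g₁ g₂ = binMap ξ (f₁ ≫ g₁) (f₂ ≫ g₂) :=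
  (ProofNetCategory.bin_comp ξ g₁ f₁ g₂ f₂).symm

theorem bin_comp'_assoc (ξ : Conn) {A₁ B₁ C₁ A₂ B₂ C₂ : 𝒞}
    (f₁ : A₁ ⟶ B₁) (g₁ : B₁ ⟶ C₁) (f₂ : A₂ ⟶ B₂) (g₂ : B₂ ⟶ C₂)
    {Z' : 𝒞} (k : _ ⟶ Z') :
    binMap ξ f₁ f₂ ≫ binMap ξ g₁ g₂ ≫ k =
      binMap ξ (f₁ ≫ g₁) (f₂ ≫ g₂) ≫ k := by
  simpa only [Category.assoc] using congrArg (· ≫ k) (bin_comp' ξ f₁ g₁ f₂ g₂)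

@[simp]
theorem assocTo_assocFrom' (ξ : Conn) (A B C : 𝒞) :
    assocTo ξ A B C ≫ assocFrom ξ A B C = 𝟙 _ :=
  ProofNetCategory.assocFrom_assocTo ξ A B C

@[simp]
theorem assocTo_assocFrom'_assoc (ξ : Conn) (A B C : 𝒞)
    {Z' : 𝒞} (k : _ ⟶ Z') :
    assocTo ξ A B C ≫ assocFrom ξ A B C ≫ k = k := by
  simpa only [Category.assoc, Category.id_comp] using congrArg (· ≫ k) (assocTo_assocFrom' ξ A B C)

@[simp]
theorem assocFrom_assocTo' (ξ : Conn) (A B C : 𝒞) :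
    assocFrom ξ A B C ≫ assocTo ξ A B C = 𝟙 _ :=
  ProofNetCategory.assocTo_assocFrom ξ A B C

@[simp]
theorem assocFrom_assocTo'_assoc (ξ : Conn) (A B C : 𝒞)
    {Z' : 𝒞} (k : _ ⟶ Z') :
    assocFrom ξ A B C ≫ assocTo ξ A B C ≫ k = k := by
  simpa only [Category.assoc, Category.id_comp] using congrArg (· ≫ k) (assocFrom_assocTo' ξ A B C)

@[simp]
theorem commConj_commConj' (A B : 𝒞) : commConj A B ≫ commConj B A = 𝟙 _ :=
  ProofNetCategory.commConj_commConj A B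

@[simp]
theorem commConj_commConj'_assoc (A B : 𝒞)
    {Z' : 𝒞} (k : _ ⟶ Z') :
    commConj A B ≫ commConj B A ≫ k = k := by
  simpa only [Category.assoc, Category.id_comp] using congrArg (· ≫ k) (commConj_commConj' A B)

@[simp]
theorem commDisj_commDisj' (A B : 𝒞) : commDisj A B ≫ commDisj B A = 𝟙 _ :=
  ProofNetCategory.commDisj_commDisj B A

@[simp]
theorem commDisj_commDisj'_assoc (A B : 𝒞)
    {Z' : 𝒞} (k : _ ⟶ Z') :
    commDisj A B ≫ commDisj B A ≫ k = k := by
  simpa only [Category.assoc, Category.id_comp] using congrArg (· ≫ k) (commDisj_commDisj' A B)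

theorem assocTo_nat' (ξ : Conn) {A B C D E F : 𝒞} (f : A ⟶ D) (g : B ⟶ E) (h : C ⟶ F) :
    assocTo ξ A B C ≫ binMap ξ (binMap ξ f g) h = binMap ξ f (binMap ξ g h) ≫ assocTo ξ D E F :=
  ProofNetCategory.assocTo_nat ξ f g h

theorem assocFrom_nat (ξ : Conn) {A B C D E F : 𝒞} (f : A ⟶ D) (g : B ⟶ E) (h : C ⟶ F) :
    binMap ξ (binMap ξ f g) h ≫ assocFrom ξ D E F =
      assocFrom ξ A B C ≫ binMap ξ f (binMap ξ g h) := by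
  have h := congrArg (fun t => assocFrom ξ A B C ≫ t ≫ assocFrom ξ D E F) (assocTo_nat' ξ f g h)
  simpa using h

theorem assocFrom_nat_assoc (ξ : Conn) {A B C D E F : 𝒞} (f : A ⟶ D) (g : B ⟶ E) (h : C ⟶ F)
    {Z' : 𝒞} (k : _ ⟶ Z') :
    binMap ξ (binMap ξ f g) h ≫ assocFrom ξ D E F ≫ k =
      assocFrom ξ A B C ≫ binMap ξ f (binMap ξ g h) ≫ k := by
  simpa only [Category.assoc] using congrArg (· ≫ k) (assocFrom_nat ξ f g h)

theorem commConj_nat' {A B D E : 𝒞} (f : A ⟶ D) (g : B ⟶ E) :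
    commConj A B ≫ (g ⋏ₐ f) = (f ⋏ₐ g) ≫ commConj D E :=
  ProofNetCategory.commConj_nat f g

theorem commConj_nat'_assoc {A B D E : 𝒞} (f : A ⟶ D) (g : B ⟶ E)
    {Z' : 𝒞} (k : _ ⟶ Z') :
    commConj A B ≫ (g ⋏ₐ f) ≫ k =
      (f ⋏ₐ g) ≫ commConj D E ≫ k := by
  simpa only [Category.assoc] using congrArg (· ≫ k) (commConj_nat' f g)

theorem commDisj_nat' {A B D E : 𝒞} (f : A ⟶ D) (g : B ⟶ E) :
    commDisj B A ≫ (g ⋎ₐ f) = (f ⋎ₐ g) ≫ commDisj E D :=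
  ProofNetCategory.commDisj_nat f g

theorem commDisj_nat'_assoc {A B D E : 𝒞} (f : A ⟶ D) (g : B ⟶ E)
    {Z' : 𝒞} (k : _ ⟶ Z') :
    commDisj B A ≫ (g ⋎ₐ f) ≫ k =
      (f ⋎ₐ g) ≫ commDisj E D ≫ k := by
  simpa only [Category.assoc] using congrArg (· ≫ k) (commDisj_nat' f g)

attribute [simp] ProofNetCategory.bin_id

@[simps]
def assocIso (ξ : Conn) (A B C : 𝒞) : bin ξ (bin ξ A B) C ≅ bin ξ A (bin ξ B C) where
  hom := assocFrom ξ A B C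
  inv := assocTo ξ A B C

@[simps]
def commConjIso (A B : 𝒞) : A ⋏ B ≅ B ⋏ A where
  hom := commConj A B
  inv := commConj B A

@[simps]
def commDisjIso (A B : 𝒞) : A ⋎ B ≅ B ⋎ A where
  hom := commDisj B A
  inv := commDisj A B

@[simps]
def binIso (ξ : Conn) {A B D E : 𝒞} (f : A ≅ D) (g : B ≅ E) : bin ξ A B ≅ bin ξ D E where
  hom := binMap ξ f.hom g.hom
  inv := binMap ξ f.inv g.inv
  hom_inv_id := by rw [bin_comp']; simp
  inv_hom_id := by rw [bin_comp']; simp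

theorem hexagonConj' (A B C : 𝒞) :
    assocFrom .conj A B C ≫ commConj A (B ⋏ C) ≫ assocFrom .conj B C A =
      (commConj A B ⋏ₐ 𝟙 C) ≫ assocFrom .conj B A C ≫ (𝟙 B ⋏ₐ commConj A C) := by
  have h := ProofNetCategory.hexagonConj A B C
  rw [← h]
  simp only [Category.assoc, bin_comp', bin_comp'_assoc]
  simp

/-- All arrows of the hexagon are invertible; inverting it gives the mirrored one. -/
theorem hexagonConj_reverse (A B C : 𝒞) :
    assocTo .conj A B C ≫ commConj (A ⋏ B) C ≫ assocTo .conj C A B =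
      (𝟙 A ⋏ₐ commConj B C) ≫ assocTo .conj A C B ≫ (commConj A C ⋏ₐ 𝟙 B) := by
  have h : assocIso .conj C A B ≪≫ commConjIso C (A ⋏ B) ≪≫ assocIso .conj A B C =
      binIso .conj (commConjIso C A) (Iso.refl B) ≪≫ assocIso .conj A C B ≪≫
        binIso .conj (Iso.refl A) (commConjIso C B) := by
    ext; simpa using hexagonConj' C A B
  simpa using congrArg Iso.inv h

theorem hexagonDisj' (A B C : 𝒞) :
    assocFrom .disj A B C ≫ commDisj (B ⋎ C) A ≫ assocFrom .disj B C A =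
      (commDisj B A ⋎ₐ 𝟙 C) ≫ assocFrom .disj B A C ≫ (𝟙 B ⋎ₐ commDisj C A) := by
  have h := ProofNetCategory.hexagonDisj A B C
  rw [← h]
  simp only [Category.assoc, bin_comp', bin_comp'_assoc]
  simp

theorem hexagonDisj_reverse (A B C : 𝒞) :
    assocTo .disj A B C ≫ commDisj C (A ⋎ B) ≫ assocTo .disj C A B =
      (𝟙 A ⋎ₐ commDisj C B) ≫ assocTo .disj A C B ≫ (commDisj C A ⋎ₐ 𝟙 B) := by
  have h : assocIso .disj C A B ≪≫ commDisjIso C (A ⋎ B) ≪≫ assocIso .disj A B C =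
      binIso .disj (commDisjIso C A) (Iso.refl B) ≪≫ assocIso .disj A C B ≪≫
        binIso .disj (Iso.refl A) (commDisjIso C B) := by
    ext; simpa using hexagonDisj' C A B
  simpa using congrArg Iso.inv h

/-! ### Points -/

variable (𝒞) in
/-- A point of `X`, which replaces an arrow from a unit of the conjunction to `X`. -/
@[ext]
structure Point (X : 𝒞) where
  app (K : 𝒞) : K ⟶ K ⋏ X
  nat {K L : 𝒞} (f : K ⟶ L) : app K ≫ (f ⋏ₐ 𝟙 X) = f ≫ app L
  assoc (K L : 𝒞) : app (K ⋏ L) ≫ assocFrom .conj K L X = 𝟙 K ⋏ₐ app L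
  dissoc (K L : 𝒞) : app (K ⋎ L) ≫ commConj _ X ≫ ProofNetOps.dissoc X K L =
    (app K ≫ commConj K X) ⋎ₐ 𝟙 L

theorem Point.nat_assoc {X : 𝒞} (π : Point 𝒞 X) {K L : 𝒞} (f : K ⟶ L)
    {Z' : 𝒞} (k : _ ⟶ Z') :
    π.app K ≫ (f ⋏ₐ 𝟙 X) ≫ k = f ≫ π.app L ≫ k := by
  simpa only [Category.assoc] using congrArg (· ≫ k) (π.nat f)

theorem Point.assoc_assoc {X : 𝒞} (π : Point 𝒞 X) (K L : 𝒞)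
    {Z' : 𝒞} (k : _ ⟶ Z') :
    π.app (K ⋏ L) ≫ assocFrom .conj K L X ≫ k = (𝟙 K ⋏ₐ π.app L) ≫ k := by
  simpa only [Category.assoc] using congrArg (· ≫ k) (π.assoc K L)

theorem Point.dissoc_assoc {X : 𝒞} (π : Point 𝒞 X) (K L : 𝒞)
    {Z' : 𝒞} (k : _ ⟶ Z') :
    π.app (K ⋎ L) ≫ commConj _ X ≫ ProofNetOps.dissoc X K L ≫ k =
      ((π.app K ≫ commConj K X) ⋎ₐ 𝟙 L) ≫ k := by
  simpa only [Category.assoc] using congrArg (· ≫ k) (π.dissoc K L)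

theorem Point.app_conj {X : 𝒞} (π : Point 𝒞 X) (K L : 𝒞) :
    π.app (K ⋏ L) = (𝟙 K ⋏ₐ π.app L) ≫ assocTo .conj K L X := by
  rw [← π.assoc]; simp

/-- The law `assoc` inserts the new conjunct at the right end of a conjunction. Conjugating by the
symmetry and applying the hexagon shows that insertion in the middle can be made from either side.
With a genuine unit this would be the triangle identity. -/
theorem Point.app_whisker {X : 𝒞} (π : Point 𝒞 X) (K L : 𝒞) :
    (π.app K ⋏ₐ 𝟙 L) ≫ assocFrom .conj K X L = 𝟙 K ⋏ₐ (π.app L ≫ commConj L X) := by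
  have h1 : π.app (K ⋏ L) ≫ (commConj K L ⋏ₐ 𝟙 X) =
      (π.app K ⋏ₐ 𝟙 L) ≫ commConj _ _ ≫ assocTo .conj L K X := by
    rw [π.nat, π.app_conj, ← commConj_nat'_assoc]
  have h2 : (π.app K ⋏ₐ 𝟙 L) =
      π.app (K ⋏ L) ≫ (commConj K L ⋏ₐ 𝟙 X) ≫ assocFrom .conj L K X ≫ commConj _ _ := by
    rw [← Category.assoc, h1]; simp
  rw [h2]
  have h3 := hexagonConj' L K X
  have h4 : assocFrom .conj L K X ≫ commConj L (K ⋏ X) ≫ assocFrom .conj K X L =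
      (commConj L K ⋏ₐ 𝟙 X) ≫ assocFrom .conj K L X ≫ (𝟙 K ⋏ₐ commConj L X) := h3
  simp only [Category.assoc]
  rw [h4, bin_comp'_assoc]
  simp only [commConj_commConj', Category.comp_id, ProofNetCategory.bin_id, Category.id_comp]
  rw [Point.assoc_assoc, bin_comp']
  simp

theorem Point.app_whisker_assoc {X : 𝒞} (π : Point 𝒞 X) (K L : 𝒞)
    {Z' : 𝒞} (k : _ ⟶ Z') :
    (π.app K ⋏ₐ 𝟙 L) ≫ assocFrom .conj K X L ≫ k =
      (𝟙 K ⋏ₐ (π.app L ≫ commConj L X)) ≫ k := by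
  simpa only [Category.assoc] using congrArg (· ≫ k) (Point.app_whisker π K L)

-- This stands for the composite of an arrow from the missing unit with `f`.
@[simps]
def Point.map {X Y : 𝒞} (π : Point 𝒞 X) (f : X ⟶ Y) : Point 𝒞 Y where
  app K := π.app K ≫ (𝟙 K ⋏ₐ f)
  nat g := by
    rw [Category.assoc, bin_comp', ← π.nat_assoc, bin_comp']; simp
  assoc K L := by
    rw [Category.assoc, ← ProofNetCategory.bin_id, assocFrom_nat, π.assoc_assoc, bin_comp']
    simp
  dissoc K L := by
    have h : (f ⋏ₐ 𝟙 (K ⋎ L)) ≫ ProofNetOps.dissoc Y K L =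
        ProofNetOps.dissoc X K L ≫ ((f ⋏ₐ 𝟙 K) ⋎ₐ 𝟙 L) := by
      have := ProofNetCategory.dissoc_nat f (𝟙 K) (𝟙 L)
      rw [ProofNetCategory.bin_id] at this
      exact this.symm
    rw [Category.assoc, ← commConj_nat'_assoc, h, π.dissoc_assoc, bin_comp',
      Category.assoc, Category.assoc, commConj_nat']
    simp

end SymmetricSemigroup

/-! ### Adjoining a unit to the conjunction -/

variable (𝒞 : Type w)

/-- The objects of `𝒞` together with a formal unit of the conjunction. -/
inductive Aug
  | unit
  | of (X : 𝒞)

namespace Aug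

variable {𝒞} [Category.{w} 𝒞] [ProofNetCategory 𝒞]

/-- Arrows of the category with a unit adjoined. -/
inductive Hom : Aug 𝒞 → Aug 𝒞 → Type w
  | idUnit : Hom unit unit
  | pt {X : 𝒞} (π : Point 𝒞 X) : Hom unit (of X)
  | arr {X Y : 𝒞} (f : X ⟶ Y) : Hom (of X) (of Y)

def Hom.id : (M : Aug 𝒞) → Hom M M
  | unit => .idUnit
  | of X => .arr (𝟙 X)

/-- No arrow leads from an object of `𝒞` to the unit, so these cases are exhaustive. -/
def Hom.comp : {M N K : Aug 𝒞} → Hom M N → Hom N K → Hom M K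
  | _, _, _, .idUnit, g => g
  | _, _, _, .pt π, .arr f => .pt (π.map f)
  | _, _, _, .arr f, .arr g => .arr (f ≫ g)

instance : Category.{w} (Aug 𝒞) where
  Hom := Hom
  id := Hom.id
  comp := Hom.comp
  id_comp f := by
    cases f with
    | arr f => exact congrArg Hom.arr (Category.id_comp f)
    | _ => rfl
  comp_id f := by
    cases f with
    | idUnit => rfl
    | arr f => exact congrArg Hom.arr (Category.comp_id f)
    | pt π =>
      refine congrArg Hom.pt (Point.ext (funext fun K => ?_))
      simp
  assoc f g h := by
    cases f with
    | idUnit => rfl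
    | arr f =>
      cases g; cases h
      exact congrArg Hom.arr (Category.assoc _ _ _)
    | pt π =>
      cases g; cases h
      refine congrArg Hom.pt (Point.ext (funext fun K => ?_))
      simp [bin_comp']

/-- The arrow between adjoined objects given by an arrow of `𝒞`. -/
abbrev arr {X Y : 𝒞} (f : X ⟶ Y) : of X ⟶ of Y := Hom.arr f

/-- The arrow from the adjoined unit given by a point. -/
abbrev pt {X : 𝒞} (π : Point 𝒞 X) : (unit : Aug 𝒞) ⟶ of X := Hom.pt π

theorem arr_comp {X Y Z : 𝒞} (f : X ⟶ Y) (g : Y ⟶ Z) : arr (f ≫ g) = arr f ≫ arr g := rfl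
theorem arr_id (X : 𝒞) : arr (𝟙 X) = 𝟙 (of X) := rfl
theorem arr_injective {X Y : 𝒞} : Function.Injective (arr : (X ⟶ Y) → _) :=
  fun _ _ h => Hom.arr.inj h

def arrIso {X Y : 𝒞} (f : X ≅ Y) : of X ≅ of Y where
  hom := arr f.hom
  inv := arr f.inv
  hom_inv_id := by rw [← arr_comp]; simp [arr_id]
  inv_hom_id := by rw [← arr_comp]; simp [arr_id]

-- The unit is strict: every structural isomorphism with the unit among its arguments is an
-- identity. This leaves only the laws of `𝒞` and identities to verify.
@[reducible]
def tensor : Aug 𝒞 → Aug 𝒞 → Aug 𝒞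
  | unit, M => M
  | of X, unit => of X
  | of X, of Y => of (X ⋏ Y)

/-- Here the components of a point are used: since `of X ⊗ unit` is `of X`, the component at `X` is
the whiskering of the point by `of X`. -/
def wl : (M : Aug 𝒞) → {N K : Aug 𝒞} → Hom N K → Hom (tensor M N) (tensor M K)
  | unit, _, _, f => f
  | of X, _, _, .idUnit => .arr (𝟙 X)
  | of X, _, _, .pt π => .arr (π.app X)
  | of X, _, _, .arr f => .arr (𝟙 X ⋏ₐ f)

def wr : {N K : Aug 𝒞} → Hom N K → (M : Aug 𝒞) → Hom (tensor N M) (tensor K M)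
  | _, _, .idUnit, M => Hom.id M
  | _, _, .pt π, unit => .pt π
  | _, _, .pt (X := Y) π, of X => .arr (π.app X ≫ commConj X Y)
  | _, _, .arr f, unit => .arr f
  | _, _, .arr f, of X => .arr (f ⋏ₐ 𝟙 X)

def ass : (M N K : Aug 𝒞) → (tensor (tensor M N) K ≅ tensor M (tensor N K))
  | unit, _, _ => Iso.refl _
  | of _, unit, _ => Iso.refl _
  | of _, of _, unit => Iso.refl _
  | of X, of Y, of Z => arrIso (assocIso .conj X Y Z)

def runit : (M : Aug 𝒞) → (tensor M unit ≅ M)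
  | unit => Iso.refl _
  | of _ => Iso.refl _

def braid : (M N : Aug 𝒞) → (tensor M N ≅ tensor N M)
  | unit, unit => Iso.refl _
  | unit, of _ => Iso.refl _
  | of _, unit => Iso.refl _
  | of X, of Y => arrIso (commConjIso X Y)

instance : MonoidalCategoryStruct (Aug 𝒞) where
  tensorObj := tensor
  tensorUnit := unit
  whiskerLeft M _ _ f := wl M f
  whiskerRight f M := wr f M
  tensorHom f g := CategoryStruct.comp (obj := Aug 𝒞) (wr f _) (wl _ g)
  associator := ass
  leftUnitor M := Iso.refl M
  rightUnitor := runit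

theorem wl_id (M N : Aug 𝒞) : M ◁ 𝟙 N = 𝟙 (M ⊗ N) := by
  rcases M with _ | X <;> rcases N with _ | Y <;> try rfl
  exact congrArg Hom.arr (ProofNetCategory.bin_id _ _ _)

theorem id_wr (M N : Aug 𝒞) : 𝟙 M ▷ N = 𝟙 (M ⊗ N) := by
  rcases M with _ | X <;> rcases N with _ | Y <;> try rfl
  exact congrArg Hom.arr (ProofNetCategory.bin_id _ _ _)

theorem wl_comp (M : Aug 𝒞) {N K L : Aug 𝒞} (f : N ⟶ K) (g : K ⟶ L) :
    M ◁ (f ≫ g) = M ◁ f ≫ M ◁ g := by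
  rcases M with _ | X
  · rfl
  rcases f with _ | π | f
  · exact (Category.id_comp _).symm
  · rcases g with _ | _ | g
    rfl
  · rcases g with _ | _ | g
    refine congrArg Hom.arr ?_
    rw [bin_comp']; simp

theorem wr_comp {N K L : Aug 𝒞} (f : N ⟶ K) (g : K ⟶ L) (M : Aug 𝒞) :
    (f ≫ g) ▷ M = f ▷ M ≫ g ▷ M := by
  rcases f with _ | π | f
  · exact (Category.id_comp _).symm
  · rcases g with _ | _ | g
    rcases M with _ | Z
    · rfl
    refine congrArg Hom.arr ?_
    change (π.app Z ≫ (𝟙 Z ⋏ₐ g)) ≫ commConj Z _ = (π.app Z ≫ commConj Z _) ≫ (g ⋏ₐ 𝟙 Z)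
    simp [commConj_nat']
  · rcases g with _ | _ | g
    rcases M with _ | Z
    · rfl
    refine congrArg Hom.arr ?_
    rw [bin_comp']; simp

theorem exchange {M N K L : Aug 𝒞} (f : M ⟶ N) (g : K ⟶ L) :
    M ◁ g ≫ f ▷ L = f ▷ K ≫ N ◁ g := by
  rcases f with _ | f | f
  · exact (Category.comp_id _).trans (Category.id_comp _).symm
  · rcases g with _ | g | g
    · exact (Category.id_comp _).trans (Category.comp_id _).symm
    · refine congrArg Hom.pt (Point.ext (funext fun X => ?_))
      change g.app X ≫ (𝟙 X ⋏ₐ (f.app _ ≫ commConj _ _)) = f.app X ≫ (𝟙 X ⋏ₐ g.app _)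
      -- Two points can be inserted in either order: the first insertion is moved to the left by
      -- `Point.app_whisker`, the two commute by naturality, and the law `assoc` absorbs the
      -- associativity.
      rw [← Point.app_whisker, Point.nat_assoc, ← Point.assoc]
    · refine congrArg Hom.arr ?_
      rw [Category.assoc, commConj_nat', ← Point.nat_assoc]
  · rcases g with _ | g | g
    · exact (Category.id_comp _).trans (Category.comp_id _).symm
    · refine congrArg Hom.arr ?_
      rw [Point.nat]
    · refine congrArg Hom.arr ?_
      rw [bin_comp', bin_comp']; simp

theorem ass_nat_right (M N : Aug 𝒞) {K L : Aug 𝒞} (f : K ⟶ L) :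
    (M ⊗ N) ◁ f ≫ (α_ M N L).hom = (α_ M N K).hom ≫ M ◁ N ◁ f := by
  rcases M with _ | M <;> rcases N with _ | N <;>
    try exact (Category.comp_id _).trans (Category.id_comp _).symm
  rcases f with _ | f | f <;> refine congrArg Hom.arr ?_
  · simp
  · change f.app (M ⋏ N) ≫ assocFrom .conj M N _ = 𝟙 _ ≫ (𝟙 M ⋏ₐ f.app N)
    rw [Point.assoc, Category.id_comp]
  · change (𝟙 (M ⋏ N) ⋏ₐ f) ≫ assocFrom .conj M N _ = assocFrom .conj M N _ ≫ (𝟙 M ⋏ₐ (𝟙 N ⋏ₐ f))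
    rw [← assocFrom_nat]; simp

theorem ass_nat_middle (M : Aug 𝒞) {K L : Aug 𝒞} (f : K ⟶ L) (N : Aug 𝒞) :
    (M ◁ f) ▷ N ≫ (α_ M L N).hom = (α_ M K N).hom ≫ M ◁ (f ▷ N) := by
  rcases M with _ | M
  · exact (Category.comp_id _).trans (Category.id_comp _).symm
  rcases N with _ | N <;> rcases f with _ | f | f <;>
    try exact (Category.comp_id _).trans (Category.id_comp _).symm
  · refine congrArg Hom.arr ?_
    change (f.app M ⋏ₐ 𝟙 N) ≫ assocFrom .conj M _ N =
      𝟙 _ ≫ (𝟙 M ⋏ₐ (f.app N ≫ commConj N _))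
    rw [Point.app_whisker, Category.id_comp]
  · rename_i K L
    refine congrArg Hom.arr ?_
    change ((𝟙 M ⋏ₐ f) ⋏ₐ 𝟙 N) ≫ assocFrom .conj M _ N =
      assocFrom .conj M _ N ≫ (𝟙 M ⋏ₐ (f ⋏ₐ 𝟙 N))
    rw [← assocFrom_nat]

theorem braid_nat_left {M N : Aug 𝒞} (f : M ⟶ N) (K : Aug 𝒞) :
    f ▷ K ≫ (braid N K).hom = (braid M K).hom ≫ K ◁ f := by
  rcases f with _ | f | f <;> rcases K with _ | K <;>
    first
    | rfl
    | exact (Category.comp_id _).trans (Category.id_comp _).symm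
    | refine congrArg Hom.arr ?_
  · simp
  · change (f ⋏ₐ 𝟙 K) ≫ commConj _ K = commConj _ K ≫ (𝟙 K ⋏ₐ f)
    rw [commConj_nat']

theorem braid_braid (M N : Aug 𝒞) : (braid M N).hom ≫ (braid N M).hom = 𝟙 (M ⊗ N) := by
  rcases M with _ | M <;> rcases N with _ | N <;> try exact Category.comp_id _
  exact congrArg Hom.arr (commConj_commConj' M N)

theorem hexagon (M N K : Aug 𝒞) :
    (α_ M N K).hom ≫ (braid M (N ⊗ K)).hom ≫ (α_ N K M).hom =
      ((braid M N).hom ▷ K) ≫ (α_ N M K).hom ≫ (N ◁ (braid M K).hom) := by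
  rcases M with _ | M <;> rcases N with _ | N <;> rcases K with _ | K
  case of.of.of => exact congrArg Hom.arr (hexagonConj' M N K)
  case unit.of.of =>
    refine congrArg Hom.arr (?_ : 𝟙 _ ≫ 𝟙 _ ≫ 𝟙 _ = (𝟙 N ⋏ₐ 𝟙 K) ≫ 𝟙 _ ≫ (𝟙 N ⋏ₐ 𝟙 K))
    simp
  case of.unit.of =>
    refine congrArg Hom.arr (?_ : 𝟙 _ ≫ commConj M K ≫ 𝟙 _ =
      (𝟙 M ⋏ₐ 𝟙 K) ≫ 𝟙 _ ≫ commConj M K)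
    simp
  case of.of.unit =>
    refine congrArg Hom.arr (?_ : 𝟙 _ ≫ commConj M N ≫ 𝟙 _ =
      commConj M N ≫ 𝟙 _ ≫ (𝟙 N ⋏ₐ 𝟙 M))
    simp
  all_goals rfl

/-- Naturality of the associator in the first argument, from the other two and the symmetry. -/
theorem ass_nat_left {K L : Aug 𝒞} (f : K ⟶ L) (M N : Aug 𝒞) :
    (f ▷ M) ▷ N ≫ (α_ L M N).hom = (α_ K M N).hom ≫ f ▷ (M ⊗ N) := by
  rcases f with _ | f | f
  · change 𝟙 M ▷ N ≫ 𝟙 _ = 𝟙 _ ≫ 𝟙 (M ⊗ N)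
    rw [id_wr]
  · rename_i L
    rcases M with _ | M <;> rcases N with _ | N <;>
      try exact (Category.comp_id _).trans (Category.id_comp _).symm
    refine congrArg Hom.arr ?_
    change ((f.app M ≫ commConj M L) ⋏ₐ 𝟙 N) ≫ assocFrom .conj L M N =
      𝟙 _ ≫ f.app (M ⋏ N) ≫ commConj (M ⋏ N) L
    have h := hexagonConj_reverse M N L
    have h2 : commConj (M ⋏ N) L = assocFrom .conj M N L ≫ (𝟙 M ⋏ₐ commConj N L) ≫
        assocTo .conj M L N ≫ (commConj M L ⋏ₐ 𝟙 N) ≫ assocFrom .conj L M N := by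
      have h3 := congrArg (fun t => assocFrom .conj M N L ≫ t ≫ assocFrom .conj L M N) h
      simpa using h3
    rw [h2, Point.assoc_assoc, bin_comp'_assoc, Category.id_comp, Category.id_comp,
      ← Point.app_whisker_assoc]
    simp only [Category.id_comp, assocFrom_assocTo'_assoc, bin_comp'_assoc]
  · rcases M with _ | M <;> rcases N with _ | N <;>
      try exact (Category.comp_id _).trans (Category.id_comp _).symm
    refine congrArg Hom.arr ?_
    change ((f ⋏ₐ 𝟙 M) ⋏ₐ 𝟙 N) ≫ assocFrom .conj _ M N =
      assocFrom .conj _ M N ≫ (f ⋏ₐ 𝟙 (M ⋏ N))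
    rw [assocFrom_nat]; simp

theorem pentagon' (M N K L : Aug 𝒞) :
    (α_ M N K).hom ▷ L ≫ (α_ M (N ⊗ K) L).hom ≫ M ◁ (α_ N K L).hom =
        (α_ (M ⊗ N) K L).hom ≫ (α_ M N (K ⊗ L)).hom := by
  rcases M with _ | M <;> rcases N with _ | N <;> rcases K with _ | K <;> rcases L with _ | L
  case of.of.of.of =>
    exact congrArg Hom.arr (ProofNetCategory.pentagon .conj M N K L).symm
  case unit.of.of.of =>
    refine congrArg Hom.arr (?_ : (𝟙 _ ⋏ₐ 𝟙 _) ≫ 𝟙 _ ≫ assocFrom .conj N K L =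
      assocFrom .conj N K L ≫ 𝟙 _)
    simp
  case of.unit.of.of =>
    refine congrArg Hom.arr (?_ : (𝟙 _ ⋏ₐ 𝟙 _) ≫ assocFrom .conj M K L ≫ (𝟙 _ ⋏ₐ 𝟙 _) =
      assocFrom .conj M K L ≫ 𝟙 _)
    simp
  case of.of.unit.of =>
    refine congrArg Hom.arr (?_ : (𝟙 _ ⋏ₐ 𝟙 _) ≫ assocFrom .conj M N L ≫ (𝟙 _ ⋏ₐ 𝟙 _) =
      𝟙 _ ≫ assocFrom .conj M N L)
    simp
  case of.of.of.unit =>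
    refine congrArg Hom.arr (?_ : assocFrom .conj M N K ≫ 𝟙 _ ≫ (𝟙 _ ⋏ₐ 𝟙 _) =
      𝟙 _ ≫ assocFrom .conj M N K)
    simp
  all_goals first | rfl | exact congrArg Hom.arr (by simp)

theorem triangle' (M N : Aug 𝒞) :
    (α_ M unit N).hom ≫ M ◁ 𝟙 N = (runit M).hom ▷ N := by
  rcases M with _ | M <;> rcases N with _ | N
  case of.of =>
    refine congrArg Hom.arr (?_ : 𝟙 _ ≫ (𝟙 _ ⋏ₐ 𝟙 _) = 𝟙 _ ⋏ₐ 𝟙 _)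
    simp
  all_goals first | rfl | exact congrArg Hom.arr (by simp)

theorem runit_nat {M N : Aug 𝒞} (f : M ⟶ N) :
    f ▷ unit ≫ (runit N).hom = (runit M).hom ≫ f := by
  rcases f with _ | π | f
  · rfl
  · exact Category.comp_id (obj := Aug 𝒞) (pt π)
  · exact (Category.comp_id _).trans (Category.id_comp _).symm

instance : MonoidalCategory (Aug 𝒞) where
  tensorHom_def _ _ := rfl
  id_tensorHom_id M N := by
    change 𝟙 M ▷ N ≫ M ◁ 𝟙 N = 𝟙 _
    rw [id_wr, wl_id, Category.comp_id]
  tensorHom_comp_tensorHom f g h k := by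
    change (f ▷ _ ≫ _ ◁ g) ≫ (h ▷ _ ≫ _ ◁ k) = (f ≫ h) ▷ _ ≫ _ ◁ (g ≫ k)
    rw [wr_comp, wl_comp, Category.assoc, Category.assoc, ← Category.assoc (_ ◁ g), exchange,
      Category.assoc]
  whiskerLeft_id := wl_id
  id_whiskerRight := id_wr
  associator_naturality {M₁ M₂ M₃ N₁ N₂ N₃} f g h := by
    change (((f ▷ _ ≫ _ ◁ g) ▷ _) ≫ _ ◁ h) ≫ (α_ N₁ N₂ N₃).hom =
      (α_ M₁ M₂ M₃).hom ≫ (f ▷ _ ≫ N₁ ◁ (g ▷ _ ≫ _ ◁ h))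
    rw [wr_comp, wl_comp, Category.assoc, Category.assoc, ass_nat_right,
      ← Category.assoc ((N₁ ◁ g) ▷ M₃), ass_nat_middle, Category.assoc,
      ← Category.assoc (f ▷ M₂ ▷ M₃), ass_nat_left, Category.assoc]
  leftUnitor_naturality f := (Category.comp_id _).trans (Category.id_comp _).symm
  rightUnitor_naturality := runit_nat
  pentagon := pentagon'
  triangle := triangle'

instance : SymmetricCategory (Aug 𝒞) where
  braiding := braid
  braiding_naturality_left f K := braid_nat_left f K
  braiding_naturality_right K {M N} f := by
    rw [← cancel_epi (braid M K).hom, ← Category.assoc, ← braid_nat_left, Category.assoc,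
      braid_braid, ← Category.assoc, braid_braid]
    exact (Category.comp_id _).trans (Category.id_comp _).symm
  hexagon_forward := hexagon
  hexagon_reverse M N K := by
    have h : α_ K M N ≪≫ braid K (M ⊗ N) ≪≫ α_ M N K =
        whiskerRightIso (braid K M) N ≪≫ α_ M K N ≪≫ whiskerLeftIso M (braid K N) := by
      ext; simpa using hexagon K M N
    have hb : ∀ A B : Aug 𝒞, (braid A B).inv = (braid B A).hom := fun A B => by
      rw [← cancel_epi (braid A B).hom, braid_braid]
      exact Iso.hom_inv_id _
    simpa [hb] using congrArg Iso.inv h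
  symmetry := braid_braid

end Aug

end

section

/-! ### Coherence of symmetric monoidal categories on trees without repeated leaves -/

/-- Binary bracketings of words. -/
inductive Tree (α : Type*)
  | nil
  | leaf (a : α)
  | node (S T : Tree α)

section

variable {𝓜 : Type u} [Category.{w} 𝓜] [MonoidalCategory 𝓜]

theorem whiskerLeft_comp_tensorHom {A B A' B' X Y : 𝓜} (x : X ⟶ Y) {f : A ⟶ B} {a : A ⟶ A'}
    {b : B ⟶ B'} {g : A' ⟶ B'} (e : f ≫ b = a ≫ g) :
    X ◁ f ≫ (x ⊗ₘ b) = (x ⊗ₘ a) ≫ Y ◁ g := by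
  rw [← id_tensorHom, ← id_tensorHom, tensorHom_comp_tensorHom, tensorHom_comp_tensorHom, e,
    Category.id_comp, Category.comp_id]

theorem whiskerRight_comp_tensorHom {A B A' B' X Y : 𝓜} (x : X ⟶ Y) {f : A ⟶ B} {a : A ⟶ A'}
    {b : B ⟶ B'} {g : A' ⟶ B'} (e : f ≫ b = a ≫ g) :
    f ▷ X ≫ (b ⊗ₘ x) = (a ⊗ₘ x) ≫ g ▷ Y := by
  rw [← tensorHom_id, ← tensorHom_id, tensorHom_comp_tensorHom, tensorHom_comp_tensorHom, e,
    Category.id_comp, Category.comp_id]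

theorem id_tensorHom_comp_leftUnitor {X Y : 𝓜} (x : X ⟶ Y) :
    (λ_ X).hom ≫ x = (𝟙 (𝟙_ 𝓜) ⊗ₘ x) ≫ (λ_ Y).hom := by simp

theorem id_tensorHom_comp_leftUnitor_inv {X Y : 𝓜} (x : X ⟶ Y) :
    (λ_ X).inv ≫ (𝟙 (𝟙_ 𝓜) ⊗ₘ x) = x ≫ (λ_ Y).inv := by simp

theorem tensorHom_id_comp_rightUnitor {X Y : 𝓜} (x : X ⟶ Y) :
    (ρ_ X).hom ≫ x = (x ⊗ₘ 𝟙 (𝟙_ 𝓜)) ≫ (ρ_ Y).hom := by simp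

theorem tensorHom_id_comp_rightUnitor_inv {X Y : 𝓜} (x : X ⟶ Y) :
    (ρ_ X).inv ≫ (x ⊗ₘ 𝟙 (𝟙_ 𝓜)) = x ≫ (ρ_ Y).inv := by simp

theorem associator_comp_collapse {X Y Z : 𝓜} (x : X ⟶ 𝟙_ 𝓜) (y : Y ⟶ 𝟙_ 𝓜) (z : Z ⟶ 𝟙_ 𝓜) :
    (α_ X Y Z).hom ≫ (x ⊗ₘ ((y ⊗ₘ z) ≫ (λ_ _).hom)) ≫ (λ_ _).hom =
      (((x ⊗ₘ y) ≫ (λ_ _).hom) ⊗ₘ z) ≫ (λ_ _).hom := by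
  have h : ((x ⊗ₘ y) ≫ (λ_ _).hom) ⊗ₘ z = ((x ⊗ₘ y) ⊗ₘ z) ≫ (λ_ _).hom ▷ _ := by
    rw [← tensorHom_id, tensorHom_comp_tensorHom, Category.comp_id]
  have h' : x ⊗ₘ ((y ⊗ₘ z) ≫ (λ_ _).hom) = (x ⊗ₘ (y ⊗ₘ z)) ≫ _ ◁ (λ_ _).hom := by
    rw [← id_tensorHom, tensorHom_comp_tensorHom, Category.comp_id]
  rw [h, h', Category.assoc, Category.assoc, ← associator_naturality_assoc]
  simp [unitors_equal]

variable [BraidedCategory 𝓜]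

theorem braiding_comp_collapse {X Y : 𝓜} (x : X ⟶ 𝟙_ 𝓜) (y : Y ⟶ 𝟙_ 𝓜) :
    (β_ X Y).hom ≫ (y ⊗ₘ x) ≫ (λ_ _).hom = (x ⊗ₘ y) ≫ (λ_ _).hom := by
  rw [← BraidedCategory.braiding_naturality_assoc, braiding_leftUnitor, unitors_equal]

/-- The isomorphism moving an object to the front. -/
def toFront (X A Y : 𝓜) : X ⊗ (A ⊗ Y) ≅ A ⊗ (X ⊗ Y) :=
  (α_ _ _ _).symm ≪≫ whiskerRightIso (β_ X A) Y ≪≫ α_ _ _ _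

/-- The squares for `toFront` describe how moving a factor to the front commutes with each kind of
structural arrow. They are the cases of `Tree.Str.pull`. -/
theorem toFront_nat_right (X A : 𝓜) {Y Y' : 𝓜} (y : Y ⟶ Y') :
    X ◁ A ◁ y ≫ (toFront X A Y').hom = (toFront X A Y).hom ≫ A ◁ X ◁ y := by
  simp only [toFront, Iso.trans_hom, Iso.symm_hom, whiskerRightIso_hom, Category.assoc,
    associator_inv_naturality_right_assoc, whisker_exchange_assoc, associator_naturality_right]

theorem toFront_nat_left {X X' : 𝓜} (x : X ⟶ X') (A Y : 𝓜) :
    x ▷ (A ⊗ Y) ≫ (toFront X' A Y).hom = (toFront X A Y).hom ≫ A ◁ x ▷ Y := by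
  simp [toFront, ← comp_whiskerRight_assoc]

theorem toFront_assoc (X Y A Z : 𝓜) :
    (α_ X Y (A ⊗ Z)).hom ≫ X ◁ (toFront Y A Z).hom ≫ (toFront X A (Y ⊗ Z)).hom =
      (toFront (X ⊗ Y) A Z).hom ≫ A ◁ (α_ X Y Z).hom := by
  simp [toFront]

theorem toFront_middle (X A Y Z : 𝓜) :
    (α_ X (A ⊗ Y) Z).hom ≫ X ◁ (α_ A Y Z).hom ≫ (toFront X A (Y ⊗ Z)).hom =
      (toFront X A Y).hom ▷ Z ≫ (α_ A (X ⊗ Y) Z).hom ≫ A ◁ (α_ X Y Z).hom := by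
  simp [toFront]

theorem toFront_unit (A Y : 𝓜) :
    (toFront (𝟙_ 𝓜) A Y).hom ≫ A ◁ (λ_ Y).hom = (λ_ _).hom := by
  simp [toFront]

end

section

variable {𝓜 : Type u} [Category.{w} 𝓜] [MonoidalCategory 𝓜] [SymmetricCategory 𝓜]

theorem braid_toFront (X A Y : 𝓜) :
    (β_ (A ⊗ Y) X).hom ≫ (toFront X A Y).hom = (α_ A Y X).hom ≫ A ◁ (β_ Y X).hom := by
  simp [toFront, BraidedCategory.braiding_tensor_left_hom, ← comp_whiskerRight_assoc]

theorem toFront_braid (X A Y : 𝓜) :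
    (toFront X A Y).hom ≫ A ◁ (β_ X Y).hom = (β_ X (A ⊗ Y)).hom ≫ (α_ A Y X).hom := by
  simp [toFront, BraidedCategory.braiding_tensor_right_hom]

theorem comm_inv {A X Y X' Y' : 𝓜} {e : X ≅ Y} {e' : X' ≅ Y'} {p : X ⟶ A ⊗ X'} {q : Y ⟶ A ⊗ Y'}
    (h : e.hom ≫ q = p ≫ A ◁ e'.hom) : e.inv ≫ p = q ≫ A ◁ e'.inv := by
  rw [Iso.inv_comp_eq, reassoc_of% h]; simp

end

namespace Tree

variable {α β : Type*}

def leaves : Tree α → List α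
  | nil => []
  | leaf a => [a]
  | node S T => S.leaves ++ T.leaves

def ofList : List α → Tree α
  | [] => nil
  | a :: l => node (leaf a) (ofList l)

theorem leaves_ofList (l : List α) : (ofList l).leaves = l := by
  induction l with
  | nil => rfl
  | cons a l ih => simp [ofList, leaves, ih]

variable {𝓜 : Type u} [Category.{w} 𝓜] [MonoidalCategory 𝓜] [SymmetricCategory 𝓜]

@[reducible]
def ev (ob : α → 𝓜) : Tree α → 𝓜
  | nil => 𝟙_ 𝓜
  | leaf a => ob a
  | node S T => S.ev ob ⊗ T.ev ob

/-- The arrows built from the structural isomorphisms of a symmetric monoidal category. -/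
inductive Str (ob : α → 𝓜) : (S T : Tree α) → (S.ev ob ⟶ T.ev ob) → Prop
  | id (S) : Str ob S S (𝟙 _)
  | comp {S T U f g} : Str ob S T f → Str ob T U g → Str ob S U (f ≫ g)
  | left (S) {T U f} : Str ob T U f → Str ob (node S T) (node S U) (S.ev ob ◁ f)
  | right {T U f} (S) : Str ob T U f → Str ob (node T S) (node U S) (f ▷ S.ev ob)
  | assoc (S T U) : Str ob (node (node S T) U) (node S (node T U)) (α_ _ _ _).hom
  | assocInv (S T U) : Str ob (node S (node T U)) (node (node S T) U) (α_ _ _ _).inv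
  | lunit (S) : Str ob (node nil S) S (λ_ _).hom
  | lunitInv (S) : Str ob S (node nil S) (λ_ _).inv
  | runit (S) : Str ob (node S nil) S (ρ_ _).hom
  | runitInv (S) : Str ob S (node S nil) (ρ_ _).inv
  | braid (S T) : Str ob (node S T) (node T S) (β_ _ _).hom

variable {ob : α → 𝓜}

theorem Str.perm {S T : Tree α} {f : S.ev ob ⟶ T.ev ob} (h : Str ob S T f) :
    S.leaves.Perm T.leaves := by
  induction h with
  | id S => rfl
  | comp _ _ ih₁ ih₂ => exact ih₁.trans ih₂
  | left S _ ih => exact ih.append_left _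
  | right S _ ih => exact ih.append_right _
  | assoc S T U => simp [leaves]
  | assocInv S T U => simp [leaves]
  | lunit S => simp [leaves]
  | lunitInv S => simp [leaves]
  | runit S => simp [leaves]
  | runitInv S => simp [leaves]
  | braid S T => exact List.perm_append_comm

/-! #### Naturality of structural arrows -/

/-- Substitution of trees for the leaves of a tree, together with the induced arrow. -/
def sub {ob' : β → 𝓜} (σ : ∀ a, Σ S : Tree β, (S.ev ob' ⟶ ob a)) :
    (T : Tree α) → Σ S : Tree β, (S.ev ob' ⟶ T.ev ob)
  | nil => ⟨nil, 𝟙 _⟩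
  | leaf a => σ a
  | node S T => ⟨node (sub σ S).1 (sub σ T).1, (sub σ S).2 ⊗ₘ (sub σ T).2⟩

theorem sub_congr {ob' : β → 𝓜} {σ τ : ∀ a, Σ S : Tree β, (S.ev ob' ⟶ ob a)} {T : Tree α}
    (h : ∀ a ∈ T.leaves, σ a = τ a) : sub σ T = sub τ T := by
  induction T with
  | nil => rfl
  | leaf a => exact h a (by simp [leaves])
  | node S T ihS ihT =>
    simp only [leaves, List.mem_append] at h
    rw [sub, sub, ihS fun a ha => h a (.inl ha), ihT fun a ha => h a (.inr ha)]

theorem sub_id (T : Tree α) : sub (fun a => ⟨leaf a, 𝟙 (ob a)⟩) T = ⟨T, 𝟙 (T.ev ob)⟩ := by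
  induction T with
  | nil => rfl
  | leaf a => rfl
  | node S T ihS ihT =>
    rw [sub, ihS, ihT]
    exact Sigma.ext rfl (heq_of_eq (id_tensorHom_id _ _))

/-- Every generator is natural, so replacing the leaves along arbitrary arrows gives a commuting
square whose new side is again structural. This is what lets substitution pass the structural rule
of derivations. -/
theorem Str.sub {ob' : β → 𝓜} (σ : ∀ a, Σ S : Tree β, (S.ev ob' ⟶ ob a))
    {S T : Tree α} {f : S.ev ob ⟶ T.ev ob} (hf : Str ob S T f) :
    ∃ f', Str ob' (Tree.sub σ S).1 (Tree.sub σ T).1 f' ∧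
      f' ≫ (Tree.sub σ T).2 = (Tree.sub σ S).2 ≫ f := by
  induction hf with
  | id S => exact ⟨_, .id _, by simp⟩
  | comp _ _ ih₁ ih₂ =>
    obtain ⟨f₁, h₁, e₁⟩ := ih₁
    obtain ⟨f₂, h₂, e₂⟩ := ih₂
    exact ⟨_, h₁.comp h₂, by rw [Category.assoc, e₂, reassoc_of% e₁]⟩
  | left S _ ih =>
    obtain ⟨f, h, e⟩ := ih
    exact ⟨_, h.left _, whiskerLeft_comp_tensorHom _ e⟩
  | right S _ ih =>
    obtain ⟨f, h, e⟩ := ih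
    exact ⟨_, h.right _, whiskerRight_comp_tensorHom _ e⟩
  | assoc S T U => exact ⟨_, .assoc _ _ _, (associator_naturality _ _ _).symm⟩
  | assocInv S T U => exact ⟨_, .assocInv _ _ _, (associator_inv_naturality _ _ _).symm⟩
  | lunit S => exact ⟨_, .lunit _, id_tensorHom_comp_leftUnitor (Tree.sub σ S).2⟩
  | lunitInv S => exact ⟨_, .lunitInv _, id_tensorHom_comp_leftUnitor_inv (Tree.sub σ S).2⟩
  | runit S => exact ⟨_, .runit _, tensorHom_id_comp_rightUnitor (Tree.sub σ S).2⟩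
  | runitInv S => exact ⟨_, .runitInv _, tensorHom_id_comp_rightUnitor_inv (Tree.sub σ S).2⟩
  | braid S T => exact ⟨_, .braid _ _, (BraidedCategory.braiding_naturality _ _).symm⟩

/-! #### Existence -/

/-- Trees related by a structural isomorphism. -/
def Related (ob : α → 𝓜) (S T : Tree α) : Prop :=
  ∃ f : S.ev ob ≅ T.ev ob, Str ob S T f.hom ∧ Str ob T S f.inv

namespace Related

theorem refl (S : Tree α) : Related ob S S := ⟨Iso.refl _, .id _, .id _⟩

theorem symm {S T : Tree α} : Related ob S T → Related ob T S
  | ⟨f, h, h'⟩ => ⟨f.symm, h', h⟩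

theorem trans {S T U : Tree α} : Related ob S T → Related ob T U → Related ob S U
  | ⟨f, h, h'⟩, ⟨g, k, k'⟩ => ⟨f ≪≫ g, h.comp k, k'.comp h'⟩

theorem left (S : Tree α) {T U : Tree α} : Related ob T U → Related ob (node S T) (node S U)
  | ⟨f, h, h'⟩ => ⟨whiskerLeftIso _ f, h.left _, h'.left _⟩

theorem right {T U : Tree α} (S : Tree α) : Related ob T U → Related ob (node T S) (node U S)
  | ⟨f, h, h'⟩ => ⟨whiskerRightIso f _, h.right _, h'.right _⟩

theorem assoc (S T U : Tree α) : Related ob (node (node S T) U) (node S (node T U)) :=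
  ⟨α_ _ _ _, .assoc _ _ _, .assocInv _ _ _⟩

theorem lunit (S : Tree α) : Related ob (node nil S) S := ⟨λ_ _, .lunit _, .lunitInv _⟩

theorem braid (S T : Tree α) : Related ob (node S T) (node T S) :=
  ⟨β_ _ _, .braid _ _, by
    have : (β_ (S.ev ob) (T.ev ob)).inv = (β_ (T.ev ob) (S.ev ob)).hom := by
      rw [← cancel_epi (β_ (S.ev ob) (T.ev ob)).hom]; simp
    rw [this]; exact .braid _ _⟩

theorem runit (S : Tree α) : Related ob (node S nil) S := ⟨ρ_ _, .runit _, .runitInv _⟩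

theorem append (l m : List α) :
    Related ob (node (ofList l) (ofList m)) (ofList (l ++ m)) := by
  induction l with
  | nil => exact lunit _
  | cons a l ih => exact (assoc _ _ _).trans (ih.left _)

theorem ofList_leaves (S : Tree α) : Related ob S (ofList S.leaves) := by
  induction S with
  | nil => exact refl _
  | leaf a => exact (runit _).symm
  | node S T ihS ihT => exact ((ihS.right _).trans (ihT.left _)).trans (append _ _)

theorem ofList_perm {l m : List α} (h : l.Perm m) : Related ob (ofList l) (ofList m) := by
  induction h with
  | nil => exact refl _
  | cons a _ ih => exact ih.left _
  | swap a b l => exact ((assoc _ _ _).symm.trans ((braid _ _).right _)).trans (assoc _ _ _)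
  | trans _ _ ih₁ ih₂ => exact ih₁.trans ih₂

/-- Every tree is related to the right-nested tree of its leaves, and a permutation of a list is a
sequence of exchanges of neighbours. -/
theorem of_perm {S T : Tree α} (h : S.leaves.Perm T.leaves) : Related ob S T :=
  ((ofList_leaves S).trans (ofList_perm h)).trans (ofList_leaves T).symm

end Related

theorem Str.exists {S T : Tree α} (h : S.leaves.Perm T.leaves) : ∃ f, Str ob S T f :=
  let ⟨f, hf, _⟩ := Related.of_perm (ob := ob) h
  ⟨_, hf⟩

/-! #### Uniqueness -/

/-- The isomorphism from a tree without leaves to the unit. -/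
def collapse (ob : α → 𝓜) : (S : Tree α) → S.leaves = [] → (S.ev ob ≅ 𝟙_ 𝓜)
  | nil, _ => Iso.refl _
  | leaf _, h => absurd h (by simp [leaves])
  | node S T, h =>
    (collapse ob S (List.append_eq_nil_iff.1 h).1 ⊗ᵢ collapse ob T (List.append_eq_nil_iff.1 h).2)
      ≪≫ λ_ _

/-- A tree without leaves is a product of units, and all generators are compatible with the
canonical isomorphisms to the unit. This is the base of the induction for uniqueness. -/
theorem Str.comp_collapse {S T : Tree α} {f : S.ev ob ⟶ T.ev ob} (hf : Str ob S T f)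
    (hS : S.leaves = []) (hT : T.leaves = []) :
    f ≫ (collapse ob T hT).hom = (collapse ob S hS).hom := by
  induction hf with
  | id S => simp
  | comp hf hg ih₁ ih₂ =>
    have := hf.perm
    rw [hS] at this
    rw [Category.assoc, ih₂ this.symm.eq_nil, ih₁]
  | left S _ ih =>
    simp only [leaves, List.append_eq_nil_iff] at hS hT
    simp [collapse, ev, MonoidalCategory.tensorHom_def', ← ih hS.2 hT.2]
  | right S _ ih =>
    simp only [leaves, List.append_eq_nil_iff] at hS hT
    simp [collapse, ev, MonoidalCategory.tensorHom_def, ← ih hS.1 hT.1]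
  | assoc S T U => exact associator_comp_collapse _ _ _
  | assocInv S T U =>
    rw [Iso.inv_comp_eq]
    exact (associator_comp_collapse _ _ _).symm
  | lunit S => simp [collapse, ev]
  | lunitInv S => simp [collapse, ev]
  | runit S => simp [collapse, ev, unitors_equal, MonoidalCategory.tensorHom_def]
  | runitInv S => simp [collapse, ev, unitors_equal, MonoidalCategory.tensorHom_def]
  | braid S T => exact braiding_comp_collapse _ _

/-- `Pull a S S' p`: the isomorphism `p` moves an occurrence of the leaf `a` of `S` to the front. -/
inductive Pull (ob : α → 𝓜) (a : α) :
    (S S' : Tree α) → (S.ev ob ≅ ob a ⊗ S'.ev ob) → Prop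
  | leaf : Pull ob a (leaf a) nil (ρ_ _).symm
  | left {S S' p} (T) : Pull ob a S S' p →
      Pull ob a (node S T) (node S' T) (whiskerRightIso p _ ≪≫ α_ _ _ _)
  | right (S) {T T' p} : Pull ob a T T' p →
      Pull ob a (node S T) (node S T') (whiskerLeftIso _ p ≪≫ toFront _ _ _)

theorem Pull.perm {a : α} {S S' : Tree α} {p} (h : Pull ob a S S' p) :
    S.leaves.Perm (a :: S'.leaves) := by
  induction h with
  | leaf => rfl
  | left T _ ih => exact ih.append_right _
  | right S _ ih => exact (ih.append_left _).trans List.perm_middle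

theorem Pull.exists {a : α} {S : Tree α} (h : a ∈ S.leaves) : ∃ S' p, Pull ob a S S' p := by
  induction S with
  | nil => simp [leaves] at h
  | leaf b =>
    obtain rfl : a = b := by simpa [leaves] using h
    exact ⟨_, _, .leaf⟩
  | node S T ihS ihT =>
    rcases List.mem_append.1 h with h | h
    · obtain ⟨_, _, h⟩ := ihS h
      exact ⟨_, _, h.left T⟩
    · obtain ⟨_, _, h⟩ := ihT h
      exact ⟨_, _, h.right S⟩

/-- As `a` occurs only once, the two pulls follow the same path down the tree; the mixed cases would
give a second occurrence. -/
theorem Pull.unique {a : α} {S S₁ S₂ : Tree α} {p₁ p₂} (h₁ : Pull ob a S S₁ p₁)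
    (h₂ : Pull ob a S S₂ p₂) (hS : S.leaves.Nodup) :
    ∃ u, Str ob S₁ S₂ u ∧ p₂.hom = p₁.hom ≫ ob a ◁ u := by
  induction h₁ generalizing S₂ with
  | leaf => cases h₂; exact ⟨_, .id _, by simp⟩
  | left T h₁ ih =>
    cases h₂ with
    | left _ h₂ =>
      obtain ⟨u, hu, e⟩ := ih h₂ (List.Nodup.of_append_left hS)
      exact ⟨_, hu.right _, by simp [e]⟩
    | right _ h₂ =>
      exact absurd (h₂.perm.mem_iff.2 List.mem_cons_self)
        ((List.nodup_append'.1 hS).2.2 (h₁.perm.mem_iff.2 List.mem_cons_self))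
  | right S h₁ ih =>
    cases h₂ with
    | right _ h₂ =>
      obtain ⟨u, hu, e⟩ := ih h₂ (List.Nodup.of_append_right hS)
      refine ⟨_, hu.left _, ?_⟩
      simp only [Iso.trans_hom, whiskerLeftIso_hom, e, Category.assoc, whiskerLeft_comp]
      rw [toFront_nat_right]
    | left _ h₂ =>
      exact absurd (h₁.perm.mem_iff.2 List.mem_cons_self)
        ((List.nodup_append'.1 hS).2.2 (h₂.perm.mem_iff.2 List.mem_cons_self))

/-- A structural arrow carries the chosen leaf along. For each generator and each position of the
leaf, the square with the two isomorphisms to the front is closed by a structural arrow between the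
remaining trees. -/
theorem Str.pull {a : α} {S T : Tree α} {f : S.ev ob ⟶ T.ev ob} (hf : Str ob S T f) {S' p}
    (h : Pull ob a S S' p) :
    ∃ T' q f', Pull ob a T T' q ∧ Str ob S' T' f' ∧ f ≫ q.hom = p.hom ≫ ob a ◁ f' := by
  have middle {X A A' X' Y : 𝓜} (p : A ≅ A' ⊗ X') :
      (α_ X A Y).hom ≫ X ◁ (p.hom ▷ Y ≫ (α_ A' X' Y).hom) ≫ (toFront X A' (X' ⊗ Y)).hom =
        (X ◁ p.hom ≫ (toFront X A' X').hom) ▷ Y ≫ (α_ A' (X ⊗ X') Y).hom ≫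
          A' ◁ (α_ X X' Y).hom := by
    rw [comp_whiskerRight_assoc, ← toFront_middle]; simp
  have last {X Y A A' Y' : 𝓜} (p : A ≅ A' ⊗ Y') :
      (α_ X Y A).hom ≫ X ◁ (Y ◁ p.hom ≫ (toFront Y A' Y').hom) ≫ (toFront X A' (Y ⊗ Y')).hom =
        ((X ⊗ Y) ◁ p.hom ≫ (toFront (X ⊗ Y) A' Y').hom) ≫ A' ◁ (α_ X Y Y').hom := by
    rw [Category.assoc, ← toFront_assoc]; simp
  induction hf generalizing S' with
  | id S => exact ⟨_, _, _, h, .id _, by simp⟩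
  | comp _ _ ih₁ ih₂ =>
    obtain ⟨_, _, _, h₁, s₁, e₁⟩ := ih₁ h
    obtain ⟨_, _, _, h₂, s₂, e₂⟩ := ih₂ h₁
    exact ⟨_, _, _, h₂, s₁.comp s₂, by rw [Category.assoc, e₂, reassoc_of% e₁]; simp⟩
  | @left S T U f hf ih =>
    cases h with
    | left _ h => exact ⟨_, _, _, h.left _, hf.left _, by simp [whisker_exchange_assoc]⟩
    | right _ h =>
      obtain ⟨_, _, _, h₁, s₁, e₁⟩ := ih h
      refine ⟨_, _, _, h₁.right _, s₁.left _, ?_⟩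
      simp only [Iso.trans_hom, whiskerLeftIso_hom, ← whiskerLeft_comp_assoc, e₁, Category.assoc]
      rw [whiskerLeft_comp, Category.assoc, toFront_nat_right]
  | @right T U f S hf ih =>
    cases h with
    | left _ h =>
      obtain ⟨_, _, _, h₁, s₁, e₁⟩ := ih h
      refine ⟨_, _, _, h₁.left _, s₁.right _, ?_⟩
      simp only [Iso.trans_hom, whiskerRightIso_hom, ← comp_whiskerRight_assoc, e₁, Category.assoc]
      simp
    | right _ h =>
      refine ⟨_, _, _, h.right _, hf.right _, ?_⟩
      simp only [Iso.trans_hom, whiskerLeftIso_hom, ← whisker_exchange_assoc, Category.assoc]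
      rw [toFront_nat_left]
  | assoc S T U =>
    cases h with
    | left _ h =>
      cases h with
      | left _ h => exact ⟨_, _, _, h.left _, .assoc _ _ _, by simp⟩
      | right _ h => exact ⟨_, _, _, (h.left _).right _, .assoc _ _ _,
          (middle _).trans (Category.assoc _ _ _).symm⟩
    | right _ h => exact ⟨_, _, _, (h.right _).right _, .assoc _ _ _, last _⟩
  | assocInv S T U =>
    cases h with
    | left _ h => exact ⟨_, _, _, (h.left _).left _, .assocInv _ _ _, by simp⟩
    | right _ h =>
      cases h with
      | left _ h => exact ⟨_, _, _, (h.right _).left _, .assocInv _ _ _,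
          comm_inv ((middle _).trans (Category.assoc _ _ _).symm)⟩
      | right _ h => exact ⟨_, _, _, h.right _, .assocInv _ _ _, comm_inv (last _)⟩
  | lunit S =>
    have key {A A' Y : 𝓜} (p : A ≅ A' ⊗ Y) : (λ_ A).hom ≫ p.hom =
        (𝟙_ 𝓜 ◁ p.hom ≫ (toFront _ A' Y).hom) ≫ A' ◁ (λ_ Y).hom := by
      rw [Category.assoc, toFront_unit, leftUnitor_naturality]
    cases h with
    | left _ h => cases h
    | right _ h => exact ⟨_, _, _, h, .lunit _, key _⟩
  | lunitInv S =>
    have key {A A' Y : 𝓜} (p : A ≅ A' ⊗ Y) : (λ_ A).hom ≫ p.hom =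
        (𝟙_ 𝓜 ◁ p.hom ≫ (toFront _ A' Y).hom) ≫ A' ◁ (λ_ Y).hom := by
      rw [Category.assoc, toFront_unit, leftUnitor_naturality]
    exact ⟨_, _, _, h.right _, .lunitInv _, comm_inv (key _)⟩
  | runit S =>
    cases h with
    | left _ h => exact ⟨_, _, _, h, .runit _, by simp⟩
    | right _ h => cases h
  | runitInv S => exact ⟨_, _, _, h.left _, .runitInv _, by simp⟩
  | braid S T =>
    cases h with
    | left _ h =>
      refine ⟨_, _, _, h.right _, .braid _ _, ?_⟩
      simp only [Iso.trans_hom, whiskerLeftIso_hom, whiskerRightIso_hom, Category.assoc]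
      rw [← BraidedCategory.braiding_naturality_left_assoc, braid_toFront]
    | right _ h =>
      refine ⟨_, _, _, h.left _, .braid _ _, ?_⟩
      simp only [Iso.trans_hom, whiskerLeftIso_hom, whiskerRightIso_hom, Category.assoc]
      rw [toFront_braid, ← BraidedCategory.braiding_naturality_right_assoc]

/-- Coherence: structural arrows between trees without repeated leaves are equal. -/
theorem Str.unique {S T : Tree α} {f g : S.ev ob ⟶ T.ev ob} (hf : Str ob S T f)
    (hg : Str ob S T g) (hS : S.leaves.Nodup) : f = g := by
  induction n : S.leaves.length generalizing S T with
  | zero =>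
    have h := List.length_eq_zero_iff.1 n
    have h' : T.leaves = [] := by
      have := hf.perm
      rw [h] at this
      exact this.symm.eq_nil
    rw [← cancel_mono (collapse ob T h').hom, hf.comp_collapse h, hg.comp_collapse h]
  | succ n ih =>
    obtain ⟨a, ha⟩ := List.exists_mem_of_length_pos (l := S.leaves) (by omega)
    obtain ⟨S', p, hp⟩ := Pull.exists (ob := ob) ha
    obtain ⟨T₁, q₁, f', h₁, sf, ef⟩ := hf.pull hp
    obtain ⟨T₂, q₂, g', h₂, sg, eg⟩ := hg.pull hp
    obtain ⟨u, hu, eu⟩ := h₁.unique h₂ (hf.perm.nodup_iff.1 hS)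
    have hl := hp.perm
    -- With the leaf at the front on both sides, what is left of the two arrows is structural on one
    -- leaf less. The correction `u` accounts for the two pulls having been chosen independently in
    -- `T`.
    have key : f' ≫ u = g' := ih (sf.comp hu) sg
      (List.nodup_cons.1 (hl.nodup_iff.1 hS)).2 (by have := hl.length_eq; simp at this; omega)
    rw [← cancel_mono q₂.hom, eg, eu, reassoc_of% ef, ← key]
    simp

end Tree

end

section

/-! ### Forms -/

section

variable {𝒞 : Type w} [Category.{w} 𝒞] [ProofNetCategory 𝒞]

theorem dissoc_nat' {A B C D E F : 𝒞} (f : A ⟶ D) (g : B ⟶ E) (h : C ⟶ F) :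
    dissoc A B C ≫ ((f ⋏ₐ g) ⋎ₐ h) = (f ⋏ₐ (g ⋎ₐ h)) ≫ dissoc D E F :=
  ProofNetCategory.dissoc_nat f g h

theorem dissoc_nat'_assoc {A B C D E F : 𝒞} (f : A ⟶ D) (g : B ⟶ E) (h : C ⟶ F)
    {Z' : 𝒞} (k : _ ⟶ Z') :
    dissoc A B C ≫ ((f ⋏ₐ g) ⋎ₐ h) ≫ k =
      (f ⋏ₐ (g ⋎ₐ h)) ≫ dissoc D E F ≫ k := by
  simpa only [Category.assoc] using congrArg (· ≫ k) (dissoc_nat' f g h)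

theorem dissoc_nat_left {A D : 𝒞} (f : A ⟶ D) (B C : 𝒞) :
    dissoc A B C ≫ ((f ⋏ₐ 𝟙 B) ⋎ₐ 𝟙 C) = (f ⋏ₐ 𝟙 (B ⋎ C)) ≫ dissoc D B C := by
  rw [dissoc_nat', ProofNetCategory.bin_id]

theorem dissoc_nat_left_assoc {A D : 𝒞} (f : A ⟶ D) (B C : 𝒞)
    {Z' : 𝒞} (k : _ ⟶ Z') :
    dissoc A B C ≫ ((f ⋏ₐ 𝟙 B) ⋎ₐ 𝟙 C) ≫ k =
      (f ⋏ₐ 𝟙 (B ⋎ C)) ≫ dissoc D B C ≫ k := by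
  simpa only [Category.assoc] using congrArg (· ≫ k) (dissoc_nat_left f B C)

theorem dissoc_nat_right (A B : 𝒞) {C F : 𝒞} (h : C ⟶ F) :
    dissoc A B C ≫ (𝟙 (A ⋏ B) ⋎ₐ h) = (𝟙 A ⋏ₐ (𝟙 B ⋎ₐ h)) ≫ dissoc A B F := by
  rw [← dissoc_nat', ProofNetCategory.bin_id]

theorem dissoc_nat_right_assoc (A B : 𝒞) {C F : 𝒞} (h : C ⟶ F)
    {Z' : 𝒞} (k : _ ⟶ Z') :
    dissoc A B C ≫ (𝟙 (A ⋏ B) ⋎ₐ h) ≫ k =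
      (𝟙 A ⋏ₐ (𝟙 B ⋎ₐ h)) ≫ dissoc A B F ≫ k := by
  simpa only [Category.assoc] using congrArg (· ≫ k) (dissoc_nat_right A B h)

theorem dissocR_eq (C B A : 𝒞) : dissocR C B A =
    commConj (C ⋎ B) A ≫ (𝟙 A ⋏ₐ commDisj B C) ≫ dissoc A B C ≫ (commConj A B ⋎ₐ 𝟙 C) ≫
      commDisj C (B ⋏ A) := by
  simp only [dissocR]

theorem dissocR_nat {A B C D E F : 𝒞} (f : A ⟶ D) (g : B ⟶ E) (h : C ⟶ F) :
    dissocR A B C ≫ (f ⋎ₐ (g ⋏ₐ h)) = ((f ⋎ₐ g) ⋏ₐ h) ≫ dissocR D E F := by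
  have e1 : (commConj C B ⋎ₐ 𝟙 A) ≫ ((g ⋏ₐ h) ⋎ₐ f) =
      ((h ⋏ₐ g) ⋎ₐ f) ≫ (commConj F E ⋎ₐ 𝟙 D) := by
    rw [bin_comp', bin_comp', commConj_nat', Category.id_comp, Category.comp_id]
  have e2 : (𝟙 C ⋏ₐ commDisj B A) ≫ (h ⋏ₐ (g ⋎ₐ f)) =
      (h ⋏ₐ (f ⋎ₐ g)) ≫ (𝟙 F ⋏ₐ commDisj E D) := by
    rw [bin_comp', bin_comp', commDisj_nat', Category.id_comp, Category.comp_id]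
  rw [dissocR_eq, dissocR_eq]
  simp only [Category.assoc]
  rw [commDisj_nat', reassoc_of% e1, dissoc_nat'_assoc, reassoc_of% e2, commConj_nat'_assoc]

variable (𝒞) in
/-- A form on `X`, which replaces an arrow from `X` to a unit of the disjunction. -/
@[ext]
structure Form₀ (X : 𝒞) where
  app (K : 𝒞) : X ⋎ K ⟶ K
  nat {K L : 𝒞} (f : K ⟶ L) : (𝟙 X ⋎ₐ f) ≫ app L = app K ≫ f
  assoc (K L : 𝒞) : assocFrom .disj X K L ≫ app (K ⋎ L) = app K ⋎ₐ 𝟙 L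
  dissoc (K L : 𝒞) : ProofNetOps.dissoc K L X ≫ commDisj X (K ⋏ L) ≫ app (K ⋏ L) =
    𝟙 K ⋏ₐ (commDisj X L ≫ app L)

namespace Form₀

theorem assoc_assoc {X : 𝒞} (ν : Form₀ 𝒞 X) (K L : 𝒞)
    {Z' : 𝒞} (k : _ ⟶ Z') :
    assocFrom .disj X K L ≫ ν.app (K ⋎ L) ≫ k = (ν.app K ⋎ₐ 𝟙 L) ≫ k := by
  simpa only [Category.assoc] using congrArg (· ≫ k) (ν.assoc K L)

theorem dissoc_assoc {X : 𝒞} (ν : Form₀ 𝒞 X) (K L : 𝒞)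
    {Z' : 𝒞} (k : _ ⟶ Z') :
    ProofNetOps.dissoc K L X ≫ commDisj X (K ⋏ L) ≫ ν.app (K ⋏ L) ≫ k =
      (𝟙 K ⋏ₐ (commDisj X L ≫ ν.app L)) ≫ k := by
  simpa only [Category.assoc] using congrArg (· ≫ k) (ν.dissoc K L)

variable {X Y : 𝒞}

@[simps]
def pre (ν : Form₀ 𝒞 Y) (f : X ⟶ Y) : Form₀ 𝒞 X where
  app K := (f ⋎ₐ 𝟙 K) ≫ ν.app K
  nat g := by
    rw [bin_comp'_assoc, Category.assoc, ← ν.nat, bin_comp'_assoc]; simp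
  assoc K L := by
    have h := assocFrom_nat .disj f (𝟙 K) (𝟙 L)
    rw [ProofNetCategory.bin_id] at h
    rw [← reassoc_of% h, ν.assoc, bin_comp', Category.comp_id]
  dissoc K L := by
    rw [commDisj_nat'_assoc, ← ProofNetCategory.bin_id, dissoc_nat'_assoc, ν.dissoc, bin_comp',
      commDisj_nat'_assoc, Category.id_comp]

/-- The form applied on the right. -/
theorem app_whisker (ν : Form₀ 𝒞 X) (K L : 𝒞) :
    (commDisj X K ≫ ν.app K) ⋎ₐ 𝟙 L = assocFrom .disj K X L ≫ (𝟙 K ⋎ₐ ν.app L) := by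
  have h1 : 𝟙 K ⋎ₐ ν.app L = commDisj (X ⋎ L) K ≫ (ν.app L ⋎ₐ 𝟙 K) ≫ commDisj K L := by
    rw [← commDisj_nat', commDisj_commDisj'_assoc]
  have h2 := hexagonDisj' K X L
  rw [h1, ← ν.assoc_assoc, ← ν.nat, reassoc_of% h2, bin_comp'_assoc, commDisj_commDisj',
    Category.comp_id, ProofNetCategory.bin_id, Category.id_comp, ν.assoc, bin_comp',
    Category.comp_id]

theorem dissocR (ν : Form₀ 𝒞 X) (K L : 𝒞) :
    ProofNetOps.dissocR X K L ≫ ν.app (K ⋏ L) = ν.app K ⋏ₐ 𝟙 L := by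
  rw [dissocR_eq]
  simp only [Category.assoc]
  rw [← commDisj_nat'_assoc, ν.nat, ν.dissoc_assoc, bin_comp'_assoc, commDisj_commDisj'_assoc,
    Category.id_comp, ← commConj_nat', commConj_commConj'_assoc]

/-- Two forms combine to a form on the disjunction, as if by the isomorphism of the missing unit
with its own double. The order in which the two disjuncts are eliminated does not matter. -/
theorem mult_comm {Y : 𝒞} (ν : Form₀ 𝒞 X) (μ : Form₀ 𝒞 Y) :
    μ.pre (ν.app Y) = (ν.pre (μ.app X)).pre (commDisj Y X) := by
  ext Z
  simp only [pre_app]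
  rw [bin_comp'_assoc, Category.comp_id, app_whisker, Category.assoc, ν.nat, ← ν.assoc_assoc]

end Form₀

end

/-! ### Forms in a context and their combination -/

namespace Aug

variable {𝒞 : Type w} [Category.{w} 𝒞] [ProofNetCategory 𝒞]

/-- Forms on the objects of the category with a unit adjoined. -/
@[reducible]
def Form : Aug 𝒞 → Type w
  | unit => PUnit
  | of X => Form₀ 𝒞 X

/-- A form on the adjoined unit carries no data. This loses nothing here, because an arrow into the
unit starts at the unit, so a genuine form is never required from a trivial one. -/
def Form.pre : {M N : Aug 𝒞} → Form N → (M ⟶ N) → Form M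
  | unit, _, _, _ => ⟨⟩
  | of _, of _, ν, .arr f => Form₀.pre ν f

theorem Form.pre_id {M : Aug 𝒞} (ν : Form M) : Form.pre ν (𝟙 M) = ν := by
  rcases M with _ | X
  · rfl
  · refine Form₀.ext (funext fun K => ?_)
    change (𝟙 X ⋎ₐ 𝟙 K) ≫ ν.app K = _
    simp

theorem Form.pre_comp {M N K : Aug 𝒞} (ν : Form K) (f : M ⟶ N) (g : N ⟶ K) :
    Form.pre ν (f ≫ g) = Form.pre (Form.pre ν g) f := by
  rcases f with _ | f | f
  · rfl
  · rfl
  · rcases g with _ | g | g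
    refine Form₀.ext (funext fun K => ?_)
    change ((f ≫ g) ⋎ₐ 𝟙 K) ≫ ν.app K = (f ⋎ₐ 𝟙 K) ≫ (g ⋎ₐ 𝟙 K) ≫ ν.app K
    rw [bin_comp'_assoc, Category.comp_id]

/-- Elimination of a disjunct by a form in a context. -/
def elim : {Γ : Aug 𝒞} → {A : 𝒞} → Form (Γ ⊗ of A) → (Z : 𝒞) → (Γ ⊗ of (A ⋎ Z) ⟶ of Z)
  | unit, _, ν, Z => arr (Form₀.app ν Z)
  | of G, A, ν, Z => arr (dissoc G A Z ≫ Form₀.app ν Z)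

theorem elim_pre_left {Γ Γ' : Aug 𝒞} {A : 𝒞} (ν : Form (Γ ⊗ of A)) (f : Γ' ⟶ Γ) (Z : 𝒞) :
    elim (Form.pre ν (f ▷ of A)) Z = f ▷ of (A ⋎ Z) ≫ elim ν Z := by
  rcases f with _ | f | f
  · refine congrArg Hom.arr (?_ : (𝟙 A ⋎ₐ 𝟙 Z) ≫ ν.app Z = 𝟙 _ ≫ ν.app Z)
    simp
  · rename_i G
    refine congrArg Hom.arr (?_ : ((f.app A ≫ commConj A G) ⋎ₐ 𝟙 Z) ≫ ν.app Z =
      (f.app (A ⋎ Z) ≫ commConj _ G) ≫ dissoc G A Z ≫ ν.app Z)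
    -- The law `dissoc` of a point is precisely the naturality of elimination along it.
    rw [← f.dissoc_assoc, Category.assoc]
  · rename_i G' G
    refine congrArg Hom.arr (?_ : dissoc G' A Z ≫ ((f ⋏ₐ 𝟙 A) ⋎ₐ 𝟙 Z) ≫ ν.app Z =
      (f ⋏ₐ 𝟙 (A ⋎ Z)) ≫ dissoc G A Z ≫ ν.app Z)
    rw [dissoc_nat_left_assoc]

theorem elim_pre_right {Γ : Aug 𝒞} {A A' : 𝒞} (ν : Form (Γ ⊗ of A)) (a : A' ⟶ A) (Z : 𝒞) :
    elim (Form.pre ν (Γ ◁ arr a)) Z = Γ ◁ arr (a ⋎ₐ 𝟙 Z) ≫ elim ν Z := by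
  rcases Γ with _ | G
  · rfl
  · refine congrArg Hom.arr (?_ : dissoc G A' Z ≫ ((𝟙 G ⋏ₐ a) ⋎ₐ 𝟙 Z) ≫ ν.app Z =
      (𝟙 G ⋏ₐ (a ⋎ₐ 𝟙 Z)) ≫ dissoc G A Z ≫ ν.app Z)
    rw [dissoc_nat'_assoc]

theorem elim_nat {Γ : Aug 𝒞} {A : 𝒞} (ν : Form (Γ ⊗ of A)) {Z Z' : 𝒞} (h : Z ⟶ Z') :
    elim ν Z ≫ arr h = Γ ◁ arr (𝟙 A ⋎ₐ h) ≫ elim ν Z' := by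
  rcases Γ with _ | G
  · exact congrArg Hom.arr (ν.nat h).symm
  · refine congrArg Hom.arr (?_ : (dissoc G A Z ≫ ν.app Z) ≫ h =
      (𝟙 G ⋏ₐ (𝟙 A ⋎ₐ h)) ≫ dissoc G A Z' ≫ ν.app Z')
    rw [Category.assoc, ← ν.nat, dissoc_nat_right_assoc]

/-- Elimination with a conjunct moved to the context. -/
theorem elim_conj {Γ : Aug 𝒞} {A B : 𝒞} (ν : Form (Γ ⊗ of (A ⋏ B))) (Z : 𝒞) :
    elim (Form.pre ν (α_ Γ (of A) (of B)).hom) Z =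
      (α_ Γ (of A) (of (B ⋎ Z))).hom ≫ Γ ◁ arr (dissoc A B Z) ≫ elim ν Z := by
  rcases Γ with _ | G
  · refine congrArg Hom.arr (?_ : dissoc A B Z ≫ (𝟙 _ ⋎ₐ 𝟙 _) ≫ ν.app Z =
      𝟙 _ ≫ dissoc A B Z ≫ ν.app Z)
    simp
  · refine congrArg Hom.arr (?_ : dissoc (G ⋏ A) B Z ≫ (assocFrom .conj G A B ⋎ₐ 𝟙 Z) ≫ ν.app Z =
      assocFrom .conj G A (B ⋎ Z) ≫ (𝟙 G ⋏ₐ dissoc A B Z) ≫ dissoc G (A ⋏ B) Z ≫ ν.app Z)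
    have h := ProofNetCategory.dissoc_conj G A B Z
    rw [reassoc_of% h]

/-- Moving the second part of a context to the front. -/
def shuffle (Γ Δ X : Aug 𝒞) : (Γ ⊗ Δ) ⊗ X ⟶ Δ ⊗ (Γ ⊗ X) :=
  (β_ Γ Δ).hom ▷ X ≫ (α_ Δ Γ X).hom

theorem shuffle_nat {Γ Γ' Δ Δ' X X' : Aug 𝒞} (f : Γ ⟶ Γ') (g : Δ ⟶ Δ') (h : X ⟶ X') :
    ((f ⊗ₘ g) ⊗ₘ h) ≫ shuffle Γ' Δ' X' = shuffle Γ Δ X ≫ (g ⊗ₘ (f ⊗ₘ h)) := by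
  rw [shuffle, shuffle, ← tensorHom_id, ← tensorHom_id, tensorHom_comp_tensorHom_assoc,
    BraidedCategory.braiding_naturality, Category.comp_id, Category.assoc,
    ← associator_naturality, tensorHom_comp_tensorHom_assoc, Category.id_comp]

theorem _root_.ProofNet.Tree.Str.shuffle {α : Type*} {ob : α → Aug 𝒞} (S T U : Tree α) :
    Tree.Str ob (.node (.node S T) U) (.node T (.node S U)) (shuffle _ _ _) :=
  ((Tree.Str.braid _ _).right _).comp (.assoc _ _ _)

/-- The combination of two forms in a form on a disjunction. -/
def R {Γ Δ : Aug 𝒞} {A B : 𝒞} (ν : Form (Γ ⊗ of A)) (μ : Form (Δ ⊗ of B)) :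
    Form ((Γ ⊗ Δ) ⊗ of (A ⋎ B)) :=
  Form.pre μ (shuffle Γ Δ _ ≫ Δ ◁ elim ν B)

/-- The combination of forms is natural in the contexts; `R_pre_right` is its naturality in the two
formulae. -/
theorem R_pre_left {Γ Γ' Δ Δ' : Aug 𝒞} {A B : 𝒞} (ν : Form (Γ ⊗ of A)) (μ : Form (Δ ⊗ of B))
    (f : Γ' ⟶ Γ) (g : Δ' ⟶ Δ) :
    R (Form.pre ν (f ▷ of A)) (Form.pre μ (g ▷ of B)) = Form.pre (R ν μ) ((f ⊗ₘ g) ▷ _) := by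
  rw [R, R, ← Form.pre_comp, ← Form.pre_comp, elim_pre_left, ← tensorHom_id (f ⊗ₘ g),
    ← Category.assoc _ _ (Δ ◁ _), shuffle_nat, Category.assoc, Category.assoc, tensorHom_id,
    whiskerLeft_comp, Category.assoc, whisker_exchange, MonoidalCategory.tensorHom_def',
    Category.assoc, whisker_exchange_assoc]

theorem R_pre_right {Γ Δ : Aug 𝒞} {A B A' B' : 𝒞} (ν : Form (Γ ⊗ of A)) (μ : Form (Δ ⊗ of B))
    (a : A' ⟶ A) (b : B' ⟶ B) :
    R (Form.pre ν (Γ ◁ arr a)) (Form.pre μ (Δ ◁ arr b)) =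
      Form.pre (R ν μ) ((Γ ⊗ Δ) ◁ arr (a ⋎ₐ b)) := by
  have h : Γ ◁ arr (a ⋎ₐ 𝟙 B') ≫ Γ ◁ arr (𝟙 A ⋎ₐ b) = Γ ◁ arr (a ⋎ₐ b) := by
    rw [← whiskerLeft_comp, ← arr_comp, bin_comp']; simp
  have h2 := shuffle_nat (𝟙 Γ) (𝟙 Δ) (arr (a ⋎ₐ b))
  rw [id_tensorHom_id, id_tensorHom, id_tensorHom, id_tensorHom] at h2
  rw [R, R, ← Form.pre_comp, ← Form.pre_comp, elim_pre_right, Category.assoc, ← whiskerLeft_comp,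
    Category.assoc, elim_nat, reassoc_of% h, reassoc_of% h2, whiskerLeft_comp]

theorem shuffle_unit_unit (X : 𝒞) : shuffle unit unit (of X) = arr (𝟙 X) :=
  congrArg Hom.arr (Category.comp_id (𝟙 X))

theorem shuffle_of_unit (G X : 𝒞) : shuffle (of G) unit (of X) = arr (𝟙 (G ⋏ X)) := by
  refine congrArg Hom.arr (?_ : (𝟙 G ⋏ₐ 𝟙 X) ≫ 𝟙 (G ⋏ X) = 𝟙 (G ⋏ X))
  simp

theorem shuffle_unit_of (D X : 𝒞) : shuffle unit (of D) (of X) = arr (𝟙 (D ⋏ X)) := by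
  refine congrArg Hom.arr (?_ : (𝟙 D ⋏ₐ 𝟙 X) ≫ 𝟙 (D ⋏ X) = 𝟙 (D ⋏ X))
  simp

theorem shuffle_of_of (G D X : 𝒞) : shuffle (of G) (of D) (of X) =
    arr ((commConj G D ⋏ₐ 𝟙 X) ≫ assocFrom .conj D G X) := rfl

/-- The four cases, according to which contexts are units, present the combination as the same form
on a disjunction precomposed with an arrow of `𝒞`. In this shape its commutativity reduces to
`Form₀.mult_comm`. -/
theorem R_unit_unit {A B : 𝒞} (ν : Form₀ 𝒞 A) (μ : Form₀ 𝒞 B) :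
    R (Γ := unit) (Δ := unit) (A := A) (B := B) ν μ = Form₀.pre μ (ν.app B) := by
  rw [R, shuffle_unit_unit]
  exact congrArg (Form₀.pre μ) (Category.id_comp (ν.app B))

theorem R_of_unit {G A B : 𝒞} (ν : Form₀ 𝒞 (G ⋏ A)) (μ : Form₀ 𝒞 B) :
    R (Γ := of G) (Δ := unit) (A := A) (B := B) ν μ =
      Form₀.pre (Form₀.pre μ (ν.app B)) (dissoc G A B) := by
  rw [R, shuffle_of_unit]
  refine (congrArg (Form₀.pre μ) (Category.id_comp (dissoc G A B ≫ ν.app B))).trans ?_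
  exact Form.pre_comp (K := of B) μ (arr (dissoc G A B)) (arr (ν.app B))

theorem R_unit_of {D A B : 𝒞} (ν : Form₀ 𝒞 A) (μ : Form₀ 𝒞 (D ⋏ B)) :
    R (Γ := unit) (Δ := of D) (A := A) (B := B) ν μ = Form₀.pre (Form₀.pre μ (ν.app (D ⋏ B)))
      ((𝟙 D ⋏ₐ commDisj B A) ≫ dissoc D B A ≫ commDisj A (D ⋏ B)) := by
  rw [R, shuffle_unit_of]
  refine (congrArg (Form₀.pre μ) (Category.id_comp (𝟙 D ⋏ₐ ν.app B))).trans ?_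
  refine Eq.trans (congrArg (Form₀.pre μ) ?_)
    (Form.pre_comp (K := of (D ⋏ B)) μ (arr ((𝟙 D ⋏ₐ commDisj B A) ≫ dissoc D B A ≫
      commDisj A (D ⋏ B))) (arr (ν.app (D ⋏ B))))
  rw [Category.assoc, Category.assoc, ν.dissoc, bin_comp', commDisj_commDisj'_assoc,
    Category.id_comp]

theorem R_of_of {G D A B : 𝒞} (ν : Form₀ 𝒞 (G ⋏ A)) (μ : Form₀ 𝒞 (D ⋏ B)) :
    R (Γ := of G) (Δ := of D) (A := A) (B := B) ν μ =
      Form₀.pre (Form₀.pre μ (ν.app (D ⋏ B)))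
        ((commConj G D ⋏ₐ 𝟙 (A ⋎ B)) ≫ assocFrom .conj D G (A ⋎ B) ≫ (𝟙 D ⋏ₐ dissoc G A B) ≫
          (𝟙 D ⋏ₐ commDisj B (G ⋏ A)) ≫ dissoc D B (G ⋏ A) ≫ commDisj (G ⋏ A) (D ⋏ B)) := by
  rw [R, shuffle_of_of]
  refine Eq.trans (congrArg (Form₀.pre μ) ?_)
    (Form.pre_comp (K := of (D ⋏ B)) μ (arr ((commConj G D ⋏ₐ 𝟙 (A ⋎ B)) ≫
      assocFrom .conj D G (A ⋎ B) ≫ (𝟙 D ⋏ₐ dissoc G A B) ≫ (𝟙 D ⋏ₐ commDisj B (G ⋏ A)) ≫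
      dissoc D B (G ⋏ A) ≫ commDisj (G ⋏ A) (D ⋏ B))) (arr (ν.app (D ⋏ B))))
  change ((commConj G D ⋏ₐ 𝟙 (A ⋎ B)) ≫ assocFrom .conj D G (A ⋎ B)) ≫
    (𝟙 D ⋏ₐ (dissoc G A B ≫ ν.app B)) = ((commConj G D ⋏ₐ 𝟙 (A ⋎ B)) ≫
      assocFrom .conj D G (A ⋎ B) ≫ (𝟙 D ⋏ₐ dissoc G A B) ≫ (𝟙 D ⋏ₐ commDisj B (G ⋏ A)) ≫
      dissoc D B (G ⋏ A) ≫ commDisj (G ⋏ A) (D ⋏ B)) ≫ _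
  simp only [Category.assoc]
  rw [ν.dissoc, bin_comp', commDisj_commDisj'_assoc, Category.id_comp, bin_comp', Category.id_comp]

/-- Eliminating `A ⋎ B` from `(A ⋎ B) ⋎ C` amounts to eliminating first `A` and then `B`. The inputs
are the law `assoc` of forms and, where a context is present, the compatibility of `d` with the two
associativities. -/
theorem elim_R {Γ Δ : Aug 𝒞} {A B : 𝒞} (ν : Form (Γ ⊗ of A)) (μ : Form (Δ ⊗ of B)) (C : 𝒞) :
    elim (R ν μ) C = (Γ ⊗ Δ) ◁ arr (assocFrom .disj A B C) ≫ shuffle Γ Δ _ ≫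
      Δ ◁ elim ν (B ⋎ C) ≫ elim μ C := by
  rcases Γ with _ | G <;> rcases Δ with _ | D
  · rw [R_unit_unit, shuffle_unit_unit]
    refine congrArg Hom.arr (?_ : (ν.app B ⋎ₐ 𝟙 C) ≫ μ.app C =
      assocFrom .disj A B C ≫ 𝟙 _ ≫ ν.app (B ⋎ C) ≫ μ.app C)
    rw [Category.id_comp, ν.assoc_assoc]
  · rw [R, shuffle_unit_of, shuffle_unit_of]
    refine congrArg Hom.arr (?_ : dissoc D (A ⋎ B) C ≫ ((𝟙 _ ≫ (𝟙 D ⋏ₐ ν.app B)) ⋎ₐ 𝟙 C) ≫ μ.app C =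
      (𝟙 D ⋏ₐ assocFrom .disj A B C) ≫ 𝟙 _ ≫ (𝟙 D ⋏ₐ ν.app (B ⋎ C)) ≫ dissoc D B C ≫ μ.app C)
    rw [Category.id_comp, Category.id_comp, bin_comp'_assoc, ν.assoc, dissoc_nat'_assoc,
      Category.id_comp]
  · rw [R, shuffle_of_unit, shuffle_of_unit]
    refine congrArg Hom.arr (?_ : dissoc G (A ⋎ B) C ≫
      ((𝟙 _ ≫ dissoc G A B ≫ ν.app B) ⋎ₐ 𝟙 C) ≫ μ.app C =
      (𝟙 G ⋏ₐ assocFrom .disj A B C) ≫ 𝟙 _ ≫ (dissoc G A (B ⋎ C) ≫ ν.app (B ⋎ C)) ≫ μ.app C)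
    have h : (𝟙 G ⋏ₐ assocFrom .disj A B C) ≫ dissoc G A (B ⋎ C) = dissoc G (A ⋎ B) C ≫
      (dissoc G A B ⋎ₐ 𝟙 C) ≫ assocFrom .disj (G ⋏ A) B C := ProofNetCategory.dissoc_disj C B A G
    rw [Category.id_comp, Category.id_comp, Category.assoc, reassoc_of% h, ν.assoc_assoc,
      bin_comp'_assoc, Category.comp_id]
  · rw [R, shuffle_of_of, shuffle_of_of]
    refine congrArg Hom.arr (?_ : dissoc (G ⋏ D) (A ⋎ B) C ≫
      ((((commConj G D ⋏ₐ 𝟙 (A ⋎ B)) ≫ assocFrom .conj D G (A ⋎ B)) ≫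
        (𝟙 D ⋏ₐ (dissoc G A B ≫ ν.app B))) ⋎ₐ 𝟙 C) ≫ μ.app C =
      (𝟙 (G ⋏ D) ⋏ₐ assocFrom .disj A B C) ≫ ((commConj G D ⋏ₐ 𝟙 (A ⋎ (B ⋎ C))) ≫
        assocFrom .conj D G (A ⋎ (B ⋎ C))) ≫ (𝟙 D ⋏ₐ (dissoc G A (B ⋎ C) ≫ ν.app (B ⋎ C))) ≫
        dissoc D B C ≫ μ.app C)
    have h : (𝟙 G ⋏ₐ assocFrom .disj A B C) ≫ dissoc G A (B ⋎ C) = dissoc G (A ⋎ B) C ≫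
      (dissoc G A B ⋎ₐ 𝟙 C) ≫ assocFrom .disj (G ⋏ A) B C := ProofNetCategory.dissoc_disj C B A G
    have h3 : dissoc (D ⋏ G) (A ⋎ B) C ≫ (assocFrom .conj D G (A ⋎ B) ⋎ₐ 𝟙 C) =
      assocFrom .conj D G ((A ⋎ B) ⋎ C) ≫ (𝟙 D ⋏ₐ dissoc G (A ⋎ B) C) ≫
        dissoc D (G ⋏ (A ⋎ B)) C := by
      rw [ProofNetCategory.dissoc_conj]
    have e1 : ∀ {X Y Z W : 𝒞} (f : X ⟶ Y) (g : Y ⟶ Z) (h : Z ⟶ W), ((f ≫ g) ≫ h) ⋎ₐ 𝟙 C =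
        (f ⋎ₐ 𝟙 C) ≫ (g ⋎ₐ 𝟙 C) ≫ (h ⋎ₐ 𝟙 C) := fun f g h => by
      rw [bin_comp', bin_comp']; simp
    have e2 : (𝟙 (G ⋏ D) ⋏ₐ assocFrom .disj A B C) ≫ (commConj G D ⋏ₐ 𝟙 (A ⋎ (B ⋎ C))) =
        (commConj G D ⋏ₐ 𝟙 _) ≫ ((𝟙 D ⋏ₐ 𝟙 G) ⋏ₐ assocFrom .disj A B C) := by
      rw [bin_comp', bin_comp']; simp
    rw [e1]
    simp only [Category.assoc]
    rw [dissoc_nat_left_assoc, reassoc_of% h3, dissoc_nat'_assoc, reassoc_of% e2,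
      assocFrom_nat_assoc, bin_comp'_assoc, bin_comp'_assoc, reassoc_of% h, ν.assoc, bin_comp',
      Category.comp_id, Category.id_comp]

theorem R_comm {Γ Δ : Aug 𝒞} {A B : 𝒞} (ν : Form (Γ ⊗ of A)) (μ : Form (Δ ⊗ of B)) :
    R ν μ = Form.pre (R μ ν) ((β_ Γ Δ).hom ▷ _ ≫ (Δ ⊗ Γ) ◁ arr (commDisj B A)) := by
  -- By `Form₀.mult_comm` it is enough to compare two arrows of `𝒞` into a disjunction. Only the
  -- case of two proper contexts needs more than the symmetries.
  have key {X Y Z W : 𝒞} (ν : Form₀ 𝒞 X) (μ : Form₀ 𝒞 Y) {f : Z ⟶ X ⋎ Y} {g : Z ⟶ W}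
      {h : W ⟶ Y ⋎ X} (e : f ≫ commDisj Y X = g ≫ h) :
      Form₀.pre (Form₀.pre μ (ν.app Y)) f = Form₀.pre (Form₀.pre (Form₀.pre ν (μ.app X)) h) g := by
    rw [Form₀.mult_comm]
    refine (Form.pre_comp (K := of (Y ⋎ X)) (Form₀.pre ν (μ.app X)) (arr f)
      (arr (commDisj Y X))).symm.trans ?_
    refine Eq.trans ?_ (Form.pre_comp (K := of (Y ⋎ X)) (Form₀.pre ν (μ.app X)) (arr g) (arr h))
    exact congrArg (Form₀.pre (Form₀.pre ν (μ.app X))) e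
  rcases Γ with _ | G <;> rcases Δ with _ | D
  · rw [R_unit_unit, R_unit_unit, Form₀.mult_comm]
    refine congrArg (Form₀.pre _) (?_ : _ = (𝟙 _ ≫ commDisj B A))
    simp
  · rw [R_unit_of, R_of_unit]
    refine key ν μ (?_ : _ = ((𝟙 _ ⋏ₐ 𝟙 _) ≫ (𝟙 D ⋏ₐ commDisj B A)) ≫ _)
    simp
  · rw [R_unit_of, R_of_unit]
    refine key ν μ (?_ : _ = ((𝟙 _ ⋏ₐ 𝟙 _) ≫ (𝟙 G ⋏ₐ commDisj B A)) ≫ _)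
    simp [bin_comp'_assoc]
  · rw [R_of_of, R_of_of]
    refine key ν μ (?_ : _ = ((commConj G D ⋏ₐ 𝟙 _) ≫ (𝟙 _ ⋏ₐ commDisj B A)) ≫ _)
    -- The arrow `d`, surrounded by symmetries, is rewritten as the mirrored `dissocR`, so that the
    -- law `dissoc_assocConj` relating the two distributions becomes applicable.
    have hr : ∀ Y : 𝒞, (𝟙 D ⋏ₐ commDisj B Y) ≫ dissoc D B Y ≫ commDisj Y (D ⋏ B) =
        commConj D (Y ⋎ B) ≫ dissocR Y B D ≫ (𝟙 Y ⋎ₐ commConj B D) := fun Y => by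
      rw [dissocR_eq]
      simp only [Category.assoc]
      rw [commDisj_nat', bin_comp'_assoc]
      simp
    have ha : (dissoc G A B ⋏ₐ 𝟙 D) ≫ dissocR (G ⋏ A) B D =
        assocFrom .conj G (A ⋎ B) D ≫ (𝟙 G ⋏ₐ dissocR A B D) ≫ dissoc G A (B ⋏ D) :=
      ProofNetCategory.dissoc_assocConj G A B D
    have e2 : (𝟙 (D ⋏ G) ⋏ₐ commDisj B A) ≫ (commConj D G ⋏ₐ 𝟙 (B ⋎ A)) =
        (commConj D G ⋏ₐ 𝟙 _) ≫ ((𝟙 G ⋏ₐ 𝟙 D) ⋏ₐ commDisj B A) := by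
      rw [bin_comp', bin_comp']; simp
    simp only [Category.assoc]
    rw [reassoc_of% (hr (G ⋏ A)), reassoc_of% e2, bin_comp'_assoc, commConj_commConj',
      Category.comp_id, ProofNetCategory.bin_id, Category.id_comp, assocFrom_nat_assoc,
      bin_comp'_assoc, bin_comp'_assoc, Category.id_comp, Category.id_comp, Category.assoc, hr A,
      ← commConj_nat'_assoc, reassoc_of% ha, reassoc_of% (hexagonConj' D G (A ⋎ B)),
      bin_comp'_assoc, bin_comp'_assoc, commConj_commConj', Category.comp_id,
      ProofNetCategory.bin_id, Category.id_comp, Category.id_comp, dissoc_nat_right_assoc]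
    simp only [bin_comp'_assoc, Category.comp_id, Category.assoc]

theorem shuffle_shuffle (Γ Δ Θ X : Aug 𝒞) :
    shuffle (Γ ⊗ Δ) Θ X ≫ Θ ◁ shuffle Γ Δ X =
      (α_ Γ Δ Θ).hom ▷ X ≫ shuffle Γ (Δ ⊗ Θ) X ≫ shuffle Δ Θ (Γ ⊗ X) := by
  -- The four objects are treated as the distinct leaves `0` to `3`, even if some of them coincide;
  -- coherence then applies.
  exact Tree.Str.unique (ob := ![Γ, Δ, Θ, X])
    (S := .node (.node (.node (.leaf 0) (.leaf 1)) (.leaf 2)) (.leaf 3))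
    (T := .node (.leaf 2) (.node (.leaf 1) (.node (.leaf 0) (.leaf 3))))
    ((Tree.Str.shuffle _ _ _).comp ((Tree.Str.shuffle _ _ _).left _))
    (((Tree.Str.assoc _ _ _).right _).comp
      ((Tree.Str.shuffle _ _ _).comp (Tree.Str.shuffle _ _ _))) (by decide)

/-- Both sides eliminate `A`, then `B`, and apply `ξ` to what is left. They differ only by a
rearrangement of the contexts, covered by `shuffle_shuffle`. -/
theorem R_assoc {Γ Δ Θ : Aug 𝒞} {A B C : 𝒞} (ν : Form (Γ ⊗ of A)) (μ : Form (Δ ⊗ of B))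
    (ξ : Form (Θ ⊗ of C)) :
    R (R ν μ) ξ =
      Form.pre (R ν (R μ ξ)) ((α_ _ _ _).hom ▷ _ ≫ _ ◁ arr (assocFrom .disj A B C)) := by
  have h := shuffle_nat (𝟙 Δ) (𝟙 Θ) (elim ν (B ⋎ C))
  have h2 := shuffle_nat (𝟙 (Γ ⊗ Δ)) (𝟙 Θ) (arr (assocFrom .disj A B C))
  rw [id_tensorHom_id, id_tensorHom, id_tensorHom, id_tensorHom] at h h2
  change Form.pre ξ (_ ≫ Θ ◁ elim (R ν μ) C) = Form.pre (Form.pre (Form.pre ξ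
    (_ ≫ Θ ◁ elim μ C)) (_ ≫ (Δ ⊗ Θ) ◁ elim ν (B ⋎ C))) _
  rw [← Form.pre_comp, elim_R, ← Form.pre_comp]
  refine congrArg (Form.pre ξ) ?_
  simp only [Category.assoc, whiskerLeft_comp]
  rw [reassoc_of% h, ← reassoc_of% h2, reassoc_of% shuffle_shuffle, whisker_exchange_assoc]

/-- Elimination in the second of two formulae. -/
theorem R_conj {Γ Δ : Aug 𝒞} {A B C : 𝒞} (ν : Form (Γ ⊗ of (A ⋏ B))) (μ : Form (Δ ⊗ of C)) :
    R (Form.pre ν (α_ Γ (of A) (of B)).hom) μ = Form.pre (R ν μ)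
      ((α_ _ _ _).hom ▷ _ ≫ (α_ _ _ _).hom ≫ Γ ◁ (shuffle (of A) Δ _) ≫ (α_ _ _ _).inv ≫
        (Γ ⊗ Δ) ◁ arr (dissoc A B C)) := by
  have h := shuffle_nat (𝟙 Γ) (𝟙 Δ) (arr (dissoc A B C))
  rw [id_tensorHom_id, id_tensorHom, id_tensorHom, id_tensorHom] at h
  have h2 : ((α_ Γ (of A) Δ).hom ▷ of (B ⋎ C) ≫ (α_ _ _ _).hom ≫ Γ ◁ (shuffle (of A) Δ _) ≫
      (α_ _ _ _).inv) ≫ shuffle Γ Δ (of A ⊗ of (B ⋎ C)) =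
        shuffle (Γ ⊗ of A) Δ (of (B ⋎ C)) ≫ Δ ◁ (α_ _ _ _).hom :=
    Tree.Str.unique (ob := ![Γ, of A, Δ, of (B ⋎ C)])
      (S := .node (.node (.node (.leaf 0) (.leaf 1)) (.leaf 2)) (.leaf 3))
      (T := .node (.leaf 2) (.node (.leaf 0) (.node (.leaf 1) (.leaf 3))))
      ((((Tree.Str.assoc _ _ _).right _).comp ((Tree.Str.assoc _ _ _).comp
        (((Tree.Str.shuffle _ _ _).left _).comp (.assocInv _ _ _)))).comp (.shuffle _ _ _))
      ((Tree.Str.shuffle _ _ _).comp ((Tree.Str.assoc _ _ _).left _)) (by decide)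
  simp only [Category.assoc] at h2
  rw [R, R, ← Form.pre_comp, elim_conj]
  refine congrArg (Form.pre μ) ?_
  simp only [Category.assoc, whiskerLeft_comp]
  rw [reassoc_of% h]
  have h3 := congrArg (· ≫ Δ ◁ Γ ◁ arr (dissoc A B C) ≫ Δ ◁ elim ν C) h2
  simp only [Category.assoc] at h3
  exact h3.symm

end Aug

end

section

/-! ### Dual pairs -/

open Aug

variable {𝒞 : Type w} [Category.{w} 𝒞] [ProofNetCategory 𝒞]

/-- A pair of objects with a unit and a counit of a duality. -/
structure DualPair (X X' : 𝒞) where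
  unit : Point 𝒞 (X' ⋎ X)
  counit : Form₀ 𝒞 (X ⋏ X')
  zigzag : unit.app X ≫ dissoc X X' X ≫ counit.app X = 𝟙 X
  zigzag' : unit.app X' ≫ (𝟙 X' ⋏ₐ commDisj X X') ≫ dissoc X' X X' ≫
    (commConj X' X ⋎ₐ 𝟙 X') ≫ counit.app X' = 𝟙 X'

namespace DualPair

variable {X X' Y Y' : 𝒞}

/-- Duality is symmetric: under the symmetries of both connectives the two zigzag identities change
places. -/
def swap (D : DualPair X X') : DualPair X' X where
  unit := D.unit.map (commDisj X X')
  counit := D.counit.pre (commConj X' X)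
  zigzag := by simpa using D.zigzag'
  zigzag' := by
    have h := D.zigzag
    simp only [Point.map_app, Form₀.pre_app, Category.assoc, bin_comp'_assoc, commDisj_commDisj',
      commConj_commConj', Category.comp_id, ProofNetCategory.bin_id, Category.id_comp]
    exact h

/-- The duality of an object and its negation. -/
def ofNeg (A : 𝒞) : DualPair A (∼A) where
  unit :=
    { app := deltaConj A
      nat := ProofNetCategory.deltaConj_nat A
      assoc := fun K L => ProofNetCategory.assocConj_deltaConj K L A
      dissoc := fun K L => by
        have h := ProofNetCategory.dissoc_sigmaConj A K L
        simpa only [sigmaConj, Category.assoc] using h }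
  counit :=
    { app := sigmaDisj A
      nat := fun f => (ProofNetCategory.sigmaDisj_nat A f).symm
      assoc := fun K L => ProofNetCategory.assocDisj_sigmaDisj L K A
      dissoc := fun K L => ProofNetCategory.dissoc_deltaDisj A L K }
  zigzag := by simpa only [Category.assoc] using ProofNetCategory.sigmaDisj_deltaConj A
  zigzag' := by
    have h := ProofNetCategory.sigmaDisjPrime_deltaConjPrime A
    simpa only [sigmaDisjPrime, deltaConjPrime, Category.assoc] using h

def mapIso (D : DualPair X X') (e : X ≅ Y) (e' : X' ≅ Y') : DualPair Y Y' where
  unit := D.unit.map (e'.hom ⋎ₐ e.hom)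
  counit := D.counit.pre (e.inv ⋏ₐ e'.inv)
  zigzag := by
    have h := D.zigzag
    have h2 : (e.hom ⋏ₐ (e'.hom ⋎ₐ e.hom)) ≫ dissoc Y Y' Y ≫ ((e.inv ⋏ₐ e'.inv) ⋎ₐ 𝟙 Y) =
        dissoc X X' X ≫ (𝟙 _ ⋎ₐ e.hom) := by
      rw [dissoc_nat', bin_comp'_assoc, bin_comp', e.hom_inv_id, e'.hom_inv_id, Category.comp_id,
        dissoc_nat_right]
    rw [← cancel_epi e.hom]
    simp only [Point.map_app, Form₀.pre_app, Category.assoc]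
    rw [← D.unit.nat_assoc, bin_comp'_assoc, Category.comp_id, Category.id_comp, reassoc_of% h2,
      D.counit.nat, reassoc_of% h]
  zigzag' := by
    have h := D.zigzag'
    have h2 : (e'.hom ⋏ₐ (e'.hom ⋎ₐ e.hom)) ≫ (𝟙 Y' ⋏ₐ commDisj Y Y') ≫ dissoc Y' Y Y' ≫
        (commConj Y' Y ⋎ₐ 𝟙 Y') ≫ ((e.inv ⋏ₐ e'.inv) ⋎ₐ 𝟙 Y') =
        (𝟙 X' ⋏ₐ commDisj X X') ≫ dissoc X' X X' ≫ (commConj X' X ⋎ₐ 𝟙 X') ≫ (𝟙 _ ⋎ₐ e'.hom) := by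
      have h3 : (e'.hom ⋏ₐ (e'.hom ⋎ₐ e.hom)) ≫ (𝟙 Y' ⋏ₐ commDisj Y Y') =
          (𝟙 X' ⋏ₐ commDisj X X') ≫ (e'.hom ⋏ₐ (e.hom ⋎ₐ e'.hom)) := by
        rw [bin_comp', bin_comp', commDisj_nat', Category.id_comp, Category.comp_id]
      rw [reassoc_of% h3, ← dissoc_nat'_assoc]
      simp only [bin_comp', commConj_nat', Category.id_comp, Category.comp_id]
      rw [bin_comp'_assoc, e.hom_inv_id, e'.hom_inv_id]
      simp
    rw [← cancel_epi e'.hom]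
    simp only [Point.map_app, Form₀.pre_app, Category.assoc]
    rw [← D.unit.nat_assoc, bin_comp'_assoc, Category.comp_id, Category.id_comp, reassoc_of% h2,
      D.counit.nat, reassoc_of% h]

/-- The counit as a form on a tensor product. -/
abbrev form (D : DualPair X X') : Form (of X ⊗ of X') := D.counit

theorem swap_form (D : DualPair X X') :
    D.swap.form = Form.pre D.form (β_ (of X') (of X)).hom := rfl

theorem zig (D : DualPair X X') :
    (ρ_ (of X)).inv ≫ of X ◁ pt D.unit ≫ elim D.form X = 𝟙 (of X) := by
  refine congrArg Hom.arr (?_ : 𝟙 X ≫ D.unit.app X ≫ dissoc X X' X ≫ D.counit.app X = 𝟙 X)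
  rw [Category.id_comp, D.zigzag]

/-- Transposition of a form. -/
def transpose (D : DualPair X X') {Γ : Aug 𝒞} (ν : Form (Γ ⊗ of X')) : Γ ⟶ of X :=
  (ρ_ Γ).inv ≫ Γ ◁ pt D.unit ≫ elim ν X

theorem transpose_form (D : DualPair X X') {Γ : Aug 𝒞} (f : Γ ⟶ of X) :
    D.transpose (Form.pre D.form (f ▷ of X')) = f := by
  rw [transpose, elim_pre_left, whisker_exchange_assoc, ← rightUnitor_inv_naturality_assoc, zig,
    Category.comp_id]

/-- The left-hand side is the combination of `ν` with the swapped counit, preceded by the unit.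
Commutativity of the combination exchanges the roles of the two forms, and the zigzag identity of
the swapped pair then cancels unit against counit. With `transpose_form` this makes transposition a
bijection. -/
theorem form_transpose (D : DualPair X X') {Γ : Aug 𝒞} (ν : Form (Γ ⊗ of X')) :
    Form.pre D.form (D.transpose ν ▷ of X') = ν := by
  have h1 : D.form = Form.pre D.swap.form (β_ (of X) (of X')).hom := by
    rw [swap_form, ← Form.pre_comp, SymmetricCategory.symmetry, Form.pre_id]
  have h2 : (β_ Γ (of X')).hom ≫ of X' ◁ (ρ_ Γ).inv ≫ of X' ◁ Γ ◁ pt D.unit =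
      (ρ_ (Γ ⊗ of X')).inv ≫ (Γ ⊗ of X') ◁ pt D.unit ≫ shuffle Γ (of X') _ := by
    have h := shuffle_nat (𝟙 Γ) (𝟙 (of X')) (pt D.unit)
    rw [id_tensorHom_id, id_tensorHom, id_tensorHom, id_tensorHom] at h
    rw [h, ← Category.assoc, ← Category.assoc]
    refine congrArg (· ≫ _) ?_
    exact Tree.Str.unique (ob := ![Γ, of X']) (S := .node (.leaf 0) (.leaf 1))
      (T := .node (.leaf 1) (.node (.leaf 0) .nil))
      ((Tree.Str.braid _ _).comp ((Tree.Str.runitInv _).left _))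
      ((Tree.Str.runitInv _).comp (.shuffle _ _ _)) (by decide)
  have h3 : Form.pre D.form (D.transpose ν ▷ of X') =
      Form.pre (R ν D.swap.form) ((ρ_ _).inv ≫ _ ◁ pt D.unit) := by
    rw [h1, ← Form.pre_comp, BraidedCategory.braiding_naturality_left, R, ← Form.pre_comp,
      transpose, whiskerLeft_comp, whiskerLeft_comp, reassoc_of% h2]
    simp only [Category.assoc]
  have h4 := D.swap.zig
  have h5 : (of X' ⊗ Γ) ◁ pt D.swap.unit ≫ shuffle (of X') Γ _ =
      shuffle (of X') Γ (𝟙_ _) ≫ Γ ◁ of X' ◁ pt D.swap.unit := by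
    have h := shuffle_nat (𝟙 (of X')) (𝟙 Γ) (pt D.swap.unit)
    rwa [id_tensorHom_id, id_tensorHom, id_tensorHom, id_tensorHom] at h
  have h6 : (Γ ⊗ of X') ◁ pt D.unit ≫ (β_ Γ (of X')).hom ▷ of (X' ⋎ X) ≫
      (of X' ⊗ Γ) ◁ arr (commDisj X X') = (β_ Γ (of X')).hom ▷ 𝟙_ _ ≫ _ ◁ pt D.swap.unit := by
    rw [whisker_exchange_assoc, ← whiskerLeft_comp]; rfl
  have h7 : (ρ_ (Γ ⊗ of X')).inv ≫ (β_ Γ (of X')).hom ▷ 𝟙_ (Aug 𝒞) ≫ shuffle (of X') Γ (𝟙_ _) =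
      Γ ◁ (ρ_ (of X')).inv :=
    Tree.Str.unique (ob := ![Γ, of X']) (S := .node (.leaf 0) (.leaf 1))
      (T := .node (.leaf 0) (.node (.leaf 1) .nil))
      ((Tree.Str.runitInv _).comp (((Tree.Str.braid _ _).right _).comp (.shuffle _ _ _)))
      ((Tree.Str.runitInv _).left _) (by decide)
  rw [h3, R_comm, R, ← Form.pre_comp, ← Form.pre_comp]
  simp only [Category.assoc]
  rw [reassoc_of% h6, reassoc_of% h5, reassoc_of% h7, ← whiskerLeft_comp, ← whiskerLeft_comp, h4,
    whiskerLeft_id, Form.pre_id]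

theorem form_injective (D : DualPair X X') {Γ : Aug 𝒞} {f g : Γ ⟶ of X}
    (h : Form.pre D.form (f ▷ of X') = Form.pre D.form (g ▷ of X')) : f = g := by
  rw [← D.transpose_form f, h, transpose_form]

/-- Transposition of a form on the other side. -/
def transposeR (D : DualPair X X') {Γ : Aug 𝒞} (ν : Form (of X ⊗ Γ)) : Γ ⟶ of X' :=
  D.swap.transpose (Form.pre ν (β_ Γ (of X)).hom)

theorem form_transposeR (D : DualPair X X') {Γ : Aug 𝒞} (ν : Form (of X ⊗ Γ)) :
    Form.pre D.form (of X ◁ D.transposeR ν) = ν := by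
  have h := D.swap.form_transpose (Form.pre ν (β_ Γ (of X)).hom)
  have h2 := congrArg (fun t => Form.pre t (β_ (of X) Γ).hom) h
  simp only [swap_form, ← Form.pre_comp, SymmetricCategory.symmetry, Form.pre_id] at h2
  rw [BraidedCategory.braiding_naturality_left, SymmetricCategory.symmetry_assoc] at h2
  exact h2

theorem form_injectiveR (D : DualPair X X') {Γ : Aug 𝒞} {f g : Γ ⟶ of X'}
    (h : Form.pre D.form (of X ◁ f) = Form.pre D.form (of X ◁ g)) : f = g := by
  refine D.swap.form_injective ?_
  rw [swap_form, ← Form.pre_comp, ← Form.pre_comp, BraidedCategory.braiding_naturality_left,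
    BraidedCategory.braiding_naturality_left, Form.pre_comp, h, Form.pre_comp]

/-! #### Tensor products of dual pairs -/

/-- The unit of the adjunction between conjunction with `X` and disjunction with `X'`. -/
def adjUnit (D : DualPair X X') (Z : 𝒞) : Z ⟶ X' ⋎ (X ⋏ Z) :=
  D.unit.app Z ≫ commConj Z (X' ⋎ X) ≫ dissocR X' X Z

theorem adjUnit_nat (D : DualPair X X') {Z W : 𝒞} (f : Z ⟶ W) :
    D.adjUnit Z ≫ (𝟙 X' ⋎ₐ (𝟙 X ⋏ₐ f)) = f ≫ D.adjUnit W := by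
  rw [adjUnit, adjUnit, Category.assoc, Category.assoc, dissocR_nat, ProofNetCategory.bin_id,
    commConj_nat'_assoc, D.unit.nat_assoc]

/-- One triangle identity of the adjunction between conjunction with `X` and disjunction with `X'`.
It comes from `dissoc_assocConj` and `zigzag`, the other one from `dissoc_assocDisj` and `zigzag'`.
-/
theorem adjUnit_counit (D : DualPair X X') (Z : 𝒞) :
    of X ◁ arr (D.adjUnit Z) ≫ elim D.form (X ⋏ Z) = 𝟙 _ := by
  refine congrArg Hom.arr (?_ : (𝟙 X ⋏ₐ (D.unit.app Z ≫ commConj Z (X' ⋎ X) ≫ dissocR X' X Z)) ≫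
    dissoc X X' (X ⋏ Z) ≫ D.counit.app (X ⋏ Z) = 𝟙 (X ⋏ Z))
  have h : (dissoc X X' X ⋏ₐ 𝟙 Z) ≫ dissocR (X ⋏ X') X Z =
      assocFrom .conj X (X' ⋎ X) Z ≫ (𝟙 X ⋏ₐ dissocR X' X Z) ≫ dissoc X X' (X ⋏ Z) :=
    ProofNetCategory.dissoc_assocConj X X' X Z
  have h2 : 𝟙 X ⋏ₐ (D.unit.app Z ≫ commConj Z (X' ⋎ X) ≫ dissocR X' X Z) =
      (D.unit.app X ⋏ₐ 𝟙 Z) ≫ assocFrom .conj X (X' ⋎ X) Z ≫ (𝟙 X ⋏ₐ dissocR X' X Z) := by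
    rw [Point.app_whisker_assoc, bin_comp']; simp
  rw [h2]
  simp only [Category.assoc]
  rw [← reassoc_of% h, Form₀.dissocR, bin_comp', bin_comp', D.zigzag]
  simp

theorem counit_adjUnit (D : DualPair X X') (Z : 𝒞) :
    D.adjUnit (X' ⋎ Z) ≫ (𝟙 X' ⋎ₐ (dissoc X X' Z ≫ D.counit.app Z)) = 𝟙 _ := by
  have h : dissocR X' X (X' ⋎ Z) ≫ (𝟙 X' ⋎ₐ dissoc X X' Z) =
      dissoc (X' ⋎ X) X' Z ≫ (dissocR X' X X' ⋎ₐ 𝟙 Z) ≫ assocFrom .disj X' (X ⋏ X') Z := by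
    have := ProofNetCategory.dissoc_assocDisj Z X' X X'
    simpa only [Category.assoc] using this
  have h2 : 𝟙 X' ⋎ₐ (dissoc X X' Z ≫ D.counit.app Z) =
      (𝟙 X' ⋎ₐ dissoc X X' Z) ≫ (𝟙 X' ⋎ₐ D.counit.app Z) := by
    rw [bin_comp', Category.comp_id]
  have h3 : D.unit.app X' ≫ commConj X' (X' ⋎ X) ≫ dissocR X' X X' ≫
      commDisj (X ⋏ X') X' ≫ D.counit.app X' = 𝟙 X' := by
    rw [dissocR_eq]
    simp only [Category.assoc, commConj_commConj'_assoc, commDisj_commDisj'_assoc]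
    exact D.zigzag'
  rw [h2, adjUnit]
  simp only [Category.assoc]
  rw [reassoc_of% h, D.unit.dissoc_assoc, ← Form₀.app_whisker]
  simp only [bin_comp', Category.assoc, h3, Category.comp_id, ProofNetCategory.bin_id]

theorem R_form_pre (D : DualPair X X') (E : DualPair Y Y') {Γ : Aug 𝒞} (h : Γ ⟶ of (X' ⋎ Y')) :
    Form.pre (R D.form E.form) (_ ◁ h) = Form.pre (Form.pre E.form
      (of Y ◁ (of X ◁ h ≫ elim D.form Y'))) (shuffle (of X) (of Y) Γ) := by
  have h2 := shuffle_nat (𝟙 (of X)) (𝟙 (of Y)) h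
  rw [id_tensorHom_id, id_tensorHom, id_tensorHom, id_tensorHom] at h2
  rw [R, ← Form.pre_comp, ← Form.pre_comp, reassoc_of% h2, whiskerLeft_comp]

instance (Γ Δ X : Aug 𝒞) : IsIso (shuffle Γ Δ X) := by unfold shuffle; infer_instance

/-- The adjunction recovers an arrow into `X' ⋎ Y'` from the result of eliminating `X'` against `X`.
That result is an arrow into `Y'`, determined by its pairing with `Y`. -/
theorem R_form_injective (D : DualPair X X') (E : DualPair Y Y') {Z : 𝒞}
    {f g : Z ⟶ X' ⋎ Y'} (h : Form.pre (R D.form E.form) (_ ◁ arr f) =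
      Form.pre (R D.form E.form) (_ ◁ arr g)) : f = g := by
  have key (f : Z ⟶ X' ⋎ Y') : f = D.adjUnit Z ≫
      (𝟙 X' ⋎ₐ ((𝟙 X ⋏ₐ f) ≫ dissoc X X' Y' ≫ D.counit.app Y')) := by
    have h2 : 𝟙 X' ⋎ₐ ((𝟙 X ⋏ₐ f) ≫ dissoc X X' Y' ≫ D.counit.app Y') =
        (𝟙 X' ⋎ₐ (𝟙 X ⋏ₐ f)) ≫ (𝟙 X' ⋎ₐ (dissoc X X' Y' ≫ D.counit.app Y')) := by
      rw [bin_comp', Category.comp_id]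
    rw [h2, reassoc_of% D.adjUnit_nat, counit_adjUnit, Category.comp_id]
  rw [R_form_pre, R_form_pre] at h
  have h2 := congrArg (fun t => Form.pre t (CategoryTheory.inv (shuffle (of X) (of Y) (of Z)))) h
  simp only [← Form.pre_comp, IsIso.inv_hom_id_assoc] at h2
  have h3 := E.form_injectiveR h2
  rw [key f, key g]
  exact congrArg (fun t => D.adjUnit Z ≫ (𝟙 X' ⋎ₐ t)) (arr_injective h3)

/-- The arrow of `𝒞` underlying an arrow between adjoined objects. -/
def _root_.ProofNet.Aug.ofArr {X Y : 𝒞} : (of X ⟶ of Y) → (X ⟶ Y)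
  | .arr f => f

@[simp]
theorem arr_ofArr (f : of X ⟶ of Y) : arr (ofArr f) = f := by
  rcases f with _ | _ | f; rfl

/-- Transposition along the tensor product of two dual pairs. -/
def tensorTranspose (D : DualPair X X') (E : DualPair Y Y') {Z : 𝒞}
    (ν : Form ((of X ⊗ of Y) ⊗ of Z)) : Z ⟶ X' ⋎ Y' :=
  D.adjUnit Z ≫ (𝟙 X' ⋎ₐ ofArr (E.transposeR
    (Form.pre ν ((α_ _ _ _).inv ≫ (β_ (of Y) (of X)).hom ▷ of Z)) : of X ⊗ of Z ⟶ of Y'))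

theorem form_tensorTranspose (D : DualPair X X') (E : DualPair Y Y') {Z : 𝒞}
    (ν : Form ((of X ⊗ of Y) ⊗ of Z)) :
    Form.pre (R D.form E.form) (_ ◁ arr (D.tensorTranspose E ν)) = ν := by
  rw [R_form_pre]
  have h : of X ◁ arr (D.tensorTranspose E ν) ≫ elim D.form Y' = E.transposeR
    (Form.pre ν ((α_ _ _ _).inv ≫ (β_ (of Y) (of X)).hom ▷ of Z)) := by
    rw [tensorTranspose, arr_comp, whiskerLeft_comp, Category.assoc, ← elim_nat,
      reassoc_of% D.adjUnit_counit, arr_ofArr]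
  rw [h, form_transposeR, ← Form.pre_comp, shuffle]
  simp only [Category.assoc, Iso.hom_inv_id_assoc, ← comp_whiskerRight,
    SymmetricCategory.symmetry, id_whiskerRight, Form.pre_id]

/-- De Morgan's law: by transposition, arrows from an object `Z` into either object correspond to
forms on `(of X ⊗ of Y) ⊗ of Z`. -/
def tensorIso (D : DualPair X X') (E : DualPair Y Y') : ∼(X ⋏ Y) ≅ X' ⋎ Y' where
  hom := D.tensorTranspose E (ofNeg (X ⋏ Y)).form
  inv := ofArr ((ofNeg (X ⋏ Y)).transposeR (R D.form E.form))
  hom_inv_id := by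
    refine arr_injective ((ofNeg (X ⋏ Y)).form_injectiveR ?_)
    rw [arr_comp, arr_ofArr, whiskerLeft_comp, Form.pre_comp, form_transposeR]
    exact (D.form_tensorTranspose E (ofNeg (X ⋏ Y)).form).trans
      ((congrArg _ (wl_id _ _)).trans (Form.pre_id _)).symm
  inv_hom_id := by
    refine D.R_form_injective E ?_
    rw [arr_comp, arr_ofArr, whiskerLeft_comp, Form.pre_comp, form_tensorTranspose, arr_id,
      whiskerLeft_id, Form.pre_id]
    exact form_transposeR _ _

/-- Transporting the duality of `X ⋏ Y` and its negation along De Morgan's isomorphism makes a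
separate proof of the zigzag identities unnecessary. -/
def tensor (D : DualPair X X') (E : DualPair Y Y') : DualPair (X ⋏ Y) (X' ⋎ Y') :=
  (ofNeg (X ⋏ Y)).mapIso (Iso.refl _) (D.tensorIso E)

/-- This ties the duality of compound formulae to the rules: the counit is what the rule for
disjunctions makes of the two counits. -/
theorem tensor_form (D : DualPair X X') (E : DualPair Y Y') :
    (D.tensor E).form = R D.form E.form :=
  form_transposeR (ofNeg (X ⋏ Y)) (R D.form E.form : Form (of (X ⋏ Y) ⊗ of (X' ⋎ Y')))

/-- Duals are unique up to isomorphism. -/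
def dualIso (D : DualPair X X') (E : DualPair X Y') : X' ≅ Y' where
  hom := ofArr (E.transposeR D.form)
  inv := ofArr (D.transposeR E.form)
  hom_inv_id := by
    refine arr_injective (D.form_injectiveR ?_)
    rw [arr_comp, arr_ofArr, arr_ofArr, whiskerLeft_comp, Form.pre_comp, form_transposeR,
      form_transposeR, arr_id, whiskerLeft_id, Form.pre_id]
  inv_hom_id := by
    refine arr_injective (E.form_injectiveR ?_)
    rw [arr_comp, arr_ofArr, arr_ofArr, whiskerLeft_comp, Form.pre_comp, form_transposeR,
      form_transposeR, arr_id, whiskerLeft_id, Form.pre_id]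

theorem form_dualIso (D : DualPair X X') (E : DualPair X Y') :
    Form.pre E.form (of X ◁ arr (D.dualIso E).hom) = D.form := by
  simp only [dualIso, arr_ofArr, form_transposeR]

end DualPair

end

section

/-! ### Cut-free derivations -/

open Aug DualPair

/-- Formulae in negation normal form, with a label attached to each literal. -/
inductive NF (P : Type u)
  | lit (p : P) (l : ℕ) (b : Bool)
  | bin (ξ : Conn) (X Y : NF P)

variable {P : Type u} {𝒞 : Type w} [Category.{w} 𝒞] [ProofNetCategory 𝒞] (v : P → 𝒞)

@[reducible]
def NF.obj : NF P → 𝒞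
  | lit p _ true => v p
  | lit p _ false => ∼(v p)
  | bin ξ X Y => ProofNetOps.bin ξ X.obj Y.obj

-- The number in a leaf is a mere tag that keeps the leaves of a sequent distinct, so that coherence
-- applies. It is unrelated to the labels of literals, which record the links.
@[reducible]
def leafOb (a : NF P × ℕ) : Aug 𝒞 := of (a.1.obj v)

/-- Sequents are one-sided, with all formulae on the left: a derivation yields a form on the tensor
product of the leaves, that is, an arrow to the missing unit of the disjunction. Hence conjunction
has a rule with one premise, which leaves the form unchanged because `of X ⊗ of Y` is `of (X ⋏ Y)`
by definition, and disjunction has a rule with two premises. -/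
abbrev Seq (P : Type u) := Tree (NF P × ℕ)

/-- Cut-free derivations of forms. -/
inductive CF : (T : Seq P) → Form (T.ev (leafOb v)) → Prop
  | ax (p : P) (l m n : ℕ) :
      CF (.node (.leaf (.lit p l true, m)) (.leaf (.lit p l false, n))) (ofNeg (v p)).form
  | str {S T : Seq P} {ν s} : CF T ν → Tree.Str (leafOb v) S T s → CF S (Form.pre ν s)
  | conj {Θ : Seq P} {X Y : NF P} {i j : ℕ} (k : ℕ) {ν} :
      CF (.node Θ (.node (.leaf (X, i)) (.leaf (Y, j)))) ν →
      (Tree.node Θ (.leaf (NF.bin .conj X Y, k))).leaves.Nodup →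
      CF (.node Θ (.leaf (NF.bin .conj X Y, k))) ν
  | disj {Γ Δ : Seq P} {X Y : NF P} {i j : ℕ} (k : ℕ) {ν μ} :
      CF (.node Γ (.leaf (X, i))) ν → CF (.node Δ (.leaf (Y, j))) μ →
      (Tree.node (.node Γ Δ) (.leaf (NF.bin .disj X Y, k))).leaves.Nodup →
      CF (.node (.node Γ Δ) (.leaf (NF.bin .disj X Y, k))) (R ν μ)

/-- Forms introduced by a rule whose principal leaf is given. -/
inductive Principal : (Γ : Seq P) → (a : NF P × ℕ) → Form (Γ.ev (leafOb v) ⊗ leafOb v a) → Prop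
  | pos (p : P) (l m n : ℕ) :
      Principal (.leaf (.lit p l false, m)) (.lit p l true, n) (ofNeg (v p)).swap.form
  | neg (p : P) (l m n : ℕ) :
      Principal (.leaf (.lit p l true, m)) (.lit p l false, n) (ofNeg (v p)).form
  | conj {Θ : Seq P} {X Y : NF P} {i j : ℕ} (k : ℕ) {ν} :
      CF v (.node Θ (.node (.leaf (X, i)) (.leaf (Y, j)))) ν →
      Principal Θ (NF.bin .conj X Y, k) ν
  | disj {Γ Δ : Seq P} {X Y : NF P} {i j : ℕ} (k : ℕ) {ν μ} :
      CF v (.node Γ (.leaf (X, i))) ν → CF v (.node Δ (.leaf (Y, j))) μ →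
      Principal (.node Γ Δ) (NF.bin .disj X Y, k) (R ν μ)

variable {v}

theorem CF.nodup {T : Seq P} {ν} (h : CF v T ν) : T.leaves.Nodup := by
  induction h with
  | ax => simp [Tree.leaves]
  | str _ hs ih => exact hs.perm.nodup_iff.2 ih
  | conj _ _ h _ => exact h
  | disj _ _ _ h _ _ => exact h

theorem CF.of_eq {T : Seq P} {ν μ} (h : CF v T ν) (e : ν = μ) : CF v T μ :=
  e ▸ h

theorem CF.braid {S T : Seq P} {ν} (h : CF v (.node S T) ν) :
    CF v (.node T S) (Form.pre ν (β_ _ _).hom) :=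
  h.str (.braid _ _)

theorem Principal.cf {Γ : Seq P} {a : NF P × ℕ} {ν} (h : Principal v Γ a ν)
    (ha : (Tree.node Γ (.leaf a)).leaves.Nodup) : CF v (.node Γ (.leaf a)) ν := by
  cases h with
  | pos p l m n => exact (CF.ax p l n m).str (.braid _ _)
  | neg p l m n => exact CF.ax p l m n
  | conj k h => exact h.conj k ha
  | disj k h₁ h₂ => exact h₁.disj k h₂ ha

theorem Principal.rename {Γ : Seq P} {a : NF P × ℕ} {ν} (h : Principal v Γ a ν) (m : ℕ) :
    Principal v Γ (a.1, m) ν := by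
  cases h with
  | pos p l _ _ => exact .pos p l _ m
  | neg p l _ _ => exact .neg p l _ m
  | conj k h => exact .conj m h
  | disj k h₁ h₂ => exact .disj m h₁ h₂

variable (v) in
/-- A tree can be substituted for a principal leaf. -/
def PrincipalSubst (a : NF P × ℕ) (s : Σ S : Seq P, (S.ev (leafOb v) ⟶ leafOb v a)) : Prop :=
  ∀ (Γ : Seq P) (ν), Principal v Γ a ν → (Tree.node Γ s.1).leaves.Nodup →
    CF v (.node Γ s.1) (Form.pre ν (Γ.ev (leafOb v) ◁ s.2))

variable (v) in
/-- The renaming of a leaf. -/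
@[reducible]
def renameLeaf (a : NF P × ℕ) (m : ℕ) : Σ S : Seq P, (S.ev (leafOb v) ⟶ leafOb v a) :=
  ⟨.leaf (a.1, m), 𝟙 _⟩

theorem PrincipalSubst.rename (a : NF P × ℕ) (m : ℕ) : PrincipalSubst v a (renameLeaf v a m) := by
  intro Γ ν h hn
  have e : Form.pre ν (Γ.ev (leafOb v) ◁ (renameLeaf v a m).2) = ν := by
    change Form.pre ν (Γ.ev (leafOb v) ◁ 𝟙 _) = ν
    rw [whiskerLeft_id, Form.pre_id]
  rw [e]
  exact (h.rename m).cf hn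

variable (v) in
/-- Substitutions that rename all leaves but `L`. -/
structure LeafSubst (L : NF P × ℕ)
    (σ : ∀ a, Σ S : Seq P, (S.ev (leafOb v) ⟶ leafOb v a)) : Prop where
  rename {a} : a ≠ L → ∃ m, σ a = renameLeaf v a m
  principal : PrincipalSubst v L (σ L)

namespace LeafSubst

variable {L : NF P × ℕ} {σ : ∀ a, Σ S : Seq P, (S.ev (leafOb v) ⟶ leafOb v a)}

theorem principalSubst (h : LeafSubst v L σ) (a) : PrincipalSubst v a (σ a) := by
  by_cases ha : a = L
  · rw [ha]; exact h.principal
  · obtain ⟨m, hm⟩ := h.rename ha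
    rw [hm]; exact .rename _ _

open Classical in
theorem update (h : LeafSubst v L σ) (a : NF P × ℕ) (m : ℕ) :
    LeafSubst v L (Function.update σ a (renameLeaf v a m)) := by
  constructor
  · intro b hb
    by_cases hba : b = a
    · subst hba; exact ⟨m, Function.update_self ..⟩
    · rw [Function.update_of_ne hba]; exact h.rename hb
  · by_cases ha : L = a
    · subst ha; rw [Function.update_self]; exact .rename _ _
    · rw [Function.update_of_ne ha]; exact h.principal

end LeafSubst

/-- The bound supplies fresh tags. -/
theorem Seq.exists_bound (T : Seq P) : ∃ N, ∀ a ∈ T.leaves, a.2 < N := by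
  obtain ⟨N, hN⟩ := (T.leaves.map Prod.snd).toFinset.exists_nat_subset_range
  exact ⟨N, fun a ha => Finset.mem_range.1 (hN (by simpa using ⟨_, ha⟩))⟩

-- Substitution travels up the derivation to the rule that introduces `L`, where `PrincipalSubst`
-- applies to the substituted premises. All other leaves are merely renamed. Structural arrows are
-- passed by their naturality, `Tree.Str.sub`.
open Classical in
theorem CF.subst {L : NF P × ℕ} {T : Seq P} {ν} (h : CF v T ν)
    {σ : ∀ a, Σ S : Seq P, (S.ev (leafOb v) ⟶ leafOb v a)} (hσ : LeafSubst v L σ)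
    (hn : (Tree.sub σ T).1.leaves.Nodup) :
    CF v (Tree.sub σ T).1 (Form.pre ν (Tree.sub σ T).2) := by
  have pre_tensor {A A' B B' : Aug 𝒞} (ν : Form (A' ⊗ B')) (f : A ⟶ A') (g : B ⟶ B') :
      Form.pre ν (f ⊗ₘ g) = Form.pre (Form.pre ν (f ▷ B')) (A ◁ g) := by
    rw [← Form.pre_comp, MonoidalCategory.tensorHom_def']
  induction h generalizing σ with
  | ax p l m n =>
    simp only [Tree.sub] at hn ⊢
    -- At most one of the two literals is `L`. The other one is only renamed, and the axiom is read
    -- as introducing the literal that may be `L`.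
    by_cases hb : (NF.lit p l false, n) = L
    · obtain ⟨m', hm⟩ := hσ.rename (a := (NF.lit p l true, m)) (by rintro rfl; simp at hb)
      have h := hσ.principalSubst (NF.lit p l false, n)
      revert hn h hm
      generalize σ (NF.lit p l true, m) = s
      generalize σ (NF.lit p l false, n) = t
      rintro hn rfl h
      have h2 := h _ _ (.neg p l m' n) hn
      have e : (renameLeaf v (NF.lit p l true, m) m').2 ⊗ₘ t.2 = _ ◁ t.2 :=
        MonoidalCategory.id_tensorHom _ _
      rw [e]
      exact h2
    · obtain ⟨n', hm⟩ := hσ.rename hb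
      have h := hσ.principalSubst (NF.lit p l true, m)
      revert hn h hm
      generalize σ (NF.lit p l true, m) = s
      generalize σ (NF.lit p l false, n) = t
      rintro hn rfl h
      have h2 := (h _ _ (.pos p l n' m) (by
        simp only [Tree.leaves] at hn ⊢
        exact List.perm_append_comm.nodup_iff.1 hn)).braid
      have e : s.2 ⊗ₘ (renameLeaf v (NF.lit p l false, n) n').2 = s.2 ▷ _ :=
        MonoidalCategory.tensorHom_id _ _
      rw [e]
      rw [DualPair.swap_form, ← Form.pre_comp, ← Form.pre_comp] at h2
      refine h2.of_eq (congrArg (Form.pre _) ?_)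
      rw [Category.assoc, BraidedCategory.braiding_naturality_right,
        SymmetricCategory.symmetry_assoc]
  | @str S T ν s h hs ih =>
    obtain ⟨s', hs', e⟩ := hs.sub σ
    rw [← Form.pre_comp, ← e, Form.pre_comp]
    exact (ih hσ (hs'.perm.nodup_iff.1 hn)).str hs'
  | @conj Θ X Y i j k ν h hk ih =>
    obtain ⟨N, hN⟩ := Seq.exists_bound (Tree.sub σ Θ).1
    -- The components of the conjunction receive the fresh tags `N` and `N + 1`, which keeps them
    -- apart from the substituted context. Overriding `σ` also protects a component that happens to
    -- coincide with `L` as a leaf.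
    set σ' := Function.update (Function.update σ (X, i) (renameLeaf v _ N)) (Y, j)
      (renameLeaf v _ (N + 1)) with hσ'
    have hXY : (X, i) ≠ (Y, j) ∧ ∀ a ∈ Θ.leaves, a ≠ (X, i) ∧ a ≠ (Y, j) := by
      have := h.nodup
      simp only [Tree.leaves, List.nodup_append', List.cons_append, List.nil_append,
        List.nodup_cons, List.mem_singleton, List.disjoint_cons_right] at this
      exact ⟨this.2.1.1, fun a ha => ⟨fun e => this.2.2.1 (e ▸ ha), fun e => this.2.2.2.1 (e ▸ ha)⟩⟩
    have hΘ : Tree.sub σ' Θ = Tree.sub σ Θ := Tree.sub_congr fun a ha => by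
      rw [hσ', Function.update_of_ne (hXY.2 a ha).2, Function.update_of_ne (hXY.2 a ha).1]
    have hX : σ' (X, i) = renameLeaf v _ N := by
      rw [hσ', Function.update_of_ne hXY.1, Function.update_self]
    have hY : σ' (Y, j) = renameLeaf v _ (N + 1) := by
      rw [hσ', Function.update_self]
    have h2 := ih ((hσ.update (X, i) N).update (Y, j) (N + 1))
    rw [← hσ'] at h2
    simp only [Tree.sub] at h2
    rw [hΘ, hX, hY] at h2
    simp only [Tree.sub] at hn ⊢
    have hp := hσ.principalSubst (NF.bin .conj X Y, k)
    rw [pre_tensor]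
    refine hp _ _ (Principal.conj (i := N) (j := N + 1) k ?_) hn
    refine (h2 ?_).of_eq (congrArg (Form.pre _) ?_)
    rotate_left
    · rw [MonoidalCategory.id_tensorHom_id, MonoidalCategory.tensorHom_id]
    · simp only [Tree.leaves, List.nodup_append', List.cons_append, List.nil_append] at hn ⊢
      refine ⟨hn.1, by simp, ?_⟩
      rw [List.disjoint_right]
      simp only [List.mem_cons, List.not_mem_nil, or_false]
      rintro a (rfl | rfl) ha
      · exact absurd (hN _ ha) (by simp)
      · exact absurd (hN _ ha) (by simp)
  | @disj Γ Δ X Y i j k ν μ h₁ h₂ hk ih₁ ih₂ =>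
    -- Both premises are handled alike: substitute in the context and give the active formula a
    -- fresh tag.
    have hone : ∀ (Γ : Seq P) (X : NF P) (i : ℕ)
        (ν : Form ((Tree.node Γ (.leaf (X, i))).ev (leafOb v))),
        (Tree.node Γ (.leaf (X, i))).leaves.Nodup → (Tree.sub σ Γ).1.leaves.Nodup →
        (∀ {σ}, LeafSubst v L σ → (Tree.sub σ (.node Γ (.leaf (X, i)))).1.leaves.Nodup →
          CF v (Tree.sub σ (.node Γ (.leaf (X, i)))).1
            (Form.pre ν (Tree.sub σ (.node Γ (.leaf (X, i)))).2)) →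
        ∃ N, CF v (.node (Tree.sub σ Γ).1 (.leaf (X, N))) (Form.pre ν ((Tree.sub σ Γ).2 ▷ _)) := by
      intro Γ X i ν hd hn ih
      obtain ⟨N, hN⟩ := Seq.exists_bound (Tree.sub σ Γ).1
      refine ⟨N, ?_⟩
      set σ' := Function.update σ (X, i) (renameLeaf v _ N) with hσ'
      have hX' : ∀ a ∈ Γ.leaves, a ≠ (X, i) := by
        simp only [Tree.leaves, List.nodup_append', List.disjoint_cons_right] at hd
        exact fun a ha e => hd.2.2.1 (e ▸ ha)
      have hΓ : Tree.sub σ' Γ = Tree.sub σ Γ := Tree.sub_congr fun a ha => by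
        rw [hσ', Function.update_of_ne (hX' a ha)]
      have hX : σ' (X, i) = renameLeaf v _ N := by
        rw [hσ', Function.update_self]
      have h2 := ih (hσ.update (X, i) N)
      rw [← hσ'] at h2
      simp only [Tree.sub] at h2
      rw [hΓ, hX] at h2
      refine (h2 ?_).of_eq (congrArg (Form.pre _) ?_)
      rotate_left
      · rw [MonoidalCategory.tensorHom_id]
      · simp only [Tree.leaves, List.nodup_append'] at hn ⊢
        refine ⟨hn, by simp, ?_⟩
        rw [List.disjoint_right]
        simp only [List.mem_cons, List.not_mem_nil, or_false]
        rintro a rfl ha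
        exact absurd (hN _ ha) (by simp)
    simp only [Tree.sub] at hn ⊢
    have hn' := hn
    simp only [Tree.leaves, List.nodup_append'] at hn'
    obtain ⟨N, c₁⟩ := hone Γ X i ν h₁.nodup hn'.1.1 ih₁
    obtain ⟨M, c₂⟩ := hone Δ Y j μ h₂.nodup hn'.1.2.1 ih₂
    have hp := hσ.principalSubst (NF.bin .disj X Y, k) _ _ (Principal.disj k c₁ c₂) hn
    rw [R_pre_left, ← Form.pre_comp, ← MonoidalCategory.tensorHom_def'] at hp
    exact hp

end

/-! ### Substitution of trees for leaves -/

section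

open Aug DualPair

variable {P : Type u} {𝒞 : Type w} [Category.{w} 𝒞] [ProofNetCategory 𝒞] (v : P → 𝒞)

/-- A tree can be substituted for a leaf. -/
def Subst (X : NF P) (T : Seq P) (h : T.ev (leafOb v) ⟶ of (X.obj v)) : Prop :=
  ∀ (n : ℕ) (Γ : Seq P) (ν), CF v (.node Γ (.leaf (X, n))) ν → (Tree.node Γ T).leaves.Nodup →
    CF v (.node Γ T) (Form.pre ν (Γ.ev (leafOb v) ◁ h))

variable {v}

attribute [local simp] Tree.leaves List.nodup_append'

-- It is enough to treat derivations whose last rule introduces the leaf: `CF.subst` is applied to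
-- the substitution that fixes all other leaves.
open Classical in
theorem Subst.of_principal {X : NF P} {T : Seq P} {h : T.ev (leafOb v) ⟶ of (X.obj v)}
    (hp : ∀ n, PrincipalSubst v (X, n) ⟨T, h⟩) : Subst v X T h := by
  intro n Γ ν hν hn
  set L : NF P × ℕ := (X, n)
  let σ₀ : ∀ a, Σ S : Seq P, (S.ev (leafOb v) ⟶ leafOb v a) := fun a => ⟨.leaf a, 𝟙 _⟩
  set σ := Function.update σ₀ L ⟨T, h⟩ with hσ
  have hL : LeafSubst v L σ := by
    constructor
    · intro a ha
      exact ⟨a.2, by rw [hσ, Function.update_of_ne ha]⟩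
    · rw [hσ, Function.update_self]; exact hp n
  have hΓ : Tree.sub σ Γ = ⟨Γ, 𝟙 _⟩ := by
    have h0 := hν.nodup
    simp only [Tree.leaves, List.nodup_append', List.disjoint_cons_right] at h0
    refine (Tree.sub_congr (τ := σ₀) fun a ha => ?_).trans (Tree.sub_id _)
    rw [hσ, Function.update_of_ne]
    rintro rfl
    exact h0.2.2.1 ha
  have h2 := hν.subst hL
  simp only [Tree.sub] at h2
  have hσL : σ L = ⟨T, h⟩ := by rw [hσ, Function.update_self]
  rw [hΓ, hσL] at h2
  rw [← MonoidalCategory.id_tensorHom]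
  exact h2 hn

theorem Subst.rename (X : NF P) (m : ℕ) : Subst v X (.leaf (X, m)) (𝟙 _) :=
  .of_principal fun n => .rename (X, n) m

theorem Subst.comp {X Y : NF P} {T : Seq P} {h : T.ev (leafOb v) ⟶ of (X.obj v)}
    {g : of (X.obj v) ⟶ of (Y.obj v)} (H : Subst v X T h)
    (K : ∀ m, Subst v Y (.leaf (X, m)) g) : Subst v Y T (h ≫ g) := by
  intro n Γ ν hν hn
  obtain ⟨N, hN⟩ := Seq.exists_bound Γ
  have h2 := K N n Γ ν hν (by
    simp at hN hn ⊢; grind [List.disjoint_comm])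
  refine (H N Γ _ h2 hn).of_eq ?_
  rw [← Form.pre_comp, ← MonoidalCategory.whiskerLeft_comp]

theorem Subst.right {Y : NF P} {T : Seq P} {h : T.ev (leafOb v) ⟶ of (Y.obj v)}
    (H : Subst v Y T h) {n : ℕ} {Γ S : Seq P} {ν}
    (hν : CF v (.node Γ (.node S (.leaf (Y, n)))) ν) (hn : (Tree.node Γ (.node S T)).leaves.Nodup) :
    CF v (.node Γ (.node S T)) (Form.pre ν (Γ.ev _ ◁ S.ev _ ◁ h)) := by
  have h2 := (H n (.node Γ S) _ (hν.str (.assoc _ _ _)) (by simpa using hn)).str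
    (.assocInv _ _ _)
  refine h2.of_eq ?_
  rw [← Form.pre_comp, ← Form.pre_comp]
  congr 1
  simp

theorem Subst.left {X : NF P} {T : Seq P} {h : T.ev (leafOb v) ⟶ of (X.obj v)}
    (H : Subst v X T h) {n : ℕ} {Γ S : Seq P} {ν}
    (hν : CF v (.node Γ (.node (.leaf (X, n)) S)) ν) (hn : (Tree.node Γ (.node T S)).leaves.Nodup) :
    CF v (.node Γ (.node T S)) (Form.pre ν (Γ.ev _ ◁ h ▷ S.ev _)) := by
  have h2 := (H.right (hν.str ((Tree.Str.braid _ _).left _)) (by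
    simp at hn ⊢; grind [List.disjoint_comm])).str ((Tree.Str.braid _ _).left _)
  refine h2.of_eq ?_
  rw [← Form.pre_comp, ← Form.pre_comp, ← MonoidalCategory.whiskerLeft_comp,
    ← MonoidalCategory.whiskerLeft_comp, Category.assoc,
    BraidedCategory.braiding_naturality_right, SymmetricCategory.symmetry_assoc]

theorem Subst.both {X Y : NF P} {T T' : Seq P} {h : T.ev (leafOb v) ⟶ of (X.obj v)}
    {h' : T'.ev (leafOb v) ⟶ of (Y.obj v)} (H : Subst v X T h) (H' : Subst v Y T' h')
    {n n' : ℕ} {Γ : Seq P} {ν}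
    (hν : CF v (.node Γ (.node (.leaf (X, n)) (.leaf (Y, n')))) ν)
    (hn : (Tree.node Γ (.node T T')).leaves.Nodup) :
    CF v (.node Γ (.node T T')) (Form.pre ν (Γ.ev _ ◁ (h ⊗ₘ h'))) := by
  obtain ⟨N, hN⟩ := Seq.exists_bound (.node (.leaf (X, n)) (.node Γ (.node T T')))
  -- The second leaf first gets a fresh tag, since `T` may contain the leaf `(Y, n')` itself.
  have c₁ := (Subst.rename Y N).right hν (by
    have := hν.nodup
    simp at this hN ⊢
    grind [List.disjoint_comm])
  have c₂ := H.left c₁ (by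
    simp at hN hn ⊢
    grind [List.disjoint_comm])
  have c₃ := H'.right c₂ hn
  refine c₃.of_eq ?_
  rw [← Form.pre_comp, ← Form.pre_comp, MonoidalCategory.tensorHom_def']
  simp

/-- The rule for conjunctions is invertible. -/
theorem Subst.split (X Y : NF P) (i j : ℕ) :
    Subst v (.bin .conj X Y) (.node (.leaf (X, i)) (.leaf (Y, j))) (𝟙 _) := by
  refine .of_principal fun n Γ ν h hn => ?_
  cases h with
  | conj k h =>
    refine ((Subst.rename X i).both (Subst.rename Y j) h hn).of_eq ?_
    rw [MonoidalCategory.id_tensorHom_id]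

end

/-! ### Arrows that preserve derivability -/

section

open Aug DualPair

variable {P : Type u} {𝒞 : Type w} [Category.{w} 𝒞] [ProofNetCategory 𝒞] {v : P → 𝒞}

attribute [local simp] Tree.leaves List.nodup_append'

theorem Aug.arr_tensor {A B C D : 𝒞} (f : A ⟶ B) (g : C ⟶ D) :
    arr f ⊗ₘ arr g = arr (f ⋏ₐ g) := by
  refine congrArg Hom.arr (?_ : (f ⋏ₐ 𝟙 C) ≫ (𝟙 B ⋏ₐ g) = f ⋏ₐ g)
  rw [bin_comp', Category.comp_id, Category.id_comp]

theorem Aug.cancel_unshuffle {Γ Δ W V : Aug 𝒞} (X : Aug 𝒞) (g : (Γ ⊗ Δ) ⊗ X ⊗ W ⟶ V) :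
    ((α_ Γ Δ (X ⊗ W)).hom ≫ Γ ◁ ((α_ Δ X W).inv ≫ (β_ Δ X).hom ▷ W) ≫ (α_ _ _ _).inv ≫
      (α_ _ _ _).inv ▷ W) ≫ (α_ _ _ _).hom ▷ W ≫ (α_ _ _ _).hom ≫ Γ ◁ shuffle X Δ W ≫
        (α_ _ _ _).inv ≫ g = g := by
  simp only [shuffle, MonoidalCategory.whiskerLeft_comp, Category.assoc,
    MonoidalCategory.inv_hom_whiskerRight_assoc, Iso.inv_hom_id_assoc]
  rw [← MonoidalCategory.whiskerLeft_comp_assoc Γ ((β_ Δ X).hom ▷ W),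
    ← MonoidalCategory.comp_whiskerRight, SymmetricCategory.symmetry]
  simp

theorem Aug.shuffle_left_comp (Γ Δ : Aug 𝒞) {W W' V : Aug 𝒞} (g : W ⟶ W') (F : Γ ⊗ W' ⟶ V) :
    shuffle Γ Δ W ≫ Δ ◁ (Γ ◁ g ≫ F) = (Γ ⊗ Δ) ◁ g ≫ shuffle Γ Δ W' ≫ Δ ◁ F := by
  have h := shuffle_nat (𝟙 Γ) (𝟙 Δ) g
  rw [MonoidalCategory.id_tensorHom_id, MonoidalCategory.id_tensorHom, MonoidalCategory.id_tensorHom,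
    MonoidalCategory.id_tensorHom] at h
  rw [reassoc_of% h, MonoidalCategory.whiskerLeft_comp]

theorem Aug.unshuffle_elim {Γ Δ E W W' V : Aug 𝒞} (e : E ≅ Γ ⊗ Δ) (g : W ⟶ W') (F : Γ ⊗ W' ⟶ V) :
    (((α_ Δ Γ W).inv ≫ ((β_ Δ Γ).hom ≫ e.inv) ▷ W) ≫ e.hom ▷ W ≫ (Γ ⊗ Δ) ◁ g) ≫
      shuffle Γ Δ W' ≫ Δ ◁ F = Δ ◁ (Γ ◁ g ≫ F) := by
  simp only [Category.assoc]
  rw [← shuffle_left_comp, shuffle, MonoidalCategory.comp_whiskerRight_assoc,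
    MonoidalCategory.inv_hom_whiskerRight_assoc, Category.assoc,
    ← MonoidalCategory.comp_whiskerRight_assoc, SymmetricCategory.symmetry,
    MonoidalCategory.id_whiskerRight, Category.id_comp, Iso.inv_hom_id_assoc]

variable (v) in
/-- Arrows that act on the cut-free derivations. -/
def Admissible (X Y : NF P) (f : X.obj v ⟶ Y.obj v) : Prop :=
  ∀ m, Subst v Y (.leaf (X, m)) (arr f)

namespace Admissible

variable {X Y Z X' Y' : NF P}

theorem id (X : NF P) : Admissible v X X (𝟙 _) :=
  fun m => Subst.rename X m

theorem comp {f : X.obj v ⟶ Y.obj v} {g : Y.obj v ⟶ Z.obj v} (hf : Admissible v X Y f)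
    (hg : Admissible v Y Z g) : Admissible v X Z (f ≫ g) :=
  fun m => (hf m).comp (g := arr g) hg

/-- By invertibility the conjunction is split; `f` and `g` act on its components, and the rule is
applied again. -/
theorem conj {f : X.obj v ⟶ X'.obj v} {g : Y.obj v ⟶ Y'.obj v} (hf : Admissible v X X' f)
    (hg : Admissible v Y Y' g) : Admissible v (.bin .conj X Y) (.bin .conj X' Y') (f ⋏ₐ g) := by
  intro m n Γ ν h hn
  obtain ⟨N, hN⟩ := Seq.exists_bound Γ
  have c₁ := Subst.split X' Y' N (N + 1) n Γ ν h (by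
    simp at hN hn ⊢; grind [List.disjoint_comm])
  have c₂ := (hf N).both (hg (N + 1)) c₁ (by
    simp at hN hn ⊢; grind [List.disjoint_comm])
  refine (CF.conj m c₂ hn).of_eq ?_
  rw [MonoidalCategory.whiskerLeft_id, Form.pre_id, arr_tensor]

/-- At the rule that introduces the disjunction, `f` acts on one premise and `g` on the other;
naturality of `R` shows that this is the action of `f ⋎ₐ g`. -/
theorem disj {f : X.obj v ⟶ X'.obj v} {g : Y.obj v ⟶ Y'.obj v} (hf : Admissible v X X' f)
    (hg : Admissible v Y Y' g) : Admissible v (.bin .disj X Y) (.bin .disj X' Y') (f ⋎ₐ g) := by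
  intro m
  refine .of_principal fun n Θ ν h hn => ?_
  cases h with
  | @disj Γ Δ _ _ i j _ ν μ h₁ h₂ =>
    obtain ⟨N, hN⟩ := Seq.exists_bound (.node Γ Δ)
    have c₁ := hf N _ _ _ h₁ (by
      simp at hN hn ⊢; grind [List.disjoint_comm])
    have c₂ := hg N _ _ _ h₂ (by
      simp at hN hn ⊢; grind [List.disjoint_comm])
    exact (CF.disj m c₁ c₂ hn).of_eq (R_pre_right ..)

theorem commConj (X Y : NF P) : Admissible v (.bin .conj X Y) (.bin .conj Y X)
    (ProofNetOps.commConj (X.obj v) (Y.obj v)) := by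
  intro m n Γ ν h hn
  obtain ⟨N, hN⟩ := Seq.exists_bound Γ
  have c₁ := Subst.split Y X N (N + 1) n Γ ν h (by
    simp at hN hn ⊢; grind [List.disjoint_comm])
  refine (CF.conj m (c₁.str ((Tree.Str.braid _ _).left Γ)) hn).of_eq ?_
  rw [MonoidalCategory.whiskerLeft_id, Form.pre_id]
  rfl

theorem commDisj (X Y : NF P) : Admissible v (.bin .disj Y X) (.bin .disj X Y)
    (ProofNetOps.commDisj (X.obj v) (Y.obj v)) := by
  intro m
  refine .of_principal fun n Θ ν h hn => ?_
  cases h with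
  | @disj Γ Δ _ _ i j _ ν μ h₁ h₂ =>
    have c := CF.disj m h₂ h₁ (by
      simp at hn ⊢; grind [List.disjoint_comm])
    refine (c.str ((Tree.Str.braid _ _).right _)).of_eq ?_
    rw [R_comm ν μ, ← Form.pre_comp, MonoidalCategory.whisker_exchange_assoc,
      ← MonoidalCategory.whiskerLeft_comp, ← arr_comp, commDisj_commDisj', arr_id,
      MonoidalCategory.whiskerLeft_id, Category.comp_id]

theorem assocToConj (X Y Z : NF P) : Admissible v (.bin .conj X (.bin .conj Y Z))
    (.bin .conj (.bin .conj X Y) Z) (assocTo .conj (X.obj v) (Y.obj v) (Z.obj v)) := by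
  intro m n Γ ν h hn
  obtain ⟨N, hN⟩ := Seq.exists_bound Γ
  have c₁ := Subst.split _ Z N (N + 1) n Γ ν h (by
    simp at hN hn ⊢; grind [List.disjoint_comm])
  have c₂ := (Subst.split X Y (N + 2) (N + 3)).left c₁ (by
    simp at hN hn ⊢; grind [List.disjoint_comm])
  have c₃ := CF.conj (N + 4) (c₂.str ((Tree.Str.assoc _ _ _).comp
    ((Tree.Str.assocInv (.leaf (X, N + 2)) (.leaf (Y, N + 3)) (.leaf (Z, N + 1))).left Γ))) (by
    simp at hN hn ⊢; grind [List.disjoint_comm])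
  refine (CF.conj m (c₃.str (.assocInv _ _ _)) hn).of_eq ?_
  simp only [MonoidalCategory.whiskerLeft_id, MonoidalCategory.id_whiskerRight, Form.pre_id,
    ← Form.pre_comp]
  exact congrArg (Form.pre ν) (Iso.inv_hom_id_assoc (α_ (Γ.ev (leafOb v)) (of (X.obj v))
    (of (Y.obj v) ⊗ of (Z.obj v))) (_ ◁ (α_ (of (X.obj v)) (of (Y.obj v)) (of (Z.obj v))).inv))

theorem assocFromConj (X Y Z : NF P) : Admissible v (.bin .conj (.bin .conj X Y) Z)
    (.bin .conj X (.bin .conj Y Z)) (assocFrom .conj (X.obj v) (Y.obj v) (Z.obj v)) := by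
  intro m n Γ ν h hn
  obtain ⟨N, hN⟩ := Seq.exists_bound Γ
  have c₁ := Subst.split X _ N (N + 1) n Γ ν h (by
    simp at hN hn ⊢; grind [List.disjoint_comm])
  have c₂ := (Subst.split Y Z (N + 2) (N + 3)).right c₁ (by
    simp at hN hn ⊢; grind [List.disjoint_comm])
  have c₃ := CF.conj (N + 4) (c₂.str ((Tree.Str.assoc _ (.leaf (Z, N + 3)) _).comp
    (((Tree.Str.braid _ _).left Γ).comp
      ((Tree.Str.assoc (.leaf (X, N)) (.leaf (Y, N + 2)) (.leaf (Z, N + 3))).left Γ)))) (by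
    simp at hN hn ⊢; grind [List.disjoint_comm])
  refine (CF.conj m (c₃.str (((Tree.Str.braid _ _).left Γ).comp (.assocInv _ _ _))) hn).of_eq ?_
  simp only [MonoidalCategory.whiskerLeft_id, Form.pre_id, ← Form.pre_comp]
  refine congrArg (Form.pre ν) ?_
  change ((_ ◁ (β_ (of (X.obj v) ⊗ of (Y.obj v)) (of (Z.obj v))).hom) ≫ (α_ _ _ _).inv) ≫
    (α_ _ _ _).hom ≫ (_ ◁ (β_ (of (Z.obj v)) (of (X.obj v) ⊗ of (Y.obj v))).hom) ≫
      _ ◁ (α_ (of (X.obj v)) (of (Y.obj v)) (of (Z.obj v))).hom =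
    _ ◁ (α_ (of (X.obj v)) (of (Y.obj v)) (of (Z.obj v))).hom
  rw [Category.assoc, Iso.inv_hom_id_assoc, ← MonoidalCategory.whiskerLeft_comp_assoc,
    SymmetricCategory.symmetry, MonoidalCategory.whiskerLeft_id, Category.id_comp]

/-- The rule that introduces `(X ⋏ Y) ⋎ Z` has a premise containing `X ⋏ Y`. Split this conjunction,
keep `X` in the context, apply the rule for disjunctions to `Y` and `Z`, and join `X` to the result.
By `R_conj` the form so obtained is the required one. -/
theorem dissoc (X Y Z : NF P) : Admissible v (.bin .conj X (.bin .disj Y Z))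
    (.bin .disj (.bin .conj X Y) Z) (ProofNetOps.dissoc (X.obj v) (Y.obj v) (Z.obj v)) := by
  intro m
  refine .of_principal fun n Θ ν h hn => ?_
  cases h with
  | @disj Γ Δ _ _ i j _ ν μ h₁ h₂ =>
    obtain ⟨N, hN⟩ := Seq.exists_bound (.node Γ Δ)
    have c₁ := Subst.split X Y N (N + 1) _ Γ ν h₁ (by
      simp at hN hn ⊢; grind [List.disjoint_comm])
    rw [MonoidalCategory.whiskerLeft_id, Form.pre_id] at c₁
    have c₂ := (CF.disj (N + 2) (c₁.str (.assoc _ _ _)) h₂ (by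
      simp at hN hn ⊢; grind [List.disjoint_comm])).of_eq (R_conj ν μ)
    have c₃ := CF.conj m (c₂.str ((Tree.Str.assoc _ _ _).comp ((((Tree.Str.assocInv _ _ _).comp
      ((Tree.Str.braid _ _).right _)).left Γ).comp ((Tree.Str.assocInv _ _ _).comp
        ((Tree.Str.assocInv _ _ _).right _))))) hn
    refine c₃.of_eq ?_
    rw [← Form.pre_comp]
    exact congrArg (Form.pre _) (cancel_unshuffle (of (X.obj v)) _)

/-- Disjunctions associate to the right. -/
theorem assocFromDisj (X Y Z : NF P) : Admissible v (.bin .disj (.bin .disj X Y) Z)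
    (.bin .disj X (.bin .disj Y Z)) (assocFrom .disj (X.obj v) (Y.obj v) (Z.obj v)) := by
  intro m
  -- The premise with `Y ⋎ Z` need not end with the rule that introduces this disjunction. Hence the
  -- premise `h₁` for `X` is carried, as part of a substitution, to the place where `Y ⋎ Z` is
  -- introduced; there `X` is joined with `Y` and then with `Z`.
  have key (Γ : Seq P) (i ν) (h₁ : CF v (.node Γ (.leaf (X, i))) ν) :
      Subst v (.bin .disj Y Z) (.node Γ (.leaf (.bin .disj (.bin .disj X Y) Z, m)))
        (Γ.ev _ ◁ arr (assocFrom .disj (X.obj v) (Y.obj v) (Z.obj v)) ≫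
          elim ν (Y.obj v ⋎ Z.obj v)) := by
    refine .of_principal fun n Θ ν₀ h hn => ?_
    cases h with
    | @disj Δ Ξ _ _ j k _ κ μ h₂ h₃ =>
      obtain ⟨N, hN⟩ := Seq.exists_bound (.node Γ (.node Δ Ξ))
      have c := (CF.disj m (CF.disj N h₁ h₂ (by
        simp at hN hn ⊢; grind [List.disjoint_comm])) h₃ (by
        simp at hN hn ⊢; grind [List.disjoint_comm])).of_eq (R_assoc ν κ μ)
      refine (c.str ((Tree.Str.assocInv _ _ _).comp (((Tree.Str.braid _ _).comp
        (.assocInv _ _ _)).right _))).of_eq ?_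
      rw [R, ← Form.pre_comp, ← Form.pre_comp]
      exact congrArg (Form.pre _) (unshuffle_elim
        (α_ (Γ.ev (leafOb v)) (Δ.ev (leafOb v)) (Ξ.ev (leafOb v)))
        (arr (assocFrom .disj (X.obj v) (Y.obj v) (Z.obj v))) (elim ν (Y.obj v ⋎ Z.obj v)))
  refine .of_principal fun n Θ ν h hn => ?_
  cases h with
  | @disj Γ Δ _ _ i j _ ν μ h₁ h₂ =>
    have c := key Γ i ν h₁ j Δ μ h₂ (by
      simp at hn ⊢; grind [List.disjoint_comm])
    refine (c.str (.shuffle _ _ _)).of_eq ?_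
    rw [R, ← Form.pre_comp, ← Form.pre_comp]
    exact congrArg (Form.pre _) (shuffle_left_comp _ _ (arr (assocFrom .disj _ _ _)) (elim ν _))

theorem assocToDisj (X Y Z : NF P) : Admissible v (.bin .disj X (.bin .disj Y Z))
    (.bin .disj (.bin .disj X Y) Z) (assocTo .disj (X.obj v) (Y.obj v) (Z.obj v)) := by
  -- By the hexagons, the opposite associativity is a composite of commutations and instances of
  -- `assocFrom`, for which admissibility is already known.
  have e : assocTo .disj (X.obj v) (Y.obj v) (Z.obj v) =
      ProofNetOps.commDisj _ _ ≫ assocFrom .disj (Y.obj v) (Z.obj v) (X.obj v) ≫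
        ProofNetOps.commDisj _ _ ≫ assocFrom .disj (Z.obj v) (X.obj v) (Y.obj v) ≫
          ProofNetOps.commDisj _ _ := by
    have h := hexagonDisj_reverse (X.obj v) (Y.obj v) (Z.obj v)
    have h2 := hexagonDisj' (X.obj v) (Y.obj v) (Z.obj v)
    have h3 := hexagonDisj' (Y.obj v) (X.obj v) (Z.obj v)
    have e1 : ProofNetOps.commDisj (Y.obj v ⋎ Z.obj v) (X.obj v) ≫
        assocFrom .disj (Y.obj v) (Z.obj v) (X.obj v) =
      assocTo .disj _ _ _ ≫ (ProofNetOps.commDisj (Y.obj v) (X.obj v) ⋎ₐ 𝟙 (Z.obj v)) ≫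
        assocFrom .disj _ _ _ ≫ (𝟙 (Y.obj v) ⋎ₐ ProofNetOps.commDisj (Z.obj v) (X.obj v)) := by
      rw [← h2, assocTo_assocFrom'_assoc]
    have e2 : assocFrom .disj (Y.obj v) (X.obj v) (Z.obj v) ≫ ProofNetOps.commDisj _ _ =
      (ProofNetOps.commDisj (X.obj v) (Y.obj v) ⋎ₐ 𝟙 (Z.obj v)) ≫ assocFrom .disj _ _ _ ≫
        (𝟙 (X.obj v) ⋎ₐ ProofNetOps.commDisj (Z.obj v) (Y.obj v)) ≫ assocTo .disj _ _ _ := by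
      rw [← reassoc_of% h3, assocFrom_assocTo', Category.comp_id]
    rw [reassoc_of% e1, ← commDisj_nat'_assoc, reassoc_of% e2, bin_comp'_assoc, commDisj_commDisj',
      Category.id_comp, ProofNetCategory.bin_id, Category.id_comp, assocTo_assocFrom'_assoc,
      ← reassoc_of% h, assocTo_assocFrom'_assoc, commDisj_commDisj', Category.comp_id]
  rw [e]
  exact (commDisj _ _).comp ((assocFromDisj _ _ _).comp ((commDisj _ _).comp
    ((assocFromDisj _ _ _).comp (commDisj _ _))))

end Admissible

end

section

open Aug DualPair

variable {P : Type u} {𝒞 : Type w} [Category.{w} 𝒞] [ProofNetCategory 𝒞] {v : P → 𝒞}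

attribute [local simp] Tree.leaves List.nodup_append'

/-! ### Cut elimination -/

section

variable {X X' Y Y' : NF P}

theorem Aug.cut_exchange {M M' N N' : Aug 𝒞} (f : M ⟶ M') (j : N ⟶ N') :
    (β_ M N).hom ≫ N ◁ f ≫ N ◁ 𝟙 M' ≫ (β_ N M').hom ≫ M' ◁ j = M ◁ j ≫ f ▷ N' := by
  simp [MonoidalCategory.whisker_exchange]

theorem Aug.unit_shuffle_comp (Γ : Aug 𝒞) {W W' : 𝒞} (f : unit ⊗ of W ⟶ of W') :
    (λ_ Γ).inv ▷ (of W) ≫ shuffle unit Γ (of W) ≫ Γ ◁ f = Γ ◁ f := by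
  have h : (λ_ Γ).inv ▷ (of W) ≫ shuffle unit Γ (of W) = Γ ◁ (λ_ (of W)).inv := by
    exact Tree.Str.unique (ob := ![Γ, of W]) (S := .node (.leaf 0) (.leaf 1))
      (T := .node (.leaf 0) (.node .nil (.leaf 1)))
      (((Tree.Str.lunitInv _).right _).comp (.shuffle _ _ _)) ((Tree.Str.lunitInv _).left _)
      (by decide)
  rw [reassoc_of% h]
  exact (MonoidalCategory.whiskerLeft_comp _ _ _).symm.trans
    (congrArg (fun t => Γ ◁ t) (Category.id_comp f))

theorem Aug.point_whisker (Γ : Aug 𝒞) {A X : 𝒞} (π : Point 𝒞 X) :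
    Γ ◁ (ρ_ (of A)).inv ≫ Γ ◁ (𝟙 (of A) ▷ unit) ≫ Γ ◁ (of A ◁ pt π) ≫ Γ ◁ 𝟙 _ =
      Γ ◁ arr (π.app A) := by
  simp only [MonoidalCategory.id_whiskerRight, ← MonoidalCategory.whiskerLeft_comp]
  refine congrArg (fun t => Γ ◁ t) ?_
  refine congrArg Hom.arr (?_ : 𝟙 A ≫ 𝟙 A ≫ π.app A ≫ 𝟙 (A ⋏ X) = π.app A)
  simp

/-- The zigzag identity removes the unit after it has been moved past the context `Δ`. This is the
equation behind replacing a disjunction `X' ⋎ X` by the empty sequent. -/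
theorem Aug.shuffle_zig {Γ Δ X W : Aug 𝒞} (t : Γ ⟶ X) {π : unit ⟶ W} {F : X ⊗ W ⟶ X}
    (h : (ρ_ X).inv ≫ X ◁ π ≫ F = 𝟙 X) :
    (Γ ⊗ Δ) ◁ π ≫ (t ⊗ₘ 𝟙 Δ) ▷ W ≫ shuffle X Δ W ≫ Δ ◁ F =
      ((ρ_ (Γ ⊗ Δ)).hom ≫ (β_ Γ Δ).hom) ≫ Δ ◁ t := by
  have h₁ := shuffle_nat t (𝟙 Δ) π
  have h₂ : shuffle Γ Δ unit ≫ Δ ◁ (ρ_ Γ).hom = (ρ_ (Γ ⊗ Δ)).hom ≫ (β_ Γ Δ).hom :=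
    Tree.Str.unique (ob := ![Γ, Δ]) (S := .node (.node (.leaf 0) (.leaf 1)) .nil)
      (T := .node (.leaf 1) (.leaf 0))
      ((Tree.Str.shuffle _ _ _).comp ((Tree.Str.runit _).left _))
      ((Tree.Str.runit _).comp (.braid _ _)) (by decide)
  rw [Iso.inv_comp_eq, Category.comp_id] at h
  rw [← MonoidalCategory.tensorHom_def'_assoc, reassoc_of% h₁, MonoidalCategory.id_tensorHom,
    MonoidalCategory.tensorHom_def, ← MonoidalCategory.whiskerLeft_comp, Category.assoc, h,
    ← h₂, Category.assoc, ← MonoidalCategory.whiskerLeft_comp]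
  exact congrArg (fun s => shuffle Γ Δ unit ≫ Δ ◁ s)
    (MonoidalCategory.rightUnitor_naturality t)

/-- The form of a dual pair has a cut-free derivation. -/
def Ident (D : DualPair (X.obj v) (X'.obj v)) : Prop :=
  ∀ m n, CF v (.node (.leaf (X, m)) (.leaf (X', n))) D.form

/-- Cuts along a dual pair are admissible. -/
def Cut (D : DualPair (X.obj v) (X'.obj v)) : Prop :=
  ∀ (m : ℕ) (T : Seq P) (j : T.ev (leafOb v) ⟶ of (X'.obj v)),
    CF v (.node (.leaf (X, m)) T) (Form.pre D.form (of (X.obj v) ◁ j)) → Subst v X' T j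

variable {D : DualPair (X.obj v) (X'.obj v)} {E : DualPair (Y.obj v) (Y'.obj v)}

theorem Ident.swap (h : Ident D) : Ident D.swap :=
  fun m n => (h n m).braid

theorem Ident.congr {D' : DualPair (X.obj v) (X'.obj v)} (h : Ident D) (e : D.form = D'.form) :
    Ident D' :=
  fun m n => (h m n).of_eq e

theorem Cut.congr {D' : DualPair (X.obj v) (X'.obj v)} (h : Cut D) (e : D.form = D'.form) :
    Cut D' := by
  intro m T j c
  rw [← e] at c
  exact h m T j c

/-- Identities are expanded: the rule for disjunctions combines the two smaller identities, and the
rule for conjunctions joins the remaining formulae. -/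
theorem Ident.tensor (h : Ident D) (h' : Ident E) :
    Ident (X := .bin .conj X Y) (X' := .bin .disj X' Y') (D.tensor E) := by
  intro m n
  have c := (CF.disj n (h (n + 1) 0) (h' (n + 2) 0) (by simp)).braid
  have c₂ := (CF.conj m c (by simp)).braid
  refine c₂.of_eq ?_
  rw [tensor_form]
  refine (Form.pre_comp _ _ _).symm.trans ?_
  exact (congrArg (Form.pre _) (SymmetricCategory.symmetry _ _)).trans (Form.pre_id _)

/-- A cut is symmetric in its premises. The form of the second premise transposes to an arrow from
its context to `X'`, and the cut along `D` substitutes this arrow in the first premise. -/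
theorem Cut.swap (h : Cut D) : Cut D.swap := by
  intro m T j c n Γ ν hν hn
  have e := D.form_transposeR (Form.pre ν (β_ (of (X.obj v)) (Γ.ev (leafOb v))).hom)
  have s := h n Γ _ (hν.braid.of_eq e.symm)
  have c₂ := (s m T _ c.braid (by simp at hn ⊢; grind [List.disjoint_comm])).braid
  refine c₂.of_eq ?_
  have e₂ : ν = Form.pre D.form ((β_ _ _).hom ≫ of (X.obj v) ◁
      (D.transposeR (Form.pre ν (β_ (of (X.obj v)) (Γ.ev (leafOb v))).hom))) := by
    rw [Form.pre_comp, e, ← Form.pre_comp, SymmetricCategory.symmetry, Form.pre_id]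
  generalize D.transposeR (Form.pre ν (β_ (of (X.obj v)) (Γ.ev (leafOb v))).hom) = t at e₂
  rw [e₂, swap_form]
  simp only [← Form.pre_comp]
  refine congrArg (Form.pre D.form) ?_
  simp [MonoidalCategory.whisker_exchange]

/-- A derivation with a leaf `X'` is, by transposition, an arrow from the rest of the sequent to
`X`. Cuts along `D` make this arrow substitutable. -/
theorem Cut.subst_transpose (h : Cut D) {Γ : Seq P} {i : ℕ} {ν}
    (c : CF v (.node Γ (.leaf (X', i))) ν) : Subst v X Γ (D.transpose ν) := by
  refine h.swap i Γ (D.transpose ν) (c.braid.of_eq ?_)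
  conv_lhs => rw [← D.form_transpose ν]
  rw [swap_form]
  refine (Form.pre_comp _ _ _).symm.trans (Eq.trans ?_ (Form.pre_comp _ _ _))
  exact congrArg (Form.pre D.form) (BraidedCategory.braiding_naturality_right ..).symm

/-- The principal case of cut elimination. At the rule that introduces `X' ⋎ Y'` the premises
transpose to arrows into `X` and `Y`. On the other side the conjunction is split, and the cut
becomes two cuts on its components. -/
theorem Cut.tensor (h : Cut D) (h' : Cut E) :
    Cut (X := .bin .conj X Y) (X' := .bin .disj X' Y') (D.tensor E) := by
  intro m T j c
  rw [tensor_form] at c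
  refine .of_principal fun n Θ ν hν hn => ?_
  cases hν with
  | @disj Γ Δ _ _ i k _ ν μ h₁ h₂ =>
    obtain ⟨N, hN⟩ := Seq.exists_bound (.node T (.node Γ Δ))
    have c₁ := Subst.split X Y N (N + 1) _ _ _ c.braid (by
      simp at hN hn ⊢; grind [List.disjoint_comm])
    have c₂ := ((h.subst_transpose h₁).both (h'.subst_transpose h₂) c₁ (by
      simp at hN hn ⊢; grind [List.disjoint_comm])).braid
    refine c₂.of_eq ?_
    conv_rhs => rw [← D.form_transpose ν, ← E.form_transpose μ, R_pre_left]
    generalize D.transpose ν = s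
    generalize E.transpose μ = t
    simp only [← Form.pre_comp]
    exact congrArg (Form.pre (R D.form E.form)) (cut_exchange _ _)

/-- Removing `X' ⋎ X` by the unit amounts to cutting the two premises of the rule that introduces it
against each other; the zigzag identity shows that the forms agree. -/
theorem Cut.subst_unit (h : Cut D) : Subst v (.bin .disj X' X) .nil (pt D.unit) := by
  refine .of_principal fun n Θ ν hν hn => ?_
  cases hν with
  | @disj Γ Δ _ _ i k _ ν μ h₁ h₂ =>
    refine ((h.subst_transpose h₁ _ _ _ h₂ (by
      simp at hn ⊢; grind [List.disjoint_comm])).str (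
        (Tree.Str.runit _).comp (.braid Γ Δ))).of_eq ?_
    conv_rhs => rw [← D.form_transpose ν]
    generalize D.transpose ν = t
    have e := R_pre_left D.form μ t (𝟙 _)
    rw [MonoidalCategory.id_whiskerRight, Form.pre_id] at e
    rw [e, R]
    simp only [← Form.pre_comp]
    exact congrArg (Form.pre μ) (shuffle_zig t D.zig).symm

namespace Admissible

/-- The identity of the dual pair, derived in the empty context, serves as one premise of the rule
for disjunctions, with the given derivation as the other. -/
theorem sigma (h : Ident D) (A : NF P) : Admissible v (.bin .disj (.bin .conj X X') A) A
    (D.counit.app (A.obj v)) := by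
  intro m n Γ ν hν hn
  obtain ⟨N, hN⟩ := Seq.exists_bound Γ
  have c₁ := CF.conj (Θ := .nil) N ((h 0 1).str (.lunit _)) (by simp)
  have c₂ := CF.disj m c₁ hν (by simp at hN hn ⊢; grind [List.disjoint_comm])
  refine (c₂.str ((Tree.Str.lunitInv Γ).right _)).of_eq ?_
  rw [R, ← Form.pre_comp]
  have e : elim (Γ := .unit) (Form.pre D.form (λ_ (of (X.obj v) ⊗ of (X'.obj v))).hom) (A.obj v) =
      arr (D.counit.app (A.obj v)) :=
    congrArg (fun κ => arr (Form₀.app κ (A.obj v))) (Form.pre_id D.form)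
  refine congrArg (Form.pre ν) (Eq.trans ?_ (congrArg (fun t => _ ◁ t) e))
  exact unit_shuffle_comp _ _

/-- After the conjunction is split, `X' ⋎ X` is replaced by the empty sequent. This is where cut
elimination enters. -/
theorem delta (h : Cut D) (A : NF P) : Admissible v A (.bin .conj A (.bin .disj X' X))
    (D.unit.app (A.obj v)) := by
  intro m n Γ ν hν hn
  obtain ⟨N, hN⟩ := Seq.exists_bound Γ
  have c₁ := Subst.split A _ N (N + 1) _ _ _ hν (by
    simp at hN hn ⊢; grind [List.disjoint_comm])
  have c₂ := h.subst_unit.right c₁ (by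
    simp at hN hn ⊢; grind [List.disjoint_comm])
  have c₃ := (Subst.rename A m).left c₂ (by
    simp at hN hn ⊢; grind [List.disjoint_comm])
  refine (c₃.str ((Tree.Str.runitInv _).left Γ)).of_eq ?_
  simp only [← Form.pre_comp]
  refine congrArg (Form.pre _) ?_
  exact point_whisker _ _

end Admissible

end

end

section

open Aug DualPair

/-! ### Cut-free derivations of arrow terms -/

section

variable {P : Type u} {𝒞 : Type w} [Category.{w} 𝒞] [ProofNetCategory 𝒞] (v : P → 𝒞)

/-- The negation of a formula in negation normal form. -/
@[reducible]
def NF.dual : NF P → NF P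
  | lit p l b => lit p l (!b)
  | bin .conj X Y => bin .disj X.dual Y.dual
  | bin .disj X Y => bin .conj X.dual Y.dual

/-- The duality of a formula in negation normal form and its negation. -/
def NF.dp : (X : NF P) → DualPair (X.obj v) (X.dual.obj v)
  | lit p _ true => ofNeg (v p)
  | lit p _ false => (ofNeg (v p)).swap
  | bin .conj X Y => X.dp.tensor Y.dp
  | bin .disj X Y => (X.dp.swap.tensor Y.dp.swap).swap

variable {v}

theorem NF.ident_dp : (X : NF P) → Ident (X' := X.dual) (X.dp v)
  | lit p l true => fun m n => CF.ax p l m n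
  | lit p l false => Ident.swap (X := lit p l true) (X' := lit p l false)
      (D := ofNeg (v p)) fun m n => CF.ax p l m n
  | bin .conj X Y => X.ident_dp.tensor Y.ident_dp
  | bin .disj X Y => (X.ident_dp.swap.tensor Y.ident_dp.swap).swap

/-- The negative literal can be introduced only by an axiom, and the axiom links it to the positive
literal with the same label. Hence the cut merely renames a leaf of the other derivation. -/
theorem Cut.ofNeg (p : P) (l : ℕ) : Cut (X := .lit p l true) (X' := .lit p l false)
    (DualPair.ofNeg (v p)) := by
  intro m T j c
  refine .of_principal fun n Γ ν h hn => ?_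
  cases h with
  | neg p l m' n =>
    have c₂ := (Subst.rename (NF.lit p l true) m' m T _ c.braid
      (List.perm_append_comm.nodup_iff.1 hn)).braid
    refine c₂.of_eq ?_
    rw [MonoidalCategory.whiskerLeft_id, Form.pre_id, ← Form.pre_comp]
    exact (congrArg (Form.pre _) (SymmetricCategory.symmetry _ _)).trans (Form.pre_id _)

theorem NF.cut_dp : (X : NF P) → Cut (X' := X.dual) (X.dp v)
  | lit p l true => Cut.ofNeg p l
  | lit p l false => (Cut.ofNeg p l).swap
  | bin .conj X Y => X.cut_dp.tensor Y.cut_dp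
  | bin .disj X Y => (X.cut_dp.swap.tensor Y.cut_dp.swap).swap

/-- Arrows whose conjugates by isomorphisms with normal forms act on the cut-free derivations. -/
def AdmissibleVia {A B : 𝒞} {X Y : NF P} (i : A ≅ X.obj v) (j : B ≅ Y.obj v) (f : A ⟶ B) : Prop :=
  Admissible v X Y (i.inv ≫ f ≫ j.hom)

namespace AdmissibleVia

variable {A B C A' B' C' : 𝒞} {X Y Z X' Y' Z' : NF P} {i : A ≅ X.obj v} {j : B ≅ Y.obj v}
  {k : C ≅ Z.obj v} {i' : A' ≅ X'.obj v} {j' : B' ≅ Y'.obj v}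

variable (i j k)

theorem id : AdmissibleVia i i (𝟙 A) := by
  have h := Admissible.id (v := v) X
  simpa [AdmissibleVia] using h

variable {i j k} in
theorem comp {f : A ⟶ B} {g : B ⟶ C} (hf : AdmissibleVia i j f) (hg : AdmissibleVia j k g) :
    AdmissibleVia i k (f ≫ g) := by
  have h := Admissible.comp hf hg
  simpa [AdmissibleVia] using h

variable {i j} in
theorem bin (ξ : Conn) {f : A ⟶ B} {g : A' ⟶ B'} (hf : AdmissibleVia i j f)
    (hg : AdmissibleVia i' j' g) : AdmissibleVia (X := .bin ξ X X') (Y := .bin ξ Y Y')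
      (binIso ξ i i') (binIso ξ j j') (binMap ξ f g) := by
  have h : Admissible v (.bin ξ X X') (.bin ξ Y Y')
      (binMap ξ (i.inv ≫ f ≫ j.hom) (i'.inv ≫ g ≫ j'.hom)) := by
    cases ξ
    · exact Admissible.conj hf hg
    · exact Admissible.disj hf hg
  simpa [AdmissibleVia, bin_comp'] using h

theorem assocTo (ξ : Conn) : AdmissibleVia (X := .bin ξ X (.bin ξ Y Z))
    (Y := .bin ξ (.bin ξ X Y) Z) (binIso ξ i (binIso ξ j k)) (binIso ξ (binIso ξ i j) k)
    (ProofNetOps.assocTo ξ A B C) := by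
  have h : Admissible v (.bin ξ X (.bin ξ Y Z)) (.bin ξ (.bin ξ X Y) Z)
      (ProofNetOps.assocTo ξ (X.obj v) (Y.obj v) (Z.obj v)) := by
    cases ξ
    · exact .assocToConj X Y Z
    · exact .assocToDisj X Y Z
  simpa [AdmissibleVia, assocTo_nat', bin_comp'_assoc, bin_comp'] using h

theorem assocFrom (ξ : Conn) : AdmissibleVia (X := .bin ξ (.bin ξ X Y) Z)
    (Y := .bin ξ X (.bin ξ Y Z)) (binIso ξ (binIso ξ i j) k) (binIso ξ i (binIso ξ j k))
    (ProofNetOps.assocFrom ξ A B C) := by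
  have h : Admissible v (.bin ξ (.bin ξ X Y) Z) (.bin ξ X (.bin ξ Y Z))
      (ProofNetOps.assocFrom ξ (X.obj v) (Y.obj v) (Z.obj v)) := by
    cases ξ
    · exact .assocFromConj X Y Z
    · exact .assocFromDisj X Y Z
  simpa [AdmissibleVia, ← assocFrom_nat, bin_comp'_assoc, bin_comp'] using h

theorem commConj : AdmissibleVia (X := .bin .conj X Y) (Y := .bin .conj Y X) (binIso .conj i j)
    (binIso .conj j i) (ProofNetOps.commConj A B) := by
  have h := Admissible.commConj (v := v) X Y
  simpa [AdmissibleVia, commConj_nat', bin_comp'_assoc] using h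

theorem commDisj : AdmissibleVia (X := .bin .disj Y X) (Y := .bin .disj X Y) (binIso .disj j i)
    (binIso .disj i j) (ProofNetOps.commDisj A B) := by
  have h := Admissible.commDisj (v := v) X Y
  simpa [AdmissibleVia, commDisj_nat', bin_comp'_assoc] using h

theorem dissoc : AdmissibleVia (X := .bin .conj X (.bin .disj Y Z))
    (Y := .bin .disj (.bin .conj X Y) Z) (binIso .conj i (binIso .disj j k))
    (binIso .disj (binIso .conj i j) k) (ProofNetOps.dissoc A B C) := by
  have h := Admissible.dissoc (v := v) X Y Z
  simpa [AdmissibleVia, dissoc_nat', bin_comp'_assoc, bin_comp'] using h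

theorem sigma {D : DualPair A A'} (h : Ident (D.mapIso i i')) :
    AdmissibleVia (X := .bin .disj (.bin .conj X X') Z) (Y := Z)
      (binIso .disj (binIso .conj i i') k) k (D.counit.app C) := by
  have h' := Admissible.sigma h Z
  have e : (binIso Conn.disj (binIso Conn.conj i i') k).inv ≫ D.counit.app C ≫ k.hom =
      (D.mapIso i i').counit.app (Z.obj v) := by
    rw [← D.counit.nat]
    simp [DualPair.mapIso, bin_comp'_assoc]
  rw [AdmissibleVia, e]
  exact h'

theorem delta {D : DualPair A A'} (h : Cut (D.mapIso i i')) :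
    AdmissibleVia (X := Z) (Y := .bin .conj Z (.bin .disj X' X))
      k (binIso .conj k (binIso .disj i' i)) (D.unit.app C) := by
  have h' := Admissible.delta h Z
  have e : k.inv ≫ D.unit.app C ≫ (binIso Conn.conj k (binIso Conn.disj i' i)).hom =
      (D.mapIso i i').unit.app (Z.obj v) := by
    have e₂ : binMap .conj k.hom (i'.hom ⋎ₐ i.hom) =
        (k.hom ⋏ₐ 𝟙 _) ≫ (𝟙 _ ⋏ₐ (i'.hom ⋎ₐ i.hom)) := by
      rw [bin_comp', Category.id_comp, Category.comp_id]
    simp only [DualPair.mapIso, Point.map, binIso_hom]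
    rw [e₂, D.unit.nat_assoc, Iso.inv_hom_id_assoc]
  rw [AdmissibleVia, e]
  exact h'

end AdmissibleVia

/-- The comparison of duals is chosen to match counits, so a dual pair transported along it acquires
the form of `E`. In this way derivability of identities and admissibility of cuts pass from normal
forms to the negation of the category. -/
theorem DualPair.mapIso_dualIso_form {A A' B B' : 𝒞} (D : DualPair A A') (E : DualPair B B')
    (i : A ≅ B) : (D.mapIso i (dualIso (D.mapIso i (Iso.refl _)) E)).form = E.form := by
  have h := form_dualIso (D.mapIso i (Iso.refl _)) E
  have e : (D.mapIso i (dualIso (D.mapIso i (Iso.refl _)) E)).form =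
      Form.pre (D.mapIso i (Iso.refl _)).form
        (of B ◁ arr (dualIso (D.mapIso i (Iso.refl _)) E).inv) := by
    refine (congrArg (Form₀.pre D.counit) ?_).trans (Form.pre_comp (K := of (A ⋏ A')) D.counit
      (arr (𝟙 B ⋏ₐ (dualIso (D.mapIso i (Iso.refl _)) E).inv)) (arr (i.inv ⋏ₐ 𝟙 A')))
    rw [bin_comp', Category.id_comp, Category.comp_id]
  rw [e, ← h, ← Form.pre_comp, ← MonoidalCategory.whiskerLeft_comp, ← arr_comp, Iso.inv_hom_id,
    arr_id, MonoidalCategory.whiskerLeft_id, Form.pre_id]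

end

/-! ### Labelled normal forms of formulae -/

variable {P : Type u}

/-- The negation normal form of a formula whose occurrences of letters are labelled. -/
def Formula.nnf : (A : Formula P) → (A.Occ → ℕ) → NF P
  | letter p, a => .lit p (a ()) true
  | neg A, a => (A.nnf a).dual
  | bin ξ A B, a => .bin ξ (A.nnf fun x => a (.inl x)) (B.nnf fun x => a (.inr x))

/-- The letters as objects of `PN^¬`. -/
@[reducible]
def PN.letter (p : P) : PN P := ⟨.letter p⟩

/-- A formula is isomorphic to its negation normal form. -/
def Formula.iota : (A : Formula P) → (a : A.Occ → ℕ) → (PN.mk A ≅ (A.nnf a).obj PN.letter)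
  | letter _, _ => Iso.refl _
  | neg A, a => dualIso ((ofNeg (PN.mk A)).mapIso (A.iota a) (Iso.refl _)) ((A.nnf a).dp PN.letter)
  | bin ξ A B, a => binIso ξ (A.iota fun x => a (.inl x)) (B.iota fun x => a (.inr x))

theorem Formula.ident_iota (A : Formula P) (a : A.Occ → ℕ) :
    Ident ((ofNeg (PN.mk A)).mapIso (A.iota a) (Formula.iota (.neg A) a)) :=
  (A.nnf a).ident_dp.congr (mapIso_dualIso_form _ _ _).symm

theorem Formula.cut_iota (A : Formula P) (a : A.Occ → ℕ) :
    Cut ((ofNeg (PN.mk A)).mapIso (A.iota a) (Formula.iota (.neg A) a)) :=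
  (A.nnf a).cut_dp.congr (mapIso_dualIso_form _ _ _).symm

namespace BrauerianSplit

/-- Labels that are constant on the classes of a split equivalence. -/
def Respects {X Y : Type} (R : BrauerianSplit X Y) (a : X → ℕ) (b : Y → ℕ) : Prop :=
  ∀ u v, R.rel u v → Sum.elim a b u = Sum.elim a b v

theorem Respects.ofEquiv {X Y : Type} {e : X ≃ Y} {a : X → ℕ} {b : Y → ℕ}
    (h : (ofEquiv e).Respects a b) : b = fun y => a (e.symm y) := by
  funext y
  have := h (.inr y) (.inl (e.symm y)) (by simp [ofEquiv_rel])
  simpa using this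

open Classical in
theorem Respects.comp {X Y Z : Type} [Finite X] [Finite Y] [Finite Z] {Q : BrauerianSplit Y Z}
    {R : BrauerianSplit X Y} {a : X → ℕ} {c : Z → ℕ} (h : (comp Q R).Respects a c) :
    ∃ b, R.Respects a b ∧ Q.Respects b c := by
  -- An occurrence connected to an outer one inherits its label; the choice does not matter because
  -- the outer labels are constant on the classes of the composite. Closed loops in the middle meet
  -- no outer occurrence and receive `0`.
  let L : X ⊕ (Y ⊕ Z) → ℕ := fun w =>
    if hw : ∃ u : X ⊕ Z, Relation.TransGen (Glue Q R) w (Sum.map id Sum.inr u) then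
      Sum.elim a c hw.choose else 0
  have symm {u v} (h : Relation.TransGen (Glue Q R) u v) : Relation.TransGen (Glue Q R) v u := by
    have : Std.Symm (Glue Q R) := ⟨fun _ _ => glue_symm⟩
    exact (inferInstance : Std.Symm (Relation.TransGen (Glue Q R))).symm _ _ h
  have h₁ (w) (u : X ⊕ Z) (hu : Relation.TransGen (Glue Q R) w (Sum.map id Sum.inr u)) :
      L w = Sum.elim a c u := by
    have hw : ∃ u : X ⊕ Z, Relation.TransGen (Glue Q R) w (Sum.map id Sum.inr u) := ⟨u, hu⟩
    simp only [L, dif_pos hw]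
    exact h _ _ ((symm hw.choose_spec).trans hu)
  have h₂ (w w') (hw : Glue Q R w w') : L w = L w' := by
    by_cases hu : ∃ u : X ⊕ Z, Relation.TransGen (Glue Q R) w' (Sum.map id Sum.inr u)
    · obtain ⟨u, hu⟩ := hu
      rw [h₁ w' u hu, h₁ w u (.head hw hu)]
    · have hu' : ¬ ∃ u : X ⊕ Z, Relation.TransGen (Glue Q R) w (Sum.map id Sum.inr u) :=
        fun ⟨u, h⟩ => hu ⟨u, .head (glue_symm hw) h⟩
      simp only [L, dif_neg hu, dif_neg hu']
  have h₃ (u : X ⊕ Z) : L (Sum.map id Sum.inr u) = Sum.elim a c u :=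
    h₁ _ u (.single (glue_refl _ _ _))
  refine ⟨fun y => L (.inr (.inl y)), fun u w hu => ?_, fun u w hu => ?_⟩
  · have := h₂ _ _ (.upper hu)
    have h₄ (x) : L (.inl x) = a x := h₃ (.inl x)
    rcases u with u | u <;> rcases w with w | w <;> simpa [h₄] using this
  · have := h₂ _ _ (.lower hu)
    have h₄ (x) : L (.inr (.inr x)) = c x := h₃ (.inr x)
    rcases u with u | u <;> rcases w with w | w <;> simpa [h₄] using this

end BrauerianSplit

/-- Arrow terms act on the cut-free derivations. -/
theorem ArrowTerm.admissibleVia {A B : Formula P} (t : ArrowTerm A B) (a : A.Occ → ℕ)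
    (b : B.Occ → ℕ) (h : t.graph.Respects a b) : AdmissibleVia (A.iota a) (B.iota b) t.arrow := by
  induction t with
  | id A =>
    obtain rfl := h.ofEquiv
    exact .id (A.iota a)
  | assocTo ξ A B C =>
    obtain rfl := h.ofEquiv
    exact .assocTo (A.iota _) (B.iota _) (C.iota _) ξ
  | assocFrom ξ A B C =>
    obtain rfl := h.ofEquiv
    exact .assocFrom (A.iota _) (B.iota _) (C.iota _) ξ
  | commConj A B =>
    obtain rfl := h.ofEquiv
    exact .commConj (A.iota _) (B.iota _)
  | commDisj A B =>
    obtain rfl := h.ofEquiv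
    exact .commDisj (A.iota _) (B.iota _)
  | dissoc A B C =>
    obtain rfl := h.ofEquiv
    exact .dissoc (A.iota _) (B.iota _) (C.iota _)
  | deltaConj B A =>
    -- The links in the target force both copies of `B` to carry the same labels, as required for
    -- the dual pair of a formula and its negation.
    obtain ⟨x, rfl⟩ : ∃ x : B.Occ → ℕ, b = Sum.elim a (Sum.elim x x) := by
      refine ⟨fun y => b (.inr (.inl y)), funext ?_⟩
      rintro (y | y | y)
      · exact h (.inr (.inl y)) (.inl y) rfl
      · rfl
      · exact h (.inr (.inr (.inr y))) (.inr (.inr (.inl y))) rfl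
    exact .delta (B.iota x) (A.iota a) (B.cut_iota x)
  | sigmaDisj B A =>
    obtain ⟨x, rfl⟩ : ∃ x : B.Occ → ℕ, a = Sum.elim (Sum.elim x x) b := by
      refine ⟨fun y => a (.inl (.inl y)), funext ?_⟩
      rintro ((y | y) | y)
      · rfl
      · exact h (.inl (.inl (.inr y))) (.inl (.inl (.inl y))) rfl
      · exact h (.inl (.inr y)) (.inr y) rfl
    exact .sigma (B.iota x) (A.iota b) (B.ident_iota x)
  | comp f g ihf ihg =>
    obtain ⟨c, h₁, h₂⟩ := BrauerianSplit.Respects.comp h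
    exact (ihg _ _ h₁).comp (ihf _ _ h₂)
  | bin ξ f g ihf ihg =>
    refine .bin ξ (ihf _ _ ?_) (ihg _ _ ?_)
    · rintro (u | u) (v | v) huv
      · exact h (.inl (.inl u)) (.inl (.inl v)) (.inl huv)
      · exact h (.inl (.inl u)) (.inr (.inl v)) (.inl huv)
      · exact h (.inr (.inl u)) (.inl (.inl v)) (.inl huv)
      · exact h (.inr (.inl u)) (.inr (.inl v)) (.inl huv)
    · rintro (u | u) (v | v) huv
      · exact h (.inl (.inr u)) (.inl (.inr v)) (.inr huv)
      · exact h (.inl (.inr u)) (.inr (.inr v)) (.inr huv)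
      · exact h (.inr (.inr u)) (.inl (.inr v)) (.inr huv)
      · exact h (.inr (.inr u)) (.inr (.inr v)) (.inr huv)

end

section

/-! ### Uniqueness of cut-free derivations -/

open Aug DualPair

variable {P : Type u} {𝒞 : Type w} [Category.{w} 𝒞] [ProofNetCategory 𝒞] {v : P → 𝒞}

attribute [local simp] Tree.leaves List.nodup_append'

/-- The labels of the literals of a formula. -/
def NF.labels : NF P → List ℕ
  | lit _ l _ => [l]
  | bin _ X Y => X.labels ++ Y.labels

theorem NF.labels_ne_nil (X : NF P) : X.labels ≠ [] := by
  induction X with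
  | lit => simp [labels]
  | bin _ _ _ h _ => simp [labels, h]

/-- The labels of the literals of a sequent. -/
def Seq.labels (T : Seq P) : List ℕ :=
  T.leaves.flatMap fun a => a.1.labels

theorem Seq.labels_perm {S T : Seq P} (h : S.leaves.Perm T.leaves) :
    (Seq.labels S).Perm (Seq.labels T) :=
  h.flatMap_right _

@[simp]
theorem Seq.labels_leaf (a : NF P × ℕ) : Seq.labels (.leaf a) = a.1.labels := by
  simp [Seq.labels]

@[simp]
theorem Seq.labels_node (S T : Seq P) :
    Seq.labels (.node S T) = Seq.labels S ++ Seq.labels T := by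
  simp [Seq.labels]

/-- All labels of a formula have the color `c`. -/
def NF.Mono (χ : ℕ → Bool) (c : Bool) (X : NF P) : Prop :=
  ∀ l ∈ X.labels, χ l = c

theorem NF.mono_bin {χ : ℕ → Bool} {c : Bool} {ξ : Conn} {X Y : NF P} :
    (NF.bin ξ X Y).Mono χ c ↔ X.Mono χ c ∧ Y.Mono χ c := by
  simp only [NF.Mono, NF.labels, List.mem_append]
  exact ⟨fun h => ⟨fun l hl => h l (.inl hl), fun l hl => h l (.inr hl)⟩,
    fun h l hl => hl.elim (h.1 l) (h.2 l)⟩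

theorem NF.Mono.unique {χ : ℕ → Bool} {c d : Bool} {X : NF P} (h : X.Mono χ c) (k : X.Mono χ d) :
    c = d := by
  obtain ⟨l, hl⟩ := List.exists_mem_of_ne_nil _ X.labels_ne_nil
  exact (h l hl).symm.trans (k l hl)

/-- All formulae of a sequent have the color `c`. -/
def Seq.Mono (χ : ℕ → Bool) (c : Bool) (T : Seq P) : Prop :=
  ∀ a ∈ T.leaves, a.1.Mono χ c

@[simp]
theorem Seq.mono_leaf {χ : ℕ → Bool} {c : Bool} {a : NF P × ℕ} :
    Seq.Mono χ c (.leaf a) ↔ a.1.Mono χ c := by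
  simp [Seq.Mono]

@[simp]
theorem Seq.mono_node {χ : ℕ → Bool} {c : Bool} {S T : Seq P} :
    Seq.Mono χ c (.node S T) ↔ Seq.Mono χ c S ∧ Seq.Mono χ c T := by
  simp only [Seq.Mono, Tree.leaves, List.mem_append]
  exact ⟨fun h => ⟨fun l hl => h l (.inl hl), fun l hl => h l (.inr hl)⟩,
    fun h l hl => hl.elim (h.1 l) (h.2 l)⟩

/-- An axiom contributes its label twice, and the other rules only gather or rearrange literals. -/
theorem CF.even_count {T : Seq P} {ν} (h : CF v T ν) (l : ℕ) : Even ((Seq.labels T).count l) := by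
  induction h with
  | ax p l' m n =>
    simp only [Seq.labels_node, Seq.labels_leaf, NF.labels, List.count_append]
    exact ⟨_, rfl⟩
  | str _ hs ih => rwa [(Seq.labels_perm hs.perm).count_eq]
  | conj k _ _ ih => simpa [NF.labels] using ih
  | disj k _ _ _ ih₁ ih₂ =>
    simp only [Seq.labels_node, Seq.labels_leaf, NF.labels, List.count_append] at ih₁ ih₂ ⊢
    obtain ⟨r, hr⟩ := ih₁
    obtain ⟨s, hs⟩ := ih₂
    exact ⟨r + s, by omega⟩

/-- The graph of formulae and links of a derivation is connected. -/
theorem CF.connected {T : Seq P} {ν} (h : CF v T ν) {χ : ℕ → Bool}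
    (hT : ∀ a ∈ T.leaves, ∃ c, a.1.Mono χ c) : ∃ c, Seq.Mono χ c T := by
  induction h with
  | ax p l m n => exact ⟨χ l, by simp [NF.Mono, NF.labels]⟩
  | str _ hs ih =>
    obtain ⟨c, hc⟩ := ih fun a ha => hT a (hs.perm.mem_iff.2 ha)
    exact ⟨c, fun a ha => hc a (hs.perm.mem_iff.1 ha)⟩
  | @conj Θ X Y i j k ν _ _ ih =>
    obtain ⟨c, hc⟩ := hT (NF.bin .conj X Y, k) (by simp)
    rw [NF.mono_bin] at hc
    obtain ⟨d, hd⟩ := ih (by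
      simp only [Tree.leaves, List.mem_append, List.mem_singleton]
      rintro a (ha | rfl | rfl)
      · exact hT a (by simp [ha])
      · exact ⟨c, hc.1⟩
      · exact ⟨c, hc.2⟩)
    refine ⟨d, ?_⟩
    simpa [NF.mono_bin] using hd
  | @disj Γ Δ X Y i j k ν μ _ _ _ ih₁ ih₂ =>
    obtain ⟨c, hc⟩ := hT (NF.bin .disj X Y, k) (by simp)
    rw [NF.mono_bin] at hc
    obtain ⟨d, hd⟩ := ih₁ (by
      simp only [Tree.leaves, List.mem_append, List.mem_singleton]
      rintro a (ha | rfl)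
      · exact hT a (by simp [ha])
      · exact ⟨c, hc.1⟩)
    obtain ⟨e, he⟩ := ih₂ (by
      simp only [Tree.leaves, List.mem_append, List.mem_singleton]
      rintro a (ha | rfl)
      · exact hT a (by simp [ha])
      · exact ⟨c, hc.2⟩)
    simp only [Seq.mono_node, Seq.mono_leaf] at hd he
    obtain rfl := hd.2.unique hc.1
    obtain rfl := he.2.unique hc.2
    refine ⟨e, ?_⟩
    simp only [Seq.mono_node, Seq.mono_leaf, NF.mono_bin]
    exact ⟨⟨hd.1, he.1⟩, hc⟩

/-- By commutativity the combination can also be read as the first form precomposed with an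
elimination by the second. This allows a rule to be permuted into either of its premises. -/
theorem R_right {Γ Δ : Aug 𝒞} {A B : 𝒞} (ν : Form (Γ ⊗ of A)) (μ : Form (Δ ⊗ of B)) :
    R ν μ = Form.pre ν ((α_ Γ Δ _).hom ≫ Γ ◁ (Δ ◁ arr (commDisj B A) ≫ elim μ A)) := by
  rw [R_comm, R, ← Form.pre_comp]
  congr 1
  rw [shuffle, Category.assoc, ← whisker_exchange_assoc, Category.assoc, ← comp_whiskerRight_assoc,
    SymmetricCategory.symmetry, id_whiskerRight, Category.id_comp, whiskerLeft_comp,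
    ← associator_naturality_right_assoc]

/-- The exchange of the last two factors. -/
def swapRight (Γ T X : Aug 𝒞) : (Γ ⊗ T) ⊗ X ⟶ (Γ ⊗ X) ⊗ T :=
  (α_ _ _ _).hom ≫ _ ◁ (β_ _ _).hom ≫ (α_ _ _ _).inv

theorem swapRight_nat_right (Γ X : Aug 𝒞) {T T' : Aug 𝒞} (e : T ⟶ T') :
    (Γ ⊗ X) ◁ e ≫ swapRight Γ X T' = swapRight Γ X T ≫ (Γ ◁ e) ▷ X := by
  simp only [swapRight, Category.assoc]
  rw [associator_naturality_right_assoc, ← whiskerLeft_comp_assoc,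
    BraidedCategory.braiding_naturality_right, whiskerLeft_comp_assoc,
    associator_inv_naturality_middle]

theorem _root_.ProofNet.Tree.Str.swapRight {α : Type*} {ob : α → Aug 𝒞} (S T U : Tree α) :
    Tree.Str ob (.node (.node S T) U) (.node (.node S U) T) (swapRight _ _ _) :=
  (Tree.Str.assoc _ _ _).comp (((Tree.Str.braid _ _).left _).comp (.assocInv _ _ _))

/-- Moving the last factor into the first part of a context. -/
def insertLeft (Γ Δ X T : Aug 𝒞) : ((Γ ⊗ Δ) ⊗ X) ⊗ T ⟶ ((Γ ⊗ T) ⊗ Δ) ⊗ X :=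
  swapRight (Γ ⊗ Δ) X T ≫ swapRight Γ Δ T ▷ X

/-- Moving the last factor into the second part of a context. -/
def insertRight (Γ Δ X T : Aug 𝒞) : ((Γ ⊗ Δ) ⊗ X) ⊗ T ⟶ (Γ ⊗ (Δ ⊗ T)) ⊗ X :=
  swapRight (Γ ⊗ Δ) X T ≫ (α_ Γ Δ T).hom ▷ X

theorem insertLeft_nat (Γ Δ X : Aug 𝒞) {T T' : Aug 𝒞} (e : T ⟶ T') :
    ((Γ ⊗ Δ) ⊗ X) ◁ e ≫ insertLeft Γ Δ X T' = insertLeft Γ Δ X T ≫ ((Γ ◁ e) ▷ Δ) ▷ X := by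
  rw [insertLeft, insertLeft, ← Category.assoc, swapRight_nat_right, Category.assoc,
    ← comp_whiskerRight, swapRight_nat_right, Category.assoc, ← comp_whiskerRight]

theorem insertRight_nat (Γ Δ X : Aug 𝒞) {T T' : Aug 𝒞} (e : T ⟶ T') :
    ((Γ ⊗ Δ) ⊗ X) ◁ e ≫ insertRight Γ Δ X T' = insertRight Γ Δ X T ≫ (Γ ◁ (Δ ◁ e)) ▷ X := by
  rw [insertRight, insertRight, ← Category.assoc, swapRight_nat_right, Category.assoc,
    ← comp_whiskerRight, associator_naturality_right, Category.assoc, ← comp_whiskerRight]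

theorem _root_.ProofNet.Tree.Str.insertLeft {α : Type*} {ob : α → Aug 𝒞} (S T U V : Tree α) :
    Tree.Str ob (.node (.node (.node S T) U) V) (.node (.node (.node S V) T) U)
      (insertLeft _ _ _ _) :=
  (Tree.Str.swapRight _ _ _).comp ((Tree.Str.swapRight _ _ _).right _)

theorem _root_.ProofNet.Tree.Str.insertRight {α : Type*} {ob : α → Aug 𝒞} (S T U V : Tree α) :
    Tree.Str ob (.node (.node (.node S T) U) V) (.node (.node S (.node T V)) U)
      (insertRight _ _ _ _) :=
  (Tree.Str.swapRight _ _ _).comp ((Tree.Str.assoc _ _ _).right _)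

theorem pre_swapRight {Γ T T' X : Aug 𝒞} (ν : Form ((Γ ⊗ T') ⊗ X)) (e : T ⟶ T') :
    Form.pre (Form.pre (Form.pre ν (swapRight _ _ _)) ((Γ ⊗ X) ◁ e)) (swapRight _ _ _) =
      Form.pre ν ((Γ ◁ e) ▷ X) := by
  have h : swapRight Γ T X ≫ swapRight Γ X T = 𝟙 _ := by
    simp only [swapRight, Category.assoc, Iso.inv_hom_id_assoc]
    rw [← whiskerLeft_comp_assoc, SymmetricCategory.symmetry]
    simp
  rw [← Form.pre_comp, ← Form.pre_comp, Category.assoc, swapRight_nat_right, reassoc_of% h]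

theorem R_insertLeft {Φ Γ Γ' Δ T T' : Aug 𝒞} {A B : 𝒞} (ν : Form ((Γ' ⊗ T') ⊗ of A))
    (μ : Form (Δ ⊗ of B)) (e : T ⟶ T') (t : Γ ⟶ Γ' ⊗ T) (r : Φ ⟶ (Γ' ⊗ Δ) ⊗ of (A ⋎ B))
    {s : Φ ⊗ T ⟶ (Γ ⊗ Δ) ⊗ of (A ⋎ B)} (hs : s ≫ (t ▷ Δ) ▷ _ = r ▷ T ≫ insertLeft _ _ _ _) :
    Form.pre (Form.pre (R ν μ) (r ▷ T' ≫ insertLeft _ _ _ _)) (Φ ◁ e) =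
      Form.pre (R (Form.pre (Form.pre ν ((Γ' ◁ e) ▷ of A)) (t ▷ of A)) μ) s := by
  have e3 := R_pre_left ν μ (t ≫ Γ' ◁ e) (𝟙 _)
  rw [id_whiskerRight, Form.pre_id, MonoidalCategory.tensorHom_id, comp_whiskerRight,
    Form.pre_comp] at e3
  rw [e3, ← Form.pre_comp, ← Form.pre_comp, comp_whiskerRight, comp_whiskerRight, reassoc_of% hs,
    whisker_exchange_assoc, insertLeft_nat]

theorem R_insertRight {Φ Γ Δ Δ' T T' : Aug 𝒞} {A B : 𝒞} (ν : Form (Γ ⊗ of A))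
    (μ : Form ((Δ' ⊗ T') ⊗ of B)) (e : T ⟶ T') (t : Δ ⟶ Δ' ⊗ T) (r : Φ ⟶ (Γ ⊗ Δ') ⊗ of (A ⋎ B))
    {s : Φ ⊗ T ⟶ (Γ ⊗ Δ) ⊗ of (A ⋎ B)} (hs : s ≫ (Γ ◁ t) ▷ _ = r ▷ T ≫ insertRight _ _ _ _) :
    Form.pre (Form.pre (R ν μ) (r ▷ T' ≫ insertRight _ _ _ _)) (Φ ◁ e) =
      Form.pre (R ν (Form.pre (Form.pre μ ((Δ' ◁ e) ▷ of B)) (t ▷ of B))) s := by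
  have e3 := R_pre_left ν μ (𝟙 _) (t ≫ Δ' ◁ e)
  rw [id_whiskerRight, Form.pre_id, MonoidalCategory.id_tensorHom, comp_whiskerRight,
    Form.pre_comp] at e3
  rw [e3, ← Form.pre_comp, ← Form.pre_comp, whiskerLeft_comp, comp_whiskerRight, reassoc_of% hs,
    whisker_exchange_assoc, insertRight_nat]

variable (v) in
/-- The part `T₀` of a sequent can be replaced by `T₁`. -/
def Rep (T₀ T₁ : Seq P) (e : T₁.ev (leafOb v) ⟶ T₀.ev (leafOb v)) : Prop :=
  ∀ (Φ : Seq P) (κ), CF v (.node Φ T₀) κ → (Tree.node Φ T₁).leaves.Nodup →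
    CF v (.node Φ T₁) (Form.pre κ (Φ.ev (leafOb v) ◁ e))

theorem Rep.conj (Z W : NF P) (i j k : ℕ) :
    Rep v (.node (.leaf (Z, i)) (.leaf (W, j))) (.leaf (NF.bin .conj Z W, k))
      (𝟙 (of (Z.obj v ⋏ W.obj v))) := by
  intro Φ κ h hn
  refine (h.conj k hn).of_eq ?_
  exact ((congrArg (Form.pre κ) (MonoidalCategory.whiskerLeft_id _ _)).trans (Form.pre_id κ)).symm

/-- The rule for disjunctions is viewed as an operation on its first premise, with the second
premise held fixed; `Rep.disjRight` does the converse. Such operations can be carried out after a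
splitting instead of before it. -/
theorem Rep.disjLeft {Z W : NF P} {i j : ℕ} (k : ℕ) {Ψ : Seq P} {μ}
    (hμ : CF v (.node Ψ (.leaf (W, j))) μ) :
    Rep v (.leaf (Z, i)) (.node Ψ (.leaf (NF.bin .disj Z W, k)))
      (Ψ.ev (leafOb v) ◁ arr (commDisj (W.obj v) (Z.obj v)) ≫ elim μ (Z.obj v)) := by
  intro Φ κ h hn
  have h2 := (h.disj k hμ (by simpa using hn)).str (.assocInv _ _ _)
  refine h2.of_eq ?_
  rw [R_right, ← Form.pre_comp, Iso.inv_hom_id_assoc]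

theorem Rep.disjRight {Z W : NF P} {i j : ℕ} (k : ℕ) {Φ : Seq P} {ν}
    (hν : CF v (.node Φ (.leaf (Z, i))) ν) :
    Rep v (.leaf (W, j)) (.node Φ (.leaf (NF.bin .disj Z W, k))) (elim ν (W.obj v)) := by
  intro Ψ κ h hn
  obtain ⟨s, hs⟩ := Tree.Str.exists (ob := leafOb v)
    (S := .node Ψ (.node Φ (.leaf (NF.bin .disj Z W, k))))
    (T := .node (.node Φ Ψ) (.leaf (NF.bin .disj Z W, k))) (by
      simp only [Tree.leaves, ← List.append_assoc]
      exact List.perm_append_comm.append_right _)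
  have h2 := (hν.disj k h (hs.perm.nodup_iff.1 hn)).str hs
  refine h2.of_eq ?_
  have e : s ≫ shuffle (Φ.ev (leafOb v)) (Ψ.ev (leafOb v)) (of (Z.obj v ⋎ W.obj v)) = 𝟙 _ :=
    Tree.Str.unique (hs.comp (Tree.Str.shuffle _ _ _)) (.id _) hn
  rw [R, ← Form.pre_comp, reassoc_of% e]

variable (v) in
/-- Every division of the context of a disjunction that respects a coloring splits the form. -/
def Splits (χ : ℕ → Bool) (T : Seq P) (μ : Form (T.ev (leafOb v))) : Prop :=
  ∀ (Γ Δ : Seq P) (X Y : NF P) (k : ℕ)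
    (s : T.ev (leafOb v) ⟶
      (Tree.node (.node Γ Δ) (.leaf (NF.bin .disj X Y, k))).ev (leafOb v)),
    Tree.Str (leafOb v) T (.node (.node Γ Δ) (.leaf (NF.bin .disj X Y, k))) s →
    Seq.Mono χ true Γ → Seq.Mono χ false Δ → X.Mono χ true → Y.Mono χ false →
    ∃ i j μ₁ μ₂, CF v (.node Γ (.leaf (X, i))) μ₁ ∧ CF v (.node Δ (.leaf (Y, j))) μ₂ ∧
      μ = Form.pre (R μ₁ μ₂) s

theorem CF.rename_last {Γ : Seq P} {X : NF P} {i : ℕ} {ν} (h : CF v (.node Γ (.leaf (X, i))) ν)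
    {N : ℕ} (hN : (Tree.node Γ (.leaf (X, N))).leaves.Nodup) :
    CF v (.node Γ (.leaf (X, N))) ν := by
  refine (Subst.rename X N _ _ _ h hN).of_eq ?_
  exact (congrArg (Form.pre ν) (MonoidalCategory.whiskerLeft_id _ _)).trans (Form.pre_id ν)

/-- The replacement also applies beside a further leaf `X`, which receives a fresh tag so that it
cannot clash with `T₁`. -/
theorem Rep.under {T₀ T₁ : Seq P} {e : T₁.ev (leafOb v) ⟶ T₀.ev (leafOb v)} (h : Rep v T₀ T₁ e)
    {Γ : Seq P} {X : NF P} {i : ℕ} {ν} (hν : CF v (.node (.node Γ T₀) (.leaf (X, i))) ν)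
    (hn : (Tree.node Γ T₁).leaves.Nodup) :
    ∃ j, CF v (.node (.node Γ T₁) (.leaf (X, j)))
      (Form.pre ν ((Γ.ev (leafOb v) ◁ e) ▷ of (X.obj v))) := by
  obtain ⟨N, hN⟩ := Seq.exists_bound (.node (.node Γ T₀) (.node Γ T₁))
  have h1 := hν.rename_last (N := N) (by
    have := hν.nodup
    simp at this hN ⊢
    grind)
  refine ⟨N, ((h _ _ (h1.str (.swapRight _ _ _)) ?_).str (.swapRight _ _ _)).of_eq ?_⟩
  · simp at hn hN ⊢
    grind
  · exact pre_swapRight _ _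

/-- If the replaced part has the first color, it lies in the first premise of the splitting. The
replacement is made there, and naturality of `R` brings it back to the conclusion. -/
theorem Splits.rep_true {χ : ℕ → Bool} {Φ T₀ T₁ : Seq P} {e : T₁.ev (leafOb v) ⟶ T₀.ev (leafOb v)}
    (h : Rep v T₀ T₁ e) {κ} (hκ : Splits v χ (.node Φ T₀) κ)
    (hn : (Tree.node Φ T₁).leaves.Nodup) {Γ' Δ : Seq P} {X Y : NF P} {k : ℕ}
    (hΦ : Φ.leaves.Perm (Tree.node (.node Γ' Δ) (.leaf (NF.bin .disj X Y, k))).leaves)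
    (h₀ : Seq.Mono χ true T₀) (hΓ : Seq.Mono χ true Γ') (hΔ : Seq.Mono χ false Δ)
    (hX : X.Mono χ true) (hY : Y.Mono χ false)
    {Γ : Seq P} (hΓ' : Γ.leaves.Perm (Tree.node Γ' T₁).leaves)
    {s : (Tree.node Φ T₁).ev (leafOb v) ⟶
      (Tree.node (.node Γ Δ) (.leaf (NF.bin .disj X Y, k))).ev (leafOb v)}
    (hs : Tree.Str (leafOb v) (.node Φ T₁) (.node (.node Γ Δ) (.leaf (NF.bin .disj X Y, k))) s) :
    ∃ i j μ₁ μ₂, CF v (.node Γ (.leaf (X, i))) μ₁ ∧ CF v (.node Δ (.leaf (Y, j))) μ₂ ∧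
      Form.pre κ (Φ.ev (leafOb v) ◁ e) = Form.pre (R μ₁ μ₂) s := by
  obtain ⟨r, hr⟩ := Tree.Str.exists (ob := leafOb v) hΦ
  obtain ⟨t, ht⟩ := Tree.Str.exists (ob := leafOb v) hΓ'
  obtain ⟨i, j, μ₁, μ₂, c₁, c₂, rfl⟩ := hκ _ _ X Y k _ ((hr.right T₀).comp (.insertLeft _ _ _ _))
    (Seq.mono_node.2 ⟨hΓ, h₀⟩) hΔ hX hY
  obtain ⟨i', c₃⟩ := h.under c₁ (by
    have := hs.perm.nodup_iff.1 hn
    simp only [Tree.leaves, List.nodup_append'] at this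
    exact hΓ'.nodup_iff.1 this.1.1)
  refine ⟨i', j, _, μ₂, c₃.str (ht.right _), c₂, ?_⟩
  exact R_insertLeft μ₁ μ₂ e t r (Tree.Str.unique (hs.comp ((ht.right _).right _))
    ((hr.right _).comp (.insertLeft _ _ _ _)) hn)

theorem Splits.rep_false {χ : ℕ → Bool} {Φ T₀ T₁ : Seq P} {e : T₁.ev (leafOb v) ⟶ T₀.ev (leafOb v)}
    (h : Rep v T₀ T₁ e) {κ} (hκ : Splits v χ (.node Φ T₀) κ)
    (hn : (Tree.node Φ T₁).leaves.Nodup) {Γ Δ' : Seq P} {X Y : NF P} {k : ℕ}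
    (hΦ : Φ.leaves.Perm (Tree.node (.node Γ Δ') (.leaf (NF.bin .disj X Y, k))).leaves)
    (h₀ : Seq.Mono χ false T₀) (hΓ : Seq.Mono χ true Γ) (hΔ : Seq.Mono χ false Δ')
    (hX : X.Mono χ true) (hY : Y.Mono χ false)
    {Δ : Seq P} (hΔ' : Δ.leaves.Perm (Tree.node Δ' T₁).leaves)
    {s : (Tree.node Φ T₁).ev (leafOb v) ⟶
      (Tree.node (.node Γ Δ) (.leaf (NF.bin .disj X Y, k))).ev (leafOb v)}
    (hs : Tree.Str (leafOb v) (.node Φ T₁) (.node (.node Γ Δ) (.leaf (NF.bin .disj X Y, k))) s) :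
    ∃ i j μ₁ μ₂, CF v (.node Γ (.leaf (X, i))) μ₁ ∧ CF v (.node Δ (.leaf (Y, j))) μ₂ ∧
      Form.pre κ (Φ.ev (leafOb v) ◁ e) = Form.pre (R μ₁ μ₂) s := by
  obtain ⟨r, hr⟩ := Tree.Str.exists (ob := leafOb v) hΦ
  obtain ⟨t, ht⟩ := Tree.Str.exists (ob := leafOb v) hΔ'
  obtain ⟨i, j, μ₁, μ₂, c₁, c₂, rfl⟩ := hκ _ _ X Y k _ ((hr.right T₀).comp (.insertRight _ _ _ _))
    hΓ (Seq.mono_node.2 ⟨hΔ, h₀⟩) hX hY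
  obtain ⟨j', c₃⟩ := h.under c₂ (by
    have := hs.perm.nodup_iff.1 hn
    simp only [Tree.leaves, List.nodup_append'] at this
    exact hΔ'.nodup_iff.1 this.1.2.1)
  refine ⟨i, j', μ₁, _, c₁, c₃.str (ht.right _), ?_⟩
  exact R_insertRight μ₁ μ₂ e t r (Tree.Str.unique (hs.comp ((ht.left _).right _))
    ((hr.right _).comp (.insertRight _ _ _ _)) hn)

end

/-! ### Splitting along a coloring, and uniqueness -/

section

open Aug DualPair

variable {P : Type u} {𝒞 : Type w} [Category.{w} 𝒞] [ProofNetCategory 𝒞] {v : P → 𝒞}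

attribute [local simp] Tree.leaves List.nodup_append'

theorem _root_.List.Perm.exists_of_append_subset {α : Type*} {F T G D : List α}
    (h : (F ++ T).Perm (G ++ D))
    (hn : T.Nodup) (hs : T ⊆ G) : ∃ G', G.Perm (G' ++ T) ∧ F.Perm (G' ++ D) := by
  obtain ⟨T', hT, hG⟩ := hn.subperm hs
  obtain ⟨G', hG'⟩ := hG.exists_perm_append
  have h1 : G.Perm (G' ++ T) :=
    hG'.trans ((hT.append_right _).trans List.perm_append_comm)
  refine ⟨G', h1, (List.perm_append_right_iff T).1 (h.trans ((h1.append_right D).trans ?_))⟩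
  rw [List.append_assoc, List.append_assoc]
  exact List.perm_append_comm.append_left _

theorem Splits.rep {χ : ℕ → Bool} {Φ T₀ T₁ : Seq P} {e : T₁.ev (leafOb v) ⟶ T₀.ev (leafOb v)}
    (h : Rep v T₀ T₁ e) {κ} (hκ : Splits v χ (.node Φ T₀) κ) (hn : (Tree.node Φ T₁).leaves.Nodup)
    {Γ Δ : Seq P} {X Y : NF P} {k : ℕ} {s : (Tree.node Φ T₁).ev (leafOb v) ⟶
      (Tree.node (.node Γ Δ) (.leaf (NF.bin .disj X Y, k))).ev (leafOb v)}
    (hs : Tree.Str (leafOb v) (.node Φ T₁) (.node (.node Γ Δ) (.leaf (NF.bin .disj X Y, k))) s)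
    (hΓ : Seq.Mono χ true Γ) (hΔ : Seq.Mono χ false Δ)
    (hX : X.Mono χ true) (hY : Y.Mono χ false) {c : Bool} (h₀ : Seq.Mono χ c T₀)
    (h₁ : Seq.Mono χ c T₁) :
    ∃ i j μ₁ μ₂, CF v (.node Γ (.leaf (X, i))) μ₁ ∧ CF v (.node Δ (.leaf (Y, j))) μ₂ ∧
      Form.pre κ (Φ.ev (leafOb v) ◁ e) = Form.pre (R μ₁ μ₂) s := by
  have hp := hs.perm
  simp only [Tree.leaves] at hp hn
  have hcases : ∀ a ∈ T₁.leaves, a ∈ Γ.leaves ∧ c = true ∨ a ∈ Δ.leaves ∧ c = false := by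
    intro a ha
    have h2 := hp.mem_iff.1 (List.mem_append_right _ ha)
    simp only [List.mem_append, List.mem_singleton] at h2
    rcases h2 with (h2 | h2) | rfl
    · exact .inl ⟨h2, (h₁ a ha).unique (hΓ a h2)⟩
    · exact .inr ⟨h2, (h₁ a ha).unique (hΔ a h2)⟩
    -- The disjunction to be split cannot belong to `T₁`: its two halves have different colors,
    -- while `T₁` has only one.
    · have h3 := NF.mono_bin.1 (h₁ _ ha)
      exact absurd ((hX.unique h3.1).trans (h3.2.unique hY)) (by simp)
  cases c
  · obtain ⟨D, hD, hF⟩ := List.Perm.exists_of_append_subset (G := Δ.leaves)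
      (D := Γ.leaves ++ [(NF.bin .disj X Y, k)]) (hp.trans (by
        rw [← List.append_assoc]
        exact List.perm_append_comm.append_right _)) hn.of_append_right
      fun a ha => by simpa using hcases a ha
    rw [← Tree.leaves_ofList D] at hD hF
    refine rep_false h hκ hn (hF.trans ?_) h₀ hΓ (fun a ha => hΔ a ?_) hX hY hD hs
    · simp only [Tree.leaves]
      rw [← List.append_assoc]
      exact List.perm_append_comm.append_right _
    · exact hD.mem_iff.2 (List.mem_append_left _ ha)
  · obtain ⟨G, hG, hF⟩ := List.Perm.exists_of_append_subset (G := Γ.leaves)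
      (D := Δ.leaves ++ [(NF.bin .disj X Y, k)]) (hp.trans (by
        rw [← List.append_assoc])) hn.of_append_right
      fun a ha => by simpa using hcases a ha
    rw [← Tree.leaves_ofList G] at hG hF
    refine rep_true h hκ hn (hF.trans ?_) h₀ (fun a ha => hΓ a ?_) hΔ hX hY hG hs
    · simp only [Tree.leaves]
      rw [← List.append_assoc]
    · exact hG.mem_iff.2 (List.mem_append_left _ ha)

theorem R_transport {Γ Γ' Δ Δ' : Aug 𝒞} {A B : 𝒞} (ν : Form (Γ ⊗ of A)) (μ : Form (Δ ⊗ of B))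
    (f : Γ' ⟶ Γ) (g : Δ' ⟶ Δ) {s : (Γ ⊗ Δ) ⊗ of (A ⋎ B) ⟶ (Γ' ⊗ Δ') ⊗ of (A ⋎ B)}
    (hs : s ≫ (f ⊗ₘ g) ▷ _ = 𝟙 _) :
    R ν μ = Form.pre (R (Form.pre ν (f ▷ of A)) (Form.pre μ (g ▷ of B))) s := by
  rw [R_pre_left, ← Form.pre_comp, hs, Form.pre_id]

theorem _root_.ProofNet.Tree.Str.tensor {α : Type*} {ob : α → Aug 𝒞} {S S' T T' : Tree α} {f g}
    (hf : Tree.Str ob S S' f) (hg : Tree.Str ob T T' g) :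
    Tree.Str ob (.node S T) (.node S' T') (f ⊗ₘ g) := by
  rw [MonoidalCategory.tensorHom_def]
  exact (hf.right _).comp (hg.left _)

/-- Moving the first part of a context back. -/
def unshuffle (Γ Δ X : Aug 𝒞) : Δ ⊗ (Γ ⊗ X) ⟶ (Γ ⊗ Δ) ⊗ X :=
  (α_ Δ Γ X).inv ≫ (β_ Δ Γ).hom ▷ X

theorem R_eq_of_left {Γ Δ M : Aug 𝒞} {A B : 𝒞} (ν : Form (Γ ⊗ of A)) (μ : Form (Δ ⊗ of B))
    {s : (Γ ⊗ Δ) ⊗ of (A ⋎ B) ⟶ M} {κ : Form M}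
    (h : Form.pre ν (Γ ◁ (Δ ◁ arr (commDisj B A) ≫ elim μ A)) =
      Form.pre κ ((α_ _ _ _).inv ≫ s)) : R ν μ = Form.pre κ s := by
  rw [R_right, Form.pre_comp, h, ← Form.pre_comp, Iso.hom_inv_id_assoc]

theorem R_eq_of_right {Γ Δ M : Aug 𝒞} {A B : 𝒞} (ν : Form (Γ ⊗ of A)) (μ : Form (Δ ⊗ of B))
    {s : (Γ ⊗ Δ) ⊗ of (A ⋎ B) ⟶ M} {κ : Form M}
    (h : Form.pre μ (Δ ◁ elim ν B) = Form.pre κ (unshuffle _ _ _ ≫ s)) :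
    R ν μ = Form.pre κ s := by
  have e : shuffle Γ Δ (of (A ⋎ B)) ≫ unshuffle _ _ _ = 𝟙 _ := by
    simp [shuffle, unshuffle, ← comp_whiskerRight]
  rw [R, Form.pre_comp, h, ← Form.pre_comp, reassoc_of% e]

/-- This is permutation of rules. A last rule other than the one that introduces the given
disjunction acts on formulae of one color, by connectedness of derivations, so it can be moved into
one premise of the splitting. -/
theorem CF.splits {T : Seq P} {ν} (h : CF v T ν) (χ : ℕ → Bool) : Splits v χ T ν := by
  induction h with
  | ax p l m n =>
    intro Γ Δ X Y k s hs
    have := hs.perm.mem_iff (a := (NF.bin .disj X Y, k))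
    simp at this
  | @str S T ν s₀ h hs₀ ih =>
    intro Γ Δ X Y k s hs hΓ hΔ hX hY
    obtain ⟨t, ht⟩ := Tree.Str.exists (ob := leafOb v) (hs₀.perm.symm.trans hs.perm)
    obtain ⟨i, j, μ₁, μ₂, c₁, c₂, rfl⟩ := ih Γ Δ X Y k t ht hΓ hΔ hX hY
    refine ⟨i, j, μ₁, μ₂, c₁, c₂, ?_⟩
    rw [← Form.pre_comp, Tree.Str.unique (hs₀.comp ht) hs (h.str hs₀).nodup]
  | @conj Θ Z W i j k' κ h hn ih =>
    intro Γ Δ X Y k s hs hΓ hΔ hX hY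
    obtain ⟨c, hc⟩ : ∃ c, (NF.bin .conj Z W).Mono χ c := by
      have := hs.perm.mem_iff (a := (NF.bin .conj Z W, k'))
      simp at this
      exact this.elim (fun h => ⟨_, hΓ _ h⟩) (fun h => ⟨_, hΔ _ h⟩)
    obtain ⟨i', j', μ₁, μ₂, c₁, c₂, h2⟩ := ih.rep (Rep.conj Z W i j k') hn hs hΓ hΔ hX hY (c := c)
      (by simpa [NF.mono_bin] using hc) (by simpa using hc)
    have e : Form.pre κ (Θ.ev (leafOb v) ◁ 𝟙 (of (Z.obj v ⋏ W.obj v))) = κ :=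
      (congrArg (Form.pre κ) (MonoidalCategory.whiskerLeft_id _ _)).trans (Form.pre_id κ)
    exact ⟨i', j', μ₁, μ₂, c₁, c₂, e.symm.trans h2⟩
  | @disj Φ Ψ Z W i j k' ν μ h₁ h₂ hn ih₁ ih₂ =>
    intro Γ Δ X Y k s hs hΓ hΔ hX hY
    -- If the last rule introduces the given disjunction itself, tag included, connectedness makes
    -- each premise monochromatic. The two contexts then agree with `Γ` and `Δ` up to permutation.
    by_cases hP : (NF.bin .disj Z W, k') = (NF.bin .disj X Y, k)
    · cases hP
      have hp : (Φ.leaves ++ Ψ.leaves).Perm (Γ.leaves ++ Δ.leaves) :=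
        (List.perm_append_right_iff _).1 hs.perm
      have hmono : ∀ a ∈ Φ.leaves ++ Ψ.leaves, ∃ c, a.1.Mono χ c := fun a ha =>
        (List.mem_append.1 (hp.mem_iff.1 ha)).elim (fun h => ⟨_, hΓ a h⟩) (fun h => ⟨_, hΔ a h⟩)
      have hΦ : Seq.Mono χ true Φ := by
        obtain ⟨c, hc⟩ := h₁.connected (χ := χ) fun a ha => by
          rcases List.mem_append.1 ha with ha | ha
          · exact hmono a (List.mem_append_left _ ha)
          · cases List.mem_singleton.1 ha
            exact ⟨_, hX⟩
        rw [Seq.mono_node, Seq.mono_leaf] at hc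
        exact (hc.2.unique hX) ▸ hc.1
      have hΨ : Seq.Mono χ false Ψ := by
        obtain ⟨c, hc⟩ := h₂.connected (χ := χ) fun a ha => by
          rcases List.mem_append.1 ha with ha | ha
          · exact hmono a (List.mem_append_right _ ha)
          · cases List.mem_singleton.1 ha
            exact ⟨_, hY⟩
        rw [Seq.mono_node, Seq.mono_leaf] at hc
        exact (hc.2.unique hY) ▸ hc.1
      have hn' := hn
      simp only [Tree.leaves, List.nodup_append'] at hn'
      have hn₂ := hp.nodup_iff.1 (List.nodup_append'.2 hn'.1)
      have hTF : ∀ a : NF P × ℕ, a.1.Mono χ true → ¬ a.1.Mono χ false := fun a h h' =>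
        absurd (h.unique h') (by simp)
      have hm : ∀ a, (a ∈ Φ.leaves ∨ a ∈ Ψ.leaves) ↔ (a ∈ Γ.leaves ∨ a ∈ Δ.leaves) := fun a => by
        simpa using hp.mem_iff (a := a)
      obtain ⟨f, hf⟩ := Tree.Str.exists (ob := leafOb v) (S := Γ) (T := Φ)
        ((List.perm_ext_iff_of_nodup hn₂.of_append_left hn'.1.1).2 fun a =>
          ⟨fun ha => ((hm a).2 (.inl ha)).resolve_right fun h => hTF a (hΓ a ha) (hΨ a h),
            fun ha => ((hm a).1 (.inl ha)).resolve_right fun h => hTF a (hΦ a ha) (hΔ a h)⟩)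
      obtain ⟨g, hg⟩ := Tree.Str.exists (ob := leafOb v) (S := Δ) (T := Ψ)
        ((List.perm_ext_iff_of_nodup hn₂.of_append_right hn'.1.2.1).2 fun a =>
          ⟨fun ha => ((hm a).2 (.inr ha)).resolve_left fun h => hTF a (hΦ a h) (hΔ a ha),
            fun ha => ((hm a).1 (.inr ha)).resolve_left fun h => hTF a (hΓ a h) (hΨ a ha)⟩)
      exact ⟨i, j, _, _, h₁.str (hf.right _), h₂.str (hg.right _), R_transport _ _ _ _
        (Tree.Str.unique (hs.comp ((hf.tensor hg).right _)) (.id _) hn)⟩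
    · have hmono : ∀ a ∈ (Φ.leaves ++ Ψ.leaves) ++ [(NF.bin .disj Z W, k')],
          a ≠ (NF.bin .disj X Y, k) → ∃ c, a.1.Mono χ c := fun a ha hne => by
        have h := hs.perm.mem_iff.1 ha
        simp only [Tree.leaves, List.mem_append, List.mem_singleton, hne, or_false] at h
        exact h.elim (fun h => ⟨_, hΓ a h⟩) (fun h => ⟨_, hΔ a h⟩)
      obtain ⟨c, hc⟩ := hmono _ (by simp) hP
      have hc' := NF.mono_bin.1 hc
      have hmem := hs.perm.mem_iff (a := (NF.bin .disj X Y, k))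
      have hn' := hn
      simp only [Tree.leaves, List.mem_append, List.mem_singleton, or_true, iff_true,
        Ne.symm hP, or_false] at hmem
      simp only [Tree.leaves, List.nodup_append'] at hn'
      rcases hmem with hmem | hmem
      -- The disjunction to be split lies in the first premise, so every formula of the second one
      -- has a color and connectedness gives all of them the color of `W`. The last rule can thus be
      -- performed after splitting the first premise.
      · have hΨ : Seq.Mono χ c Ψ := by
          obtain ⟨d, hd⟩ := h₂.connected (χ := χ) fun a ha => by
            rcases List.mem_append.1 ha with ha | ha
            · refine hmono a (by simp [ha]) ?_
              rintro rfl
              exact hn'.1.2.2 hmem ha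
            · cases List.mem_singleton.1 ha
              exact ⟨_, hc'.2⟩
          rw [Seq.mono_node, Seq.mono_leaf] at hd
          exact (hd.2.unique hc'.2) ▸ hd.1
        have hi : Tree.Str (leafOb v) (.node Φ (.node Ψ (.leaf (NF.bin .disj Z W, k'))))
          (.node (.node Φ Ψ) (.leaf (NF.bin .disj Z W, k'))) _ := .assocInv _ _ _
        obtain ⟨i', j', μ₁, μ₂, c₁, c₂, h2⟩ := ih₁.rep (Rep.disjLeft k' h₂)
          (hi.perm.nodup_iff.2 hn) (hi.comp hs) hΓ hΔ hX hY (c := c)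
          (by simpa using hc'.1) (by simpa using ⟨hΨ, hc⟩)
        refine ⟨i', j', μ₁, μ₂, c₁, c₂, ?_⟩
        exact R_eq_of_left _ _ h2
      · have hΦ : Seq.Mono χ c Φ := by
          obtain ⟨d, hd⟩ := h₁.connected (χ := χ) fun a ha => by
            rcases List.mem_append.1 ha with ha | ha
            · refine hmono a (by simp [ha]) ?_
              rintro rfl
              exact hn'.1.2.2 ha hmem
            · cases List.mem_singleton.1 ha
              exact ⟨_, hc'.1⟩
          rw [Seq.mono_node, Seq.mono_leaf] at hd
          exact (hd.2.unique hc'.1) ▸ hd.1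
        have hi : Tree.Str (leafOb v) (.node Ψ (.node Φ (.leaf (NF.bin .disj Z W, k'))))
          (.node (.node Φ Ψ) (.leaf (NF.bin .disj Z W, k'))) (unshuffle _ _ _) :=
            (Tree.Str.assocInv _ _ _).comp ((Tree.Str.braid _ _).right _)
        obtain ⟨i', j', μ₁, μ₂, c₁, c₂, h2⟩ := ih₂.rep (Rep.disjRight k' h₁)
          (hi.perm.nodup_iff.2 hn) (hi.comp hs) hΓ hΔ hX hY (c := c)
          (by simpa using hc'.2) (by simpa using ⟨hΦ, hc⟩)
        refine ⟨i', j', μ₁, μ₂, c₁, c₂, ?_⟩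
        exact R_eq_of_right _ _ h2

/-- A sequent of literals can only come from an axiom and structural arrows, and coherence leaves no
choice for the latter. -/
theorem CF.eq_ax {T : Seq P} {μ} (h : CF v T μ) {p : P} {l m n : ℕ} {s}
    (hs : Tree.Str (leafOb v) T (.node (.leaf (.lit p l true, m)) (.leaf (.lit p l false, n))) s) :
    μ = Form.pre (ofNeg (v p)).form s := by
  induction h with
  | ax p' l' m' n' =>
    have h1 := hs.perm.mem_iff (a := (NF.lit p' l' true, m'))
    have h2 := hs.perm.mem_iff (a := (NF.lit p' l' false, n'))
    simp at h1 h2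
    obtain ⟨⟨rfl, rfl⟩, rfl⟩ := h1
    obtain ⟨-, rfl⟩ := h2
    have e : s = 𝟙 _ := hs.unique (.id _) (by simp)
    rw [e]
    exact (Form.pre_id _).symm
  | @str S T ν s₀ h hs₀ ih =>
    obtain ⟨t, ht⟩ := Tree.Str.exists (ob := leafOb v) (hs₀.perm.symm.trans hs.perm)
    rw [ih ht, ← Form.pre_comp, Tree.Str.unique (hs₀.comp ht) hs (h.str hs₀).nodup]
  | @conj Θ Z W i j k =>
    have := hs.perm.mem_iff (a := (NF.bin .conj Z W, k))
    simp at this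
  | @disj Φ Ψ Z W i j k =>
    have := hs.perm.mem_iff (a := (NF.bin .disj Z W, k))
    simp at this

/-- A sequent in which every label occurs at most twice has at most one derivable form. -/
theorem CF.unique {T : Seq P} {ν} (h : CF v T ν) (hT : ∀ l, (Seq.labels T).count l ≤ 2) {μ}
    (hμ : CF v T μ) : ν = μ := by
  induction h with
  | ax p l m n => exact (Form.pre_id _).symm.trans (hμ.eq_ax (.id _)).symm
  | @str S T ν s h hs ih =>
    obtain ⟨t, ht⟩ := Tree.Str.exists (ob := leafOb v) hs.perm.symm
    rw [ih (fun l => (Seq.labels_perm hs.perm).count_eq l ▸ hT l) (hμ.str ht), ← Form.pre_comp,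
      Tree.Str.unique (hs.comp ht) (.id _) hμ.nodup, Form.pre_id]
  | @conj Θ X Y i j k ν h hn ih =>
    have h1 := h.nodup
    -- Invertibility turns the second derivation into one of the same premise.
    have h2 := Subst.split X Y i j _ _ _ hμ h1
    refine (ih (fun l => by simpa [NF.labels] using hT l) h2).trans ?_
    exact (congrArg (Form.pre _) (MonoidalCategory.whiskerLeft_id _ _)).trans (Form.pre_id _)
  | @disj Γ Δ X Y i j k ν₁ ν₂ h₁ h₂ hn ih₁ ih₂ =>
    simp only [Seq.labels_node, Seq.labels_leaf, NF.labels, List.count_append] at hT ih₁ ih₂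
    -- The labels of the first premise are colored `true`. A label occurring in both premises would
    -- occur at least twice in each, by parity, hence four times in the conclusion. So the coloring
    -- separates the premises, and the second derivation splits in the same way.
    let χ : ℕ → Bool := fun l => decide (l ∈ Seq.labels Γ ++ X.labels)
    have hχ : ∀ l ∈ Seq.labels Δ ++ Y.labels, χ l = false := by
      intro l hl
      rw [decide_eq_false_iff_not]
      intro hl'
      have e₁ := h₁.even_count l
      have e₂ := h₂.even_count l
      have p₁ := List.count_pos_iff.2 hl
      have p₂ := List.count_pos_iff.2 hl'
      have := hT l
      simp only [Seq.labels_node, Seq.labels_leaf, List.count_append] at e₁ e₂ p₁ p₂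
      obtain ⟨r, hr⟩ := e₁
      obtain ⟨s, hs⟩ := e₂
      omega
    obtain ⟨i', j', μ₁, μ₂, c₁, c₂, e⟩ := hμ.splits χ Γ Δ X Y k _ (.id _)
      (fun a ha l hl => decide_eq_true (List.mem_append_left _ (List.mem_flatMap.2 ⟨a, ha, hl⟩)))
      (fun a ha l hl => hχ l (List.mem_append_left _ (List.mem_flatMap.2 ⟨a, ha, hl⟩)))
      (fun l hl => decide_eq_true (List.mem_append_right _ hl))
      (fun l hl => hχ l (List.mem_append_right _ hl))
    rw [e.trans (Form.pre_id _), ih₁ (fun l => by have := hT l; omega) (c₁.rename_last h₁.nodup),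
      ih₂ (fun l => by have := hT l; omega) (c₂.rename_last h₂.nodup)]

end

section

/-! ### Coherence -/

open Aug DualPair

variable {P : Type u}

theorem NF.labels_dual : (X : NF P) → X.dual.labels = X.labels
  | lit _ _ _ => rfl
  | bin .conj X Y => congrArg₂ (· ++ ·) X.labels_dual Y.labels_dual
  | bin .disj X Y => congrArg₂ (· ++ ·) X.labels_dual Y.labels_dual

theorem Formula.count_labels_nnf (A : Formula P) (a : A.Occ → ℕ) (l : ℕ) :
    (A.nnf a).labels.count l = Nat.card {x : A.Occ // a x = l} := by
  induction A with
  | letter p =>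
    by_cases h : a () = l
    · have : Unique {x : Unit // a x = l} := ⟨⟨⟨(), h⟩⟩, fun _ => rfl⟩
      exact (by simp [nnf, NF.labels, h] : _ = 1).trans
        (Nat.card_unique (α := {x : Unit // a x = l})).symm
    · have : IsEmpty {x : Unit // a x = l} := ⟨fun x => h x.2⟩
      exact (by simp [nnf, NF.labels, h] : _ = 0).trans
        (Nat.card_of_isEmpty (α := {x : Unit // a x = l})).symm
  | neg A ih =>
    rw [nnf, NF.labels_dual]
    exact ih a
  | bin ξ A B ihA ihB =>
    rw [nnf, NF.labels, List.count_append, ihA, ihB, ← Nat.card_sum]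
    exact Nat.card_congr (Equiv.subtypeSum (p := fun x : A.Occ ⊕ B.Occ => a x = l)).symm

/-- A labelling that distinguishes the classes of a split equivalence. -/
theorem BrauerianSplit.exists_labels {X Y : Type} [Finite X] [Finite Y] (R : BrauerianSplit X Y) :
    ∃ (a : X → ℕ) (b : Y → ℕ), R.Respects a b ∧
      ∀ l, Nat.card {x // a x = l} + Nat.card {y // b y = l} ≤ 2 := by
  obtain ⟨n, ⟨e⟩⟩ := Finite.exists_equiv_fin (X ⊕ Y)
  -- A class is labelled by the smaller of the numbers of its two elements, so different classes
  -- have different labels.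
  let lab : X ⊕ Y → ℕ := fun u => min (e u) (e (R.partner u))
  have hlab : Sum.elim (fun x => lab (.inl x)) (fun y => lab (.inr y)) = lab := by
    funext u
    cases u <;> rfl
  refine ⟨fun x => lab (.inl x), fun y => lab (.inr y), fun u w h => ?_, fun l => ?_⟩
  · rw [hlab]
    by_cases hw : w = u
    · rw [hw]
    · rw [R.eq_partner h hw]
      simp only [lab, partner_partner]
      exact min_comm _ _
  · rw [← Nat.card_sum, ← Nat.card_congr (Equiv.subtypeSum (p := fun u => lab u = l))]
    rcases isEmpty_or_nonempty {u // lab u = l} with h | ⟨u, hu⟩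
    · simp
    obtain ⟨w, hw⟩ : ∃ w, (e w : ℕ) = l := by
      rcases min_choice (e u : ℕ) (e (R.partner u)) with h | h
      · exact ⟨u, h.symm.trans hu⟩
      · exact ⟨_, h.symm.trans hu⟩
    have hsub : {u | lab u = l} ⊆ {w, R.partner w} := by
      intro z hz
      have hz' : min (e z : ℕ) (e (R.partner z)) = l := hz
      rcases min_choice (e z : ℕ) (e (R.partner z)) with h | h
      · exact .inl (e.injective (Fin.ext ((h.symm.trans hz').trans hw.symm)))
      · have : R.partner z = w := e.injective (Fin.ext ((h.symm.trans hz').trans hw.symm))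
        exact .inr ((R.partner_partner z).symm.trans (congrArg _ this))
    exact (Set.ncard_le_ncard hsub (Set.toFinite _)).trans
      ((Set.ncard_insert_le _ _).trans (by simp))

/-- Arrow terms with the same graph are equal in `PN^¬`. -/
theorem ArrowTerm.arrow_eq_of_graph_eq {A B : Formula P} {f g : ArrowTerm A B}
    (h : f.graph = g.graph) : f.arrow = g.arrow := by
  obtain ⟨a, b, hr, hc⟩ := f.graph.exists_labels
  -- The term acts on the identity derivation of the normal form of `B`. The resulting sequent
  -- depends on the labels `a` and `b` but not on `t`, and its form is the transpose of `t` up to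
  -- the isomorphisms with normal forms.
  have key (t : ArrowTerm A B) (ht : t.graph.Respects a b) :
      CF PN.letter (.node (.leaf ((B.nnf b).dual, 0)) (.leaf (A.nnf a, 1)))
        (Form.pre ((B.nnf b).dp PN.letter).swap.form
          (of _ ◁ arr ((A.iota a).inv ≫ t.arrow ≫ (B.iota b).hom))) :=
    t.admissibleVia a b ht 1 1 (.leaf ((B.nnf b).dual, 0)) _
      ((B.nnf b).ident_dp.swap 0 1) (by simp [Tree.leaves])
  have e := (key f hr).unique (fun l => by
    rw [Seq.labels_node, Seq.labels_leaf, Seq.labels_leaf, NF.labels_dual, List.count_append,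
      Formula.count_labels_nnf, Formula.count_labels_nnf, add_comm]
    exact hc l) (key g (h ▸ hr))
  have e₂ := Hom.arr.inj (((B.nnf b).dp PN.letter).swap.form_injectiveR e)
  rwa [Iso.cancel_iso_inv_left, Iso.cancel_iso_hom_right] at e₂

end

section

/-! ### Consequences of coherence -/

variable {P : Type u}

theorem BrauerianSplit.relabel_injective {X Y X' Y' : Type} (e : X ≃ X') (f : Y ≃ Y') :
    Function.Injective (relabel e f) := by
  intro R S h
  refine ext_rel fun u w => ?_
  have h₂ := congrArg (fun T : BrauerianSplit X' Y' => T.rel (Sum.map e f u) (Sum.map e f w)) h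
  simpa [relabel_rel, Sum.map_map] using h₂

theorem ArrowTerm.arrow_eq_iff {A B : Formula P} {f g : ArrowTerm A B} :
    f.arrow = g.arrow ↔ Equation f g :=
  Quotient.eq (r := ArrowTerm.setoid A B)

theorem ArrowTerm.arrow_eq_iff_graph {A B : Formula P} {f g : ArrowTerm A B} :
    f.arrow = g.arrow ↔ f.graph = g.graph :=
  ⟨fun h => (arrow_eq_iff.1 h).sound, arrow_eq_of_graph_eq⟩

theorem ArrowTerm.map_arrow_eq_iff {A B : Formula P} {f g : ArrowTerm A B} :
    (PN.G P).map f.arrow = (PN.G P).map g.arrow ↔ f.graph = g.graph :=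
  (BrauerianSplit.relabel_injective A.number B.number).eq_iff

/-- The equations of `PN^¬` hold in every proof-net category. -/
theorem ArrowTerm.Equation.interp_eq {𝒞 : Type w} [Category.{z} 𝒞] [ProofNetCategory 𝒞] (v : P → 𝒞)
    {A B : Formula P} {f g : ArrowTerm A B} (h : Equation f g) : f.interp v = g.interp v := by
  induction h with
  | refl f => rfl
  | symm _ ih => exact ih.symm
  | trans _ _ ih₁ ih₂ => exact ih₁.trans ih₂
  | cong_comp _ _ ih₁ ih₂ => exact congrArg₂ (fun f g => g ≫ f) ih₁ ih₂
  | cong_bin ξ _ _ ih₁ ih₂ => exact congrArg₂ (binMap ξ) ih₁ ih₂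
  | comp_id f => exact Category.id_comp _
  | id_comp f => exact Category.comp_id _
  | assoc h g f => exact Category.assoc _ _ _
  | bin_id ξ A B => exact ProofNetCategory.bin_id _ _ _
  | bin_comp ξ g₁ f₁ g₂ f₂ => exact ProofNetCategory.bin_comp _ _ _ _ _
  | assocTo_nat ξ f g h => exact ProofNetCategory.assocTo_nat _ _ _ _
  | commConj_nat f g => exact ProofNetCategory.commConj_nat _ _
  | commDisj_nat f g => exact ProofNetCategory.commDisj_nat _ _
  | dissoc_nat f g h => exact ProofNetCategory.dissoc_nat _ _ _
  | assocFrom_assocTo ξ A B C => exact ProofNetCategory.assocFrom_assocTo _ _ _ _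
  | assocTo_assocFrom ξ A B C => exact ProofNetCategory.assocTo_assocFrom _ _ _ _
  | pentagon ξ A B C D => exact ProofNetCategory.pentagon _ _ _ _ _
  | commConj_commConj A B => exact ProofNetCategory.commConj_commConj _ _
  | commDisj_commDisj A B => exact ProofNetCategory.commDisj_commDisj _ _
  | hexagonConj A B C => exact ProofNetCategory.hexagonConj _ _ _
  | hexagonDisj A B C => exact ProofNetCategory.hexagonDisj _ _ _
  | dissoc_conj A B C D => exact ProofNetCategory.dissoc_conj _ _ _ _
  | dissoc_disj A B C D => exact ProofNetCategory.dissoc_disj _ _ _ _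
  | dissoc_assocConj A B C D => exact ProofNetCategory.dissoc_assocConj _ _ _ _
  | dissoc_assocDisj A B C D => exact ProofNetCategory.dissoc_assocDisj _ _ _ _
  | deltaConj_nat B f => exact ProofNetCategory.deltaConj_nat _ _
  | sigmaDisj_nat B f => exact ProofNetCategory.sigmaDisj_nat _ _
  | assocConj_deltaConj A B C => exact ProofNetCategory.assocConj_deltaConj _ _ _
  | assocDisj_sigmaDisj A B C => exact ProofNetCategory.assocDisj_sigmaDisj _ _ _
  | dissoc_sigmaConj A B C => exact ProofNetCategory.dissoc_sigmaConj _ _ _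
  | dissoc_deltaDisj A B C => exact ProofNetCategory.dissoc_deltaDisj _ _ _
  | sigmaDisj_deltaConj A => exact ProofNetCategory.sigmaDisj_deltaConj _
  | sigmaDisjPrime_deltaConjPrime A => exact ProofNetCategory.sigmaDisjPrime_deltaConjPrime _

theorem PN.faithful_G : (PN.G P).Faithful where
  map_injective {A B f g} := by
    induction f using Quotient.inductionOn with | h f => ?_
    induction g using Quotient.inductionOn with | h g => ?_
    exact fun h => ArrowTerm.arrow_eq_of_graph_eq (ArrowTerm.map_arrow_eq_iff.1 h)

end

section

/-! ### The computation of graphs -/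

/-- The renaming given by a list of pairs: the last pair is applied first. -/
def renameLabel (ρ : List (ℕ × ℕ)) (z : ℕ) : ℕ :=
  ρ.foldr (fun p z => if z = p.1 then p.2 else z) z

/-- A renaming that identifies the two components of every pair of a list. -/
def unifier (l : List (ℕ × ℕ)) : List (ℕ × ℕ) :=
  l.foldr (fun p ρ => (renameLabel ρ p.2, renameLabel ρ p.1) :: ρ) []

theorem renameLabel_unifier_cons (p : ℕ × ℕ) (l : List (ℕ × ℕ)) (z : ℕ) :
    renameLabel (unifier (p :: l)) z =
      if renameLabel (unifier l) z = renameLabel (unifier l) p.2 then renameLabel (unifier l) p.1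
      else renameLabel (unifier l) z := rfl

theorem renameLabel_unifier_eq {l : List (ℕ × ℕ)} {p : ℕ × ℕ} (hp : p ∈ l) :
    renameLabel (unifier l) p.1 = renameLabel (unifier l) p.2 := by
  induction l with
  | nil => simp at hp
  | cons q l ih =>
    rw [renameLabel_unifier_cons, renameLabel_unifier_cons]
    rcases List.mem_cons.1 hp with rfl | hp
    · simp
    · rw [ih hp]

/-- A property that does not distinguish the components of any pair is invariant under the renaming.
Applied to connectedness, this shows that the unifier identifies no more than it has to. -/
theorem iff_renameLabel_unifier {g : ℕ → Prop} {l : List (ℕ × ℕ)}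
    (hg : ∀ p ∈ l, g p.1 ↔ g p.2) (z : ℕ) : g (renameLabel (unifier l) z) ↔ g z := by
  induction l generalizing z with
  | nil => rfl
  | cons q l ih =>
    have ih := ih fun p hp => hg p (List.mem_cons_of_mem _ hp)
    rw [renameLabel_unifier_cons]
    split_ifs with h
    · rw [ih, hg q List.mem_cons_self, ← ih q.2, ← h, ih]
    · exact ih z

/-- The labels of the occurrences of letters in the source and in the target of an arrow. -/
abbrev Labelling := List ℕ × List ℕ

namespace Labelling

/-- The labelling of a juxtaposition. -/
def juxtapose (x y : Labelling) : Labelling :=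
  (x.1.map (2 * ·) ++ y.1.map (2 * · + 1), x.2.map (2 * ·) ++ y.2.map (2 * · + 1))

/-- The labelling of a commutation. -/
def comm (x y : Labelling) : Labelling :=
  (x.1.map (2 * ·) ++ y.1.map (2 * · + 1), y.1.map (2 * · + 1) ++ x.1.map (2 * ·))

/-- The labelling of an arrow that creates the second argument twice. -/
def caps (y x : Labelling) : Labelling :=
  (x.1.map (2 * ·), x.1.map (2 * ·) ++ (y.1.map (2 * · + 1) ++ y.1.map (2 * · + 1)))

/-- The labelling of an arrow that deletes the second argument twice. -/
def cups (y x : Labelling) : Labelling :=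
  ((y.1.map (2 * · + 1) ++ y.1.map (2 * · + 1)) ++ x.1.map (2 * ·), x.1.map (2 * ·))

/-- The renaming used in the composite of `y` and `x`. -/
def glue (y x : Labelling) : List (ℕ × ℕ) :=
  unifier ((List.range x.2.length).map fun i => (2 * x.2.getI i, 2 * y.1.getI i + 1))

/-- The labelling of the composite of `y` and `x`. -/
def comp (y x : Labelling) : Labelling :=
  (x.1.map fun a => renameLabel (glue y x) (2 * a),
    y.2.map fun a => renameLabel (glue y x) (2 * a + 1))

/-- The matrix of the kernel of a labelling. -/
def kernel (x : Labelling) : List (List Bool) :=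
  (x.1 ++ x.2).map fun a => (x.1 ++ x.2).map fun b => decide (a = b)

/-- The action of a symbol of Polish notation on a stack of labellings. -/
def step (c : ℕ) (st : List Labelling) : List Labelling :=
  if c = 0 ∨ c = 3 then st
  else if c = 1 ∨ c = 2 ∨ c = 14 ∨ c = 15 then juxtapose st.headI st.tail.headI :: st.tail.tail
  else if c = 8 then comm st.headI st.tail.headI :: st.tail.tail
  else if c = 9 then comm st.tail.headI st.headI :: st.tail.tail
  else if c = 11 then caps st.headI st.tail.headI :: st.tail.tail
  else if c = 12 then cups st.headI st.tail.headI :: st.tail.tail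
  else if c = 13 then comp st.headI st.tail.headI :: st.tail.tail
  -- The codes that remain are those of the two associativities and of `d`, all with three formulae
  -- as arguments. Their graphs preserve the order of the letters.
  else if c < 16 then
    juxtapose (juxtapose st.headI st.tail.headI) st.tail.tail.headI :: st.tail.tail.tail
  -- A letter; which one does not affect the graph.
  else ([0], [0]) :: st

/-- The evaluation of a word in Polish notation. -/
def run (w : List ℕ) : List Labelling :=
  -- The word is read from its right end, so the arguments of a symbol are on the stack, the first
  -- one on top, when the symbol is reached.
  w.foldr step []

section Computability

open Primrec

theorem primrec_renameLabel : Primrec₂ renameLabel :=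
  list_foldr fst snd (Primrec.ite (Primrec.eq.comp (snd.comp snd) (fst.comp (fst.comp snd)))
    (snd.comp (fst.comp snd)) (snd.comp snd)).to₂

theorem primrec_unifier : Primrec unifier :=
  list_foldr .id (.const []) (list_cons.comp (Primrec.pair
    (primrec_renameLabel.comp (snd.comp snd) (snd.comp (fst.comp snd)))
    (primrec_renameLabel.comp (snd.comp snd) (fst.comp (fst.comp snd)))) (snd.comp snd)).to₂

theorem primrec_map_double : Primrec (List.map (2 * ·) : List ℕ → List ℕ) :=
  list_map .id (nat_double.comp snd).to₂

theorem primrec_map_double_succ : Primrec (List.map (2 * · + 1) : List ℕ → List ℕ) :=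
  list_map .id (nat_double_succ.comp snd).to₂

theorem primrec_juxtapose : Primrec₂ juxtapose :=
  Primrec.pair
    (list_append.comp (primrec_map_double.comp (fst.comp fst))
      (primrec_map_double_succ.comp (fst.comp snd)))
    (list_append.comp (primrec_map_double.comp (snd.comp fst))
      (primrec_map_double_succ.comp (snd.comp snd)))

theorem primrec_comm : Primrec₂ comm :=
  Primrec.pair
    (list_append.comp (primrec_map_double.comp (fst.comp fst))
      (primrec_map_double_succ.comp (fst.comp snd)))
    (list_append.comp (primrec_map_double_succ.comp (fst.comp snd))
      (primrec_map_double.comp (fst.comp fst)))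

theorem primrec_caps : Primrec₂ caps :=
  Primrec.pair (primrec_map_double.comp (fst.comp snd))
    (list_append.comp (primrec_map_double.comp (fst.comp snd))
      (list_append.comp (primrec_map_double_succ.comp (fst.comp fst))
        (primrec_map_double_succ.comp (fst.comp fst))))

theorem primrec_cups : Primrec₂ cups :=
  Primrec.pair
    (list_append.comp (list_append.comp (primrec_map_double_succ.comp (fst.comp fst))
      (primrec_map_double_succ.comp (fst.comp fst))) (primrec_map_double.comp (fst.comp snd)))
    (primrec_map_double.comp (fst.comp snd))

theorem primrec_glue : Primrec₂ glue :=
  primrec_unifier.comp (list_map (list_range.comp (list_length.comp (snd.comp snd)))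
    (Primrec.pair (nat_double.comp (list_getI.comp (snd.comp (snd.comp fst)) snd))
      (nat_double_succ.comp (list_getI.comp (fst.comp (fst.comp fst)) snd))).to₂)

theorem primrec_comp : Primrec₂ comp :=
  Primrec.pair
    (list_map (fst.comp snd) (primrec_renameLabel.comp (primrec_glue.comp (fst.comp fst)
      (snd.comp fst)) (nat_double.comp snd)).to₂)
    (list_map (snd.comp fst) (primrec_renameLabel.comp (primrec_glue.comp (fst.comp fst)
      (snd.comp fst)) (nat_double_succ.comp snd)).to₂)

theorem primrec_kernel : Primrec kernel := by
  have h : Primrec fun x : Labelling => x.1 ++ x.2 := list_append.comp fst snd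
  exact list_map h (list_map (h.comp fst)
    (Primrec.eq.decide.comp (snd.comp fst) snd).to₂).to₂

theorem primrec_step : Primrec₂ step := by
  have hc {n : ℕ} : PrimrecPred fun p : ℕ × List Labelling => p.1 = n :=
    Primrec.eq.comp fst (.const n)
  have h₀ : Primrec fun p : ℕ × List Labelling => p.2 := snd
  have h₁ : Primrec fun p : ℕ × List Labelling => p.2.tail := list_tail.comp h₀
  have h₂ : Primrec fun p : ℕ × List Labelling => p.2.tail.tail := list_tail.comp h₁
  have h₃ : Primrec fun p : ℕ × List Labelling => p.2.tail.tail.tail := list_tail.comp h₂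
  have e₀ := list_headI.comp h₀
  have e₁ := list_headI.comp h₁
  have e₂ := list_headI.comp h₂
  exact .ite (hc.or hc) h₀ <|
    .ite (hc.or (hc.or (hc.or hc))) (list_cons.comp (primrec_juxtapose.comp e₀ e₁) h₂) <|
    .ite hc (list_cons.comp (primrec_comm.comp e₀ e₁) h₂) <|
    .ite hc (list_cons.comp (primrec_comm.comp e₁ e₀) h₂) <|
    .ite hc (list_cons.comp (primrec_caps.comp e₀ e₁) h₂) <|
    .ite hc (list_cons.comp (primrec_cups.comp e₀ e₁) h₂) <|
    .ite hc (list_cons.comp (primrec_comp.comp e₀ e₁) h₂) <|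
    .ite (nat_lt.comp fst (.const 16))
      (list_cons.comp (primrec_juxtapose.comp (primrec_juxtapose.comp e₀ e₁) e₂) h₃)
      (list_cons.comp (.const ([0], [0])) h₀)

theorem primrec_run : Primrec run :=
  list_foldr .id (.const []) (primrec_step.comp (fst.comp snd) (snd.comp snd)).to₂

theorem primrec_decision :
    Primrec₂ fun w w' : List ℕ => decide (kernel (run w).headI = kernel (run w').headI) :=
  Primrec.eq.decide.comp (primrec_kernel.comp (list_headI.comp (primrec_run.comp fst)))
    (primrec_kernel.comp (list_headI.comp (primrec_run.comp snd)))

end Computability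

end Labelling

end

section

/-! ### The correctness of the computation -/

variable {P : Type u}

/-- The list of the labels of the occurrences of letters in a formula. -/
def Formula.word {α : Type*} : (A : Formula P) → (A.Occ → α) → List α
  | letter _, a => [a ()]
  | neg A, a => A.word a
  | bin _ A B, a => (A.word fun x => a (.inl x)) ++ B.word fun x => a (.inr x)

namespace Formula

theorem length_word {α : Type*} (A : Formula P) (a : A.Occ → α) : (A.word a).length = A.size := by
  induction A with
  | letter p => rfl
  | neg A ih => exact ih a
  | bin ξ A B ihA ihB => simp only [word, List.length_append, ihA, ihB, size]

theorem word_injective {α : Type*} (A : Formula P) :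
    Function.Injective (A.word : (A.Occ → α) → List α) := by
  induction A with
  | letter p =>
    intro a b h
    funext x
    exact (List.cons.inj h).1
  | neg A ih => exact ih
  | bin ξ A B ihA ihB =>
    intro a b h
    obtain ⟨h₁, h₂⟩ := List.append_inj h (by rw [length_word, length_word])
    have h₁ := ihA h₁
    have h₂ := ihB h₂
    funext x
    rcases x with x | x
    · exact congrFun h₁ x
    · exact congrFun h₂ x

theorem map_word {α β : Type*} (f : α → β) (A : Formula P) (a : A.Occ → α) :
    (A.word a).map f = A.word fun x => f (a x) := by
  induction A with
  | letter p => rfl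
  | neg A ih => exact ih a
  | bin ξ A B ihA ihB => simp only [word, List.map_append, ihA, ihB]

theorem zip_word {α β : Type*} (A : Formula P) (a : A.Occ → α) (b : A.Occ → β) :
    (A.word a).zip (A.word b) = A.word fun x => (a x, b x) := by
  induction A with
  | letter p => rfl
  | neg A ih => exact ih a b
  | bin ξ A B ihA ihB =>
    simp only [word]
    rw [List.zip_append (by rw [length_word, length_word]), ihA, ihB]

theorem mem_word {α : Type*} (A : Formula P) (a : A.Occ → α) (z : α) :
    z ∈ A.word a ↔ ∃ x, a x = z := by
  induction A with
  | letter p => exact ⟨fun h => ⟨(), (List.mem_singleton.1 h).symm⟩,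
      fun ⟨_, h⟩ => List.mem_singleton.2 h.symm⟩
  | neg A ih => exact ih a
  | bin ξ A B ihA ihB =>
    simp only [word, List.mem_append, ihA, ihB]
    exact (Sum.exists (p := fun x : A.Occ ⊕ B.Occ => a x = z)).symm

end Formula

namespace Labelling

/-- A labelling represents the identity arrow of a formula. -/
def RepFormula (x : Labelling) (A : Formula P) : Prop :=
  ∃ a : A.Occ → ℕ, a.Injective ∧ x = (A.word a, A.word a)

/-- A labelling represents a split equivalence. -/
def Rep (x : Labelling) {A B : Formula P} (R : BrauerianSplit A.Occ B.Occ) : Prop :=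
  ∃ (a : A.Occ → ℕ) (b : B.Occ → ℕ), x = (A.word a, B.word b) ∧
    ∀ u w, R.rel u w ↔ Sum.elim a b u = Sum.elim a b w

/-- Labels for a disjoint union. -/
def sum {X Y : Type} (a : X → ℕ) (b : Y → ℕ) : X ⊕ Y → ℕ :=
  Sum.elim (fun x => 2 * a x) fun y => 2 * b y + 1

theorem sum_injective {X Y : Type} {a : X → ℕ} {b : Y → ℕ} (ha : a.Injective) (hb : b.Injective) :
    (sum a b).Injective := by
  rintro (x | x) (y | y) h <;> simp only [sum, Sum.elim_inl, Sum.elim_inr] at h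
  · rw [ha (by omega : a x = a y)]
  · omega
  · omega
  · rw [hb (by omega : b x = b y)]

theorem RepFormula.juxtapose {x y : Labelling} {A B : Formula P} (hx : RepFormula x A)
    (hy : RepFormula y B) (ξ : Conn) : RepFormula (x.juxtapose y) (.bin ξ A B) := by
  obtain ⟨a, ha, rfl⟩ := hx
  obtain ⟨b, hb, rfl⟩ := hy
  refine ⟨sum a b, sum_injective ha hb, ?_⟩
  simp only [Labelling.juxtapose, Formula.map_word]
  rfl

/-- The primitive graphs are kernels of explicit maps, and any injective numbering of the values of
such a map is a labelling that represents the graph. -/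
theorem Rep.of_ker {x : Labelling} {A B : Formula P} {R : BrauerianSplit A.Occ B.Occ} {Z : Type}
    {φ : A.Occ ⊕ B.Occ → Z} (hR : ∀ u w, R.rel u w ↔ φ u = φ w) {c : Z → ℕ} (hc : c.Injective)
    (hx : x = (A.word fun u => c (φ (.inl u)), B.word fun u => c (φ (.inr u)))) : Rep x R := by
  refine ⟨_, _, hx, fun u w => (hR u w).trans (hc.eq_iff.symm.trans ?_)⟩
  have h (u) : Sum.elim (fun u => c (φ (.inl u))) (fun u => c (φ (.inr u))) u = c (φ u) := by
    cases u <;> rfl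
  rw [h, h]

open BrauerianSplit

theorem _root_.ProofNet.BrauerianSplit.ofEquiv_rel_symm {X Y : Type} (e : X ≃ Y) (u w : X ⊕ Y) :
    (ofEquiv e).rel u w ↔ Sum.elim _root_.id e.symm u = Sum.elim _root_.id e.symm w := by
  rw [ofEquiv_rel, ← e.symm.injective.eq_iff]
  rcases u with u | u <;> rcases w with w | w <;> simp

theorem juxtapose_rel_iff {X Y X' Y' : Type} {R : BrauerianSplit X X'} {S : BrauerianSplit Y Y'}
    {a : X → ℕ} {b : Y → ℕ} {a' : X' → ℕ} {b' : Y' → ℕ}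
    (hR : ∀ u w, R.rel u w ↔ Sum.elim a a' u = Sum.elim a a' w)
    (hS : ∀ u w, S.rel u w ↔ Sum.elim b b' u = Sum.elim b b' w) (u w : (X ⊕ Y) ⊕ (X' ⊕ Y')) :
    (BrauerianSplit.juxtapose R S).rel u w ↔
      Sum.elim (sum a b) (sum a' b') u = Sum.elim (sum a b) (sum a' b') w := by
  rw [juxtapose_rel]
  rcases u with (u | u) | (u | u) <;> rcases w with (w | w) | (w | w) <;>
    simp [regroup_1, regroup_2, regroup_3, regroup_4, hR, hS, sum] <;> omega

theorem RepFormula.id {x : Labelling} {A : Formula P} (h : RepFormula x A) :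
    Rep x (ofEquiv (Equiv.refl A.Occ)) := by
  obtain ⟨a, ha, rfl⟩ := h
  exact Rep.of_ker (fun u w => ofEquiv_rel _ u w) ha rfl

theorem RepFormula.assocTo {x : Labelling} {A B C : Formula P} {ξ ζ ξ' ζ' : Conn}
    (h : RepFormula x (.bin ξ (.bin ζ A B) C)) :
    Rep (A := .bin ξ' A (.bin ζ' B C)) (B := .bin ξ (.bin ζ A B) C) x
      (ofEquiv (Equiv.sumAssoc A.Occ B.Occ C.Occ).symm) := by
  obtain ⟨a, ha, rfl⟩ := h
  refine Rep.of_ker (fun u w => ofEquiv_rel _ u w) ha (Prod.ext ?_ rfl)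
  exact List.append_assoc _ _ _

theorem RepFormula.assocFrom {x : Labelling} {A B C : Formula P} {ξ ζ ξ' ζ' : Conn}
    (h : RepFormula x (.bin ξ (.bin ζ A B) C)) :
    Rep (A := .bin ξ (.bin ζ A B) C) (B := .bin ξ' A (.bin ζ' B C)) x
      (ofEquiv (Equiv.sumAssoc A.Occ B.Occ C.Occ)) := by
  obtain ⟨a, ha, rfl⟩ := h
  refine Rep.of_ker (fun u w => ofEquiv_rel_symm _ u w) ha (Prod.ext rfl ?_)
  exact List.append_assoc _ _ _

theorem RepFormula.comm {x y : Labelling} {A B : Formula P} (hx : RepFormula x A)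
    (hy : RepFormula y B) (ξ ζ : Conn) :
    Rep (A := .bin ξ A B) (B := .bin ζ B A) (x.comm y) (ofEquiv (Equiv.sumComm A.Occ B.Occ)) := by
  obtain ⟨a, ha, rfl⟩ := hx
  obtain ⟨b, hb, rfl⟩ := hy
  refine Rep.of_ker (fun u w => ofEquiv_rel_symm _ u w) (sum_injective ha hb) ?_
  simp only [Labelling.comm, Formula.map_word]
  rfl

theorem RepFormula.caps {x y : Labelling} {A B : Formula P} (hy : RepFormula y B)
    (hx : RepFormula x A) : Rep (A := A) (B := .bin .conj A (.bin .disj (.neg B) B)) (y.caps x)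
      (BrauerianSplit.caps B.Occ A.Occ) := by
  obtain ⟨a, ha, rfl⟩ := hx
  obtain ⟨b, hb, rfl⟩ := hy
  refine Rep.of_ker (fun u w => caps_rel _ _ u w) (sum_injective ha hb) ?_
  simp only [Labelling.caps, Formula.map_word]
  rfl

theorem RepFormula.cups {x y : Labelling} {A B : Formula P} (hy : RepFormula y B)
    (hx : RepFormula x A) : Rep (A := .bin .disj (.bin .conj B (.neg B)) A) (B := A) (y.cups x)
      (BrauerianSplit.cups B.Occ A.Occ) := by
  obtain ⟨a, ha, rfl⟩ := hx
  obtain ⟨b, hb, rfl⟩ := hy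
  refine Rep.of_ker (fun u w => cups_rel _ _ u w)
    (c := fun z => sum a b z.swap) ((sum_injective ha hb).comp (Equiv.sumComm _ _).injective) ?_
  simp only [Labelling.cups, Formula.map_word]
  rfl

theorem Rep.juxtapose {x y : Labelling} {A B D E : Formula P} {R : BrauerianSplit A.Occ D.Occ}
    {S : BrauerianSplit B.Occ E.Occ} (hx : Rep x R) (hy : Rep y S) (ξ ζ : Conn) :
    Rep (A := .bin ξ A B) (B := .bin ζ D E) (x.juxtapose y) (BrauerianSplit.juxtapose R S) := by
  obtain ⟨a, d, rfl, hR⟩ := hx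
  obtain ⟨b, e, rfl, hS⟩ := hy
  refine ⟨sum a b, sum d e, ?_, juxtapose_rel_iff hR hS⟩
  simp only [Labelling.juxtapose, Formula.map_word]
  rfl

theorem glue_eq {A B C : Formula P} (a : A.Occ → ℕ) (b b' : B.Occ → ℕ) (c : C.Occ → ℕ) :
    glue (B.word b', C.word c) (A.word a, B.word b) =
      unifier (B.word fun y => (2 * b y, 2 * b' y + 1)) := by
  rw [← Formula.zip_word B (fun y => 2 * b y) fun y => 2 * b' y + 1, ← Formula.map_word (2 * ·),
    ← Formula.map_word (2 * · + 1), glue]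
  congr 1
  have h : (B.word b).length = (B.word b').length := by
    rw [Formula.length_word, Formula.length_word]
  refine List.ext_getElem (by simp [h]) fun i h₁ h₂ => ?_
  have h₃ : i < (B.word b).length := by simpa using h₁
  simp [List.getI_eq_getElem _ h₃, List.getI_eq_getElem _ (h ▸ h₃)]

/-- Doubling makes the labels of the two factors disjoint, and the unifier identifies the two labels
of each middle occurrence. Linked occurrences clearly receive equal labels; that equal labels imply
a link is the substantial half. -/
theorem Rep.comp {x y : Labelling} {A B C : Formula P} {R : BrauerianSplit A.Occ B.Occ}
    {S : BrauerianSplit B.Occ C.Occ} (hy : Rep y S) (hx : Rep x R) :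
    Rep (y.comp x) (BrauerianSplit.comp S R) := by
  obtain ⟨a, b, rfl, hR⟩ := hx
  obtain ⟨b', c, rfl, hS⟩ := hy
  set σ := renameLabel (unifier (B.word fun y => (2 * b y, 2 * b' y + 1))) with hσ
  refine ⟨fun x => σ (2 * a x), fun z => σ (2 * c z + 1), ?_, fun u w => ?_⟩
  · rw [Labelling.comp, glue_eq, Formula.map_word, Formula.map_word]
  have hb (y) : σ (2 * b y) = σ (2 * b' y + 1) :=
    renameLabel_unifier_eq ((Formula.mem_word _ _ _).2 ⟨y, rfl⟩)
  let L : A.Occ ⊕ (B.Occ ⊕ C.Occ) → ℕ :=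
    Sum.elim (fun x => 2 * a x) (Sum.elim (fun y => 2 * b y) fun z => 2 * c z + 1)
  have hL (u : A.Occ ⊕ C.Occ) : Sum.elim (fun x => σ (2 * a x)) (fun z => σ (2 * c z + 1)) u =
      σ (L (Sum.map _root_.id Sum.inr u)) := by
    cases u <;> rfl
  have hup (u : A.Occ ⊕ B.Occ) : L (Sum.map _root_.id Sum.inl u) = 2 * Sum.elim a b u := by
    cases u <;> rfl
  have hlow (u : B.Occ ⊕ C.Occ) : σ (L (Sum.inr u)) = σ (2 * Sum.elim b' c u + 1) := by
    cases u
    · exact hb _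
    · rfl
  rw [hL, hL]
  have hglue {p q} (h : Glue S R p q) : σ (L p) = σ (L q) := by
    cases h with
    | upper h => rw [hup, hup, (hR _ _).1 h]
    | lower h => rw [hlow, hlow, (hS _ _).1 h]
  constructor
  · intro h
    have h : Relation.TransGen (Glue S R) _ _ := h
    generalize Sum.map _root_.id Sum.inr w = q at h ⊢
    induction h with
    | single h => exact hglue h
    | tail _ h ih => exact ih.trans (hglue h)
  · intro h
    change Relation.TransGen (Glue S R) _ _
    generalize Sum.map _root_.id Sum.inr u = p at h ⊢
    generalize Sum.map _root_.id Sum.inr w = q at h ⊢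
    -- A middle occurrence has two labels, an even one from the first factor and an odd one from the
    -- second; outer occurrences have one. Occurrences that share a label are glued.
    let has (p : A.Occ ⊕ (B.Occ ⊕ C.Occ)) (l : ℕ) : Prop :=
      (∃ u, p = Sum.map _root_.id Sum.inl u ∧ l = 2 * Sum.elim a b u) ∨
        ∃ u, p = Sum.inr u ∧ l = 2 * Sum.elim b' c u + 1
    have has_glue {p q l} (hp : has p l) (hq : has q l) : Glue S R p q := by
      rcases hp with ⟨u, rfl, rfl⟩ | ⟨u, rfl, rfl⟩ <;> rcases hq with ⟨w, rfl, h⟩ | ⟨w, rfl, h⟩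
      · exact .upper ((hR _ _).2 (by omega))
      · omega
      · omega
      · exact .lower ((hS _ _).2 (by omega))
    have hasL (p) : has p (L p) := by
      rcases p with x | y | z
      · exact .inl ⟨.inl x, rfl, rfl⟩
      · exact .inl ⟨.inr y, rfl, rfl⟩
      · exact .inr ⟨.inr z, rfl, rfl⟩
    -- The labels reached from `p`. Each unified pair consists of the two labels of one occurrence,
    -- so both or neither are reached, and the renaming preserves this property.
    let g (l : ℕ) : Prop := ∃ p', has p' l ∧ Relation.TransGen (Glue S R) p p'
    have hg : ∀ e ∈ B.word fun y => (2 * b y, 2 * b' y + 1), g e.1 ↔ g e.2 := by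
      intro e he
      obtain ⟨y, rfl⟩ := (Formula.mem_word _ _ _).1 he
      have h₁ : has (.inr (.inl y)) (2 * b y) := .inl ⟨.inr y, rfl, rfl⟩
      have h₂ : has (.inr (.inl y)) (2 * b' y + 1) := .inr ⟨.inl y, rfl, rfl⟩
      exact ⟨fun ⟨p', hp', h⟩ => ⟨_, h₂, h.tail (has_glue hp' h₁)⟩,
        fun ⟨p', hp', h⟩ => ⟨_, h₁, h.tail (has_glue hp' h₂)⟩⟩
    have hp : g (L p) := ⟨p, hasL p, .single (glue_refl S R p)⟩
    obtain ⟨p', hp', h'⟩ : g (L q) := (iff_renameLabel_unifier hg _).1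
      ((congrArg g h).mp ((iff_renameLabel_unifier hg _).2 hp))
    exact h'.tail (has_glue hp' (hasL q))

theorem foldr_formula (ν : P → ℕ) (A : Formula P) : ∃ x, RepFormula x A ∧
    ∀ st, (A.code ν).foldr step st = x :: st := by
  induction A with
  | letter p =>
    refine ⟨([0], [0]), ⟨fun _ => 0, fun _ _ _ => rfl, rfl⟩, fun st => ?_⟩
    simp only [Formula.code, List.foldr_cons, List.foldr_nil, step]
    repeat rw [if_neg (by omega)]
  | neg A ih =>
    obtain ⟨x, hx, h⟩ := ih
    exact ⟨x, hx, fun st => by simp [Formula.code, h, step]⟩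
  | bin ξ A B ihA ihB =>
    obtain ⟨x, hx, h⟩ := ihA
    obtain ⟨y, hy, k⟩ := ihB
    refine ⟨_, hx.juxtapose hy ξ, fun st => ?_⟩
    cases ξ <;> simp [Formula.code, Conn.code, h, k, step]

theorem foldr_code (ν : P → ℕ) {A B : Formula P} (f : ArrowTerm A B) : ∃ x, Rep x f.graph ∧
    ∀ st, (f.code ν).foldr step st = x :: st := by
  induction f with
  | id A =>
    obtain ⟨x, hx, h⟩ := foldr_formula ν A
    exact ⟨x, hx.id, fun st => by simp [ArrowTerm.code, h, step]⟩
  | assocTo ξ A B C =>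
    obtain ⟨x, hx, hA⟩ := foldr_formula ν A
    obtain ⟨y, hy, hB⟩ := foldr_formula ν B
    obtain ⟨z, hz, hC⟩ := foldr_formula ν C
    refine ⟨_, ((hx.juxtapose hy ξ).juxtapose hz ξ).assocTo, fun st => ?_⟩
    cases ξ <;> simp [ArrowTerm.code, Conn.code, hA, hB, hC, step]
  | assocFrom ξ A B C =>
    obtain ⟨x, hx, hA⟩ := foldr_formula ν A
    obtain ⟨y, hy, hB⟩ := foldr_formula ν B
    obtain ⟨z, hz, hC⟩ := foldr_formula ν C
    refine ⟨_, ((hx.juxtapose hy ξ).juxtapose hz ξ).assocFrom, fun st => ?_⟩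
    cases ξ <;> simp [ArrowTerm.code, Conn.code, hA, hB, hC, step]
  | commConj A B =>
    obtain ⟨x, hx, hA⟩ := foldr_formula ν A
    obtain ⟨y, hy, hB⟩ := foldr_formula ν B
    exact ⟨_, hx.comm hy _ _, fun st => by simp [ArrowTerm.code, hA, hB, step]⟩
  | commDisj A B =>
    obtain ⟨x, hx, hA⟩ := foldr_formula ν A
    obtain ⟨y, hy, hB⟩ := foldr_formula ν B
    exact ⟨_, hy.comm hx _ _, fun st => by simp [ArrowTerm.code, hA, hB, step]⟩
  | dissoc A B C =>
    obtain ⟨x, hx, hA⟩ := foldr_formula ν A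
    obtain ⟨y, hy, hB⟩ := foldr_formula ν B
    obtain ⟨z, hz, hC⟩ := foldr_formula ν C
    exact ⟨_, ((hx.juxtapose hy .conj).juxtapose hz .disj).assocTo, fun st => by
      simp [ArrowTerm.code, hA, hB, hC, step]⟩
  | deltaConj B A =>
    obtain ⟨x, hx, hA⟩ := foldr_formula ν A
    obtain ⟨y, hy, hB⟩ := foldr_formula ν B
    exact ⟨_, hy.caps hx, fun st => by simp [ArrowTerm.code, hA, hB, step]⟩
  | sigmaDisj B A =>
    obtain ⟨x, hx, hA⟩ := foldr_formula ν A
    obtain ⟨y, hy, hB⟩ := foldr_formula ν B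
    exact ⟨_, hy.cups hx, fun st => by simp [ArrowTerm.code, hA, hB, step]⟩
  | comp f g ihf ihg =>
    obtain ⟨x, hx, hf⟩ := ihf
    obtain ⟨y, hy, hg⟩ := ihg
    exact ⟨_, hx.comp hy, fun st => by simp [ArrowTerm.code, hf, hg, step]⟩
  | bin ξ f g ihf ihg =>
    obtain ⟨x, hx, hf⟩ := ihf
    obtain ⟨y, hy, hg⟩ := ihg
    refine ⟨_, hx.juxtapose hy ξ ξ, fun st => ?_⟩
    cases ξ <;> simp [ArrowTerm.code, Conn.code, hf, hg, step]

theorem matrix_word_eq_iff (F : Formula P) (c c' : F.Occ → ℕ) :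
    ((F.word c).map fun k => (F.word c).map fun l => decide (k = l)) =
        ((F.word c').map fun k => (F.word c').map fun l => decide (k = l)) ↔
      ∀ u w, c u = c w ↔ c' u = c' w := by
  simp only [Formula.map_word, F.word_injective.eq_iff, funext_iff, decide_eq_decide]

/-- The labels depend on the way in which an arrow is built. The matrix recording which of them are
equal depends only on the graph and determines it. -/
theorem Rep.kernel_eq_iff {x y : Labelling} {A B : Formula P} {R S : BrauerianSplit A.Occ B.Occ}
    (hx : Rep x R) (hy : Rep y S) : x.kernel = y.kernel ↔ R = S := by
  obtain ⟨a, b, rfl, hR⟩ := hx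
  obtain ⟨a', b', rfl, hS⟩ := hy
  exact (matrix_word_eq_iff (.bin .conj A B) (Sum.elim a b) (Sum.elim a' b')).trans
    ⟨fun e => ext_rel fun u w => (hR u w).trans ((e u w).trans (hS u w).symm),
      fun e u w => (hR u w).symm.trans (e ▸ hS u w)⟩

theorem kernel_run_eq_iff (ν : P → ℕ) {A B : Formula P} (f g : ArrowTerm A B) :
    kernel (run (f.code ν)).headI = kernel (run (g.code ν)).headI ↔ f.graph = g.graph := by
  obtain ⟨x, hx, hf⟩ := foldr_code ν f
  obtain ⟨y, hy, hg⟩ := foldr_code ν g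
  rw [run, run, hf, hg]
  exact hx.kernel_eq_iff hy

end Labelling

end

end ProofNet

theorem mainTheorem1 (P : Type u) :
    (ProofNet.PN.G P).Faithful ∧
    (∀ (A B : ProofNet.Formula P) (f g : ProofNet.ArrowTerm A B),
      ProofNet.ArrowTerm.Equation f g ↔
        (ProofNet.PN.G P).map f.arrow = (ProofNet.PN.G P).map g.arrow) ∧
    (∀ (A B : ProofNet.Formula P) (f g : ProofNet.ArrowTerm A B),
      (ProofNet.PN.G P).map f.arrow = (ProofNet.PN.G P).map g.arrow →
      ∀ (𝒞 : Type w) [Category.{z} 𝒞] [ProofNet.ProofNetCategory 𝒞] (v : P → 𝒞),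
        f.interp v = g.interp v) ∧
    (∃ D : List ℕ → List ℕ → Bool, Computable₂ D ∧
      ∀ ν : P → ℕ, Function.Injective ν →
        ∀ (A B : ProofNet.Formula P) (f g : ProofNet.ArrowTerm A B),
          D (f.code ν) (g.code ν) = true ↔ f.arrow = g.arrow) := by
  refine ⟨ProofNet.PN.faithful_G, fun A B f g => ?_, fun A B f g h 𝒞 _ _ v => ?_,
    _, ProofNet.Labelling.primrec_decision.to_comp, fun ν _ A B f g => ?_⟩
  · rw [← ProofNet.ArrowTerm.arrow_eq_iff, ProofNet.ArrowTerm.map_arrow_eq_iff,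
      ProofNet.ArrowTerm.arrow_eq_iff_graph]
  · rw [ProofNet.ArrowTerm.map_arrow_eq_iff, ← ProofNet.ArrowTerm.arrow_eq_iff_graph,
      ProofNet.ArrowTerm.arrow_eq_iff] at h
    exact h.interp_eq v
  · rw [decide_eq_true_iff, ProofNet.Labelling.kernel_run_eq_iff,
      ProofNet.ArrowTerm.arrow_eq_iff_graph]
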